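/- Terminology. Let $M$ be a compact oriented hyperbolic 3-manifold with smooth boundary (locally modelled, up to orientation-preserving isometries, on domains with smooth boundary in $\mathbb H^3$). $M$ has *tubular boundary* if every component $T$ of $\partial M$ is a torus whose induced metric is flat and whose principal curvatures, with respect to the normal pointing into $M$, are constant and equal to $\kappa,\kappa^{-1}$ for some $\kappa\ge 1$; the sign is such that a tube of radius $R$ about a geodesic, seen from $M$ outside the tube, has curvatures $\coth R,\tanh R$. The *tube radius* of $T$ is the number $r\in(0,\infty]$ with $\coth r=\kappa$ ($r=\infty$ if $\kappa=1$). A *truncation* of $M$ is a subset $N\subseteq M$ obtained as follows: for each component $T$ of $\partial M$ a depth $d_T\ge 0$ is chosen such that the inward normal geodesics of length $d_T$ from the points of $T$ exist in $M$ and sweep out embedded, pairwise disjoint closed collars $T\times[0,d_T]$; then $N$ is $M$ minus the half-open collars $T\times[0,d_T)$. Statement. For $R>0$ put $$c(R)=\min\left\{\frac{0.980258}{\coth R+1},\ \frac{1}{2\coth R}\right\}>0 .$$ Let $M$ be a compact, orientable hyperbolic 3-manifold with tubular boundary such that each boundary component has tube radius at least $R>0$. Then $M$ has a truncation $N$ that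 is a compact hyperbolic 3-manifold with tubular boundary such that the injectivity radius of the Euclidean metric on each component of $\partial N$ is at least $c(R)$. -/

import Mathlib

open Set Filter Topology
open scoped ContDiff ENNReal

namespace TubularTruncation

noncomputable section

/-! ### Hyperbolic 3-space: the hyperboloid model -/

/-- The vector space underlying Minkowski space `ℝ^{1,3}`. -/
abbrev Mink : Type := Fin 4 → ℝ

/-- The Lorentz form of signature `(-,+,+,+)`. -/
def mink (x y : Mink) : ℝ := -(x 0 * y 0) + x 1 * y 1 + x 2 * y 2 + x 3 * y 3

/-- Hyperbolic 3-space `ℍ³`, as the upper sheet of the hyperboloid. Its tangent space at `p` is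
`{v | mink p v = 0}`, with the (positive definite) restriction of `mink` as Riemannian metric. -/
def hyp3 : Set Mink := {x | mink x x = -1 ∧ 0 < x 0}

/-- Orientation-preserving isometries of `ℍ³`, i.e. elements of `SO⁺(1,3)`. -/
structure IsOrientedIsometry (A : Mink →ₗ[ℝ] Mink) : Prop where
  map_mink : ∀ x y, mink (A x) (A y) = mink x y
  mapsTo : MapsTo A hyp3 hyp3
  det_pos : 0 < LinearMap.det A

/-! ### Local geometry of domains with smooth boundary in `ℍ³` -/

/-- Near its boundary point `p`, the set `D ⊆ ℍ³` is the domain `{g ≥ 0}` of `ℍ³`, where `g` is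
smooth near `p` and its differential does not vanish on the tangent space of `ℍ³` at `p`. -/
structure IsDefiningFunction (D : Set Mink) (p : Mink) (g : Mink → ℝ) : Prop where
  smooth : ∀ᶠ q in 𝓝 p, ContDiffAt ℝ ∞ g q
  apply_eq_zero : g p = 0
  regular : ∃ v, mink p v = 0 ∧ fderiv ℝ g p v ≠ 0
  mem_iff : ∀ᶠ q in 𝓝[hyp3] p, (q ∈ D ↔ 0 ≤ g q)

/-- `v` is tangent at `p` to the level surface of `g` in `ℍ³` through `p`. -/
def IsTangent (g : Mink → ℝ) (p v : Mink) : Prop :=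
  mink p v = 0 ∧ fderiv ℝ g p v = 0

/-- `n` is the unit normal at `p ∈ ℍ³` to the level surface of `g` in `ℍ³`, pointing into the
side on which `g` increases (for a defining function of a domain: the inward unit normal). -/
structure IsInwardUnitNormal (g : Mink → ℝ) (p n : Mink) : Prop where
  tangent : mink p n = 0
  unit : mink n n = 1
  inward : 0 < fderiv ℝ g p n
  normal : ∀ v, IsTangent g p v → mink n v = 0

/-- The boundary surface of the domain `D ⊆ ℍ³` has principal curvatures `k₁, k₂` at `p`,
with respect to the inward unit normal field `ν`. The derivative of `ν` along the surface in
`ℝ^{1,3}` is also its covariant derivative in `ℍ³`, because `mink p (ν p) = 0` and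
`mink (ν p) v = 0` for tangent `v`. The sign is such that moving the surface into `D` along `ν`
stretches a direction of positive curvature: a tube of radius `R` about a geodesic, with `D`
*outside* the tube, has curvatures `coth R, tanh R`. -/
def HasPrincipalCurvatures (D : Set Mink) (p : Mink) (k₁ k₂ : ℝ) : Prop :=
  ∃ (g : Mink → ℝ) (ν : Mink → Mink),
    IsDefiningFunction D p g ∧
    (∀ᶠ q in 𝓝 p, ContDiffAt ℝ ∞ ν q) ∧
    (∀ᶠ q in 𝓝[hyp3] p, g q = 0 → IsInwardUnitNormal g q (ν q)) ∧
    ∃ e₁ e₂ : Mink, IsTangent g p e₁ ∧ IsTangent g p e₂ ∧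
      mink e₁ e₁ = 1 ∧ mink e₂ e₂ = 1 ∧ mink e₁ e₂ = 0 ∧
      fderiv ℝ ν p e₁ = k₁ • e₁ ∧ fderiv ℝ ν p e₂ = k₂ • e₂

/-! ### Oriented hyperbolic structures -/

/-- An oriented hyperbolic atlas on a space `M`: charts `(U, f)` embed open sets `U` of `M`
into `ℍ³` and any two of them differ locally by orientation-preserving isometries of `ℍ³`.
(That the images of the charts are domains with smooth boundary is `IsManifold` below.) -/
structure HyperbolicAtlas (M : Type*) [TopologicalSpace M] where
  charts : Set (Set M × (M → Mink))
  isOpen_source : ∀ c ∈ charts, IsOpen c.1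
  cover : ∀ x : M, ∃ c ∈ charts, x ∈ c.1
  isEmbedding : ∀ c ∈ charts, IsEmbedding (fun x : c.1 => c.2 x)
  mapsTo : ∀ c ∈ charts, MapsTo c.2 c.1 hyp3
  compatible : ∀ c ∈ charts, ∀ c' ∈ charts, ∀ x ∈ c.1 ∩ c'.1,
    ∃ A : Mink →ₗ[ℝ] Mink, IsOrientedIsometry A ∧ ∀ᶠ y in 𝓝 x, c'.2 y = A (c.2 y)

namespace HyperbolicAtlas

/-- The restriction of a hyperbolic atlas to a subspace. -/
def restrict {M : Type*} [TopologicalSpace M] (𝒜 : HyperbolicAtlas M) (N : Set M) :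
    HyperbolicAtlas N where
  charts := (fun c : Set M × (M → Mink) =>
    ((Subtype.val ⁻¹' c.1, fun x : N => c.2 x) : Set N × (N → Mink))) '' 𝒜.charts
  isOpen_source := by
    rintro _ ⟨c, hc, rfl⟩
    exact (𝒜.isOpen_source c hc).preimage continuous_subtype_val
  cover := by
    intro x
    obtain ⟨c, hc, hx⟩ := 𝒜.cover x
    exact ⟨_, ⟨c, hc, rfl⟩, hx⟩
  isEmbedding := by
    rintro _ ⟨c, hc, rfl⟩
    have h : IsEmbedding (fun x : (Subtype.val ⁻¹' c.1 : Set N) =>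
        (⟨x.1.1, x.2⟩ : c.1)) := by
      refine IsEmbedding.of_comp (g := Subtype.val) ?_ continuous_subtype_val ?_
      · exact Continuous.subtype_mk (continuous_subtype_val.comp continuous_subtype_val) _
      · have h2 : IsEmbedding ((Subtype.val : N → M) ∘
            (Subtype.val : (Subtype.val ⁻¹' c.1 : Set N) → N)) :=
          IsEmbedding.subtypeVal.comp IsEmbedding.subtypeVal
        exact h2
    exact (𝒜.isEmbedding c hc).comp h
  mapsTo := by
    rintro _ ⟨c, hc, rfl⟩ x hx
    exact 𝒜.mapsTo c hc hx
  compatible := by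
    rintro _ ⟨c, hc, rfl⟩ _ ⟨c', hc', rfl⟩ x hx
    obtain ⟨A, hA, h⟩ := 𝒜.compatible c hc c' hc' x hx
    exact ⟨A, hA, continuous_subtype_val.continuousAt.eventually h⟩

variable {M : Type*} [TopologicalSpace M] (𝒜 : HyperbolicAtlas M)

/-- The interior points: those near which a chart is onto a neighbourhood in `ℍ³`. -/
def interior : Set M :=
  {x | ∃ c ∈ 𝒜.charts, x ∈ c.1 ∧ c.2 '' c.1 ∈ 𝓝[hyp3] (c.2 x)}

/-- The boundary `∂M`. -/
def boundary : Set M := 𝒜.interiorᶜ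

/-- The atlas makes `M` a hyperbolic 3-manifold with (possibly empty) smooth boundary: near
each of its points, the image of a chart is either open in `ℍ³` or a domain with smooth
boundary, the point lying on that boundary. -/
def IsManifold : Prop :=
  ∀ c ∈ 𝒜.charts, ∀ x ∈ c.1,
    c.2 '' c.1 ∈ 𝓝[hyp3] (c.2 x) ∨ ∃ g, IsDefiningFunction (c.2 '' c.1) (c.2 x) g

/-- `T` is a connected component of the boundary. -/
def IsBoundaryComponent (T : Set M) : Prop :=
  ∃ x ∈ 𝒜.boundary, T = connectedComponentIn 𝒜.boundary x

/-- `φ` is a local isometry from the Euclidean plane onto the surface `T ⊆ M` with its intrinsic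
Riemannian metric (induced from the hyperbolic metric); that is, `φ` is the universal covering
of a complete flat surface `T`, equivalently its exponential map at any point. -/
structure IsFlatUniformization (T : Set M) (φ : EuclideanSpace ℝ (Fin 2) → M) : Prop where
  continuous : Continuous φ
  range_eq : range φ = T
  smooth : ∀ c ∈ 𝒜.charts, ∀ x, φ x ∈ c.1 → ContDiffAt ℝ ∞ (fun y => c.2 (φ y)) x
  isometric : ∀ c ∈ 𝒜.charts, ∀ x, φ x ∈ c.1 → ∀ v w,
    mink (fderiv ℝ (fun y => c.2 (φ y)) x v) (fderiv ℝ (fun y => c.2 (φ y)) x w) = inner ℝ v w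

/-- The injectivity radius of the intrinsic Euclidean metric of a flat surface `T`: the supremum
of all `r` for which the exponential map at every point of `T` is injective on the open disc
of radius `r`. -/
def injRadius (T : Set M) : ℝ≥0∞ :=
  sSup {r | ∃ φ, 𝒜.IsFlatUniformization T φ ∧ ∀ x, InjOn φ {y | edist y x < r}}

end HyperbolicAtlas

/-- The tube radius `R` belonging to the larger principal curvature `κ ≥ 1`: it is determined by
`coth R = κ`, and is infinite for `κ = 1` (horospherical tori). -/
def tubeRadius (κ : ℝ) : ℝ≥0∞ :=
  if κ = 1 then ⊤ else ENNReal.ofReal (Real.artanh κ⁻¹)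

namespace HyperbolicAtlas

variable {M : Type*} [TopologicalSpace M] (𝒜 : HyperbolicAtlas M)

/-- `T ⊆ ∂M` is a tubular torus of tube radius `r`: a flat torus with constant principal
curvatures `κ ≥ 1` and `1/κ` with respect to the inward normal, where `coth r = κ`. -/
structure IsTubularTorus (T : Set M) (r : ℝ≥0∞) : Prop where
  torus : Nonempty (T ≃ₜ Circle × Circle)
  flat : ∃ φ, 𝒜.IsFlatUniformization T φ
  curvature : ∃ κ : ℝ, 1 ≤ κ ∧ tubeRadius κ = r ∧ ∀ x ∈ T, ∀ c ∈ 𝒜.charts, x ∈ c.1 →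
    HasPrincipalCurvatures (c.2 '' c.1) (c.2 x) κ κ⁻¹

/-- `M` is a hyperbolic 3-manifold with tubular boundary. -/
def HasTubularBoundary : Prop :=
  𝒜.IsManifold ∧ ∀ T, 𝒜.IsBoundaryComponent T → ∃ r, 𝒜.IsTubularTorus T r

/-- `γ : [0, ℓ] → M` is the unit speed hyperbolic geodesic of length `ℓ` that leaves the boundary
point `x` in the direction of the inward unit normal. -/
structure IsInwardNormalGeodesic (x : M) (ℓ : ℝ) (γ : ℝ → M) : Prop where
  apply_zero : γ 0 = x
  continuousOn : ContinuousOn γ (Icc 0 ℓ)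
  geodesic : ∀ s ∈ Icc 0 ℓ, ∀ c ∈ 𝒜.charts, γ s ∈ c.1 →
    ∃ v, mink (c.2 (γ s)) v = 0 ∧ mink v v = 1 ∧
      (∀ᶠ u in 𝓝[Icc 0 ℓ] s,
        c.2 (γ u) = Real.cosh (u - s) • c.2 (γ s) + Real.sinh (u - s) • v) ∧
      (s = 0 → ∃ g, IsDefiningFunction (c.2 '' c.1) (c.2 x) g ∧
        IsInwardUnitNormal g (c.2 x) v)

/-- `N ⊆ M` is obtained from `M` by truncation along parallel tori: each boundary component `T`
is moved into `M` along its inward normal geodesics through a distance `depth ≥ 0` that is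
constant on `T`, and the half-open collars `T × [0, depth)` swept out are removed. The closed
collars `T × [0, depth]` are embedded in `M` and pairwise disjoint. -/
def IsTruncation (N : Set M) : Prop :=
  ∃ (depth : M → ℝ) (E : M → ℝ → M),
    (∀ x ∈ 𝒜.boundary, 0 ≤ depth x) ∧
    (∀ T, 𝒜.IsBoundaryComponent T → ∀ x ∈ T, ∀ y ∈ T, depth x = depth y) ∧
    (∀ x ∈ 𝒜.boundary, 𝒜.IsInwardNormalGeodesic x (depth x) (E x)) ∧
    (∀ x ∈ 𝒜.boundary, ∀ y ∈ 𝒜.boundary, ∀ s ∈ Icc 0 (depth x), ∀ t ∈ Icc 0 (depth y),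
      E x s = E y t → x = y ∧ s = t) ∧
    N = {z | ∃ x ∈ 𝒜.boundary, ∃ s ∈ Ico 0 (depth x), E x s = z}ᶜ

end HyperbolicAtlas

/-- The constant `min (0.980258 / (coth R + 1)) (1 / (2 coth R))`. -/
def truncationConstant (R : ℝ) : ℝ :=
  min (0.980258 / (Real.cosh R / Real.sinh R + 1)) (1 / (2 * (Real.cosh R / Real.sinh R)))

end

end TubularTruncation

/-!
Each boundary torus is pushed inwards, to the smallest depth at which every closed geodesic of its
flat metric has length at least twice the required injectivity radius. What has to be shown is
that the collars swept out on the way are embedded and disjoint.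

*Model.* A flat surface in `ℍ³` with constant principal curvatures `κ, κ⁻¹` is congruent to a model
surface `tubeBase κ`. By the Codazzi equation, its second fundamental form is parallel in flat
coordinates; after a rotation of the plane it is diagonal, and position and normal then solve a
linear system of differential equations (`IsFlatImmersion.eq_tube`). So every boundary torus is
covered by a map `φ` from the plane that is the model surface in every chart
(`IsFlatUniformization.exists_isTubeMap`). The points of `ℍ³` at signed distance `h` from the model
surface are `tube κ z h`; in these coordinates the metric is diagonal with entries
`stretch κ h ^ 2`, `stretch κ⁻¹ h ^ 2`, `1`, and the translations of the plane extend to isometries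
of `ℍ³`. An orientation-preserving symmetry of `φ` without fixed points is such a translation
(`IsTubeMap.deck`).

*Extension.* Since `κ ≤ coth R`, the tube coordinates are regular for `-R < h`, so collars of width
`R` can be attached to `M` from outside. In the resulting space (`extAtlas`), which is no longer
complete, the exponential map at a point of `M` is still defined on the open ball of radius `R`,
because the height is 1-Lipschitz and the part of height at least `-r` is compact for `r < R`
(`IsTubeSystem.exists_exp`).

*Bumping.* Let all collars grow at unit speed from the exterior collars on. If two of them touch,
they do so with opposite normals (`eq_or_opposite`). Suppose that one of them is invariant under a
short translation. The exponential map at the midpoint of the two points of contact that differ by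
this translation sees two balls of radius `R`, tangent to the surface at these points from the far
side. In the metric of `ℍ³` they meet when the translation is short (`exists_meeting_height`). Each
of the balls is contained in the collar that is touched
(`IsCollar.exists_of_tangent_ball`), and comparing the two copies of this collar at a common point
of the balls identifies the surfaces bounding them. Then the second point of contact lies on the
wrong side of the surface bounding the collar, a contradiction (`eq_of_short`).

*Conclusion.* As long as the depth `s` of a torus is positive and at most the depth chosen for it,
the torus has a translation of length less than, or arbitrarily little above, twice the truncation
constant. That constant is small enough for such a translation to be short in the sense of the
bumping argument (`short_of_lt`, `IsTubeSystem.exists_depth`). Here `1 / (2 coth R)` bounds the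
displacement in the direction of curvature `κ`, and `0.980258 / (coth R + 1)` that in the direction
of curvature `κ⁻¹`, with room for replacing `sinh x` by `x` at `x ≤ 1 / 4`. So all collars reach
their depths (`IsTubeSystem.exists_embedded`). The complement of the half-open collars is a manifold
whose boundary consists of parallel surfaces of the model. Their normal is the restriction of a
linear map (`levelOp`), whose eigenvalues on tangent vectors are the principal curvatures. Two
points of the plane with the same image differ by a period, of length at least twice the truncation
constant, so discs whose radius is this constant are embedded (`le_injRadius_level`).
-/

namespace TubularTruncation

noncomputable section

section

/-! ### Lorentzian linear algebra and hyperbolic balls -/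

theorem mink_comm (x y : Mink) : mink x y = mink y x := by unfold mink; ring

theorem mink_add_left (x y z : Mink) : mink (x + y) z = mink x z + mink y z := by
  simp only [mink, Pi.add_apply]; ring

theorem mink_add_right (x y z : Mink) : mink x (y + z) = mink x y + mink x z := by
  simp only [mink, Pi.add_apply]; ring

theorem mink_sub_left (x y z : Mink) : mink (x - y) z = mink x z - mink y z := by
  simp only [mink, Pi.sub_apply]; ring

theorem mink_sub_right (x y z : Mink) : mink x (y - z) = mink x y - mink x z := by
  simp only [mink, Pi.sub_apply]; ring

theorem mink_smul_left (a : ℝ) (x y : Mink) : mink (a • x) y = a * mink x y := by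
  simp only [mink, Pi.smul_apply, smul_eq_mul]; ring

theorem mink_smul_right (a : ℝ) (x y : Mink) : mink x (a • y) = a * mink x y := by
  simp only [mink, Pi.smul_apply, smul_eq_mul]; ring

theorem mink_neg_left (x y : Mink) : mink (-x) y = -mink x y := by
  simp only [mink, Pi.neg_apply]; ring

theorem mink_neg_right (x y : Mink) : mink x (-y) = -mink x y := by
  simp only [mink, Pi.neg_apply]; ring

theorem mink_zero_left (x : Mink) : mink 0 x = 0 := by simp [mink]

theorem mink_zero_right (x : Mink) : mink x 0 = 0 := by simp [mink]

/-- The Lorentz form as a continuous bilinear map. -/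
def minkL : Mink →L[ℝ] Mink →L[ℝ] ℝ :=
  LinearMap.toContinuousLinearMap
    { toFun := fun x => LinearMap.toContinuousLinearMap
        { toFun := fun y => mink x y
          map_add' := mink_add_right x
          map_smul' := fun a y => mink_smul_right a x y }
      map_add' := fun x y => by ext z; simp [mink_add_left]
      map_smul' := fun a x => by ext z; simp [mink_smul_left] }

@[simp] theorem minkL_apply (x y : Mink) : minkL x y = mink x y := rfl

@[fun_prop] theorem continuous_mink : Continuous fun p : Mink × Mink => mink p.1 p.2 := by
  unfold mink; fun_prop

theorem Continuous.mink' {X : Type*} [TopologicalSpace X] {f g : X → Mink} (hf : Continuous f)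
    (hg : Continuous g) : Continuous fun x => mink (f x) (g x) :=
  continuous_mink.comp (hf.prodMk hg)

theorem eq_zero_of_mink_eq_zero {x : Mink} (h : ∀ y, mink x y = 0) : x = 0 := by
  funext i
  fin_cases i
  · have := h (Pi.single 0 1); simpa [mink] using this
  · have := h (Pi.single 1 1); simpa [mink] using this
  · have := h (Pi.single 2 1); simpa [mink] using this
  · have := h (Pi.single 3 1); simpa [mink] using this

/-- The hyperbolic cosine of the hyperbolic distance of two points of `ℍ³`. -/
def hcosh (p q : Mink) : ℝ := -mink p q

theorem hcosh_comm (p q : Mink) : hcosh p q = hcosh q p := by rw [hcosh, hcosh, mink_comm]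

theorem hcosh_self {p : Mink} (hp : p ∈ hyp3) : hcosh p p = 1 := by rw [hcosh, hp.1]; simp

theorem hcosh_pos_comp {p q : Mink} (hp : p ∈ hyp3) (hq : q ∈ hyp3) : 0 < hcosh p q := by
  obtain ⟨h1, h2⟩ := hp
  obtain ⟨h3, h4⟩ := hq
  simp only [hcosh, mink] at *
  have hcs : (p 1 * q 1 + p 2 * q 2 + p 3 * q 3) ^ 2
      ≤ (p 1 ^ 2 + p 2 ^ 2 + p 3 ^ 2) * (q 1 ^ 2 + q 2 ^ 2 + q 3 ^ 2) := by
    nlinarith [sq_nonneg (p 1 * q 2 - p 2 * q 1), sq_nonneg (p 1 * q 3 - p 3 * q 1),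
      sq_nonneg (p 2 * q 3 - p 3 * q 2)]
  have h5 : p 1 ^ 2 + p 2 ^ 2 + p 3 ^ 2 = p 0 ^ 2 - 1 := by nlinarith
  have h6 : q 1 ^ 2 + q 2 ^ 2 + q 3 ^ 2 = q 0 ^ 2 - 1 := by nlinarith
  have h7 : 1 ≤ p 0 ^ 2 := by nlinarith [sq_nonneg (p 1), sq_nonneg (p 2), sq_nonneg (p 3)]
  have h8 : 1 ≤ q 0 ^ 2 := by nlinarith [sq_nonneg (q 1), sq_nonneg (q 2), sq_nonneg (q 3)]
  rw [h5, h6] at hcs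
  have : (p 1 * q 1 + p 2 * q 2 + p 3 * q 3) ^ 2 < (p 0 * q 0) ^ 2 := by nlinarith
  have := abs_lt_of_sq_lt_sq this (by positivity)
  linarith [(abs_lt.1 this).2]

/-- The Lorentz form is positive on tangent vectors; the Euclidean norm of such a vector is
controlled by it. -/
theorem sq_le_of_tangent {p v : Mink} (hp : p ∈ hyp3) (hv : mink p v = 0) (i : Fin 4) :
    v i ^ 2 ≤ p 0 ^ 2 * mink v v := by
  obtain ⟨h1, h2⟩ := hp
  simp only [mink] at *
  have hcs : (p 1 * v 1 + p 2 * v 2 + p 3 * v 3) ^ 2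
      ≤ (p 1 ^ 2 + p 2 ^ 2 + p 3 ^ 2) * (v 1 ^ 2 + v 2 ^ 2 + v 3 ^ 2) := by
    nlinarith [sq_nonneg (p 1 * v 2 - p 2 * v 1), sq_nonneg (p 1 * v 3 - p 3 * v 1),
      sq_nonneg (p 2 * v 3 - p 3 * v 2)]
  have h5 : p 1 ^ 2 + p 2 ^ 2 + p 3 ^ 2 = p 0 ^ 2 - 1 := by nlinarith
  have h6 : p 1 * v 1 + p 2 * v 2 + p 3 * v 3 = p 0 * v 0 := by linarith
  rw [h5, h6] at hcs
  have h7 : 1 ≤ p 0 ^ 2 := by nlinarith [sq_nonneg (p 1), sq_nonneg (p 2), sq_nonneg (p 3)]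
  have key : v 1 ^ 2 + v 2 ^ 2 + v 3 ^ 2
      ≤ p 0 ^ 2 * (-(v 0 * v 0) + v 1 * v 1 + v 2 * v 2 + v 3 * v 3) := by nlinarith
  have h0 : v 0 ^ 2 ≤ v 1 ^ 2 + v 2 ^ 2 + v 3 ^ 2 := by
    by_contra hcon
    push Not at hcon
    nlinarith [sq_nonneg (v 1), sq_nonneg (v 2), sq_nonneg (v 3)]
  fin_cases i
  · exact h0.trans key
  · change v 1 ^ 2 ≤ _
    nlinarith [sq_nonneg (v 1), sq_nonneg (v 2), sq_nonneg (v 3)]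
  · change v 2 ^ 2 ≤ _
    nlinarith [sq_nonneg (v 1), sq_nonneg (v 2), sq_nonneg (v 3)]
  · change v 3 ^ 2 ≤ _
    nlinarith [sq_nonneg (v 1), sq_nonneg (v 2), sq_nonneg (v 3)]

theorem one_le_time_sq {p : Mink} (hp : p ∈ hyp3) : 1 ≤ p 0 ^ 2 := by
  have := hp.1
  simp only [mink] at this
  nlinarith [sq_nonneg (p 1), sq_nonneg (p 2), sq_nonneg (p 3)]

theorem mink_nonneg_of_tangent {p v : Mink} (hp : p ∈ hyp3) (hv : mink p v = 0) :
    0 ≤ mink v v := by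
  have h := sq_le_of_tangent hp hv 0
  have h1 := one_le_time_sq hp
  by_contra hcon
  push Not at hcon
  nlinarith [sq_nonneg (v 0)]

theorem eq_zero_of_tangent {p v : Mink} (hp : p ∈ hyp3) (hv : mink p v = 0)
    (h : mink v v = 0) : v = 0 := by
  funext i
  have := sq_le_of_tangent hp hv i
  rw [h, mul_zero] at this
  simpa using pow_eq_zero_iff (two_ne_zero) |>.1 (le_antisymm this (sq_nonneg _))

theorem mink_sq_le_of_tangent {p u v : Mink} (hp : p ∈ hyp3) (hu : mink p u = 0)
    (hv : mink p v = 0) : mink u v ^ 2 ≤ mink u u * mink v v := by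
  have hu0 := mink_nonneg_of_tangent hp hu
  have hv0 := mink_nonneg_of_tangent hp hv
  have key : ∀ a b : ℝ, 0 ≤ a ^ 2 * mink u u + 2 * a * b * mink u v + b ^ 2 * mink v v := by
    intro a b
    have h : mink p (a • u + b • v) = 0 := by
      rw [mink_add_right, mink_smul_right, mink_smul_right, hu, hv]; ring
    have h2 := mink_nonneg_of_tangent hp h
    simp only [mink_add_left, mink_add_right, mink_smul_left, mink_smul_right] at h2
    rw [mink_comm v u] at h2
    linarith
  rcases hv0.eq_or_lt with h0 | h0
  · have : v = 0 := eq_zero_of_tangent hp hv h0.symm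
    rw [this, mink_zero_right, mink_zero_right]; simp
  · have := key (mink v v) (-mink u v)
    have h3 : 0 ≤ mink v v * (mink u u * mink v v - mink u v ^ 2) := by nlinarith
    have := nonneg_of_mul_nonneg_right h3 h0
    linarith

theorem one_le_hcosh {p q : Mink} (hp : p ∈ hyp3) (hq : q ∈ hyp3) : 1 ≤ hcosh p q := by
  have h0 := hcosh_pos_comp hp hq
  have ht : mink p (q - hcosh p q • p) = 0 := by
    rw [mink_sub_right, mink_smul_right, hp.1, hcosh]; ring
  have h1 := mink_nonneg_of_tangent hp ht
  have h2 : mink (q - hcosh p q • p) (q - hcosh p q • p) = hcosh p q ^ 2 - 1 := by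
    simp only [mink_sub_left, mink_sub_right, mink_smul_left, mink_smul_right, hp.1, hq.1,
      mink_comm q p]
    simp only [hcosh]; ring
  rw [h2] at h1
  nlinarith

theorem mink_sub_hcosh_smul {p q : Mink} (hp : p ∈ hyp3) (hq : q ∈ hyp3) :
    mink p (q - hcosh p q • p) = 0 ∧
      mink (q - hcosh p q • p) (q - hcosh p q • p) = hcosh p q ^ 2 - 1 := by
  constructor
  · rw [mink_sub_right, mink_smul_right, hp.1, hcosh]; ring
  · simp only [mink_sub_left, mink_sub_right, mink_smul_left, mink_smul_right, hp.1, hq.1,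
      mink_comm q p]
    simp only [hcosh]; ring

theorem eq_of_hcosh_le_one {p q : Mink} (hp : p ∈ hyp3) (hq : q ∈ hyp3) (h : hcosh p q ≤ 1) :
    p = q := by
  have h1 : hcosh p q = 1 := le_antisymm h (one_le_hcosh hp hq)
  obtain ⟨h2, h3⟩ := mink_sub_hcosh_smul hp hq
  rw [h1] at h2 h3
  have := eq_zero_of_tangent hp h2 (by rw [h3]; ring)
  rw [one_smul, sub_eq_zero] at this
  exact this.symm

theorem hcosh_triangle {p q r : Mink} (hp : p ∈ hyp3) (hq : q ∈ hyp3) (hr : r ∈ hyp3)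
    {a b : ℝ} (ha : 0 ≤ a) (hb : 0 ≤ b) (h1 : hcosh p q ≤ Real.cosh a)
    (h2 : hcosh q r ≤ Real.cosh b) : hcosh p r ≤ Real.cosh (a + b) := by
  rw [hcosh_comm] at h1
  obtain ⟨hu, hu2⟩ := mink_sub_hcosh_smul hq hp
  obtain ⟨hv, hv2⟩ := mink_sub_hcosh_smul hq hr
  have h3 := mink_sq_le_of_tangent hq hu hv
  rw [hu2, hv2] at h3
  have h4 : hcosh p r = hcosh q p * hcosh q r
      - mink (p - hcosh q p • q) (r - hcosh q r • q) := by
    simp only [mink_sub_left, mink_sub_right, mink_smul_left, mink_smul_right, hq.1,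
      mink_comm p q]
    simp only [hcosh]; ring
  have c1 := one_le_hcosh hq hp
  have c2 := one_le_hcosh hq hr
  have sa : 0 ≤ Real.sinh a := Real.sinh_nonneg_iff.2 ha
  have sb : 0 ≤ Real.sinh b := Real.sinh_nonneg_iff.2 hb
  have ea := Real.cosh_sq a
  have eb := Real.cosh_sq b
  set U := mink (p - hcosh q p • q) (r - hcosh q r • q)
  have h5 : U ^ 2 ≤ (Real.sinh a * Real.sinh b) ^ 2 := by
    calc U ^ 2 ≤ _ := h3
      _ ≤ Real.sinh a ^ 2 * Real.sinh b ^ 2 := by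
        apply mul_le_mul <;> nlinarith
      _ = _ := by ring
  have h6 := abs_le_of_sq_le_sq h5 (by positivity)
  rw [h4, Real.cosh_add]
  have : hcosh q p * hcosh q r ≤ Real.cosh a * Real.cosh b :=
    mul_le_mul h1 h2 (by linarith) (by linarith)
  linarith [(abs_le.1 h6).1]

theorem exists_lt_cosh {c b : ℝ} (hc : 1 ≤ c) (h : c < Real.cosh b) (hb : 0 ≤ b) :
    ∃ a, 0 ≤ a ∧ a < b ∧ c = Real.cosh a := by
  obtain ⟨a, ⟨h1, h2⟩, h3⟩ := intermediate_value_Icc hb (Real.continuous_cosh.continuousOn)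
    (show c ∈ Icc (Real.cosh 0) (Real.cosh b) from ⟨by simpa using hc, h.le⟩)
  refine ⟨a, h1, lt_of_le_of_ne h2 ?_, h3.symm⟩
  rintro rfl
  exact absurd h3 h.ne'

theorem cosh_lt_cosh_of_nonneg {a b : ℝ} (ha : 0 ≤ a) (h : a < b) :
    Real.cosh a < Real.cosh b := by
  rw [Real.cosh_lt_cosh, abs_of_nonneg ha, abs_of_nonneg (ha.trans h.le)]; exact h

theorem cosh_le_cosh_of_nonneg {a b : ℝ} (ha : 0 ≤ a) (h : a ≤ b) :
    Real.cosh a ≤ Real.cosh b := by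
  rw [Real.cosh_le_cosh, abs_of_nonneg ha, abs_of_nonneg (ha.trans h)]; exact h

/-- The open hyperbolic ball of radius `r` about `p`. -/
def hball (p : Mink) (r : ℝ) : Set Mink := {x | x ∈ hyp3 ∧ hcosh p x < Real.cosh r}

theorem mem_hball_self {p : Mink} {r : ℝ} (hp : p ∈ hyp3) (hr : 0 < r) : p ∈ hball p r :=
  ⟨hp, by rw [hcosh_self hp, Real.one_lt_cosh]; exact hr.ne'⟩

theorem mem_hball_comm {p q : Mink} {r : ℝ} (hp : p ∈ hyp3) (h : q ∈ hball p r) :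
    p ∈ hball q r := ⟨hp, by rw [hcosh_comm]; exact h.2⟩

theorem hball_triangle {p q r : Mink} (hp : p ∈ hyp3) {a b : ℝ} (ha : 0 ≤ a) (hb : 0 ≤ b)
    (h1 : q ∈ hball p a) (h2 : r ∈ hball q b) : r ∈ hball p (a + b) := by
  obtain ⟨a', ha0, ha1, h⟩ := exists_lt_cosh (one_le_hcosh hp h1.1) h1.2 ha
  exact ⟨h2.1, (hcosh_triangle hp h1.1 h2.1 ha0 hb h.le h2.2.le).trans_lt
    (cosh_lt_cosh_of_nonneg (by linarith) (by linarith))⟩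

theorem hball_mono (p : Mink) {r s : ℝ} (hr : 0 ≤ r) (h : r ≤ s) : hball p r ⊆ hball p s :=
  fun _ hx => ⟨hx.1, hx.2.trans_le (cosh_le_cosh_of_nonneg hr h)⟩

theorem continuous_hcosh (p : Mink) : Continuous (hcosh p) := by
  unfold hcosh mink; fun_prop

theorem nhdsWithin_hball {p x : Mink} {r : ℝ} (hx : x ∈ hball p r) :
    𝓝[hball p r] x = 𝓝[hyp3] x := by
  have : hball p r = hyp3 ∩ {x | hcosh p x < Real.cosh r} := rfl
  rw [this]
  exact nhdsWithin_inter_of_mem' (mem_nhdsWithin_of_mem_nhds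
    ((isOpen_lt (continuous_hcosh p) continuous_const).mem_nhds hx.2))

theorem hball_mem_nhdsWithin {p x : Mink} {r : ℝ} (hx : x ∈ hball p r) :
    hball p r ∈ 𝓝[hyp3] x := by
  rw [← nhdsWithin_hball hx]; exact self_mem_nhdsWithin

theorem abs_sub_le_of_hyp3 {p q : Mink} (hp : p ∈ hyp3) (hq : q ∈ hyp3) (i : Fin 4) :
    |q i - p i| ≤ (hcosh p q - 1) * |p i| + p 0 * √(hcosh p q ^ 2 - 1) := by
  obtain ⟨hv, hv2⟩ := mink_sub_hcosh_smul hp hq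
  have h1 := one_le_hcosh hp hq
  have h := sq_le_of_tangent hp hv i
  rw [hv2] at h
  have h3 : |(q - hcosh p q • p) i| ≤ p 0 * √(hcosh p q ^ 2 - 1) := by
    apply abs_le_of_sq_le_sq _ (mul_nonneg hp.2.le (Real.sqrt_nonneg _))
    rw [mul_pow, Real.sq_sqrt (by nlinarith)]; exact h
  have h4 : q i - p i = (hcosh p q - 1) * p i + (q - hcosh p q • p) i := by
    simp only [Pi.sub_apply, Pi.smul_apply, smul_eq_mul]; ring
  rw [h4]
  refine (abs_add_le _ _).trans (add_le_add ?_ h3)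
  rw [abs_mul, abs_of_nonneg (by linarith : 0 ≤ hcosh p q - 1)]

/-- The hyperbolic balls about `p` form a basis of neighbourhoods of `p` in `ℍ³`. -/
theorem exists_hball_subset {p : Mink} (hp : p ∈ hyp3) {s : Set Mink} (hs : s ∈ 𝓝[hyp3] p) :
    ∃ ε > 0, hball p ε ⊆ s := by
  have key : Tendsto id (comap (hcosh p) (𝓝 1) ⊓ 𝓟 hyp3) (𝓝 p) := by
    rw [tendsto_pi_nhds]
    intro i
    rw [tendsto_iff_norm_sub_tendsto_zero]
    have hlim : Tendsto (fun q => (hcosh p q - 1) * |p i| + p 0 * √(hcosh p q ^ 2 - 1))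
        (comap (hcosh p) (𝓝 1) ⊓ 𝓟 hyp3) (𝓝 0) := by
      have h1 : Tendsto (fun c : ℝ => (c - 1) * |p i| + p 0 * √(c ^ 2 - 1)) (𝓝 1) (𝓝 0) := by
        have : Continuous fun c : ℝ => (c - 1) * |p i| + p 0 * √(c ^ 2 - 1) := by fun_prop
        convert this.tendsto 1 using 2; simp
      exact (h1.comp tendsto_comap).mono_left inf_le_left
    refine squeeze_zero' (Eventually.of_forall fun _ => norm_nonneg _) ?_ hlim
    filter_upwards [mem_inf_of_right (mem_principal_self _)] with q hq
    exact abs_sub_le_of_hyp3 hp hq i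
  have hs' : s ∈ comap (hcosh p) (𝓝 1) ⊓ 𝓟 hyp3 := by
    have : comap (hcosh p) (𝓝 1) ⊓ 𝓟 hyp3 ≤ 𝓝[hyp3] p := le_inf key inf_le_right
    exact this hs
  rw [mem_inf_principal] at hs'
  obtain ⟨t, ht, hts⟩ := hs'
  have h0 : Tendsto Real.cosh (𝓝[>] 0) (𝓝 1) := by
    have := Real.continuous_cosh.tendsto 0
    rw [Real.cosh_zero] at this
    exact this.mono_left nhdsWithin_le_nhds
  obtain ⟨l, u, ⟨hl, hu⟩, hlu⟩ := mem_nhds_iff_exists_Ioo_subset.1 ht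
  obtain ⟨ε, hε, hε0⟩ := ((h0.eventually (gt_mem_nhds hu)).and self_mem_nhdsWithin).exists
  refine ⟨ε, hε0, fun x hx => hts (hlu ⟨hl.trans_le (one_le_hcosh hp hx.1), hx.2.trans hε⟩) hx.1⟩

theorem exists_unit_tangent {p : Mink} (hp : p ∈ hyp3) : ∃ u, mink p u = 0 ∧ mink u u = 1 := by
  have h := hp.1
  simp only [mink] at h
  have hpos : 0 < p 0 ^ 2 - p 1 ^ 2 := by nlinarith [sq_nonneg (p 2), sq_nonneg (p 3)]
  refine ⟨(√(p 0 ^ 2 - p 1 ^ 2))⁻¹ • ![p 1, p 0, 0, 0], ?_, ?_⟩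
  · simp [mink]; ring
  · rw [mink_smul_left, mink_smul_right, ← mul_assoc, ← mul_inv, Real.mul_self_sqrt hpos.le]
    simp only [mink]
    simp
    field_simp
    ring

/-- Two points of `ℍ³` are joined by a geodesic. -/
theorem exists_geodesic {p q : Mink} (hp : p ∈ hyp3) (hq : q ∈ hyp3) :
    ∃ d u, 0 ≤ d ∧ mink p u = 0 ∧ mink u u = 1 ∧ q = Real.cosh d • p + Real.sinh d • u := by
  obtain ⟨hu, hu2⟩ := mink_sub_hcosh_smul hp hq
  have h1 := one_le_hcosh hp hq
  obtain ⟨d, hd0, -, hd⟩ := exists_lt_cosh (b := Real.arcosh (hcosh p q) + 1) h1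
    (by conv_lhs => rw [← Real.cosh_arcosh h1]
        exact cosh_lt_cosh_of_nonneg (Real.arcosh_nonneg h1) (by linarith))
    (by linarith [Real.arcosh_nonneg h1])
  rcases hd0.eq_or_lt with h0 | h0
  · obtain ⟨u, h2, h3⟩ := exists_unit_tangent hp
    rw [← h0, Real.cosh_zero] at hd
    refine ⟨0, u, le_rfl, h2, h3, ?_⟩
    rw [Real.cosh_zero, Real.sinh_zero, one_smul, zero_smul, add_zero]
    exact (eq_of_hcosh_le_one hp hq hd.le).symm
  · have hs : 0 < Real.sinh d := Real.sinh_pos_iff.2 h0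
    refine ⟨d, (Real.sinh d)⁻¹ • (q - hcosh p q • p), hd0, ?_, ?_, ?_⟩
    · rw [mink_smul_right, hu, mul_zero]
    · rw [mink_smul_left, mink_smul_right, hu2, hd, Real.cosh_sq]; field_simp; ring
    · rw [smul_smul, mul_inv_cancel₀ hs.ne', one_smul, hd]; abel

theorem geodesic_mem_hyp3 {p u : Mink} (hp : p ∈ hyp3) (h : mink p u = 0) (hu : mink u u = 1)
    (t : ℝ) : Real.cosh t • p + Real.sinh t • u ∈ hyp3 := by
  have hm : ∀ t, mink (Real.cosh t • p + Real.sinh t • u) (Real.cosh t • p + Real.sinh t • u)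
      = -1 := by
    intro t
    simp only [mink_add_left, mink_add_right, mink_smul_left, mink_smul_right, hp.1, hu, h,
      mink_comm u p]
    nlinarith [Real.cosh_sq t]
  refine ⟨hm t, ?_⟩
  have hsq := sq_le_of_tangent hp h 0
  rw [hu, mul_one] at hsq
  have habs := abs_le_of_sq_le_sq hsq hp.2.le
  have h1 : |Real.sinh t * u 0| ≤ |Real.sinh t| * p 0 := by
    rw [abs_mul]; exact mul_le_mul_of_nonneg_left (abs_le.2 (abs_le.1 habs)) (abs_nonneg _)
  have h2 : |Real.sinh t| < Real.cosh t := by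
    rw [Real.abs_sinh, ← Real.cosh_abs]; exact Real.sinh_lt_cosh _
  simp only [Pi.add_apply, Pi.smul_apply, smul_eq_mul]
  nlinarith [(abs_le.1 h1).1, hp.2]

theorem hcosh_geodesic {p u : Mink} (hp : p ∈ hyp3) (h : mink p u = 0) (hu : mink u u = 1)
    (s t : ℝ) : hcosh (Real.cosh s • p + Real.sinh s • u) (Real.cosh t • p + Real.sinh t • u)
      = Real.cosh (s - t) := by
  simp only [hcosh, mink_add_left, mink_add_right, mink_smul_left, mink_smul_right, hp.1, hu, h,
      mink_comm u p, Real.cosh_sub]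
  ring

/-- A point of a slightly larger ball is close to a point of the smaller ball. -/
theorem exists_mem_hball_near {p q : Mink} (hp : p ∈ hyp3) {r η : ℝ} (hr : 0 < r) (hη : 0 < η)
    (hq : q ∈ hball p (r + η)) : ∃ q' ∈ hball p r, q' ∈ hball q (2 * η) := by
  obtain ⟨d, u, hd, hu, hu2, rfl⟩ := exists_geodesic hp hq.1
  have hpp : ∀ t, hcosh p (Real.cosh t • p + Real.sinh t • u) = Real.cosh t := by
    intro t
    have := hcosh_geodesic hp hu hu2 0 t
    simpa using this
  have hdr : d < r + η := by
    have := hq.2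
    rw [hpp, Real.cosh_lt_cosh, abs_of_nonneg hd, abs_of_nonneg (by linarith)] at this
    exact this
  rcases lt_or_ge d r with h | h
  · exact ⟨_, ⟨hq.1, by rw [hpp]; exact cosh_lt_cosh_of_nonneg hd h⟩,
      mem_hball_self hq.1 (by linarith)⟩
  · refine ⟨Real.cosh (max 0 (r - η)) • p + Real.sinh (max 0 (r - η)) • u,
      ⟨geodesic_mem_hyp3 hp hu hu2 _, ?_⟩, geodesic_mem_hyp3 hp hu hu2 _, ?_⟩
    · rw [hpp]
      exact cosh_lt_cosh_of_nonneg (le_max_left _ _) (max_lt hr (by linarith))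
    · rw [hcosh_geodesic hp hu hu2]
      refine cosh_lt_cosh_of_nonneg (sub_nonneg.2 (max_le hd (by linarith))) ?_
      rcases max_cases 0 (r - η) with h' | h' <;> linarith

/-- The geodesic segment from `p` to `q`, as the normalised straight segment. -/
def hseg (p q : Mink) (t : ℝ) : Mink :=
  (√(-mink ((1 - t) • p + t • q) ((1 - t) • p + t • q)))⁻¹ • ((1 - t) • p + t • q)

theorem one_le_neg_mink_segment {p q : Mink} (hp : p ∈ hyp3) (hq : q ∈ hyp3) {t : ℝ}
    (ht : t ∈ Icc (0 : ℝ) 1) :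
    1 ≤ -mink ((1 - t) • p + t • q) ((1 - t) • p + t • q) := by
  have h := one_le_hcosh hp hq
  simp only [hcosh] at h
  simp only [mink_add_left, mink_add_right, mink_smul_left, mink_smul_right, hp.1, hq.1,
      mink_comm q p]
  nlinarith [mul_nonneg ht.1 (sub_nonneg.2 ht.2)]

theorem hseg_mem_hyp3 {p q : Mink} (hp : p ∈ hyp3) (hq : q ∈ hyp3) {t : ℝ}
    (ht : t ∈ Icc (0 : ℝ) 1) : hseg p q t ∈ hyp3 := by
  have h := one_le_neg_mink_segment hp hq ht
  constructor
  · rw [hseg, mink_smul_left, mink_smul_right, ← mul_assoc, ← mul_inv,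
      Real.mul_self_sqrt (by linarith), inv_neg, neg_mul,
      inv_mul_cancel₀ (by linarith : mink ((1 - t) • p + t • q) ((1 - t) • p + t • q) < 0).ne]
  · have h2 : 0 < ((1 - t) • p + t • q) 0 := by
      simp only [Pi.add_apply, Pi.smul_apply, smul_eq_mul]
      rcases ht.1.eq_or_lt with h0 | h0
      · rw [← h0]; simpa using hp.2
      · have := mul_pos h0 hq.2
        have := mul_nonneg (sub_nonneg.2 ht.2) hp.2.le
        linarith
    simp only [hseg, Pi.smul_apply, smul_eq_mul] at h2 ⊢
    have : 0 < √(-mink ((1 - t) • p + t • q) ((1 - t) • p + t • q)) :=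
      Real.sqrt_pos.2 (by linarith)
    positivity

theorem hcosh_hseg_le {x p q : Mink} (hx : x ∈ hyp3) (hp : p ∈ hyp3) (hq : q ∈ hyp3) {t : ℝ}
    (ht : t ∈ Icc (0 : ℝ) 1) :
    hcosh x (hseg p q t) ≤ (1 - t) * hcosh x p + t * hcosh x q := by
  have h := one_le_neg_mink_segment hp hq ht
  have h1 : hcosh x (hseg p q t) = (√(-mink ((1 - t) • p + t • q) ((1 - t) • p + t • q)))⁻¹ *
      ((1 - t) * hcosh x p + t * hcosh x q) := by
    simp only [hcosh, hseg, mink_smul_right, mink_add_right]; ring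
  have h2 : 1 ≤ √(-mink ((1 - t) • p + t • q) ((1 - t) • p + t • q)) := by
    rw [Real.one_le_sqrt]; exact h
  rw [h1]
  have c1 := one_le_hcosh hx hp
  have c2 := one_le_hcosh hx hq
  have h3 : 0 ≤ (1 - t) * hcosh x p + t * hcosh x q := by
    have := ht.1; have := ht.2
    have := mul_nonneg ht.1 (by linarith : 0 ≤ hcosh x q)
    have := mul_nonneg (sub_nonneg.2 ht.2) (by linarith : 0 ≤ hcosh x p)
    linarith
  exact mul_le_of_le_one_left h3 (inv_le_one_of_one_le₀ h2)

theorem hseg_zero {p : Mink} (hp : p ∈ hyp3) (q : Mink) : hseg p q 0 = p := by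
  simp [hseg, hp.1]

theorem hseg_one (p : Mink) {q : Mink} (hq : q ∈ hyp3) : hseg p q 1 = q := by
  simp [hseg, hq.1]

theorem continuousOn_hseg {p q : Mink} (hp : p ∈ hyp3) (hq : q ∈ hyp3) :
    ContinuousOn (hseg p q) (Icc 0 1) := by
  have h0 : Continuous fun t : ℝ => (1 - t) • p + t • q := by fun_prop
  refine ContinuousOn.smul (f := fun t : ℝ =>
    (√(-mink ((1 - t) • p + t • q) ((1 - t) • p + t • q)))⁻¹) (ContinuousOn.inv₀ ?_ ?_)
    h0.continuousOn
  · refine Continuous.continuousOn (Real.continuous_sqrt.comp (Continuous.neg (Continuous.mink' h0 h0)))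
  · intro t ht
    have := one_le_neg_mink_segment hp hq ht
    exact (Real.sqrt_pos.2 (by linarith)).ne'

theorem hseg_mem_hball {x p q : Mink} {r : ℝ} (hx : x ∈ hyp3) (hp : p ∈ hball x r)
    (hq : q ∈ hball x r) {t : ℝ} (ht : t ∈ Icc (0 : ℝ) 1) : hseg p q t ∈ hball x r := by
  refine ⟨hseg_mem_hyp3 hp.1 hq.1 ht, (hcosh_hseg_le hx hp.1 hq.1 ht).trans_lt ?_⟩
  rcases ht.1.eq_or_lt with h0 | h0
  · rw [← h0]; simpa using hp.2
  · have := mul_lt_mul_of_pos_left hq.2 h0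
    have := mul_le_mul_of_nonneg_left hp.2.le (sub_nonneg.2 ht.2)
    linarith

theorem isPreconnected_hseg {p q : Mink} (hp : p ∈ hyp3) (hq : q ∈ hyp3) :
    IsPreconnected (hseg p q '' Icc 0 1) :=
  isPreconnected_Icc.image _ (continuousOn_hseg hp hq)

/-! ### Isometries of hyperbolic space -/

/-- Isometries of `ℍ³`, not necessarily orientation-preserving, as invertible linear maps. -/
structure IsHypIso (A : Mink ≃ₗ[ℝ] Mink) : Prop where
  map_mink : ∀ x y, mink (A x) (A y) = mink x y
  mem_hyp3 : ∀ x ∈ hyp3, A x ∈ hyp3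

namespace IsHypIso

theorem refl : IsHypIso (LinearEquiv.refl ℝ Mink) := ⟨fun _ _ => rfl, fun _ h => h⟩

theorem trans {A B : Mink ≃ₗ[ℝ] Mink} (hA : IsHypIso A) (hB : IsHypIso B) :
    IsHypIso (A.trans B) :=
  ⟨fun x y => by simp [hB.map_mink, hA.map_mink], fun x hx => hB.mem_hyp3 _ (hA.mem_hyp3 _ hx)⟩

theorem symm {A : Mink ≃ₗ[ℝ] Mink} (hA : IsHypIso A) : IsHypIso A.symm := by
  have h1 : ∀ x y, mink (A.symm x) (A.symm y) = mink x y := fun x y => by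
    rw [← hA.map_mink, A.apply_symm_apply, A.apply_symm_apply]
  refine ⟨h1, fun x hx => ?_⟩
  have hm : mink (A.symm x) (A.symm x) = -1 := by rw [h1, hx.1]
  refine ⟨hm, ?_⟩
  by_contra hcon
  push Not at hcon
  have hne : (A.symm x) 0 ≠ 0 := by
    intro h0
    simp only [mink, h0] at hm
    nlinarith [sq_nonneg (A.symm x 1), sq_nonneg (A.symm x 2), sq_nonneg (A.symm x 3)]
  have : -A.symm x ∈ hyp3 := by
    refine ⟨by rw [mink_neg_left, mink_neg_right, hm]; ring, ?_⟩
    have := lt_of_le_of_ne hcon hne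
    simpa using this
  have := (hA.mem_hyp3 _ this).2
  rw [map_neg, A.apply_symm_apply] at this
  have := hx.2
  simp at *
  linarith

theorem hcosh_eq {A : Mink ≃ₗ[ℝ] Mink} (hA : IsHypIso A) (x y : Mink) :
    hcosh (A x) (A y) = hcosh x y := by rw [hcosh, hcosh, hA.map_mink]

theorem mem_hyp3_iff {A : Mink ≃ₗ[ℝ] Mink} (hA : IsHypIso A) {x : Mink} :
    A x ∈ hyp3 ↔ x ∈ hyp3 :=
  ⟨fun h => by simpa using hA.symm.mem_hyp3 _ h, hA.mem_hyp3 x⟩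

theorem mem_hball_iff {A : Mink ≃ₗ[ℝ] Mink} (hA : IsHypIso A) {p x : Mink} {r : ℝ} :
    A x ∈ hball (A p) r ↔ x ∈ hball p r := by
  simp only [hball, mem_ofPred_eq, hA.mem_hyp3_iff, hA.hcosh_eq]

theorem continuous (A : Mink ≃ₗ[ℝ] Mink) : Continuous A :=
  A.toLinearMap.continuous_of_finiteDimensional

theorem map_nhdsWithin {A : Mink ≃ₗ[ℝ] Mink} (hA : IsHypIso A) (x : Mink) :
    map A (𝓝[hyp3] x) = 𝓝[hyp3] (A x) := by
  have himg : A '' hyp3 = hyp3 := by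
    ext y
    constructor
    · rintro ⟨x, hx, rfl⟩; exact hA.mem_hyp3 _ hx
    · intro hy; exact ⟨A.symm y, hA.symm.mem_hyp3 _ hy, A.apply_symm_apply y⟩
  have := A.toContinuousLinearEquiv.toHomeomorph.isEmbedding.map_nhdsWithin_eq hyp3 x
  have h2 : (A.toContinuousLinearEquiv.toHomeomorph : Mink → Mink) = A := rfl
  rw [h2, himg] at this
  exact this

theorem tendsto {A : Mink ≃ₗ[ℝ] Mink} (hA : IsHypIso A) (x : Mink) :
    Tendsto A (𝓝[hyp3] x) (𝓝[hyp3] (A x)) := (hA.map_nhdsWithin x).le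

theorem of_oriented {A : Mink →ₗ[ℝ] Mink} (hA : IsOrientedIsometry A) :
    ∃ B : Mink ≃ₗ[ℝ] Mink, IsHypIso B ∧ B.toLinearMap = A := by
  have hinj : Function.Injective A := by
    rw [injective_iff_map_eq_zero]
    intro x hx
    refine eq_zero_of_mink_eq_zero fun y => ?_
    rw [← hA.map_mink, hx, mink_zero_left]
  refine ⟨LinearEquiv.ofInjectiveEndo A hinj, ⟨?_, ?_⟩, ?_⟩
  · intro x y; exact hA.map_mink x y
  · intro x hx; exact hA.mapsTo hx
  · ext; rfl

end IsHypIso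

/-- A linear map is determined by its values on a nonempty open subset of `ℍ³`. -/
theorem linearMap_eq_of_eventuallyEq {A B : Mink →ₗ[ℝ] Mink} {p : Mink} (hp : p ∈ hyp3)
    (h : ∀ᶠ x in 𝓝[hyp3] p, A x = B x) : A = B := by
  have h0 : A p = B p := h.self_of_nhdsWithin hp
  have htan : ∀ u, mink p u = 0 → mink u u = 1 → A u = B u := by
    intro u hu hu2
    have ht : Tendsto (fun t : ℝ => Real.cosh t • p + Real.sinh t • u) (𝓝 0) (𝓝[hyp3] p) := by
      refine tendsto_nhdsWithin_iff.2 ⟨?_, Eventually.of_forall fun t =>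
        geodesic_mem_hyp3 hp hu hu2 t⟩
      have : Continuous fun t : ℝ => Real.cosh t • p + Real.sinh t • u := by fun_prop
      simpa using this.tendsto 0
    have h1 := (ht.eventually h).filter_mono (nhdsWithin_le_nhds (s := Ioi 0))
    obtain ⟨t, ht1, ht2⟩ := (h1.and self_mem_nhdsWithin).exists
    have hs : Real.sinh t ≠ 0 := (Real.sinh_pos_iff.2 ht2).ne'
    simp only [map_add, map_smul, h0, add_right_inj] at ht1
    exact smul_right_injective _ hs ht1
  refine LinearMap.ext fun x => ?_
  obtain ⟨v, hv⟩ : ∃ v, v = x + mink p x • p := ⟨_, rfl⟩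
  have hx : x = (-mink p x) • p + v := by rw [hv]; simp
  have hpv : mink p v = 0 := by
    rw [hv, mink_add_right, mink_smul_right, hp.1]; ring
  have hAv : A v = B v := by
    rcases (mink_nonneg_of_tangent hp hpv).eq_or_lt with h1 | h1
    · rw [eq_zero_of_tangent hp hpv h1.symm, map_zero, map_zero]
    · have := htan ((√(mink v v))⁻¹ • v) (by rw [mink_smul_right, hpv, mul_zero])
        (by rw [mink_smul_left, mink_smul_right, ← mul_assoc, ← mul_inv,
              Real.mul_self_sqrt h1.le, inv_mul_cancel₀ h1.ne'])
      rw [map_smul, map_smul] at this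
      exact smul_right_injective _ (inv_ne_zero (Real.sqrt_pos.2 h1).ne') this
  calc A x = A (-mink p x • p + v) := congrArg A hx
    _ = B (-mink p x • p + v) := by rw [map_add, map_add, map_smul, map_smul, h0, hAv]
    _ = B x := congrArg B hx.symm

theorem linearEquiv_eq_of_eventuallyEq {A B : Mink ≃ₗ[ℝ] Mink} {p : Mink} (hp : p ∈ hyp3)
    (h : ∀ᶠ x in 𝓝[hyp3] p, A x = B x) : A = B :=
  LinearEquiv.toLinearMap_injective (linearMap_eq_of_eventuallyEq hp h)

/-- The linear map taking the standard frame to the frame `p, e₁, e₂, n`. -/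
def frameMap (p e₁ e₂ n : Mink) : Mink →ₗ[ℝ] Mink where
  toFun v := v 0 • p + v 1 • e₁ + v 2 • e₂ + v 3 • n
  map_add' x y := by simp only [Pi.add_apply, add_smul]; abel
  map_smul' a x := by
    simp only [Pi.smul_apply, smul_eq_mul, RingHom.id_apply, smul_add, mul_smul]

/-- `p, e₁, e₂, n` is a Lorentz-orthonormal frame at the point `p` of `ℍ³`. -/
structure IsFrame (p e₁ e₂ n : Mink) : Prop where
  mem : p ∈ hyp3
  pe₁ : mink p e₁ = 0
  pe₂ : mink p e₂ = 0
  pn : mink p n = 0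
  e₁₁ : mink e₁ e₁ = 1
  e₂₂ : mink e₂ e₂ = 1
  nn : mink n n = 1
  e₁₂ : mink e₁ e₂ = 0
  e₁n : mink e₁ n = 0
  e₂n : mink e₂ n = 0

theorem IsFrame.exists_iso {p e₁ e₂ n : Mink} (h : IsFrame p e₁ e₂ n) :
    ∃ A : Mink ≃ₗ[ℝ] Mink, IsHypIso A ∧
      ∀ v, A v = v 0 • p + v 1 • e₁ + v 2 • e₂ + v 3 • n := by
  obtain ⟨h0, h1, h2, h3, h4, h5, h6, h7, h8, h9⟩ := h
  have hm : ∀ x y, mink (frameMap p e₁ e₂ n x) (frameMap p e₁ e₂ n y) = mink x y := by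
    intro x y
    simp only [frameMap, LinearMap.coe_mk, AddHom.coe_mk, mink_add_left, mink_add_right,
      mink_smul_left, mink_smul_right, mink_comm e₁ p, mink_comm e₂ p, mink_comm n p,
      mink_comm e₂ e₁, mink_comm n e₁, mink_comm n e₂, h0.1, h1, h2, h3, h4, h5, h6, h7, h8, h9]
    simp only [mink]; ring
  have hinj : Function.Injective (frameMap p e₁ e₂ n) := by
    rw [injective_iff_map_eq_zero]
    intro x hx
    refine eq_zero_of_mink_eq_zero fun y => ?_
    rw [← hm, hx, mink_zero_left]
  refine ⟨LinearEquiv.ofInjectiveEndo _ hinj, ⟨hm, fun x hx => ?_⟩, fun v => rfl⟩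
  change frameMap p e₁ e₂ n x ∈ hyp3
  have hx1 : mink (frameMap p e₁ e₂ n x) (frameMap p e₁ e₂ n x) = -1 := by rw [hm, hx.1]
  refine ⟨hx1, ?_⟩
  by_contra hcon
  push Not at hcon
  have hne : (frameMap p e₁ e₂ n x) 0 ≠ 0 := by
    intro h0
    simp only [mink, h0] at hx1
    nlinarith [sq_nonneg (frameMap p e₁ e₂ n x 1), sq_nonneg (frameMap p e₁ e₂ n x 2),
      sq_nonneg (frameMap p e₁ e₂ n x 3)]
  have hneg : -frameMap p e₁ e₂ n x ∈ hyp3 :=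
    ⟨by rw [mink_neg_left, mink_neg_right, hx1]; ring, by
      simpa using lt_of_le_of_ne hcon hne⟩
  have h10 := one_le_hcosh h0 hneg
  have h11 : mink p (frameMap p e₁ e₂ n x) = - x 0 := by
    simp only [frameMap, LinearMap.coe_mk, AddHom.coe_mk, mink_add_right, mink_smul_right, h0.1,
      h1, h2, h3]; ring
  rw [hcosh, mink_neg_right, h11] at h10
  linarith [hx.2]

/-- Expansion of a vector in a Lorentz-orthonormal frame. -/
theorem IsFrame.expand {p e₁ e₂ n : Mink} (h : IsFrame p e₁ e₂ n) (v : Mink) :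
    v = (-mink v p) • p + mink v e₁ • e₁ + mink v e₂ • e₂ + mink v n • n := by
  obtain ⟨A, hA, hA2⟩ := h.exists_iso
  obtain ⟨c, rfl⟩ := A.surjective v
  obtain ⟨h0, h1, h2, h3, h4, h5, h6, h7, h8, h9⟩ := h
  simp only [hA2, mink_add_left, mink_smul_left, mink_comm e₁ p, mink_comm e₂ p, mink_comm n p,
      mink_comm e₂ e₁, mink_comm n e₁, mink_comm n e₂, h0.1, h1, h2, h3, h4, h5, h6, h7, h8, h9]
  simp

end

section

/-! ### The model tubes -/

/-- The solution of `y'' = -m y` with `y(0) = 0`, `y'(0) = 1`. -/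
def sn (m x : ℝ) : ℝ :=
  if 0 < m then Real.sin (√m * x) / √m else if m = 0 then x else Real.sinh (√(-m) * x) / √(-m)

/-- The solution of `y'' = -m y` with `y(0) = 1`, `y'(0) = 0`. -/
def cn (m x : ℝ) : ℝ :=
  if 0 < m then Real.cos (√m * x) else if m = 0 then 1 else Real.cosh (√(-m) * x)

/-- The primitive of `sn m` that vanishes at `0`. -/
def vn (m x : ℝ) : ℝ := if m = 0 then x ^ 2 / 2 else (1 - cn m x) / m

theorem sn_zero (m : ℝ) : sn m 0 = 0 := by simp [sn]

theorem cn_zero (m : ℝ) : cn m 0 = 1 := by simp [cn]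

theorem vn_zero (m : ℝ) : vn m 0 = 0 := by simp [vn, cn_zero]

theorem cn_eq (m x : ℝ) : cn m x = 1 - m * vn m x := by
  unfold vn
  split_ifs with h
  · simp [h, cn]
  · field_simp; ring

theorem cn_sq (m x : ℝ) : cn m x ^ 2 + m * sn m x ^ 2 = 1 := by
  unfold sn cn
  split_ifs with h1 h2
  · rw [div_pow, Real.sq_sqrt h1.le, mul_div_cancel₀ _ h1.ne', Real.cos_sq_add_sin_sq]
  · simp [h2]
  · have h3 : m < 0 := lt_of_le_of_ne (not_lt.1 h1) h2
    rw [div_pow, Real.sq_sqrt (by linarith), Real.cosh_sq]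
    field_simp; ring

theorem sn_sq (m x : ℝ) : sn m x ^ 2 = 2 * vn m x - m * vn m x ^ 2 := by
  rcases eq_or_ne m 0 with rfl | hm
  · simp [sn, vn]; ring
  · have h1 := cn_sq m x
    rw [cn_eq] at h1
    have : m * (sn m x ^ 2 - (2 * vn m x - m * vn m x ^ 2)) = 0 := by linarith
    rcases mul_eq_zero.1 this with h | h
    · exact absurd h hm
    · linarith

theorem sn_neg (m x : ℝ) : sn m (-x) = -sn m x := by
  unfold sn; split_ifs <;> simp [Real.sin_neg, Real.sinh_neg, neg_div]

theorem cn_neg (m x : ℝ) : cn m (-x) = cn m x := by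
  unfold cn; split_ifs <;> simp

theorem vn_neg (m x : ℝ) : vn m (-x) = vn m x := by
  unfold vn; simp [cn_neg]

theorem sn_add (m x y : ℝ) : sn m (x + y) = sn m x * cn m y + cn m x * sn m y := by
  unfold sn cn
  split_ifs with h1 h2
  · rw [mul_add, Real.sin_add]; ring
  · simp
  · rw [mul_add, Real.sinh_add]; ring

theorem cn_add (m x y : ℝ) : cn m (x + y) = cn m x * cn m y - m * (sn m x * sn m y) := by
  unfold sn cn
  split_ifs with h1 h2
  · rw [mul_add, Real.cos_add]
    have h0 : √m ≠ 0 := (Real.sqrt_pos.2 h1).ne'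
    have h3 : m = √m * √m := (Real.mul_self_sqrt h1.le).symm
    have h4 : m * (Real.sin (√m * x) / √m * (Real.sin (√m * y) / √m))
        = Real.sin (√m * x) * Real.sin (√m * y) := by
      nth_rewrite 1 [h3]; field_simp
    rw [h4]
  · simp [h2]
  · have h4 : m < 0 := lt_of_le_of_ne (not_lt.1 h1) h2
    rw [mul_add, Real.cosh_add]
    have h0 : √(-m) ≠ 0 := (Real.sqrt_pos.2 (by linarith)).ne'
    have h3 : m = -(√(-m) * √(-m)) := by rw [Real.mul_self_sqrt (by linarith)]; ring
    have h5 : m * (Real.sinh (√(-m) * x) / √(-m) * (Real.sinh (√(-m) * y) / √(-m)))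
        = -(Real.sinh (√(-m) * x) * Real.sinh (√(-m) * y)) := by
      nth_rewrite 1 [h3]; field_simp
    rw [h5]; ring

theorem vn_add (m x y : ℝ) :
    vn m (x + y) = vn m x + sn m x * sn m y + cn m x * vn m y := by
  rcases eq_or_ne m 0 with rfl | hm
  · simp [sn, vn, cn]; ring
  · have h := cn_add m x y
    rw [cn_eq m (x + y), cn_eq m y] at h
    have h2 := cn_eq m x
    have : m * (vn m (x + y) - (vn m x + sn m x * sn m y + cn m x * vn m y)) = 0 := by
      rw [h2] at h ⊢; linarith
    rcases mul_eq_zero.1 this with h | h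
    · exact absurd h hm
    · linarith

theorem vn_nonneg (m x : ℝ) : 0 ≤ vn m x := by
  unfold vn cn
  split_ifs with h1 h2
  · positivity
  · exact div_nonneg (by linarith [Real.cos_le_one (√m * x)]) h2.le
  · exact div_nonneg_of_nonpos (by linarith [Real.one_le_cosh (√(-m) * x)]) (not_lt.1 h2)

theorem hasDerivAt_sn (m x : ℝ) : HasDerivAt (sn m) (cn m x) x := by
  have hlin : ∀ c : ℝ, HasDerivAt (fun y => c * y) c x := fun c => by
    simpa using (hasDerivAt_id' x).const_mul c
  unfold sn cn
  split_ifs with h1 h2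
  · have h0 : √m ≠ 0 := (Real.sqrt_pos.2 h1).ne'
    exact ((hlin √m).sin.div_const √m).congr_deriv (by field_simp)
  · exact hasDerivAt_id' x
  · have h0 : √(-m) ≠ 0 :=
      (Real.sqrt_pos.2 (by linarith [lt_of_le_of_ne (not_lt.1 h1) h2])).ne'
    exact ((hlin √(-m)).sinh.div_const √(-m)).congr_deriv (by field_simp)

theorem hasDerivAt_cn (m x : ℝ) : HasDerivAt (cn m) (-m * sn m x) x := by
  have hlin : ∀ c : ℝ, HasDerivAt (fun y => c * y) c x := fun c => by
    simpa using (hasDerivAt_id' x).const_mul c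
  unfold sn cn
  split_ifs with h1 h2
  · have h0 : √m ≠ 0 := (Real.sqrt_pos.2 h1).ne'
    refine (hlin √m).cos.congr_deriv ?_
    rw [show -m * (Real.sin (√m * x) / √m) = -(m / √m) * Real.sin (√m * x) by ring,
      Real.div_sqrt]
    ring
  · simpa [h2] using hasDerivAt_const x (1 : ℝ)
  · have h4 : 0 < -m := by linarith [lt_of_le_of_ne (not_lt.1 h1) h2]
    have h0 : √(-m) ≠ 0 := (Real.sqrt_pos.2 h4).ne'
    refine (hlin √(-m)).cosh.congr_deriv ?_
    rw [show -m * (Real.sinh (√(-m) * x) / √(-m)) = (-m / √(-m)) * Real.sinh (√(-m) * x) by ring,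
      Real.div_sqrt]
    ring

theorem hasDerivAt_vn (m x : ℝ) : HasDerivAt (vn m) (sn m x) x := by
  rcases eq_or_ne m 0 with rfl | hm
  · have h1 : vn 0 = fun x => x ^ 2 / 2 := by funext x; simp [vn]
    have h2 : sn 0 x = x := by simp [sn]
    rw [h1, h2]
    exact ((hasDerivAt_pow 2 x).div_const 2).congr_deriv (by norm_num)
  · have h1 : vn m = fun x => (1 - cn m x) / m := by funext x; simp [vn, hm]
    rw [h1]
    exact (((hasDerivAt_cn m x).const_sub 1).div_const m).congr_deriv
      (by rw [neg_mul, neg_neg, mul_div_cancel_left₀ _ hm])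

theorem contDiff_cn (m : ℝ) : ContDiff ℝ ∞ (cn m) := by
  unfold cn
  split_ifs
  · exact Real.contDiff_cos.comp (contDiff_const.mul contDiff_id)
  · exact contDiff_const
  · exact Real.contDiff_cosh.comp (contDiff_const.mul contDiff_id)

theorem contDiff_sn (m : ℝ) : ContDiff ℝ ∞ (sn m) := by
  unfold sn
  split_ifs
  · exact (Real.contDiff_sin.comp (contDiff_const.mul contDiff_id)).div_const _
  · exact contDiff_id
  · exact (Real.contDiff_sinh.comp (contDiff_const.mul contDiff_id)).div_const _

theorem contDiff_vn (m : ℝ) : ContDiff ℝ ∞ (vn m) := by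
  unfold vn
  split_ifs
  · exact (contDiff_id.pow 2).div_const _
  · exact (contDiff_const.sub (contDiff_cn m)).div_const _

theorem eventually_sn_ne_zero (m : ℝ) : ∀ᶠ x in 𝓝[≠] 0, sn m x ≠ 0 :=
  (hasDerivAt_sn m 0).eventually_ne (by rw [cn_zero]; exact one_ne_zero)

theorem sn_eq_zero_of_vn {m x : ℝ} (h : vn m x = 0) : sn m x = 0 := by
  have := sn_sq m x
  rw [h] at this
  simpa using this

theorem eventually_vn_eq_zero (m : ℝ) : ∀ᶠ x in 𝓝 0, vn m x = 0 → x = 0 := by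
  have := eventually_nhdsWithin_iff.1 (eventually_sn_ne_zero m)
  filter_upwards [this] with x hx h
  by_contra h0
  exact hx h0 (sn_eq_zero_of_vn h)

/-- The Euclidean plane. -/
abbrev Plane : Type := EuclideanSpace ℝ (Fin 2)

/-- The curvature parameter of the lines of curvature `κ` of a tube. -/
def mX (κ : ℝ) : ℝ := κ ^ 2 - 1

/-- The curvature parameter of the lines of curvature `κ⁻¹` of a tube. -/
def mY (κ : ℝ) : ℝ := κ⁻¹ ^ 2 - 1

/-- The stretching factor `cosh h + k sinh h` of a direction of principal curvature `k` under the
normal flow through the distance `h`. -/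
def stretch (k h : ℝ) : ℝ := Real.cosh h + k * Real.sinh h

/-- The flat surface through the base point of `ℍ³` with constant principal curvatures
`κ, κ⁻¹`, in flat coordinates along the lines of curvature. -/
def tubeBase (κ : ℝ) (z : Plane) : Mink :=
  ![1 + vn (mX κ) (z 0) + vn (mY κ) (z 1), sn (mX κ) (z 0),
    sn (mY κ) (z 1), -(κ * vn (mX κ) (z 0)) - κ⁻¹ * vn (mY κ) (z 1)]

/-- The linear map that takes each point of the surface `tubeBase κ` to its unit normal. -/
def shapeOp (κ : ℝ) : Mink →ₗ[ℝ] Mink where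
  toFun v := ![-v 3, κ * v 1, κ⁻¹ * v 2, v 0 + (κ + κ⁻¹) * v 3]
  map_add' x y := by funext i; fin_cases i <;> simp <;> ring
  map_smul' a x := by funext i; fin_cases i <;> simp <;> ring

/-- The point at signed distance `h` from the surface `tubeBase κ`. -/
def tube (κ : ℝ) (z : Plane) (h : ℝ) : Mink :=
  Real.cosh h • tubeBase κ z + Real.sinh h • shapeOp κ (tubeBase κ z)

/-- The unit normal at `tube κ z h` of the parallel surface at signed distance `h`. -/
def tubeN (κ : ℝ) (z : Plane) (h : ℝ) : Mink :=
  Real.sinh h • tubeBase κ z + Real.cosh h • shapeOp κ (tubeBase κ z)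

/-- The unit tangent vector in the direction of curvature `κ`. -/
def tubeE₁ (κ : ℝ) (z : Plane) : Mink :=
  ![sn (mX κ) (z 0), cn (mX κ) (z 0), 0, -(κ * sn (mX κ) (z 0))]

/-- The unit tangent vector in the direction of curvature `κ⁻¹`. -/
def tubeE₂ (κ : ℝ) (z : Plane) : Mink :=
  ![sn (mY κ) (z 1), 0, cn (mY κ) (z 1), -(κ⁻¹ * sn (mY κ) (z 1))]

theorem tubeBase_zero (κ : ℝ) : tubeBase κ 0 = ![1, 0, 0, 0] := by
  simp [tubeBase, vn_zero, sn_zero]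

theorem shapeOp_apply (κ : ℝ) (v : Mink) :
    shapeOp κ v = ![-v 3, κ * v 1, κ⁻¹ * v 2, v 0 + (κ + κ⁻¹) * v 3] := rfl

theorem shapeOp_tubeE₁ {κ : ℝ} (hκ : κ ≠ 0) (z : Plane) :
    shapeOp κ (tubeE₁ κ z) = κ • tubeE₁ κ z := by
  funext i; fin_cases i <;> simp [shapeOp_apply, tubeE₁]
  field_simp; ring

theorem shapeOp_tubeE₂ {κ : ℝ} (hκ : κ ≠ 0) (z : Plane) :
    shapeOp κ (tubeE₂ κ z) = κ⁻¹ • tubeE₂ κ z := by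
  funext i; fin_cases i <;> simp [shapeOp_apply, tubeE₂]
  field_simp; ring

theorem shapeOp_sq {κ : ℝ} (hκ : κ ≠ 0) (v : Mink) :
    shapeOp κ (shapeOp κ v) = (κ + κ⁻¹) • shapeOp κ v - v := by
  funext i
  fin_cases i <;> simp [shapeOp_apply]
  · field_simp; ring
  · field_simp; ring
  · field_simp; ring
  · ring

theorem mink_shapeOp_left (κ : ℝ) (u v : Mink) : mink (shapeOp κ u) v = mink u (shapeOp κ v) := by
  simp [mink, shapeOp_apply]; ring

theorem isFrame_tubeBase {κ : ℝ} (hκ : 0 < κ) (z : Plane) :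
    IsFrame (tubeBase κ z) (tubeE₁ κ z) (tubeE₂ κ z) (shapeOp κ (tubeBase κ z)) := by
  have h1 := sn_sq (mX κ) (z 0)
  have h2 := sn_sq (mY κ) (z 1)
  have h3 := cn_eq (mX κ) (z 0)
  have h4 := cn_eq (mY κ) (z 1)
  have h5 := vn_nonneg (mX κ) (z 0)
  have h6 := vn_nonneg (mY κ) (z 1)
  have hk : κ * κ⁻¹ = 1 := mul_inv_cancel₀ hκ.ne'
  have hb : tubeBase κ z = ![1 + vn (mX κ) (z 0) + vn (mY κ) (z 1), sn (mX κ) (z 0),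
    sn (mY κ) (z 1), -(κ * vn (mX κ) (z 0)) - κ⁻¹ * vn (mY κ) (z 1)] := rfl
  have hE1 : tubeE₁ κ z = ![sn (mX κ) (z 0), cn (mX κ) (z 0), 0, -(κ * sn (mX κ) (z 0))] := rfl
  have hE2 : tubeE₂ κ z = ![sn (mY κ) (z 1), 0, cn (mY κ) (z 1), -(κ⁻¹ * sn (mY κ) (z 1))] := rfl
  have hX : mX κ = κ ^ 2 - 1 := rfl
  have hY : mY κ = κ⁻¹ ^ 2 - 1 := rfl
  have hne : κ ≠ 0 := hκ.ne'
  generalize vn (mX κ) (z 0) = V at *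
  generalize vn (mY κ) (z 1) = W at *
  generalize sn (mX κ) (z 0) = S at *
  generalize sn (mY κ) (z 1) = T at *
  generalize cn (mX κ) (z 0) = C at *
  generalize cn (mY κ) (z 1) = D at *
  rw [hX] at h1 h3
  rw [hY] at h2 h4
  have hbb : mink (tubeBase κ z) (tubeBase κ z) = -1 := by
    rw [hb]; simp only [mink]; simp
    generalize κ⁻¹ = k at *
    linear_combination h1 + h2 + (2 * V * W) * hk
  have hbn : mink (tubeBase κ z) (shapeOp κ (tubeBase κ z)) = 0 := by
    rw [hb]; simp only [mink, shapeOp_apply]; simp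
    generalize κ⁻¹ = k at *
    linear_combination κ * h1 + k * h2 + ((κ + k) * 2 * V * W +
      (κ * V ^ 2 + k * W ^ 2)) * hk
  refine ⟨⟨hbb, ?_⟩, ?_, ?_, hbn, ?_, ?_, ?_, ?_, ?_, ?_⟩
  · rw [hb]; simp; linarith
  · rw [hb, hE1, h3]; simp only [mink]; simp
    generalize κ⁻¹ = k at *
    linear_combination (S * W) * hk
  · rw [hb, hE2, h4]; simp only [mink]; simp [-inv_pow]
    generalize κ⁻¹ = k at *
    linear_combination (T * V) * hk
  · rw [hE1, h3]; simp only [mink]; simp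
    linear_combination (κ ^ 2 - 1) * h1
  · rw [hE2, h4]; simp only [mink]; simp [-inv_pow]
    generalize κ⁻¹ = k at *
    linear_combination (k ^ 2 - 1) * h2
  · rw [mink_shapeOp_left, shapeOp_sq hκ.ne', mink_sub_right, mink_smul_right, hbn, hbb]; ring
  · rw [hE1, hE2]; simp only [mink]; simp
    generalize κ⁻¹ = k at *
    linear_combination (S * T) * hk
  · rw [← mink_shapeOp_left, shapeOp_tubeE₁ hκ.ne', mink_smul_left, mink_comm, hb, hE1, h3]
    simp only [mink]; simp
    right
    generalize κ⁻¹ = k at *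
    linear_combination (S * W) * hk
  · rw [← mink_shapeOp_left, shapeOp_tubeE₂ hκ.ne', mink_smul_left, mink_comm, hb, hE2, h4]
    simp only [mink]; simp [-inv_pow]
    right
    generalize κ⁻¹ = k at *
    linear_combination (T * V) * hk

theorem tubeBase_mem {κ : ℝ} (hκ : 0 < κ) (z : Plane) : tubeBase κ z ∈ hyp3 :=
  (isFrame_tubeBase hκ z).mem

theorem tube_mem {κ : ℝ} (hκ : 0 < κ) (z : Plane) (h : ℝ) : tube κ z h ∈ hyp3 :=
  geodesic_mem_hyp3 (tubeBase_mem hκ z) (isFrame_tubeBase hκ z).pn (isFrame_tubeBase hκ z).nn h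

theorem tube_zero (κ : ℝ) (z : Plane) : tube κ z 0 = tubeBase κ z := by simp [tube]

theorem tubeN_zero (κ : ℝ) (z : Plane) : tubeN κ z 0 = shapeOp κ (tubeBase κ z) := by
  simp [tubeN]

theorem tube_add (κ : ℝ) (z : Plane) (h t : ℝ) :
    tube κ z (h + t) = Real.cosh t • tube κ z h + Real.sinh t • tubeN κ z h := by
  simp only [tube, tubeN, Real.cosh_add, Real.sinh_add]
  module

theorem isFrame_tube {κ : ℝ} (hκ : 0 < κ) (z : Plane) (h : ℝ) :
    IsFrame (tube κ z h) (tubeE₁ κ z) (tubeE₂ κ z) (tubeN κ z h) := by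
  obtain ⟨h0, h1, h2, h3, h4, h5, h6, h7, h8, h9⟩ := isFrame_tubeBase hκ z
  have hc := Real.cosh_sq h
  refine ⟨tube_mem hκ z h, ?_, ?_, ?_, h4, h5, ?_, h7, ?_, ?_⟩ <;>
  simp only [tube, tubeN, mink_add_left, mink_add_right, mink_smul_left, mink_smul_right, h0.1,
    h1, h2, h3, h6, h8, h9, mink_comm (shapeOp κ (tubeBase κ z)) (tubeBase κ z),
    mink_comm (tubeE₁ κ z) (tubeBase κ z), mink_comm (tubeE₂ κ z) (tubeBase κ z),
    mink_comm (shapeOp κ (tubeBase κ z)) (tubeE₁ κ z),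
    mink_comm (shapeOp κ (tubeBase κ z)) (tubeE₂ κ z)] <;> nlinarith

theorem exists_tubeTrans {κ : ℝ} (hκ : 0 < κ) (v : Plane) :
    ∃ A : Mink ≃ₗ[ℝ] Mink, IsHypIso A ∧ (∀ u, A (tubeBase κ u) = tubeBase κ (v + u)) ∧
      ∀ x, A (shapeOp κ x) = shapeOp κ (A x) := by
  obtain ⟨A, hA, hA2⟩ := (isFrame_tubeBase hκ v).exists_iso
  refine ⟨A, hA, fun u => ?_, fun x => ?_⟩
  · rw [hA2]
    have h1 := vn_add (mX κ) (v 0) (u 0)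
    have h2 := vn_add (mY κ) (v 1) (u 1)
    have h3 := sn_add (mX κ) (v 0) (u 0)
    have h4 := sn_add (mY κ) (v 1) (u 1)
    have h5 := cn_eq (mX κ) (v 0)
    have h6 := cn_eq (mY κ) (v 1)
    have h7 := cn_eq (mX κ) (u 0)
    have h8 := cn_eq (mY κ) (u 1)
    have hk : κ * κ⁻¹ = 1 := mul_inv_cancel₀ hκ.ne'
    have hX : mX κ = κ ^ 2 - 1 := rfl
    have hY : mY κ = κ⁻¹ ^ 2 - 1 := rfl
    rw [h5] at h1 h3
    rw [h6] at h2 h4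
    rw [h7] at h3
    rw [h8] at h4
    simp only [tubeBase, shapeOp_apply, tubeE₁, tubeE₂, PiLp.add_apply, h1, h2, h3, h4, h5, h6]
    clear h1 h2 h3 h4 h5 h6 h7 h8
    generalize vn (mX κ) (v 0) = V
    generalize vn (mY κ) (v 1) = W
    generalize sn (mX κ) (v 0) = S
    generalize sn (mY κ) (v 1) = T
    generalize vn (mX κ) (u 0) = V'
    generalize vn (mY κ) (u 1) = W'
    generalize sn (mX κ) (u 0) = S'
    generalize sn (mY κ) (u 1) = T'
    rw [hX, hY]
    generalize κ⁻¹ = k at *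
    funext i
    fin_cases i
    · simp
      linear_combination (-(V * W' + W * V')) * hk
    · simp
      linear_combination (-S * W') * hk
    · simp
      linear_combination (-T * V') * hk
    · simp
      linear_combination (κ * V * V' + k * W * W' + (κ + k) * (V * W' + W * V')) * hk
  · rw [hA2, hA2, map_add, map_add, map_add, map_smul, map_smul, map_smul, map_smul,
      shapeOp_tubeE₁ hκ.ne', shapeOp_tubeE₂ hκ.ne', shapeOp_sq hκ.ne']
    simp [shapeOp_apply κ x]
    module

/-- The isometry of `ℍ³` that translates the surface `tubeBase κ` by `v`. -/
def tubeTrans (κ : ℝ) (v : Plane) : Mink ≃ₗ[ℝ] Mink :=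
  if hκ : 0 < κ then (exists_tubeTrans hκ v).choose else LinearEquiv.refl ℝ Mink

theorem isHypIso_tubeTrans (κ : ℝ) (v : Plane) : IsHypIso (tubeTrans κ v) := by
  unfold tubeTrans
  split_ifs with h
  · exact (exists_tubeTrans h v).choose_spec.1
  · exact IsHypIso.refl

theorem tubeTrans_shapeOp {κ : ℝ} (hκ : 0 < κ) (v : Plane) (x : Mink) :
    tubeTrans κ v (shapeOp κ x) = shapeOp κ (tubeTrans κ v x) := by
  rw [tubeTrans, dif_pos hκ]; exact (exists_tubeTrans hκ v).choose_spec.2.2 x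

theorem tubeTrans_tubeBase {κ : ℝ} (hκ : 0 < κ) (v u : Plane) :
    tubeTrans κ v (tubeBase κ u) = tubeBase κ (v + u) := by
  rw [tubeTrans, dif_pos hκ]; exact (exists_tubeTrans hκ v).choose_spec.2.1 u

theorem tubeTrans_tube {κ : ℝ} (hκ : 0 < κ) (v u : Plane) (h : ℝ) :
    tubeTrans κ v (tube κ u h) = tube κ (v + u) h := by
  simp only [tube, map_add, map_smul, tubeTrans_shapeOp hκ, tubeTrans_tubeBase hκ]

theorem mink_tube_tube {κ : ℝ} (hκ : 0 < κ) (z z' : Plane) (h h' : ℝ) :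
    mink (tube κ z h) (tube κ z' h') = -(Real.cosh (h - h')
      + stretch κ h * stretch κ h' * vn (mX κ) (z 0 - z' 0)
      + stretch κ⁻¹ h * stretch κ⁻¹ h' * vn (mY κ) (z 1 - z' 1)) := by
  have h1 := tubeTrans_tube hκ z' (z - z') h
  have h2 := tubeTrans_tube hκ z' 0 h'
  rw [add_sub_cancel] at h1
  rw [add_zero] at h2
  rw [← h1, ← h2, (isHypIso_tubeTrans κ z').map_mink]
  have hk : κ * κ⁻¹ = 1 := mul_inv_cancel₀ hκ.ne'
  simp only [tube, tubeBase_zero]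
  simp only [shapeOp_apply, mink, tubeBase, stretch, Real.cosh_sub]
  simp
  generalize vn (mX κ) (z 0 - z' 0) = V
  generalize vn (mY κ) (z 1 - z' 1) = W
  generalize κ⁻¹ = k at *
  linear_combination (-Real.sinh h * Real.sinh h') * (V + W) * hk

/-- Hyperbolic distances in tube coordinates. -/
theorem hcosh_tube {κ : ℝ} (hκ : 0 < κ) (z z' : Plane) (h h' : ℝ) :
    hcosh (tube κ z h) (tube κ z' h') = Real.cosh (h - h')
      + stretch κ h * stretch κ h' * vn (mX κ) (z 0 - z' 0)
      + stretch κ⁻¹ h * stretch κ⁻¹ h' * vn (mY κ) (z 1 - z' 1) := by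
  rw [hcosh, mink_tube_tube hκ, neg_neg]

theorem hasDerivAt_stretch (k h : ℝ) :
    HasDerivAt (stretch k) (Real.sinh h + k * Real.cosh h) h :=
  (Real.hasDerivAt_cosh h).add ((Real.hasDerivAt_sinh h).const_mul k)

theorem hasDerivAt_tube (κ : ℝ) (z : Plane) (h : ℝ) :
    HasDerivAt (tube κ z) (tubeN κ z h) h :=
  ((Real.hasDerivAt_cosh h).smul_const _).add ((Real.hasDerivAt_sinh h).smul_const _)

theorem mink_tubeN_tube {κ : ℝ} (hκ : 0 < κ) (z z' : Plane) (h h' : ℝ) :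
    mink (tubeN κ z h) (tube κ z' h') = -(Real.sinh (h - h')
      + (Real.sinh h + κ * Real.cosh h) * stretch κ h' * vn (mX κ) (z 0 - z' 0)
      + (Real.sinh h + κ⁻¹ * Real.cosh h) * stretch κ⁻¹ h' * vn (mY κ) (z 1 - z' 1)) := by
  have h1 : HasDerivAt (fun t => mink (tube κ z t) (tube κ z' h'))
      (mink (tubeN κ z h) (tube κ z' h')) h := by
    have := (minkL.flip (tube κ z' h')).hasFDerivAt.comp_hasDerivAt h (hasDerivAt_tube κ z h)
    exact this
  have h2 : HasDerivAt (fun t => mink (tube κ z t) (tube κ z' h')) (-(Real.sinh (h - h')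
      + (Real.sinh h + κ * Real.cosh h) * stretch κ h' * vn (mX κ) (z 0 - z' 0)
      + (Real.sinh h + κ⁻¹ * Real.cosh h) * stretch κ⁻¹ h' * vn (mY κ) (z 1 - z' 1))) h := by
    have hf : (fun t => mink (tube κ z t) (tube κ z' h')) = fun h => -(Real.cosh (h - h')
      + stretch κ h * stretch κ h' * vn (mX κ) (z 0 - z' 0)
      + stretch κ⁻¹ h * stretch κ⁻¹ h' * vn (mY κ) (z 1 - z' 1)) := by
      funext t; exact mink_tube_tube hκ z z' t h'
    rw [hf]
    have hc : HasDerivAt (fun t => Real.cosh (t - h')) (Real.sinh (h - h')) h := by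
      have := (Real.hasDerivAt_cosh (h - h')).comp h ((hasDerivAt_id h).sub_const h')
      rw [mul_one] at this
      exact this
    exact ((hc.add (((hasDerivAt_stretch κ h).mul_const _).mul_const _)).add
      (((hasDerivAt_stretch κ⁻¹ h).mul_const _).mul_const _)).neg
  exact h1.unique h2

/-- A linear map is determined by its values on an open piece of a tube surface. -/
theorem linearEquiv_eq_of_tubeBase {κ : ℝ} (hκ : 0 < κ) {A B : Mink ≃ₗ[ℝ] Mink} {z : Plane}
    (h : ∀ᶠ u in 𝓝 z, A (tubeBase κ u) = B (tubeBase κ u)) : A = B := by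
  have h' : ∀ᶠ u in 𝓝 (0 : Plane), (((tubeTrans κ z).trans A).toLinearMap
      - ((tubeTrans κ z).trans B).toLinearMap) (tubeBase κ u) = 0 := by
    have ht : Tendsto (fun u : Plane => z + u) (𝓝 0) (𝓝 z) := by
      have : Continuous fun u : Plane => z + u := by fun_prop
      simpa using this.tendsto 0
    filter_upwards [ht.eventually h] with u hu
    simp [tubeTrans_tubeBase hκ, hu]
  suffices hs : ((tubeTrans κ z).trans A).toLinearMap
      - ((tubeTrans κ z).trans B).toLinearMap = 0 by
    have h2 : (tubeTrans κ z).trans A = (tubeTrans κ z).trans B :=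
      LinearEquiv.toLinearMap_injective (sub_eq_zero.1 hs)
    ext1 x
    have := LinearEquiv.congr_fun h2 ((tubeTrans κ z).symm x)
    simpa using this
  generalize ((tubeTrans κ z).trans A).toLinearMap
      - ((tubeTrans κ z).trans B).toLinearMap = C at h'
  have hexp : ∀ u : Plane, C (tubeBase κ u) = C (![1, 0, 0, 0])
      + vn (mX κ) (u 0) • C (![1, 0, 0, -κ]) + sn (mX κ) (u 0) • C (![0, 1, 0, 0])
      + vn (mY κ) (u 1) • C (![1, 0, 0, -κ⁻¹])
      + sn (mY κ) (u 1) • C (![0, 0, 1, 0]) := by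
    intro u
    rw [← map_smul, ← map_smul, ← map_smul, ← map_smul, ← map_add, ← map_add, ← map_add,
      ← map_add]
    congr 1
    funext i
    fin_cases i <;> simp [tubeBase] <;> ring
  have h0 : C (![1, 0, 0, 0]) = 0 := by
    have := h'.self_of_nhds
    rw [hexp] at this
    simpa [vn_zero, sn_zero] using this
  have hx : ∀ᶠ x : ℝ in 𝓝 0, vn (mX κ) x • C (![1, 0, 0, -κ])
      + sn (mX κ) x • C (![0, 1, 0, 0]) = 0 := by
    have ht : Tendsto (fun x : ℝ => (x • EuclideanSpace.single 0 1 : Plane)) (𝓝 0) (𝓝 0) := by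
      have : Continuous (fun x : ℝ => (x • EuclideanSpace.single 0 1 : Plane)) := by fun_prop
      simpa using this.tendsto 0
    filter_upwards [ht.eventually h'] with x hx
    rw [hexp, h0] at hx
    simpa [vn_zero, sn_zero] using hx
  have hy : ∀ᶠ x : ℝ in 𝓝 0, vn (mY κ) x • C (![1, 0, 0, -κ⁻¹])
      + sn (mY κ) x • C (![0, 0, 1, 0]) = 0 := by
    have ht : Tendsto (fun x : ℝ => (x • EuclideanSpace.single 1 1 : Plane)) (𝓝 0) (𝓝 0) := by
      have : Continuous (fun x : ℝ => (x • EuclideanSpace.single 1 1 : Plane)) := by fun_prop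
      simpa using this.tendsto 0
    filter_upwards [ht.eventually h'] with x hx
    rw [hexp, h0] at hx
    simpa [vn_zero, sn_zero] using hx
  -- the derivative at the origin isolates the linear term
  have hlin : ∀ (m : ℝ) (a b : Mink), (∀ᶠ x : ℝ in 𝓝 0, vn m x • a + sn m x • b = 0) →
      b = 0 ∧ a = 0 := by
    intro m a b hab
    have hd : HasDerivAt (fun x : ℝ => vn m x • a + sn m x • b) (sn m 0 • a + cn m 0 • b) 0 :=
      ((hasDerivAt_vn m 0).smul_const a).add ((hasDerivAt_sn m 0).smul_const b)
    have hd0 : HasDerivAt (fun x : ℝ => vn m x • a + sn m x • b) 0 0 :=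
      (hasDerivAt_const (0 : ℝ) (0 : Mink)).congr_of_eventuallyEq hab
    have hb := hd.unique hd0
    rw [sn_zero, cn_zero, zero_smul, one_smul, zero_add] at hb
    refine ⟨hb, ?_⟩
    have h1 := (eventually_nhdsWithin_of_eventually_nhds (s := {(0 : ℝ)}ᶜ)
      ((eventually_vn_eq_zero m).and hab)).and self_mem_nhdsWithin
    obtain ⟨x, ⟨hx1, hx2⟩, hx3⟩ := h1.exists
    rw [hb, smul_zero, add_zero] at hx2
    exact (smul_eq_zero.1 hx2).resolve_left fun h => hx3 (hx1 h)
  obtain ⟨h1, h3⟩ := hlin _ _ _ hx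
  obtain ⟨h2, -⟩ := hlin _ _ _ hy
  have h33 : C (![0, 0, 0, 1]) = 0 := by
    have : (![1, 0, 0, -κ] : Mink) = ![1, 0, 0, 0] + (-κ) • ![0, 0, 0, 1] := by
      funext i; fin_cases i <;> simp
    rw [this, map_add, map_smul, h0, zero_add] at h3
    exact (smul_eq_zero.1 h3).resolve_left (by simpa using hκ.ne')
  refine LinearMap.ext fun x => ?_
  have hx : x = x 0 • ![1, 0, 0, 0] + x 1 • ![0, 1, 0, 0] + x 2 • ![0, 0, 1, 0]
      + x 3 • ![0, 0, 0, 1] := by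
    funext i; fin_cases i <;> simp
  rw [hx, map_add, map_add, map_add, map_smul, map_smul, map_smul, map_smul, h0, h1, h2, h33]
  simp

theorem tubeTrans_add {κ : ℝ} (hκ : 0 < κ) (u v : Plane) :
    tubeTrans κ (u + v) = (tubeTrans κ v).trans (tubeTrans κ u) := by
  refine linearEquiv_eq_of_tubeBase hκ (z := 0) (Eventually.of_forall fun w => ?_)
  simp [tubeTrans_tubeBase hκ, add_assoc]

theorem det_tubeTrans_pos {κ : ℝ} (hκ : 0 < κ) (v : Plane) :
    0 < LinearMap.det (tubeTrans κ v).toLinearMap := by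
  have h : tubeTrans κ v = (tubeTrans κ ((1 / 2 : ℝ) • v)).trans (tubeTrans κ ((1 / 2 : ℝ) • v)) := by
    rw [← tubeTrans_add hκ, ← add_smul]; norm_num
  have h0 : LinearMap.det (tubeTrans κ ((1 / 2 : ℝ) • v)).toLinearMap ≠ 0 :=
    (LinearEquiv.isUnit_det' _).ne_zero
  rw [h, LinearEquiv.coe_trans, LinearMap.det_comp]
  exact mul_self_pos.2 h0

end

section

/-! ### Tube coordinates are local coordinates -/

theorem contDiff_tubeBase (κ : ℝ) : ContDiff ℝ ∞ (tubeBase κ) := by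
  have h0 : ContDiff ℝ ∞ (fun z : Plane => z 0) := (EuclideanSpace.proj (0 : Fin 2) : Plane →L[ℝ] ℝ).contDiff
  have h1 : ContDiff ℝ ∞ (fun z : Plane => z 1) := (EuclideanSpace.proj (1 : Fin 2) : Plane →L[ℝ] ℝ).contDiff
  have hV := (contDiff_vn (mX κ)).comp h0
  have hW := (contDiff_vn (mY κ)).comp h1
  have hS := (contDiff_sn (mX κ)).comp h0
  have hT := (contDiff_sn (mY κ)).comp h1
  refine contDiff_pi.2 fun i => ?_
  fin_cases i
  · exact (contDiff_const.add hV).add hW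
  · exact hS
  · exact hT
  · exact (contDiff_const.mul hV).neg.sub (contDiff_const.mul hW)

theorem contDiff_shapeOp (κ : ℝ) : ContDiff ℝ ∞ (shapeOp κ) :=
  (LinearMap.toContinuousLinearMap (shapeOp κ)).contDiff

theorem contDiff_tube (κ : ℝ) : ContDiff ℝ ∞ (fun p : Plane × ℝ => tube κ p.1 p.2) := by
  have h1 : ContDiff ℝ ∞ (fun p : Plane × ℝ => tubeBase κ p.1) :=
    (contDiff_tubeBase κ).comp contDiff_fst
  have h2 : ContDiff ℝ ∞ (fun p : Plane × ℝ => shapeOp κ (tubeBase κ p.1)) :=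
    (contDiff_shapeOp κ).comp h1
  exact ((Real.contDiff_cosh.comp contDiff_snd).smul h1).add
    ((Real.contDiff_sinh.comp contDiff_snd).smul h2)

theorem continuous_tube (κ : ℝ) : Continuous (fun p : Plane × ℝ => tube κ p.1 p.2) :=
  (contDiff_tube κ).continuous

theorem continuous_tubeN (κ : ℝ) : Continuous (fun p : Plane × ℝ => tubeN κ p.1 p.2) := by
  have h1 : Continuous (fun p : Plane × ℝ => tubeBase κ p.1) :=
    (contDiff_tubeBase κ).continuous.comp continuous_fst
  have h2 : Continuous (fun p : Plane × ℝ => shapeOp κ (tubeBase κ p.1)) :=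
    (contDiff_shapeOp κ).continuous.comp h1
  exact ((Real.continuous_sinh.comp continuous_snd).smul h1).add
    ((Real.continuous_cosh.comp continuous_snd).smul h2)

theorem hasFDerivAt_tubeBase (κ : ℝ) (z : Plane) :
    HasFDerivAt (tubeBase κ)
      ((EuclideanSpace.proj (0 : Fin 2) : Plane →L[ℝ] ℝ).smulRight (tubeE₁ κ z)
        + (EuclideanSpace.proj (1 : Fin 2) : Plane →L[ℝ] ℝ).smulRight (tubeE₂ κ z)) z := by
  set F1 : ℝ → Mink := fun x => ![1 + vn (mX κ) x, sn (mX κ) x, 0, -(κ * vn (mX κ) x)] with hF1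
  set F2 : ℝ → Mink := fun x => ![vn (mY κ) x, 0, sn (mY κ) x, -(κ⁻¹ * vn (mY κ) x)] with hF2
  have h1 : HasDerivAt F1 (tubeE₁ κ z) (z 0) := by
    refine hasDerivAt_pi.2 fun i => ?_
    fin_cases i
    · simpa [hF1, tubeE₁] using (hasDerivAt_vn (mX κ) (z 0)).const_add 1
    · simpa [hF1, tubeE₁] using hasDerivAt_sn (mX κ) (z 0)
    · simpa [hF1, tubeE₁] using hasDerivAt_const (z 0) (0 : ℝ)
    · exact ((hasDerivAt_vn (mX κ) (z 0)).const_mul κ).fun_neg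
  have h2 : HasDerivAt F2 (tubeE₂ κ z) (z 1) := by
    refine hasDerivAt_pi.2 fun i => ?_
    fin_cases i
    · simpa [hF2, tubeE₂] using (hasDerivAt_vn (mY κ) (z 1))
    · simpa [hF2, tubeE₂] using hasDerivAt_const (z 1) (0 : ℝ)
    · simpa [hF2, tubeE₂] using hasDerivAt_sn (mY κ) (z 1)
    · exact ((hasDerivAt_vn (mY κ) (z 1)).const_mul κ⁻¹).fun_neg
  have h3 := HasFDerivAt.comp z (g := F1) (f := (EuclideanSpace.proj (0 : Fin 2) : Plane →L[ℝ] ℝ))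
    h1.hasFDerivAt (EuclideanSpace.proj (0 : Fin 2) : Plane →L[ℝ] ℝ).hasFDerivAt
  have h4 := HasFDerivAt.comp z (g := F2) (f := (EuclideanSpace.proj (1 : Fin 2) : Plane →L[ℝ] ℝ))
    h2.hasFDerivAt (EuclideanSpace.proj (1 : Fin 2) : Plane →L[ℝ] ℝ).hasFDerivAt
  refine ((h3.add h4).congr_of_eventuallyEq (Eventually.of_forall fun u => ?_)).congr_fderiv
    (by ext1 v; simp)
  funext i
  fin_cases i <;> simp [tubeBase, hF1, hF2]
  ring

theorem hasFDerivAt_tube {κ : ℝ} (hκ : κ ≠ 0) (z : Plane) (h : ℝ) :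
    HasFDerivAt (fun z => tube κ z h)
      ((EuclideanSpace.proj (0 : Fin 2) : Plane →L[ℝ] ℝ).smulRight (stretch κ h • tubeE₁ κ z)
        + (EuclideanSpace.proj (1 : Fin 2) : Plane →L[ℝ] ℝ).smulRight
          (stretch κ⁻¹ h • tubeE₂ κ z)) z := by
  have h1 := hasFDerivAt_tubeBase κ z
  have h2 := (LinearMap.toContinuousLinearMap (shapeOp κ)).hasFDerivAt.comp z h1
  refine ((h1.const_smul (Real.cosh h)).add (h2.const_smul (Real.sinh h))).congr_fderiv ?_
  ext1 v
  have e1 := shapeOp_tubeE₁ hκ z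
  have e2 := shapeOp_tubeE₂ hκ z
  simp [e1, e2, stretch]
  module

/-- Near a point of positive stretching, tube coordinates are open as a map onto `ℍ³`. -/
theorem map_tube_nhds {κ : ℝ} (hκ : 0 < κ) (z : Plane) (h : ℝ) (ha : stretch κ h ≠ 0)
    (hb : stretch κ⁻¹ h ≠ 0) :
    map (fun p : Plane × ℝ => tube κ p.1 p.2) (𝓝 (z, h)) = 𝓝[hyp3] (tube κ z h) := by
  -- the radial scaling turns tube coordinates into coordinates of the ambient vector space
  set Φ : (Plane × ℝ) × ℝ → Mink := fun q => Real.exp q.2 • tube κ q.1.1 q.1.2 with hΦ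
  have hC : ContDiff ℝ 1 Φ :=
    ((Real.contDiff_exp.comp contDiff_snd).smul ((contDiff_tube κ).comp contDiff_fst)).of_le
      (by exact_mod_cast le_top)
  have hstrict := hC.contDiffAt (x := ((z, h), (0 : ℝ))) |>.hasStrictFDerivAt one_ne_zero
  have hfd := hstrict.hasFDerivAt
  have hframe := isFrame_tube hκ z h
  set D := fderiv ℝ Φ ((z, h), 0) with hD
  have d1 : ∀ v : Plane, D ((v, 0), 0)
      = (v 0) • stretch κ h • tubeE₁ κ z + (v 1) • stretch κ⁻¹ h • tubeE₂ κ z := by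
    intro v
    have hc : HasFDerivAt (fun u : Plane => ((u, h), (0 : ℝ)))
        ((ContinuousLinearMap.inl ℝ (Plane × ℝ) ℝ).comp (ContinuousLinearMap.inl ℝ Plane ℝ)) z := by
      have h1 := (ContinuousLinearMap.inl ℝ (Plane × ℝ) ℝ).hasFDerivAt.comp z
        (((ContinuousLinearMap.inl ℝ Plane ℝ).hasFDerivAt (x := z)).add_const ((0 : Plane), h))
      refine h1.congr_of_eventuallyEq (Eventually.of_forall fun u => ?_)
      simp
    have h1 := hfd.comp z hc
    have h2 : Φ ∘ (fun u : Plane => ((u, h), (0 : ℝ))) = fun u => tube κ u h := by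
      funext u; simp [hΦ]
    rw [h2] at h1
    have := congrArg (fun L => L v) (h1.unique (hasFDerivAt_tube hκ.ne' z h))
    simpa using this
  have d2 : D ((0, 1), 0) = tubeN κ z h := by
    have hc : HasDerivAt (fun u : ℝ => ((z, u), (0 : ℝ))) (((0 : Plane), (1 : ℝ)), (0 : ℝ)) h :=
      ((hasDerivAt_const h z).prodMk (hasDerivAt_id h)).prodMk (hasDerivAt_const h (0 : ℝ))
    have h1 := hfd.comp_hasDerivAt h hc
    have h2 : Φ ∘ (fun u : ℝ => ((z, u), (0 : ℝ))) = fun u => tube κ z u := by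
      funext u; simp [hΦ]
    rw [h2] at h1
    exact h1.unique (hasDerivAt_tube κ z h)
  have d3 : D ((0, 0), 1) = tube κ z h := by
    have hc : HasDerivAt (fun u : ℝ => ((z, h), u)) (((0 : Plane), (0 : ℝ)), (1 : ℝ)) 0 :=
      (hasDerivAt_const 0 (z, h)).prodMk (hasDerivAt_id 0)
    have h1 := hfd.comp_hasDerivAt 0 hc
    have h2 : HasDerivAt (fun u : ℝ => Real.exp u • tube κ z h) (Real.exp 0 • tube κ z h) 0 :=
      (Real.hasDerivAt_exp 0).smul_const _
    rw [Real.exp_zero, one_smul] at h2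
    exact h1.unique h2
  have hsurj : D.range = ⊤ := by
    rw [LinearMap.range_eq_top]
    intro v
    refine ⟨(((mink v (tubeE₁ κ z) / stretch κ h) • EuclideanSpace.single 0 1
      + (mink v (tubeE₂ κ z) / stretch κ⁻¹ h) • EuclideanSpace.single 1 1,
      mink v (tubeN κ z h)), -mink v (tube κ z h)), ?_⟩
    have hsplit : ∀ (a : Plane) (b c : ℝ), (((a, b), c) : (Plane × ℝ) × ℝ)
        = ((a, 0), 0) + b • ((0, 1), 0) + c • ((0, 0), 1) := by
      intro a b c; simp
    rw [hsplit]
    simp only [ContinuousLinearMap.coe_coe, map_add, map_smul, d1, d2, d3]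
    conv_rhs => rw [hframe.expand v]
    simp [smul_smul, ha, hb]
    abel
  have hmap := hstrict.map_nhds_eq_of_surj hsurj
  have hΦ0 : Φ ((z, h), 0) = tube κ z h := by simp [hΦ]
  rw [hΦ0] at hmap
  apply le_antisymm
  · refine tendsto_nhdsWithin_iff.2 ⟨(continuous_tube κ).tendsto (z, h),
      Eventually.of_forall fun p => tube_mem hκ _ _⟩
  · intro s hs
    rw [mem_map] at hs
    have h1 : Φ '' (((fun p : Plane × ℝ => tube κ p.1 p.2) ⁻¹' s) ×ˢ univ) ∈ 𝓝 (tube κ z h) := by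
      rw [← hmap]
      refine image_mem_map ?_
      rw [nhds_prod_eq]
      exact prod_mem_prod hs univ_mem
    filter_upwards [mem_nhdsWithin_of_mem_nhds h1, self_mem_nhdsWithin] with x hx hx3
    obtain ⟨⟨p, t⟩, ⟨hp, -⟩, rfl⟩ := hx
    have hm := hx3.1
    simp only [hΦ, mink_smul_left, mink_smul_right, (tube_mem hκ p.1 p.2).1] at hm
    have ht : Real.exp t = 1 := by nlinarith [Real.exp_pos t]
    simpa [hΦ, ht] using hp

/-- Tube coordinates are locally injective. -/
theorem eventually_tube_injective {κ : ℝ} (hκ : 0 < κ) (z : Plane) (h : ℝ)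
    (ha : 0 < stretch κ h) (hb : 0 < stretch κ⁻¹ h) :
    ∃ s ∈ 𝓝 (z, h), InjOn (fun p : Plane × ℝ => tube κ p.1 p.2) s := by
  obtain ⟨ε1, he1, h1⟩ := Metric.eventually_nhds_iff.1 (eventually_vn_eq_zero (mX κ))
  obtain ⟨ε2, he2, h2⟩ := Metric.eventually_nhds_iff.1 (eventually_vn_eq_zero (mY κ))
  have hca : Continuous (stretch κ) := by unfold stretch; fun_prop
  have hcb : Continuous (stretch κ⁻¹) := by unfold stretch; fun_prop
  have hx : ∀ᶠ p : Plane × ℝ in 𝓝 (z, h), |p.1 0 - z 0| < ε1 / 2 := by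
    have : Continuous fun p : Plane × ℝ => |p.1 0 - z 0| := by fun_prop
    exact this.continuousAt.eventually (gt_mem_nhds (by simpa using by linarith))
  have hy : ∀ᶠ p : Plane × ℝ in 𝓝 (z, h), |p.1 1 - z 1| < ε2 / 2 := by
    have : Continuous fun p : Plane × ℝ => |p.1 1 - z 1| := by fun_prop
    exact this.continuousAt.eventually (gt_mem_nhds (by simpa using by linarith))
  have hA : ∀ᶠ p : Plane × ℝ in 𝓝 (z, h), 0 < stretch κ p.2 :=
    (hca.comp continuous_snd).continuousAt.eventually (lt_mem_nhds ha)
  have hB : ∀ᶠ p : Plane × ℝ in 𝓝 (z, h), 0 < stretch κ⁻¹ p.2 :=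
    (hcb.comp continuous_snd).continuousAt.eventually (lt_mem_nhds hb)
  refine ⟨_, (hx.and (hy.and (hA.and hB))), ?_⟩
  rintro ⟨u, s⟩ ⟨hu1, hu2, hu3, hu4⟩ ⟨v, t⟩ ⟨hv1, hv2, hv3, hv4⟩ huv
  simp only at *
  have hd := hcosh_tube hκ u v s t
  rw [huv, hcosh_self (tube_mem hκ v t)] at hd
  have hc := Real.one_le_cosh (s - t)
  have hv0 := vn_nonneg (mX κ) (u 0 - v 0)
  have hw0 := vn_nonneg (mY κ) (u 1 - v 1)
  have p1 := mul_pos hu3 hv3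
  have p2 := mul_pos hu4 hv4
  have q1 := mul_nonneg p1.le hv0
  have q2 := mul_nonneg p2.le hw0
  have r1 : vn (mX κ) (u 0 - v 0) = 0 := by
    have : stretch κ s * stretch κ t * vn (mX κ) (u 0 - v 0) = 0 := by linarith
    exact (mul_eq_zero.1 this).resolve_left p1.ne'
  have r2 : vn (mY κ) (u 1 - v 1) = 0 := by
    have : stretch κ⁻¹ s * stretch κ⁻¹ t * vn (mY κ) (u 1 - v 1) = 0 := by linarith
    exact (mul_eq_zero.1 this).resolve_left p2.ne'
  have r3 : Real.cosh (s - t) = 1 := by linarith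
  have s1 : u 0 - v 0 = 0 := by
    refine h1 ?_ r1
    rw [Real.dist_eq, sub_zero]
    calc |u 0 - v 0| = |(u 0 - z 0) - (v 0 - z 0)| := by ring_nf
      _ ≤ |u 0 - z 0| + |v 0 - z 0| := abs_sub _ _
      _ < ε1 := by linarith
  have s2 : u 1 - v 1 = 0 := by
    refine h2 ?_ r2
    rw [Real.dist_eq, sub_zero]
    calc |u 1 - v 1| = |(u 1 - z 1) - (v 1 - z 1)| := by ring_nf
      _ ≤ |u 1 - z 1| + |v 1 - z 1| := abs_sub _ _
      _ < ε2 := by linarith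
  have s3 : s - t = 0 := by
    by_contra hne
    exact absurd r3 (Real.one_lt_cosh.2 hne).ne'
  refine Prod.ext ?_ (sub_eq_zero.1 s3)
  ext i
  fin_cases i
  · exact sub_eq_zero.1 s1
  · exact sub_eq_zero.1 s2

/-- The quadratic form whose level sets in `ℍ³` are the parallel surfaces of the tube. -/
def tubeForm (κ : ℝ) (p : Mink) : ℝ := (p 0 + κ * p 3) ^ 2 + (κ ^ 2 - 1) * p 1 ^ 2

theorem tubeForm_tube {κ : ℝ} (hκ : 0 < κ) (z : Plane) (h : ℝ) :
    tubeForm κ (tube κ z h) = stretch κ h ^ 2 := by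
  have h1 := sn_sq (mX κ) (z 0)
  have hk : κ * κ⁻¹ = 1 := mul_inv_cancel₀ hκ.ne'
  simp only [tubeForm, tube, tubeBase, shapeOp_apply, stretch]
  simp
  generalize vn (mX κ) (z 0) = V at *
  generalize vn (mY κ) (z 1) = W at *
  generalize sn (mX κ) (z 0) = S at *
  have hX : mX κ = κ ^ 2 - 1 := rfl
  rw [hX] at h1
  have e1 : (Real.cosh h * (1 + V + W) + Real.sinh h * (κ⁻¹ * W + κ * V) +
      κ * (Real.cosh h * (-(κ * V) - κ⁻¹ * W) +
        Real.sinh h * (1 + V + W + (κ + κ⁻¹) * (-(κ * V) - κ⁻¹ * W))))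
      = (Real.cosh h + κ * Real.sinh h) * (1 - (κ ^ 2 - 1) * V) := by
    generalize κ⁻¹ = k at *
    linear_combination (-Real.cosh h * W - Real.sinh h * (κ * V + κ * W + k * W)) * hk
  rw [e1]
  linear_combination ((Real.cosh h + κ * Real.sinh h) ^ 2 * (κ ^ 2 - 1)) * h1

theorem stretch_pos_of_nonneg {k h : ℝ} (hk : 0 ≤ k) (hh : 0 ≤ h) : 0 < stretch k h := by
  have := Real.cosh_pos h
  have := mul_nonneg hk (Real.sinh_nonneg_iff.2 hh)
  unfold stretch; linarith

theorem stretch_pos {k h R : ℝ} (hR : 0 < R) (hk0 : 0 ≤ k) (hk : k ≤ Real.cosh R / Real.sinh R)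
    (hh : -R < h) : 0 < stretch k h := by
  rcases le_or_gt 0 h with h0 | h0
  · exact stretch_pos_of_nonneg hk0 h0
  · have hs : 0 < Real.sinh R := Real.sinh_pos_iff.2 hR
    have hsh : Real.sinh h < 0 := Real.sinh_neg_iff.2 h0
    have h1 : 0 < Real.sinh (R + h) := Real.sinh_pos_iff.2 (by linarith)
    rw [Real.sinh_add] at h1
    have h2 : Real.cosh R / Real.sinh R * Real.sinh h ≤ k * Real.sinh h :=
      mul_le_mul_of_nonpos_right hk hsh.le
    have h3 : 0 < Real.cosh h + Real.cosh R / Real.sinh R * Real.sinh h := by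
      have : Real.cosh h + Real.cosh R / Real.sinh R * Real.sinh h
          = (Real.sinh R * Real.cosh h + Real.cosh R * Real.sinh h) / Real.sinh R := by
        field_simp
      rw [this]; exact div_pos h1 hs
    unfold stretch; linarith

theorem one_lt_coth {R : ℝ} (hR : 0 < R) : 1 < Real.cosh R / Real.sinh R := by
  rw [one_lt_div (Real.sinh_pos_iff.2 hR)]; exact Real.sinh_lt_cosh R

end

section

/-! ### Flat surfaces with constant principal curvatures -/

section PartialDerivatives

variable {E : Type*} [NormedAddCommGroup E] [NormedSpace ℝ E]

/-- The `i`-th partial derivative of a map on the Euclidean plane. -/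
def pd (i : Fin 2) (F : Plane → E) (z : Plane) : E := fderiv ℝ F z (EuclideanSpace.single i 1)

theorem contDiffOn_pd {U : Set Plane} (hU : IsOpen U) {F : Plane → E}
    (hF : ContDiffOn ℝ ∞ F U) (i : Fin 2) : ContDiffOn ℝ ∞ (pd i F) U :=
  (hF.fderiv_of_isOpen hU (m := ∞) le_rfl).clm_apply contDiffOn_const

theorem contDiffOn_hasFDerivAt {U : Set Plane} (hU : IsOpen U) {F : Plane → E}
    (hF : ContDiffOn ℝ ∞ F U) {z : Plane} (hz : z ∈ U) : HasFDerivAt F (fderiv ℝ F z) z :=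
  ((hF.contDiffAt (hU.mem_nhds hz)).differentiableAt (by simp)).hasFDerivAt

theorem pd_congr {U : Set Plane} (hU : IsOpen U) {F G : Plane → E} (h : EqOn F G U) (i : Fin 2) :
    EqOn (pd i F) (pd i G) U := by
  intro z hz
  unfold pd
  rw [(h.eventuallyEq_of_mem (hU.mem_nhds hz)).fderiv_eq]

theorem pd_const (i : Fin 2) (c : E) (z : Plane) : pd i (fun _ => c) z = 0 := by simp [pd]

theorem pd_comm {U : Set Plane} (hU : IsOpen U) {F : Plane → E}
    (hF : ContDiffOn ℝ ∞ F U) (i j : Fin 2) {z : Plane} (hz : z ∈ U) :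
    pd i (pd j F) z = pd j (pd i F) z := by
  have h1 : HasFDerivAt (fderiv ℝ F) (fderiv ℝ (fderiv ℝ F) z) z :=
    contDiffOn_hasFDerivAt hU (hF.fderiv_of_isOpen hU (m := ∞) le_rfl) hz
  have h2 : ∀ᶠ y in 𝓝 z, HasFDerivAt F (fderiv ℝ F y) y := by
    filter_upwards [hU.mem_nhds hz] with y hy using contDiffOn_hasFDerivAt hU hF hy
  have h3 : ∀ i j : Fin 2, pd i (pd j F) z
      = fderiv ℝ (fderiv ℝ F) z (EuclideanSpace.single i 1) (EuclideanSpace.single j 1) := by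
    intro i j
    have := h1.clm_apply (hasFDerivAt_const (EuclideanSpace.single j (1 : ℝ) : Plane) z)
    have h4 : fderiv ℝ (pd j F) z = _ := this.fderiv
    rw [pd, h4]
    simp
  rw [h3, h3]
  exact second_derivative_symmetric_of_eventually_of_real h2 h1 _ _

theorem pd_add {U : Set Plane} (hU : IsOpen U) {F G : Plane → E}
    (hF : ContDiffOn ℝ ∞ F U) (hG : ContDiffOn ℝ ∞ G U) (i : Fin 2) {z : Plane} (hz : z ∈ U) :
    pd i (fun y => F y + G y) z = pd i F z + pd i G z := by
  have := ((contDiffOn_hasFDerivAt hU hF hz).add (contDiffOn_hasFDerivAt hU hG hz)).fderiv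
  change fderiv ℝ (F + G) z _ = _
  rw [this]; rfl

theorem pd_smul {U : Set Plane} (hU : IsOpen U) {a : Plane → ℝ} {G : Plane → E}
    (ha : ContDiffOn ℝ ∞ a U) (hG : ContDiffOn ℝ ∞ G U) (i : Fin 2) {z : Plane} (hz : z ∈ U) :
    pd i (fun y => a y • G y) z = pd i a z • G z + a z • pd i G z := by
  have := ((contDiffOn_hasFDerivAt hU ha hz).smul (contDiffOn_hasFDerivAt hU hG hz)).fderiv
  change fderiv ℝ (a • G) z _ = _
  rw [this]
  simp [pd, add_comm]

theorem contDiffOn_mink {U : Set Plane} {F G : Plane → Mink}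
    (hF : ContDiffOn ℝ ∞ F U) (hG : ContDiffOn ℝ ∞ G U) :
    ContDiffOn ℝ ∞ (fun y => mink (F y) (G y)) U :=
  (minkL.contDiff.comp_contDiffOn hF).clm_apply hG

theorem pd_mink {U : Set Plane} (hU : IsOpen U) {F G : Plane → Mink}
    (hF : ContDiffOn ℝ ∞ F U) (hG : ContDiffOn ℝ ∞ G U) (i : Fin 2) {z : Plane} (hz : z ∈ U) :
    pd i (fun y => mink (F y) (G y)) z = mink (pd i F z) (G z) + mink (F z) (pd i G z) := by
  have h1 := minkL.hasFDerivAt.comp z (contDiffOn_hasFDerivAt hU hF hz)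
  have := (h1.clm_apply (contDiffOn_hasFDerivAt hU hG hz)).fderiv
  change fderiv ℝ (fun y => (minkL ∘ F) y (G y)) z _ = _
  rw [this]
  simp [pd, add_comm]

theorem plane_expand (v : Plane) :
    v = (v 0) • EuclideanSpace.single 0 (1 : ℝ) + (v 1) • EuclideanSpace.single 1 (1 : ℝ) := by
  ext i; fin_cases i <;> simp

theorem fderiv_eq_pd (F : Plane → E) (z v : Plane) :
    fderiv ℝ F z v = v 0 • pd 0 F z + v 1 • pd 1 F z := by
  conv_lhs => rw [plane_expand v]
  simp [pd]

theorem fderiv_eq_zero_of_pd {F : Plane → E} {z : Plane} (h : ∀ i, pd i F z = 0) :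
    fderiv ℝ F z = 0 := by
  ext1 v; rw [fderiv_eq_pd, h, h]; simp

theorem eqOn_ball_of_pd_eq_zero {F : Plane → E} {z : Plane} {r : ℝ}
    (hF : ContDiffOn ℝ ∞ F (Metric.ball z r)) (h : ∀ y ∈ Metric.ball z r, ∀ i, pd i F y = 0)
    {y : Plane} (hy : y ∈ Metric.ball z r) : F y = F z := by
  have hr : 0 < r := lt_of_le_of_lt dist_nonneg hy
  refine Metric.isOpen_ball.is_const_of_fderiv_eq_zero (𝕜 := ℝ)
    (convex_ball z r).isPreconnected ?_ ?_ hy (Metric.mem_ball_self hr)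
  · intro y hy
    exact (contDiffOn_hasFDerivAt Metric.isOpen_ball hF hy).differentiableAt.differentiableWithinAt
  · intro y hy
    exact fderiv_eq_zero_of_pd (h y hy)

end PartialDerivatives

/-- The unit normal of a flat isometric immersion `f` of the plane in `ℍ³` with principal
curvatures `κ, κ⁻¹`, recovered from the Laplacian of `f`. -/
def normalField (κ : ℝ) (f : Plane → Mink) (z : Plane) : Mink :=
  (κ + κ⁻¹)⁻¹ • ((2 : ℝ) • f z + (-1 : ℝ) • pd 0 (pd 0 f) z + (-1 : ℝ) • pd 1 (pd 1 f) z)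

/-- The coefficients of the second fundamental form with respect to `normalField`. -/
def secondForm (κ : ℝ) (f : Plane → Mink) (i j : Fin 2) (z : Plane) : ℝ :=
  -mink (normalField κ f z) (pd i (pd j f) z)

/-- `n₀` is a unit normal at `z` of the immersion `f` for which the trace and the determinant of
the second fundamental form are those of the principal curvatures `κ, κ⁻¹`. -/
structure IsCurvedNormal (κ : ℝ) (f : Plane → Mink) (z : Plane) (n₀ : Mink) : Prop where
  tangent : mink (f z) n₀ = 0
  unit : mink n₀ n₀ = 1
  normal : ∀ i, mink (pd i f z) n₀ = 0
  trace : -mink n₀ (pd 0 (pd 0 f) z) - mink n₀ (pd 1 (pd 1 f) z) = κ + κ⁻¹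
  det : mink n₀ (pd 0 (pd 0 f) z) * mink n₀ (pd 1 (pd 1 f) z)
    - mink n₀ (pd 0 (pd 1 f) z) ^ 2 = 1

/-- On `U`, the map `f` is a flat isometric immersion in `ℍ³`. -/
structure IsFlatMap (U : Set Plane) (f : Plane → Mink) : Prop where
  isOpen : IsOpen U
  smooth : ContDiffOn ℝ ∞ f U
  mem : ∀ z ∈ U, f z ∈ hyp3
  isometric : ∀ z ∈ U, ∀ i j, mink (pd i f z) (pd j f z) = if i = j then 1 else 0

/-- On `U`, the map `f` is a flat isometric immersion in `ℍ³` with principal curvatures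
`κ, κ⁻¹`. -/
structure IsFlatImmersion (κ : ℝ) (U : Set Plane) (f : Plane → Mink) : Prop
    extends IsFlatMap U f where
  curved : ∀ z ∈ U, ∃ n₀, IsCurvedNormal κ f z n₀

variable {κ : ℝ} {U : Set Plane} {f : Plane → Mink}

theorem IsFlatMap.smooth₁ (H : IsFlatMap U f) (i : Fin 2) : ContDiffOn ℝ ∞ (pd i f) U :=
  contDiffOn_pd H.isOpen H.smooth i

theorem IsFlatMap.mink_pd (H : IsFlatMap U f) {z : Plane} (hz : z ∈ U) (i : Fin 2) :
    mink (f z) (pd i f z) = 0 := by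
  have h1 := pd_mink H.isOpen H.smooth H.smooth i hz
  have h2 : EqOn (fun y => mink (f y) (f y)) (fun _ => -1) U := fun y hy => (H.mem y hy).1
  rw [pd_congr H.isOpen h2 i hz, pd_const, mink_comm (pd i f z)] at h1
  linarith

theorem IsFlatMap.frame_of_normal (H : IsFlatMap U f) {z : Plane} (hz : z ∈ U) {n : Mink}
    (h0 : mink (f z) n = 0) (h1 : mink n n = 1) (h2 : ∀ i, mink (pd i f z) n = 0) :
    IsFrame (f z) (pd 0 f z) (pd 1 f z) n :=
  ⟨H.mem z hz, H.mink_pd hz 0, H.mink_pd hz 1, h0, by simpa using H.isometric z hz 0 0,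
    by simpa using H.isometric z hz 1 1, h1, by simpa using H.isometric z hz 0 1, h2 0, h2 1⟩

namespace IsFlatImmersion

theorem smooth₂ (H : IsFlatImmersion κ U f) (i j : Fin 2) : ContDiffOn ℝ ∞ (pd i (pd j f)) U :=
  contDiffOn_pd H.isOpen (H.smooth₁ j) i

theorem smooth_normal (H : IsFlatImmersion κ U f) : ContDiffOn ℝ ∞ (normalField κ f) U :=
  (((H.smooth.const_smul (2 : ℝ)).add ((H.smooth₂ 0 0).const_smul (-1 : ℝ))).add
    ((H.smooth₂ 1 1).const_smul (-1 : ℝ))).const_smul _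

theorem smooth_second (H : IsFlatImmersion κ U f) (i j : Fin 2) :
    ContDiffOn ℝ ∞ (secondForm κ f i j) U :=
  (contDiffOn_mink H.smooth_normal (H.smooth₂ i j)).neg

theorem mink_pd_pd (H : IsFlatImmersion κ U f) {z : Plane} (hz : z ∈ U) (i j : Fin 2) :
    mink (f z) (pd i (pd j f) z) = if i = j then -1 else 0 := by
  have h1 := pd_mink H.isOpen H.smooth (H.smooth₁ j) i hz
  have h2 : EqOn (fun y => mink (f y) (pd j f y)) (fun _ => 0) U := fun y hy => H.mink_pd hy j
  rw [pd_congr H.isOpen h2 i hz, pd_const, H.isometric z hz] at h1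
  split_ifs at h1 ⊢ <;> linarith

/-- The Christoffel symbols vanish. -/
theorem mink_pd_pd_pd (H : IsFlatImmersion κ U f) {z : Plane} (hz : z ∈ U) (i j k : Fin 2) :
    mink (pd i (pd j f) z) (pd k f z) = 0 := by
  have h1 : ∀ i j k, mink (pd i (pd j f) z) (pd k f z) + mink (pd i (pd k f) z) (pd j f z) = 0 := by
    intro i j k
    have h1 := pd_mink H.isOpen (H.smooth₁ j) (H.smooth₁ k) i hz
    have h2 : EqOn (fun y => mink (pd j f y) (pd k f y)) (fun _ => if j = k then 1 else 0) U :=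
      fun y hy => H.isometric y hy j k
    rw [pd_congr H.isOpen h2 i hz, pd_const, mink_comm (pd j f z)] at h1
    linarith
  have h2 : ∀ i j k, mink (pd i (pd j f) z) (pd k f z) = mink (pd j (pd i f) z) (pd k f z) := by
    intro i j k; rw [pd_comm H.isOpen H.smooth i j hz]
  have := h1 i j k
  have := h1 j k i
  have := h1 k i j
  have := h2 i j k
  have := h2 j k i
  have := h2 k i j
  linarith

theorem frame_of_curvedNormal (H : IsFlatImmersion κ U f) {z : Plane} (hz : z ∈ U) {n₀ : Mink}
    (hn : IsCurvedNormal κ f z n₀) : IsFrame (f z) (pd 0 f z) (pd 1 f z) n₀ :=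
  H.frame_of_normal hz hn.tangent hn.unit hn.normal

theorem gauss_of_curvedNormal (H : IsFlatImmersion κ U f) {z : Plane} (hz : z ∈ U) {n₀ : Mink}
    (hn : IsCurvedNormal κ f z n₀) (i j : Fin 2) :
    pd i (pd j f) z = (if i = j then (1 : ℝ) else 0) • f z
      + mink n₀ (pd i (pd j f) z) • n₀ := by
  have h1 := (H.frame_of_curvedNormal hz hn).expand (pd i (pd j f) z)
  rw [mink_comm _ (f z), H.mink_pd_pd hz, H.mink_pd_pd_pd hz, H.mink_pd_pd_pd hz,
    mink_comm _ n₀] at h1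
  rw [zero_smul, zero_smul, add_zero, add_zero] at h1
  conv_lhs => rw [h1]
  split_ifs <;> simp

theorem normalField_eq (H : IsFlatImmersion κ U f) (hκ : 0 < κ) {z : Plane} (hz : z ∈ U)
    {n₀ : Mink} (hn : IsCurvedNormal κ f z n₀) : normalField κ f z = n₀ := by
  have h0 := H.gauss_of_curvedNormal hz hn 0 0
  have h1 := H.gauss_of_curvedNormal hz hn 1 1
  have ht := hn.trace
  have hpos : 0 < κ + κ⁻¹ := by positivity
  generalize mink n₀ (pd 0 (pd 0 f) z) = a at *
  generalize mink n₀ (pd 1 (pd 1 f) z) = b at *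
  unfold normalField
  rw [h0, h1, ← ht]
  rw [← ht] at hpos
  simp only [if_true]
  have : (2 : ℝ) • f z + (-1 : ℝ) • ((1 : ℝ) • f z + a • n₀) + (-1 : ℝ) • ((1 : ℝ) • f z + b • n₀)
      = (-a - b) • n₀ := by module
  rw [this, smul_smul, inv_mul_cancel₀ hpos.ne', one_smul]

theorem isCurvedNormal (H : IsFlatImmersion κ U f) (hκ : 0 < κ) {z : Plane} (hz : z ∈ U) :
    IsCurvedNormal κ f z (normalField κ f z) := by
  obtain ⟨n₀, hn⟩ := H.curved z hz
  rwa [H.normalField_eq hκ hz hn]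

theorem frame (H : IsFlatImmersion κ U f) (hκ : 0 < κ) {z : Plane} (hz : z ∈ U) :
    IsFrame (f z) (pd 0 f z) (pd 1 f z) (normalField κ f z) :=
  H.frame_of_curvedNormal hz (H.isCurvedNormal hκ hz)

theorem gauss (H : IsFlatImmersion κ U f) (hκ : 0 < κ) {z : Plane} (hz : z ∈ U) (i j : Fin 2) :
    pd i (pd j f) z = (if i = j then (1 : ℝ) else 0) • f z
      + (-secondForm κ f i j z) • normalField κ f z := by
  rw [secondForm, neg_neg]
  exact H.gauss_of_curvedNormal hz (H.isCurvedNormal hκ hz) i j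

theorem mink_pd_normal (H : IsFlatImmersion κ U f) (hκ : 0 < κ) {z : Plane} (hz : z ∈ U)
    (i j : Fin 2) : mink (pd i (normalField κ f) z) (pd j f z) = secondForm κ f i j z := by
  have h1 := pd_mink H.isOpen (H.smooth₁ j) H.smooth_normal i hz
  have h2 : EqOn (fun y => mink (pd j f y) (normalField κ f y)) (fun _ => 0) U :=
    fun y hy => (H.isCurvedNormal hκ hy).normal j
  rw [pd_congr H.isOpen h2 i hz, pd_const, mink_comm _ (normalField κ f z),
    mink_comm (pd j f z)] at h1
  unfold secondForm; linarith

/-- The derivative of the unit normal is given by the second fundamental form. -/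
theorem weingarten (H : IsFlatImmersion κ U f) (hκ : 0 < κ) {z : Plane} (hz : z ∈ U)
    (i : Fin 2) : pd i (normalField κ f) z
      = secondForm κ f i 0 z • pd 0 f z + secondForm κ f i 1 z • pd 1 f z := by
  have h1 := (H.frame hκ hz).expand (pd i (normalField κ f) z)
  have h2 := pd_mink H.isOpen H.smooth_normal H.smooth_normal i hz
  have h3 : EqOn (fun y => mink (normalField κ f y) (normalField κ f y)) (fun _ => 1) U :=
    fun y hy => (H.isCurvedNormal hκ hy).unit
  have h4 := pd_mink H.isOpen H.smooth H.smooth_normal i hz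
  have h5 : EqOn (fun y => mink (f y) (normalField κ f y)) (fun _ => 0) U :=
    fun y hy => (H.isCurvedNormal hκ hy).tangent
  rw [pd_congr H.isOpen h3 i hz, pd_const, mink_comm (normalField κ f z)] at h2
  rw [pd_congr H.isOpen h5 i hz, pd_const, (H.isCurvedNormal hκ hz).normal, zero_add,
    mink_comm] at h4
  have h2' : mink (pd i (normalField κ f) z) (normalField κ f z) = 0 := by linarith
  rw [← h4, h2', H.mink_pd_normal hκ hz, H.mink_pd_normal hκ hz] at h1
  rw [h1]; simp

theorem second_comm (H : IsFlatImmersion κ U f) {z : Plane} (hz : z ∈ U) (i j : Fin 2) :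
    secondForm κ f i j z = secondForm κ f j i z := by
  rw [secondForm, secondForm, pd_comm H.isOpen H.smooth i j hz]

/-- Third derivatives of `f` in the normal direction. -/
theorem pd_pd_pd_normal (H : IsFlatImmersion κ U f) (hκ : 0 < κ) {z : Plane} (hz : z ∈ U)
    (i j k : Fin 2) :
    mink (pd k (pd i (pd j f)) z) (normalField κ f z) = -pd k (secondForm κ f i j) z := by
  have h1 := pd_mink H.isOpen (H.smooth₂ i j) H.smooth_normal k hz
  have h2 : EqOn (fun y => mink (pd i (pd j f) y) (normalField κ f y))
      (fun y => -secondForm κ f i j y) U := by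
    intro y hy; simp only [secondForm, neg_neg]; rw [mink_comm]
  have h3 : mink (pd i (pd j f) z) (pd k (normalField κ f) z) = 0 := by
    rw [H.weingarten hκ hz, mink_add_right, mink_smul_right, mink_smul_right,
      H.mink_pd_pd_pd hz, H.mink_pd_pd_pd hz]; simp
  have h4 : pd k (fun y => -secondForm κ f i j y) z = -pd k (secondForm κ f i j) z := by
    have := (contDiffOn_hasFDerivAt H.isOpen (H.smooth_second i j) hz).neg.fderiv
    change fderiv ℝ (-secondForm κ f i j) z _ = _
    rw [this]; rfl
  rw [pd_congr H.isOpen h2 k hz, h3, h4] at h1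
  linarith

/-- The Codazzi equation. -/
theorem codazzi (H : IsFlatImmersion κ U f) (hκ : 0 < κ) {z : Plane} (hz : z ∈ U)
    (i j k : Fin 2) : pd k (secondForm κ f i j) z = pd i (secondForm κ f k j) z := by
  have h1 := H.pd_pd_pd_normal hκ hz i j k
  have h2 := H.pd_pd_pd_normal hκ hz k j i
  rw [pd_comm H.isOpen (H.smooth₁ j) k i hz] at h1
  linarith

/-- The second fundamental form has constant trace and determinant, so by the Codazzi equation
it is parallel. -/
theorem pd_second (H : IsFlatImmersion κ U f) (hκ : 0 < κ) {z : Plane} (hz : z ∈ U)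
    (i j k : Fin 2) : pd k (secondForm κ f i j) z = 0 := by
  have htr : ∀ y ∈ U, secondForm κ f 0 0 y + secondForm κ f 1 1 y = κ + κ⁻¹ := by
    intro y hy
    have := (H.isCurvedNormal hκ hy).trace
    unfold secondForm; linarith
  have hdet : ∀ y ∈ U, secondForm κ f 0 0 y * secondForm κ f 1 1 y
      - secondForm κ f 0 1 y * secondForm κ f 0 1 y = 1 := by
    intro y hy
    have := (H.isCurvedNormal hκ hy).det
    unfold secondForm; linarith
  have hsymm : ∀ k, pd k (secondForm κ f 1 0) z = pd k (secondForm κ f 0 1) z := fun k =>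
    pd_congr H.isOpen (fun y hy => H.second_comm hy 1 0) k hz
  have dtr : ∀ k, pd k (secondForm κ f 0 0) z + pd k (secondForm κ f 1 1) z = 0 := by
    intro k
    rw [← pd_add H.isOpen (H.smooth_second 0 0) (H.smooth_second 1 1) k hz,
      pd_congr H.isOpen (show EqOn _ (fun _ => κ + κ⁻¹) U from htr) k hz, pd_const]
  rcases eq_or_ne κ 1 with rfl | hne
  · -- both eigenvalues are `1`, so the form is the identity
    have hS : ∀ y ∈ U, secondForm 1 f 0 0 y = 1 ∧ secondForm 1 f 0 1 y = 0 := by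
      intro y hy
      have h1 := htr y hy
      have h2 := hdet y hy
      norm_num at h1
      have h3 : secondForm 1 f 1 1 y = 2 - secondForm 1 f 0 0 y := by linarith
      rw [h3] at h2
      have h4 : (secondForm 1 f 0 0 y - 1) ^ 2 + secondForm 1 f 0 1 y ^ 2 = 0 := by linarith
      constructor
      · have : (secondForm 1 f 0 0 y - 1) ^ 2 = 0 := by
          nlinarith [sq_nonneg (secondForm 1 f 0 1 y), sq_nonneg (secondForm 1 f 0 0 y - 1)]
        have := pow_eq_zero_iff (two_ne_zero) |>.1 this
        linarith
      · have : secondForm 1 f 0 1 y ^ 2 = 0 := by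
          nlinarith [sq_nonneg (secondForm 1 f 0 1 y), sq_nonneg (secondForm 1 f 0 0 y - 1)]
        exact pow_eq_zero_iff (two_ne_zero) |>.1 this
    have h00 : ∀ k, pd k (secondForm 1 f 0 0) z = 0 := fun k => by
      rw [pd_congr H.isOpen (show EqOn _ (fun _ => (1 : ℝ)) U from fun y hy => (hS y hy).1) k hz,
        pd_const]
    have h01 : ∀ k, pd k (secondForm 1 f 0 1) z = 0 := fun k => by
      rw [pd_congr H.isOpen (show EqOn _ (fun _ => (0 : ℝ)) U from fun y hy => (hS y hy).2) k hz,
        pd_const]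
    fin_cases i <;> fin_cases j
    · exact h00 k
    · exact h01 k
    · exact (hsymm k).trans (h01 k)
    · have := dtr k; rw [h00 k, zero_add] at this; exact this
  · have ddet : ∀ k, pd k (secondForm κ f 0 0) z * secondForm κ f 1 1 z
        + secondForm κ f 0 0 z * pd k (secondForm κ f 1 1) z
        - 2 * (secondForm κ f 0 1 z * pd k (secondForm κ f 0 1) z) = 0 := by
      intro k
      have e1 := pd_smul H.isOpen (H.smooth_second 0 0) (H.smooth_second 1 1) k hz
      have e2 := pd_smul H.isOpen (H.smooth_second 0 1) (H.smooth_second 0 1) k hz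
      have e3 := pd_add H.isOpen ((H.smooth_second 0 1).smul (H.smooth_second 0 1))
        (contDiffOn_const (c := (1 : ℝ))) k hz
      have e4 : EqOn (fun y => secondForm κ f 0 0 y • secondForm κ f 1 1 y)
          (fun y => (secondForm κ f 0 1 • secondForm κ f 0 1) y + 1) U := by
        intro y hy
        have := hdet y hy
        simp only [smul_eq_mul, Pi.smul_apply']; linarith
      rw [pd_congr H.isOpen e4 k hz, e3, pd_const, add_zero] at e1
      have e5 : pd k (secondForm κ f 0 1 • secondForm κ f 0 1) z
        = pd k (fun y => secondForm κ f 0 1 y • secondForm κ f 0 1 y) z := rfl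
      rw [e5, e2] at e1
      simp only [smul_eq_mul] at e1
      linarith
    have c1 := H.codazzi hκ hz 0 0 1
    have c2 := H.codazzi hκ hz 0 1 1
    rw [hsymm] at c1
    have t0 := dtr 0
    have t1 := dtr 1
    have d0 := ddet 0
    have d1 := ddet 1
    have htz := htr z hz
    have hdz := hdet z hz
    have hs0 := hsymm 0
    have hs1 := hsymm 1
    have hne' : (κ - κ⁻¹) ^ 2 ≠ 0 := by
      refine pow_ne_zero _ (sub_ne_zero.2 fun h => hne ?_)
      have : κ * κ = 1 := by nth_rewrite 2 [h]; exact mul_inv_cancel₀ hκ.ne'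
      nlinarith
    have hk : κ * κ⁻¹ = 1 := mul_inv_cancel₀ hκ.ne'
    generalize secondForm κ f 0 0 z = a at *
    generalize secondForm κ f 1 1 z = d at *
    generalize secondForm κ f 0 1 z = b at *
    have x1 : pd 1 (secondForm κ f 1 1) z = -pd 0 (secondForm κ f 0 1) z := by linarith
    have x2 : pd 0 (secondForm κ f 1 1) z = -pd 0 (secondForm κ f 0 0) z := by linarith
    have x3 : pd 1 (secondForm κ f 0 1) z = -pd 0 (secondForm κ f 0 0) z := by linarith
    rw [c1, x1, x3] at d1
    rw [x2] at d0
    generalize hp : pd 0 (secondForm κ f 0 0) z = p at *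
    generalize hq : pd 0 (secondForm κ f 0 1) z = q at *
    have hD : (a - d) ^ 2 + (2 * b) ^ 2 = (κ - κ⁻¹) ^ 2 := by
      have : (κ - κ⁻¹) ^ 2 = (κ + κ⁻¹) ^ 2 - 4 * (κ * κ⁻¹) := by ring
      rw [this, hk, ← htz]; linear_combination (-4) * hdz
    rw [← hD] at hne'
    have p0 : p = 0 := by
      have : ((a - d) ^ 2 + (2 * b) ^ 2) * p = 0 := by
        linear_combination (-(a - d)) * d0 + 2 * b * d1
      exact (mul_eq_zero.1 this).resolve_left hne'
    have q0 : q = 0 := by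
      have : ((a - d) ^ 2 + (2 * b) ^ 2) * q = 0 := by
        linear_combination (-(a - d)) * d1 + (-2 * b) * d0
      exact (mul_eq_zero.1 this).resolve_left hne'
    rw [p0] at x2 x3 hp
    rw [q0] at x1 c1 hq hs0
    rw [neg_zero] at x1 x2 x3
    rw [x3] at hs1
    fin_cases k <;> fin_cases i <;> fin_cases j <;> assumption

end IsFlatImmersion

end

section

/-! ### Flat surfaces with constant principal curvatures are tubes -/

theorem IsFrame.exists_iso₂ {p e₁ e₂ n p' e₁' e₂' n' : Mink} (h : IsFrame p e₁ e₂ n)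
    (h' : IsFrame p' e₁' e₂' n') : ∃ A : Mink ≃ₗ[ℝ] Mink, IsHypIso A ∧
      A p = p' ∧ A e₁ = e₁' ∧ A e₂ = e₂' ∧ A n = n' := by
  obtain ⟨A, hA, hA'⟩ := h.exists_iso
  obtain ⟨B, hB, hB'⟩ := h'.exists_iso
  have k0 : A (Pi.single 0 1) = p := by simp [hA']
  have k1 : A (Pi.single 1 1) = e₁ := by simp [hA']
  have k2 : A (Pi.single 2 1) = e₂ := by simp [hA']
  have k3 : A (Pi.single 3 1) = n := by simp [hA']
  refine ⟨A.symm.trans B, hA.symm.trans hB, ?_, ?_, ?_, ?_⟩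
  · rw [← k0]; simp [hB']
  · rw [← k1]; simp [hB']
  · rw [← k2]; simp [hB']
  · rw [← k3]; simp [hB']

theorem pd_tubeBase (κ : ℝ) (z : Plane) :
    pd 0 (tubeBase κ) z = tubeE₁ κ z ∧ pd 1 (tubeBase κ) z = tubeE₂ κ z := by
  simp [pd, (hasFDerivAt_tubeBase κ z).fderiv]

theorem pd_shapeOp_tubeBase {κ : ℝ} (hκ : κ ≠ 0) (z : Plane) :
    pd 0 (fun y => shapeOp κ (tubeBase κ y)) z = κ • tubeE₁ κ z ∧
    pd 1 (fun y => shapeOp κ (tubeBase κ y)) z = κ⁻¹ • tubeE₂ κ z := by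
  have h := (LinearMap.toContinuousLinearMap (shapeOp κ)).hasFDerivAt.comp z
    (hasFDerivAt_tubeBase κ z)
  have h2 := h.fderiv
  change fderiv ℝ (fun y => shapeOp κ (tubeBase κ y)) z = _ at h2
  simp [pd, h2, shapeOp_tubeE₁ hκ, shapeOp_tubeE₂ hκ]

theorem hasFDerivAt_tubeE₁ {κ : ℝ} (hκ : κ ≠ 0) (z : Plane) :
    HasFDerivAt (tubeE₁ κ) ((EuclideanSpace.proj (0 : Fin 2) : Plane →L[ℝ] ℝ).smulRight
      (tubeBase κ z - κ • shapeOp κ (tubeBase κ z))) z := by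
  set F1 : ℝ → Mink := fun x => ![sn (mX κ) x, cn (mX κ) x, 0, -(κ * sn (mX κ) x)] with hF1
  have h1 : HasDerivAt F1 (tubeBase κ z - κ • shapeOp κ (tubeBase κ z)) (z 0) := by
    refine (hasDerivAt_pi (φ' := ![cn (mX κ) (z 0), -(mX κ * sn (mX κ) (z 0)), 0,
      -(κ * cn (mX κ) (z 0))]).2 fun i => ?_).congr_deriv ?_
    · fin_cases i
      · exact hasDerivAt_sn (mX κ) (z 0)
      · exact (hasDerivAt_cn (mX κ) (z 0)).congr_deriv (by simp)
      · exact hasDerivAt_const (z 0) (0 : ℝ)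
      · exact ((hasDerivAt_sn (mX κ) (z 0)).const_mul κ).fun_neg
    · have hk : κ * κ⁻¹ = 1 := mul_inv_cancel₀ hκ
      have hX : mX κ = κ ^ 2 - 1 := rfl
      funext i
      fin_cases i <;> simp [tubeBase, shapeOp_apply, cn_eq, hX]
      · linear_combination vn (mY κ) (z 1) * hk
      · ring
      · linear_combination sn (mY κ) (z 1) * hk
      · generalize κ⁻¹ = k at *
        generalize vn (mY κ) (z 1) = W at *
        linear_combination (-κ * vn (κ ^ 2 - 1) (z 0) - k * W - κ * W) * hk
  exact HasFDerivAt.congr_fderiv (HasFDerivAt.comp z (g := F1)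
    (f := (EuclideanSpace.proj (0 : Fin 2) : Plane →L[ℝ] ℝ))
    h1.hasFDerivAt (EuclideanSpace.proj (0 : Fin 2) : Plane →L[ℝ] ℝ).hasFDerivAt)
    (by ext1 v; simp)

theorem hasFDerivAt_tubeE₂ {κ : ℝ} (hκ : κ ≠ 0) (z : Plane) :
    HasFDerivAt (tubeE₂ κ) ((EuclideanSpace.proj (1 : Fin 2) : Plane →L[ℝ] ℝ).smulRight
      (tubeBase κ z - κ⁻¹ • shapeOp κ (tubeBase κ z))) z := by
  set F1 : ℝ → Mink := fun x => ![sn (mY κ) x, 0, cn (mY κ) x, -(κ⁻¹ * sn (mY κ) x)] with hF1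
  have h1 : HasDerivAt F1 (tubeBase κ z - κ⁻¹ • shapeOp κ (tubeBase κ z)) (z 1) := by
    refine (hasDerivAt_pi (φ' := ![cn (mY κ) (z 1), 0, -(mY κ * sn (mY κ) (z 1)),
      -(κ⁻¹ * cn (mY κ) (z 1))]).2 fun i => ?_).congr_deriv ?_
    · fin_cases i
      · exact hasDerivAt_sn (mY κ) (z 1)
      · exact hasDerivAt_const (z 1) (0 : ℝ)
      · exact (hasDerivAt_cn (mY κ) (z 1)).congr_deriv (by simp)
      · exact ((hasDerivAt_sn (mY κ) (z 1)).const_mul κ⁻¹).fun_neg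
    · have hk : κ * κ⁻¹ = 1 := mul_inv_cancel₀ hκ
      have hY : mY κ = κ⁻¹ ^ 2 - 1 := rfl
      have h4 : cn (mY κ) (z 1) = 1 - (κ⁻¹ ^ 2 - 1) * vn (mY κ) (z 1) := cn_eq _ _
      funext i
      generalize vn (mX κ) (z 0) = V at *
      fin_cases i <;> simp [tubeBase, shapeOp_apply, -inv_pow] <;>
        generalize vn (mY κ) (z 1) = W at * <;> generalize sn (mY κ) (z 1) = S at * <;>
        generalize sn (mX κ) (z 0) = S' at * <;>
        generalize vn (mX κ) (z 0) = V at * <;>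
        generalize cn (mY κ) (z 1) = C at * <;> generalize mY κ = m at * <;>
        generalize κ⁻¹ = k at *
      · linear_combination h4 + V * hk
      · linear_combination S' * hk
      · linear_combination (-S) * hY
      · linear_combination (-k) * h4 + (-k * W - κ * V - k * V) * hk
  exact HasFDerivAt.congr_fderiv (HasFDerivAt.comp z (g := F1)
    (f := (EuclideanSpace.proj (1 : Fin 2) : Plane →L[ℝ] ℝ))
    h1.hasFDerivAt (EuclideanSpace.proj (1 : Fin 2) : Plane →L[ℝ] ℝ).hasFDerivAt)
    (by ext1 v; simp)

theorem contDiff_tubeE₁ (κ : ℝ) : ContDiff ℝ ∞ (tubeE₁ κ) := by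
  have := contDiffOn_pd isOpen_univ (contDiff_tubeBase κ).contDiffOn 0
  rw [contDiffOn_univ] at this
  convert this using 1
  funext z; exact (pd_tubeBase κ z).1.symm

theorem contDiff_tubeE₂ (κ : ℝ) : ContDiff ℝ ∞ (tubeE₂ κ) := by
  have := contDiffOn_pd isOpen_univ (contDiff_tubeBase κ).contDiffOn 1
  rw [contDiffOn_univ] at this
  convert this using 1
  funext z; exact (pd_tubeBase κ z).2.symm

/-- A flat immersion with diagonal second fundamental form is congruent to the model tube: both
frames satisfy the same linear differential system, so that the linear map taking one to the
other is constant. -/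
theorem IsFlatImmersion.eq_tube {κ : ℝ} {U : Set Plane} {f : Plane → Mink}
    (H : IsFlatImmersion κ U f) (hκ : 0 < κ) {z : Plane} {r : ℝ} (hr : 0 < r)
    (hU : Metric.ball z r ⊆ U)
    (h00 : ∀ y ∈ Metric.ball z r, secondForm κ f 0 0 y = κ)
    (h01 : ∀ y ∈ Metric.ball z r, secondForm κ f 0 1 y = 0) :
    ∃ A : Mink ≃ₗ[ℝ] Mink, IsHypIso A ∧ ∀ y ∈ Metric.ball z r,
      f y = A (tubeBase κ y) ∧ normalField κ f y = A (shapeOp κ (tubeBase κ y)) := by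
  have hκ0 := hκ.ne'
  have hzU : z ∈ U := hU (Metric.mem_ball_self hr)
  have hM := fun y => isFrame_tubeBase hκ y
  obtain ⟨A, hA, a0, a1, a2, a3⟩ := (hM z).exists_iso₂ (H.frame hκ hzU)
  have hO : IsOpen (Metric.ball z r) := Metric.isOpen_ball
  have sB : ContDiffOn ℝ ∞ (tubeBase κ) (Metric.ball z r) := (contDiff_tubeBase κ).contDiffOn
  have s1 : ContDiffOn ℝ ∞ (tubeE₁ κ) (Metric.ball z r) := (contDiff_tubeE₁ κ).contDiffOn
  have s2 : ContDiffOn ℝ ∞ (tubeE₂ κ) (Metric.ball z r) := (contDiff_tubeE₂ κ).contDiffOn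
  have sN : ContDiffOn ℝ ∞ (fun y => shapeOp κ (tubeBase κ y)) (Metric.ball z r) :=
    ((contDiff_shapeOp κ).comp (contDiff_tubeBase κ)).contDiffOn
  have key : ∀ v : Mink, ∀ y ∈ Metric.ball z r,
      (-mink v (tubeBase κ y)) • f y + mink v (tubeE₁ κ y) • pd 0 f y
        + mink v (tubeE₂ κ y) • pd 1 f y
        + mink v (shapeOp κ (tubeBase κ y)) • normalField κ f y = A v := by
    intro v
    have cv : ContDiffOn ℝ ∞ (fun _ : Plane => v) (Metric.ball z r) := contDiffOn_const
    have t0 : ContDiffOn ℝ ∞ (fun y => -mink v (tubeBase κ y)) (Metric.ball z r) :=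
      (contDiffOn_mink cv sB).neg
    have t1 := contDiffOn_mink cv s1
    have t2 := contDiffOn_mink cv s2
    have t3 := contDiffOn_mink cv sN
    have f0 := H.smooth.mono hU
    have f1 := (H.smooth₁ 0).mono hU
    have f2 := (H.smooth₁ 1).mono hU
    have f3 := H.smooth_normal.mono hU
    intro y hy
    have hconst := eqOn_ball_of_pd_eq_zero (z := z) (r := r)
      (F := fun y => (-mink v (tubeBase κ y)) • f y + mink v (tubeE₁ κ y) • pd 0 f y
        + mink v (tubeE₂ κ y) • pd 1 f y
        + mink v (shapeOp κ (tubeBase κ y)) • normalField κ f y)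
      ((((t0.smul f0).add (t1.smul f1)).add (t2.smul f2)).add (t3.smul f3)) ?_ hy
    · refine hconst.trans ?_
      conv_rhs => rw [(hM z).expand v]
      simp only [map_add, map_smul, a0, a1, a2, a3]
    · intro x hx i
      have hxU := hU hx
      have htr := (H.isCurvedNormal hκ hxU).trace
      have h00x := h00 x hx
      have h01x := h01 x hx
      have h10x : secondForm κ f 1 0 x = 0 := by rw [H.second_comm hxU, h01x]
      have h11x : secondForm κ f 1 1 x = κ⁻¹ := by
        unfold secondForm at h00x ⊢; linarith
      have pneg : pd i (fun y => -mink v (tubeBase κ y)) x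
          = -mink v (pd i (tubeBase κ) x) := by
        have e := (contDiffOn_hasFDerivAt hO (contDiffOn_mink cv sB) hx).neg.fderiv
        have e' : pd i (fun y => -mink v (tubeBase κ y)) x
            = -pd i (fun y => mink v (tubeBase κ y)) x := by
          change fderiv ℝ (-fun y => mink v (tubeBase κ y)) x _ = _
          rw [e]; rfl
        rw [e', pd_mink hO cv sB i hx, pd_const, mink_zero_left, zero_add]
      have c0 := pd_smul hO t0 f0 i hx
      have c1 := pd_smul hO t1 f1 i hx
      have c2 := pd_smul hO t2 f2 i hx
      have c3 := pd_smul hO t3 f3 i hx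
      have d1 := pd_add hO (t0.smul f0) (t1.smul f1) i hx
      have d2 := pd_add hO ((t0.smul f0).add (t1.smul f1)) (t2.smul f2) i hx
      have d3 := pd_add hO (((t0.smul f0).add (t1.smul f1)).add (t2.smul f2)) (t3.smul f3) i hx
      refine d3.trans ?_
      refine (congrArg₂ (· + ·) (d2.trans (congrArg₂ (· + ·)
        (d1.trans (congrArg₂ (· + ·) c0 c1)) c2)) c3).trans ?_
      rw [pneg, pd_mink hO cv s1 i hx, pd_mink hO cv s2 i hx, pd_mink hO cv sN i hx, pd_const,
        mink_zero_left, zero_add, mink_zero_left, zero_add, mink_zero_left, zero_add,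
        H.gauss hκ hxU, H.gauss hκ hxU, H.weingarten hκ hxU]
      have pE1 := (hasFDerivAt_tubeE₁ hκ0 x).fderiv
      have pE2 := (hasFDerivAt_tubeE₂ hκ0 x).fderiv
      fin_cases i
      · have q1 : pd 0 (tubeE₁ κ) x = tubeBase κ x - κ • shapeOp κ (tubeBase κ x) := by
          simp [pd, pE1]
        have q2 : pd 0 (tubeE₂ κ) x = 0 := by simp [pd, pE2]
        simp only [Fin.zero_eta, Fin.isValue, (pd_tubeBase κ x).1,
          (pd_shapeOp_tubeBase hκ0 x).1, q1, q2, h00x, h01x, mink_zero_right, mink_sub_right,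
          mink_smul_right]
        simp
        module
      · have q1 : pd 1 (tubeE₁ κ) x = 0 := by simp [pd, pE1]
        have q2 : pd 1 (tubeE₂ κ) x = tubeBase κ x - κ⁻¹ • shapeOp κ (tubeBase κ x) := by
          simp [pd, pE2]
        simp only [Fin.mk_one, Fin.isValue, (pd_tubeBase κ x).2,
          (pd_shapeOp_tubeBase hκ0 x).2, q1, q2, h10x, h11x, mink_zero_right, mink_sub_right,
          mink_smul_right]
        simp
        module
  refine ⟨A, hA, fun y hy => ⟨?_, ?_⟩⟩
  · have h := key (tubeBase κ y) y hy
    rw [(hM y).mem.1, (hM y).pe₁, (hM y).pe₂, (hM y).pn] at h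
    rw [← h]; simp
  · have h := key (shapeOp κ (tubeBase κ y)) y hy
    rw [mink_comm _ (tubeBase κ y), mink_comm _ (tubeE₁ κ y), mink_comm _ (tubeE₂ κ y),
      (hM y).nn, (hM y).e₁n, (hM y).e₂n, (hM y).pn] at h
    rw [← h]; simp

end

section

/-! ### Tubular tori are covered by model tubes -/

theorem IsFlatMap.tendsto {U : Set Plane} {f : Plane → Mink} (H : IsFlatMap U f) {z : Plane}
    (hz : z ∈ U) : Tendsto f (𝓝 z) (𝓝[hyp3] (f z)) := by
  refine tendsto_nhdsWithin_iff.2 ⟨(contDiffOn_hasFDerivAt H.isOpen H.smooth hz).continuousAt, ?_⟩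
  filter_upwards [H.isOpen.mem_nhds hz] with y hy using H.mem y hy

theorem eventually_defining_eq_zero {U : Set Plane} {f : Plane → Mink} (H : IsFlatMap U f)
    {z : Plane} (hz : z ∈ U) {D : Set Mink} (hD : ∀ y ∈ U, f y ∈ D)
    (hni : ∀ y ∈ U, D ∉ 𝓝[hyp3] (f y)) {g : Mink → ℝ} (hg : IsDefiningFunction D (f z) g) :
    ∀ᶠ y in 𝓝 z, g (f y) = 0 := by
  have h1 := (H.tendsto hz).eventually (eventually_eventually_nhdsWithin.2 hg.mem_iff)
  have h2 := (H.tendsto hz).eventually hg.mem_iff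
  have h3 := (contDiffOn_hasFDerivAt H.isOpen H.smooth hz).continuousAt.eventually hg.smooth
  filter_upwards [h1, h2, h3, H.isOpen.mem_nhds hz] with y h1 h2 h3 hy
  refine le_antisymm ?_ (h2.1 (hD y hy))
  by_contra hcon
  push Not at hcon
  refine hni y hy ?_
  have h4 : ∀ᶠ q in 𝓝[hyp3] (f y), 0 < g q :=
    nhdsWithin_le_nhds (h3.continuousAt.eventually (lt_mem_nhds hcon))
  filter_upwards [h1, h4] with q hq hq'
  exact hq.2 hq'.le

theorem eventually_fderiv_defining {U : Set Plane} {f : Plane → Mink} (H : IsFlatMap U f)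
    {z : Plane} (hz : z ∈ U) {D : Set Mink} (hD : ∀ y ∈ U, f y ∈ D)
    (hni : ∀ y ∈ U, D ∉ 𝓝[hyp3] (f y)) {g : Mink → ℝ} (hg : IsDefiningFunction D (f z) g) :
    ∀ᶠ y in 𝓝 z, ∀ i, fderiv ℝ g (f y) (pd i f y) = 0 := by
  have h3 := (contDiffOn_hasFDerivAt H.isOpen H.smooth hz).continuousAt.eventually hg.smooth
  have h0 := eventually_defining_eq_zero H hz hD hni hg
  filter_upwards [eventually_eventually_nhds.2 h0, h3, H.isOpen.mem_nhds hz] with y h0 h3 hy i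
  have h4 := (h3.differentiableAt (by simp)).hasFDerivAt.comp y
    (contDiffOn_hasFDerivAt H.isOpen H.smooth hy)
  have h5 : HasFDerivAt (g ∘ f) (0 : Plane →L[ℝ] ℝ) y :=
    (hasFDerivAt_const (0 : ℝ) y).congr_of_eventuallyEq h0
  have h6 := congrArg (fun L => L (EuclideanSpace.single i 1)) (h4.unique h5)
  simpa [pd] using h6

/-- The derivative of the normal field of the boundary and the second derivatives of a
parametrization of the boundary determine the same second fundamental form. -/
theorem boundary_normal {U : Set Plane} {f : Plane → Mink} (H : IsFlatMap U f)
    {z : Plane} (hz : z ∈ U) {D : Set Mink} (hD : ∀ y ∈ U, f y ∈ D)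
    (hni : ∀ y ∈ U, D ∉ 𝓝[hyp3] (f y)) {g : Mink → ℝ} (hg : IsDefiningFunction D (f z) g)
    {ν : Mink → Mink} (hν : ∀ᶠ q in 𝓝 (f z), ContDiffAt ℝ ∞ ν q)
    (hν2 : ∀ᶠ q in 𝓝[hyp3] (f z), g q = 0 → IsInwardUnitNormal g q (ν q)) :
    IsInwardUnitNormal g (f z) (ν (f z)) ∧ (∀ i, mink (pd i f z) (ν (f z)) = 0) ∧
    ∀ i j, mink (ν (f z)) (pd i (pd j f) z) = -mink (fderiv ℝ ν (f z) (pd i f z)) (pd j f z) := by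
  have h0 := eventually_defining_eq_zero H hz hD hni hg
  have h1 := eventually_fderiv_defining H hz hD hni hg
  have h2 := (H.tendsto hz).eventually hν2
  have h3 := (contDiffOn_hasFDerivAt H.isOpen H.smooth hz).continuousAt.eventually hν
  have hall : ∀ᶠ y in 𝓝 z, y ∈ U ∧ ContDiffAt ℝ ∞ ν (f y) ∧ IsInwardUnitNormal g (f y) (ν (f y)) ∧
      ∀ i, mink (pd i f y) (ν (f y)) = 0 := by
    filter_upwards [h0, h1, h2, h3, H.isOpen.mem_nhds hz] with y h0 h1 h2 h3 hy
    have hn := h2 h0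
    refine ⟨hy, h3, hn, fun i => ?_⟩
    rw [mink_comm]
    exact hn.normal _ ⟨H.mink_pd hy i, h1 i⟩
  obtain ⟨V, hV, hVo, hzV⟩ := mem_nhds_iff.1 hall
  obtain ⟨-, hsm, hin, hno⟩ := hV hzV
  refine ⟨hin, hno, fun i j => ?_⟩
  have sV : ContDiffOn ℝ ∞ (fun y => ν (f y)) V := by
    intro y hy
    have hy' := hV hy
    exact (hy'.2.1.comp y (H.smooth.contDiffAt (H.isOpen.mem_nhds hy'.1))).contDiffWithinAt
  have e1 := pd_mink hVo ((H.smooth₁ j).mono fun y hy => (hV hy).1) sV i hzV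
  have e2 : EqOn (fun y => mink (pd j f y) (ν (f y))) (fun _ => 0) V :=
    fun y hy => (hV hy).2.2.2 j
  have e3 : pd i (fun y => ν (f y)) z = fderiv ℝ ν (f z) (pd i f z) := by
    have := ((hsm.differentiableAt (by simp)).hasFDerivAt.comp z
      (contDiffOn_hasFDerivAt H.isOpen H.smooth hz)).fderiv
    change fderiv ℝ (ν ∘ f) z _ = _
    rw [this]; rfl
  rw [pd_congr hVo e2 i hzV, pd_const, e3, mink_comm _ (ν (f z)), mink_comm (pd j f z)] at e1
  linarith

theorem boundary_curvedNormal {κ : ℝ} (hκ : 0 < κ) {f : Plane → Mink} {z : Plane} {n e₁ e₂ : Mink}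
    {L : Mink →L[ℝ] Mink} (hF : IsFrame (f z) (pd 0 f z) (pd 1 f z) n)
    (hF' : IsFrame (f z) e₁ e₂ n) (h₁ : L e₁ = κ • e₁) (h₂ : L e₂ = κ⁻¹ • e₂)
    (hL : ∀ i j, mink n (pd i (pd j f) z) = -mink (L (pd i f z)) (pd j f z)) :
    IsCurvedNormal κ f z n := by
  have x0 := hF'.expand (pd 0 f z)
  have x1 := hF'.expand (pd 1 f z)
  have y1 := hF.expand e₁
  have y2 := hF.expand e₂
  rw [mink_comm _ (f z), hF.pe₁, hF.e₁n, neg_zero, zero_smul, zero_smul, zero_add, add_zero] at x0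
  rw [mink_comm _ (f z), hF.pe₂, hF.e₂n, neg_zero, zero_smul, zero_smul, zero_add, add_zero] at x1
  rw [mink_comm _ (f z), hF'.pe₁, hF'.e₁n, neg_zero, zero_smul, zero_smul, zero_add, add_zero,
    mink_comm _ (pd 0 f z), mink_comm _ (pd 1 f z)] at y1
  rw [mink_comm _ (f z), hF'.pe₂, hF'.e₂n, neg_zero, zero_smul, zero_smul, zero_add, add_zero,
    mink_comm _ (pd 0 f z), mink_comm _ (pd 1 f z)] at y2
  have a11 := hF'.e₁₁
  have a22 := hF'.e₂₂
  have b11 := hF.e₁₁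
  have b22 := hF.e₂₂
  have b12 := hF.e₁₂
  have a21 : mink e₂ e₁ = 0 := by rw [mink_comm]; exact hF'.e₁₂
  have a12 := hF'.e₁₂
  have c1 : mink (pd 0 f z) e₁ ^ 2 + mink (pd 1 f z) e₁ ^ 2 = 1 := by
    rw [← a11]; nth_rewrite 3 [y1]
    rw [mink_add_left, mink_smul_left, mink_smul_left]; ring
  have c2 : mink (pd 0 f z) e₂ ^ 2 + mink (pd 1 f z) e₂ ^ 2 = 1 := by
    rw [← a22]; nth_rewrite 3 [y2]
    rw [mink_add_left, mink_smul_left, mink_smul_left]; ring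
  have c3 : mink (pd 0 f z) e₁ * mink (pd 0 f z) e₂ + mink (pd 1 f z) e₁ * mink (pd 1 f z) e₂
      = 0 := by
    rw [← a12]; nth_rewrite 3 [y1]
    rw [mink_add_left, mink_smul_left, mink_smul_left]
  obtain ⟨a0, ha0⟩ : ∃ a, a = mink (pd 0 f z) e₁ := ⟨_, rfl⟩
  obtain ⟨b0, hb0⟩ : ∃ a, a = mink (pd 0 f z) e₂ := ⟨_, rfl⟩
  obtain ⟨a1, ha1⟩ : ∃ a, a = mink (pd 1 f z) e₁ := ⟨_, rfl⟩
  obtain ⟨b1, hb1⟩ : ∃ a, a = mink (pd 1 f z) e₂ := ⟨_, rfl⟩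
  rw [← ha0, ← hb0] at x0
  rw [← ha1, ← hb1] at x1
  rw [← ha0, ← ha1] at c1
  rw [← hb0, ← hb1] at c2
  rw [← ha0, ← ha1, ← hb0, ← hb1] at c3
  have hLL : ∀ a b a' b' : ℝ, mink (L (a • e₁ + b • e₂)) (a' • e₁ + b' • e₂)
      = κ * a * a' + κ⁻¹ * b * b' := by
    intro a b a' b'
    simp only [map_add, map_smul, h₁, h₂, mink_add_left, mink_add_right, mink_smul_left,
      mink_smul_right, a11, a22, a12, a21]
    ring
  have l00 : mink n (pd 0 (pd 0 f) z) = -(κ * a0 * a0 + κ⁻¹ * b0 * b0) := by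
    rw [hL, x0, hLL]
  have l01 : mink n (pd 0 (pd 1 f) z) = -(κ * a0 * a1 + κ⁻¹ * b0 * b1) := by
    rw [hL, x0, x1, hLL]
  have l11 : mink n (pd 1 (pd 1 f) z) = -(κ * a1 * a1 + κ⁻¹ * b1 * b1) := by
    rw [hL, x1, hLL]
  have hk : κ * κ⁻¹ = 1 := mul_inv_cancel₀ hκ.ne'
  refine ⟨hF.pn, hF.nn, ?_, ?_, ?_⟩
  · intro i; fin_cases i
    · exact hF.e₁n
    · exact hF.e₂n
  · rw [l00, l11]
    linear_combination κ * c1 + κ⁻¹ * c2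
  · rw [l00, l01, l11]
    have hdet : (a0 * b1 - a1 * b0) ^ 2 = 1 := by
      linear_combination (b0 ^ 2 + b1 ^ 2) * c1 + c2 - (a0 * b0 + a1 * b1) * c3
    linear_combination (a0 * b1 - a1 * b0) ^ 2 * hk + hdet

variable {M : Type*} [TopologicalSpace M]

/-- Near `z`, the chart `c` takes the map `φ` from the plane to the boundary to the image under
the isometry `A` of the model surface `tubeBase κ`, and the manifold lies on the side of positive
distance. -/
structure IsTubeGerm (κ : ℝ) (φ : Plane → M) (c : Set M × (M → Mink)) (z : Plane)
    (A : Mink ≃ₗ[ℝ] Mink) : Prop where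
  iso : IsHypIso A
  eventually : ∀ᶠ p : Plane × ℝ in 𝓝 (z, 0), c.2 (φ p.1) = A (tubeBase κ p.1) ∧
    (A (tube κ p.1 p.2) ∈ c.2 '' c.1 ↔ 0 ≤ p.2)

/-- The map `φ` from the plane to the boundary is locally the model surface `tubeBase κ`, and the
manifold lies locally on the side of positive distance. -/
structure IsTubeMap (𝒜 : HyperbolicAtlas M) (κ : ℝ) (φ : Plane → M) : Prop where
  continuous : Continuous φ
  chart : ∀ z, ∀ c ∈ 𝒜.charts, φ z ∈ c.1 → ∃ A, IsTubeGerm κ φ c z A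

namespace HyperbolicAtlas

variable {𝒜 : HyperbolicAtlas M}

theorem IsFlatUniformization.isFlatMap {T : Set M} {φ : Plane → M}
    (hφ : 𝒜.IsFlatUniformization T φ) {c : Set M × (M → Mink)} (hc : c ∈ 𝒜.charts) :
    IsFlatMap (φ ⁻¹' c.1) (fun y => c.2 (φ y)) := by
  refine ⟨(𝒜.isOpen_source c hc).preimage hφ.continuous, fun z hz =>
    (hφ.smooth c hc z hz).contDiffWithinAt, fun z hz => 𝒜.mapsTo c hc hz, fun z hz i j => ?_⟩
  rw [pd, pd, hφ.isometric c hc z hz]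
  fin_cases i <;> fin_cases j <;> simp [EuclideanSpace.inner_single_left]

theorem image_notMem_nhdsWithin {c : Set M × (M → Mink)} (hc : c ∈ 𝒜.charts) {x : M}
    (hx : x ∈ c.1) (hb : x ∈ 𝒜.boundary) : c.2 '' c.1 ∉ 𝓝[hyp3] (c.2 x) :=
  fun h => hb ⟨c, hc, hx, h⟩

theorem IsFlatUniformization.boundary_normal {T : Set M} {φ : Plane → M}
    (hφ : 𝒜.IsFlatUniformization T φ) (hT : T ⊆ 𝒜.boundary) {κ : ℝ}
    {c : Set M × (M → Mink)} (hc : c ∈ 𝒜.charts) {z : Plane} (hz : φ z ∈ c.1) {g : Mink → ℝ}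
    {ν : Mink → Mink} (hg : IsDefiningFunction (c.2 '' c.1) (c.2 (φ z)) g)
    (hν : ∀ᶠ q in 𝓝 (c.2 (φ z)), ContDiffAt ℝ ∞ ν q)
    (hν2 : ∀ᶠ q in 𝓝[hyp3] (c.2 (φ z)), g q = 0 → IsInwardUnitNormal g q (ν q))
    {e₁ e₂ : Mink} (h1 : IsTangent g (c.2 (φ z)) e₁) (h2 : IsTangent g (c.2 (φ z)) e₂)
    (h11 : mink e₁ e₁ = 1) (h22 : mink e₂ e₂ = 1) (h12 : mink e₁ e₂ = 0)
    (hk1 : fderiv ℝ ν (c.2 (φ z)) e₁ = κ • e₁) (hk2 : fderiv ℝ ν (c.2 (φ z)) e₂ = κ⁻¹ • e₂)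
    (hκ : 0 < κ) :
    IsCurvedNormal κ (fun y => c.2 (φ y)) z (ν (c.2 (φ z))) ∧
    IsInwardUnitNormal g (c.2 (φ z)) (ν (c.2 (φ z))) ∧
    IsFrame (c.2 (φ z)) e₁ e₂ (ν (c.2 (φ z))) ∧
    ∀ i j, mink (ν (c.2 (φ z))) (pd i (pd j (fun y => c.2 (φ y))) z)
      = -mink (fderiv ℝ ν (c.2 (φ z)) (pd i (fun y => c.2 (φ y)) z))
          (pd j (fun y => c.2 (φ y)) z) := by
  have H := hφ.isFlatMap hc
  have hT' : ∀ y, φ y ∈ 𝒜.boundary := fun y => hT (hφ.range_eq ▸ mem_range_self y)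
  obtain ⟨a1, a2, a3⟩ := TubularTruncation.boundary_normal H hz (D := c.2 '' c.1)
    (fun y hy => mem_image_of_mem _ hy) (fun y hy => image_notMem_nhdsWithin hc hy (hT' y))
    hg hν hν2
  have hF := H.frame_of_normal hz a1.tangent a1.unit a2
  have hF' : IsFrame (c.2 (φ z)) e₁ e₂ (ν (c.2 (φ z))) :=
    ⟨H.mem z hz, h1.1, h2.1, a1.tangent, h11, h22, a1.unit, h12,
      by rw [mink_comm]; exact a1.normal _ h1, by rw [mink_comm]; exact a1.normal _ h2⟩
  exact ⟨boundary_curvedNormal hκ hF hF' hk1 hk2 a3, a1, hF', a3⟩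

theorem IsFlatUniformization.isFlatImmersion {T : Set M} {φ : Plane → M}
    (hφ : 𝒜.IsFlatUniformization T φ) (hT : T ⊆ 𝒜.boundary) {κ : ℝ} (hκ : 0 < κ)
    (hcurv : ∀ x ∈ T, ∀ c ∈ 𝒜.charts, x ∈ c.1 →
      HasPrincipalCurvatures (c.2 '' c.1) (c.2 x) κ κ⁻¹)
    {c : Set M × (M → Mink)} (hc : c ∈ 𝒜.charts) :
    IsFlatImmersion κ (φ ⁻¹' c.1) (fun y => c.2 (φ y)) := by
  refine ⟨hφ.isFlatMap hc, fun z hz => ?_⟩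
  obtain ⟨g, ν, hg, hν, hν2, e₁, e₂, h1, h2, h11, h22, h12, hk1, hk2⟩ :=
    hcurv (φ z) (hφ.range_eq ▸ mem_range_self z) c hc hz
  exact ⟨_, (hφ.boundary_normal hT hc hz hg hν hν2 h1 h2 h11 h22 h12 hk1 hk2 hκ).1⟩

theorem IsFlatUniformization.comp_isometry {T : Set M} {φ : Plane → M}
    (hφ : 𝒜.IsFlatUniformization T φ) (ρ : Plane ≃ₗᵢ[ℝ] Plane) :
    𝒜.IsFlatUniformization T (fun y => φ (ρ y)) := by
  refine ⟨hφ.continuous.comp ρ.continuous, ?_, ?_, ?_⟩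
  · rw [← hφ.range_eq]
    exact ρ.surjective.range_comp φ
  · intro c hc x hx
    exact (hφ.smooth c hc (ρ x) hx).comp x ρ.contDiff.contDiffAt
  · intro c hc x hx v w
    have h1 := ((hφ.smooth c hc (ρ x) hx).differentiableAt (by simp)).hasFDerivAt.comp x
      (ρ.toContinuousLinearEquiv.hasFDerivAt (x := x))
    have h2 : fderiv ℝ (fun y => c.2 (φ (ρ y))) x = _ := h1.fderiv
    rw [h2]
    change mink (fderiv ℝ (fun y => c.2 (φ y)) (ρ x) (ρ v))
      (fderiv ℝ (fun y => c.2 (φ y)) (ρ x) (ρ w)) = _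
    rw [hφ.isometric c hc (ρ x) hx, ρ.inner_map_map]

end HyperbolicAtlas

theorem pd_linear (A : Mink ≃ₗ[ℝ] Mink) {U : Set Plane} (hU : IsOpen U) {F : Plane → Mink}
    (hF : ContDiffOn ℝ ∞ F U) (i : Fin 2) {z : Plane} (hz : z ∈ U) :
    pd i (fun y => A (F y)) z = A (pd i F z) := by
  have := (A.toContinuousLinearEquiv.hasFDerivAt.comp z (contDiffOn_hasFDerivAt hU hF hz)).fderiv
  change fderiv ℝ (A.toContinuousLinearEquiv ∘ F) z _ = _
  rw [this]; rfl

theorem secondForm_isometry {A : Mink ≃ₗ[ℝ] Mink} (hA : IsHypIso A) (κ : ℝ) {U : Set Plane}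
    (hU : IsOpen U) {F G : Plane → Mink} (hF : ContDiffOn ℝ ∞ F U)
    (hFG : ∀ y ∈ U, G y = A (F y)) (i j : Fin 2) {z : Plane} (hz : z ∈ U) :
    secondForm κ G i j z = secondForm κ F i j z := by
  have h1 : ∀ i, EqOn (pd i G) (fun y => A (pd i F y)) U := by
    intro i y hy
    rw [pd_congr hU hFG i hy]
    exact pd_linear A hU hF i hy
  have h2 : ∀ i j, EqOn (pd i (pd j G)) (fun y => A (pd i (pd j F) y)) U := by
    intro i j y hy
    rw [pd_congr hU (h1 j) i hy]
    exact pd_linear A hU (contDiffOn_pd hU hF j) i hy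
  have h3 : normalField κ G z = A (normalField κ F z) := by
    simp only [normalField, h2 _ _ hz, hFG z hz, map_add, map_smul]
  rw [secondForm, secondForm, h3, h2 i j hz]
  simp only [hA.map_mink]

/-- The side of the model surface on which the domain lies. -/
theorem eventually_tube_mem_iff {κ : ℝ} (hκ : 0 < κ) {A : Mink ≃ₗ[ℝ] Mink} (hA : IsHypIso A)
    {D : Set Mink} {z : Plane} {g : Mink → ℝ} (hg : IsDefiningFunction D (A (tubeBase κ z)) g)
    (h0 : ∀ᶠ y in 𝓝 z, g (A (tubeBase κ y)) = 0)
    (hpos : 0 < fderiv ℝ g (A (tubeBase κ z)) (A (shapeOp κ (tubeBase κ z)))) :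
    ∀ᶠ p : Plane × ℝ in 𝓝 (z, 0), (A (tube κ p.1 p.2) ∈ D ↔ 0 ≤ p.2) := by
  have hcA := IsHypIso.continuous A
  have ht : Tendsto (fun p : Plane × ℝ => A (tube κ p.1 p.2)) (𝓝 (z, 0))
      (𝓝[hyp3] (A (tubeBase κ z))) := by
    refine tendsto_nhdsWithin_iff.2 ⟨?_, Eventually.of_forall fun p =>
      hA.mem_hyp3 _ (tube_mem hκ _ _)⟩
    have := (hcA.comp (continuous_tube κ)).tendsto (z, 0)
    simpa [tube_zero, Function.comp_def] using this
  have ht' := ht.mono_right nhdsWithin_le_nhds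
  have h1 := ht.eventually hg.mem_iff
  have h2 := ht'.eventually hg.smooth
  have h3 : ∀ᶠ p : Plane × ℝ in 𝓝 (z, 0),
      0 < fderiv ℝ g (A (tube κ p.1 p.2)) (A (tubeN κ p.1 p.2)) := by
    have c1 : ContinuousAt (fderiv ℝ g) (A (tubeBase κ z)) :=
      (hg.smooth.self_of_nhds.fderiv_right (m := 0) (by simp)).continuousAt
    have c2 := c1.tendsto.comp ht'
    have c3 := (hcA.comp (continuous_tubeN κ)).tendsto (z, 0)
    have c4 := (isBoundedBilinearMap_apply.continuous.tendsto
      (fderiv ℝ g (A (tubeBase κ z)), (A ∘ fun p : Plane × ℝ => tubeN κ p.1 p.2) (z, 0))).comp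
      (c2.prodMk_nhds c3)
    simp only [Function.comp_def, tubeN_zero] at c4
    exact c4.eventually (lt_mem_nhds hpos)
  obtain ⟨r, hr, hball⟩ := Metric.eventually_nhds_iff_ball.1 (h2.and h3)
  obtain ⟨r', hr', hball'⟩ := Metric.eventually_nhds_iff_ball.1 h0
  filter_upwards [h1, Metric.ball_mem_nhds (z, (0 : ℝ)) (lt_min hr hr')] with p hp1 hp2
  rw [hp1]
  rw [← ball_prod_same] at hp2
  obtain ⟨q1, q2⟩ := hp2
  have hmem : ∀ h ∈ Metric.ball (0 : ℝ) r, (p.1, h) ∈ Metric.ball (z, (0 : ℝ)) r := by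
    intro h hh
    rw [← ball_prod_same]
    exact ⟨Metric.ball_subset_ball (min_le_left _ _) q1, hh⟩
  have hd : ∀ h ∈ Metric.ball (0 : ℝ) r, HasDerivAt (fun t => g (A (tube κ p.1 t)))
      (fderiv ℝ g (A (tube κ p.1 h)) (A (tubeN κ p.1 h))) h := by
    intro h hh
    have e1 := A.toContinuousLinearEquiv.hasFDerivAt.comp_hasDerivAt h (hasDerivAt_tube κ p.1 h)
    have e2 := ((hball _ (hmem h hh)).1.differentiableAt (by simp)).hasFDerivAt
    exact e2.comp_hasDerivAt h e1
  have hmono : StrictMonoOn (fun t => g (A (tube κ p.1 t))) (Metric.ball (0 : ℝ) r) := by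
    refine strictMonoOn_of_deriv_pos (convex_ball 0 r)
      (fun h hh => (hd h hh).continuousAt.continuousWithinAt) ?_
    intro h hh
    rw [Metric.isOpen_ball.interior_eq] at hh
    rw [(hd h hh).deriv]
    exact (hball _ (hmem h hh)).2
  have h00 : g (A (tube κ p.1 0)) = 0 := by
    rw [tube_zero]; exact hball' _ (Metric.ball_subset_ball (min_le_right _ _) q1)
  have q2' : p.2 ∈ Metric.ball (0 : ℝ) r := Metric.ball_subset_ball (min_le_left _ _) q2
  have h5 := hmono.le_iff_le (Metric.mem_ball_self hr) q2'
  simp only [h00] at h5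
  exact h5

namespace HyperbolicAtlas

variable {𝒜 : HyperbolicAtlas M}

/-- Coordinates on the plane that diagonalize the second fundamental form at one point. -/
theorem IsFlatUniformization.exists_diagonal {T : Set M} {φ : Plane → M}
    (hφ : 𝒜.IsFlatUniformization T φ) (hT : T ⊆ 𝒜.boundary) {κ : ℝ} (hκ : 0 < κ)
    (hcurv : ∀ x ∈ T, ∀ c ∈ 𝒜.charts, x ∈ c.1 →
      HasPrincipalCurvatures (c.2 '' c.1) (c.2 x) κ κ⁻¹) :
    ∃ φ', 𝒜.IsFlatUniformization T φ' ∧ ∃ c ∈ 𝒜.charts, φ' 0 ∈ c.1 ∧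
      secondForm κ (fun y => c.2 (φ' y)) 0 0 0 = κ ∧
      secondForm κ (fun y => c.2 (φ' y)) 0 1 0 = 0 := by
  obtain ⟨c, hc, hz⟩ := 𝒜.cover (φ 0)
  obtain ⟨g, ν, hg, hν, hν2, e₁, e₂, h1, h2, h11, h22, h12, hk1, hk2⟩ :=
    hcurv (φ 0) (hφ.range_eq ▸ mem_range_self 0) c hc hz
  obtain ⟨b1, b2, b3, b4⟩ := hφ.boundary_normal hT hc hz hg hν hν2 h1 h2 h11 h22 h12 hk1 hk2 hκ
  have H := hφ.isFlatMap hc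
  have hF := H.frame_of_normal hz b2.tangent b2.unit b1.normal
  have hex : ∀ e : Mink, mink (c.2 (φ 0)) e = 0 → mink e (ν (c.2 (φ 0))) = 0 →
      ∃ u : Plane, fderiv ℝ (fun y => c.2 (φ y)) 0 u = e := by
    intro e he he'
    refine ⟨!₂[mink e (pd 0 (fun y => c.2 (φ y)) 0), mink e (pd 1 (fun y => c.2 (φ y)) 0)], ?_⟩
    rw [fderiv_eq_pd]
    conv_rhs => rw [hF.expand e]
    rw [mink_comm e (c.2 (φ 0)), he, he']
    simp
  obtain ⟨u₁, hu₁⟩ := hex e₁ b3.pe₁ b3.e₁n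
  obtain ⟨u₂, hu₂⟩ := hex e₂ b3.pe₂ b3.e₂n
  have i11 : inner ℝ u₁ u₁ = 1 := by rw [← hφ.isometric c hc 0 hz, hu₁, h11]
  have i22 : inner ℝ u₂ u₂ = 1 := by rw [← hφ.isometric c hc 0 hz, hu₂, h22]
  have i12 : inner ℝ u₁ u₂ = 0 := by rw [← hφ.isometric c hc 0 hz, hu₁, hu₂, h12]
  have horth : Orthonormal ℝ ![u₁, u₂] := by
    rw [orthonormal_iff_ite]
    intro i j
    fin_cases i <;> fin_cases j
    · simpa using i11
    · simpa using i12
    · simpa using (real_inner_comm u₁ u₂).trans i12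
    · simpa using i22
  let b0 := basisOfOrthonormalOfCardEqFinrank horth (by simp)
  have hb0 : ⇑b0 = ![u₁, u₂] := coe_basisOfOrthonormalOfCardEqFinrank horth (by simp)
  let b := b0.toOrthonormalBasis (by rw [hb0]; exact horth)
  have hbb : ⇑b = ![u₁, u₂] := by simp [b, hb0]
  let ρ : Plane ≃ₗᵢ[ℝ] Plane := b.repr.symm
  have r1 : ρ (EuclideanSpace.single 0 1) = u₁ := by
    rw [show ρ (EuclideanSpace.single 0 1) = b 0 from b.repr_symm_single 0, hbb]; rfl
  have r2 : ρ (EuclideanSpace.single 1 1) = u₂ := by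
    rw [show ρ (EuclideanSpace.single 1 1) = b 1 from b.repr_symm_single 1, hbb]; rfl
  have hφ' := hφ.comp_isometry ρ
  refine ⟨fun y => φ (ρ y), hφ', c, hc, by simpa using hz, ?_⟩
  have hz' : φ (ρ 0) ∈ c.1 := by simpa using hz
  have hp : ∀ i, pd i (fun y => c.2 (φ (ρ y))) 0
      = fderiv ℝ (fun y => c.2 (φ y)) 0 (ρ (EuclideanSpace.single i 1)) := by
    intro i
    have h1 := ((hφ.smooth c hc (ρ 0) hz').differentiableAt (by simp)).hasFDerivAt.comp 0
      (ρ.toContinuousLinearEquiv.hasFDerivAt (x := 0))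
    have h2 : fderiv ℝ (fun y => c.2 (φ (ρ y))) 0 = _ := h1.fderiv
    rw [pd, h2]
    change fderiv ℝ (fun y => c.2 (φ y)) (ρ 0) (ρ _) = _
    rw [map_zero]
  have p0 : pd 0 (fun y => c.2 (φ (ρ y))) 0 = e₁ := by rw [hp, r1, hu₁]
  have p1 : pd 1 (fun y => c.2 (φ (ρ y))) 0 = e₂ := by rw [hp, r2, hu₂]
  have h00 : φ (ρ 0) = φ 0 := by rw [map_zero]
  have hg' : IsDefiningFunction (c.2 '' c.1) (c.2 (φ (ρ 0))) g := by rwa [h00]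
  obtain ⟨d1, -, -, d4⟩ := hφ'.boundary_normal hT hc hz' hg' (by rwa [h00]) (by rwa [h00])
    (e₁ := e₁) (e₂ := e₂) (by rwa [h00]) (by rwa [h00]) h11 h22 h12 (by rwa [h00])
    (by rwa [h00]) hκ
  have hn := (hφ'.isFlatImmersion hT hκ hcurv hc).normalField_eq hκ hz' d1
  constructor
  · rw [secondForm, hn, d4, p0, h00, hk1, mink_smul_left, h11]; ring
  · rw [secondForm, hn, d4, p0, p1, h00, hk1, mink_smul_left, h12]; ring

/-- A tubular boundary component is the image of the model surface. -/
theorem IsFlatUniformization.exists_isTubeMap {T : Set M} {φ₀ : Plane → M}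
    (hφ₀ : 𝒜.IsFlatUniformization T φ₀) (hT : T ⊆ 𝒜.boundary) {κ : ℝ} (hκ : 0 < κ)
    (hcurv : ∀ x ∈ T, ∀ c ∈ 𝒜.charts, x ∈ c.1 →
      HasPrincipalCurvatures (c.2 '' c.1) (c.2 x) κ κ⁻¹) :
    ∃ φ, 𝒜.IsFlatUniformization T φ ∧ IsTubeMap 𝒜 κ φ := by
  obtain ⟨φ, hφ, c₀, hc₀, hz₀, s1, s2⟩ := hφ₀.exists_diagonal hT hκ hcurv
  refine ⟨φ, hφ, hφ.continuous, ?_⟩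
  have HI := fun {c : Set M × (M → Mink)} (hc : c ∈ 𝒜.charts) =>
    hφ.isFlatImmersion hT hκ hcurv hc
  have hball : ∀ z, ∀ c ∈ 𝒜.charts, φ z ∈ c.1 → ∃ r > 0, Metric.ball z r ⊆ φ ⁻¹' c.1 ∧
      ∀ y ∈ Metric.ball z r, ∀ i j, secondForm κ (fun y => c.2 (φ y)) i j y
        = secondForm κ (fun y => c.2 (φ y)) i j z := by
    intro z c hc hz
    obtain ⟨r, hr, hsub⟩ := Metric.isOpen_iff.1 (HI hc).isOpen z hz
    refine ⟨r, hr, hsub, fun y hy i j => ?_⟩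
    exact eqOn_ball_of_pd_eq_zero (((HI hc).smooth_second i j).mono hsub)
      (fun x hx k => (HI hc).pd_second hκ (hsub hx) i j k) hy
  have hchange : ∀ z, ∀ c ∈ 𝒜.charts, φ z ∈ c.1 → ∀ c' ∈ 𝒜.charts, φ z ∈ c'.1 → ∀ i j,
      secondForm κ (fun y => c'.2 (φ y)) i j z = secondForm κ (fun y => c.2 (φ y)) i j z := by
    intro z c hc hz c' hc' hz' i j
    obtain ⟨A, hA, hAe⟩ := 𝒜.compatible c hc c' hc' (φ z) ⟨hz, hz'⟩
    obtain ⟨B, hB, hBA⟩ := IsHypIso.of_oriented hA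
    have h1 : ∀ᶠ y in 𝓝 z, c'.2 (φ y) = B (c.2 (φ y)) ∧ φ y ∈ c.1 := by
      filter_upwards [hφ.continuous.continuousAt.eventually hAe,
        (HI hc).isOpen.mem_nhds hz] with y hy hy'
      rw [hy, ← hBA]; exact ⟨rfl, hy'⟩
    obtain ⟨V, hV, hVo, hzV⟩ := mem_nhds_iff.1 h1
    exact secondForm_isometry hB κ hVo ((HI hc).smooth.mono fun y hy => (hV hy).2)
      (fun y hy => (hV hy).1) i j hzV
  -- the second fundamental form is constant, since the plane is connected
  let P : Plane → Prop := fun z => ∀ c ∈ 𝒜.charts, φ z ∈ c.1 →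
    secondForm κ (fun y => c.2 (φ y)) 0 0 z = κ ∧ secondForm κ (fun y => c.2 (φ y)) 0 1 z = 0
  have hPiff : ∀ z, ∀ c ∈ 𝒜.charts, φ z ∈ c.1 → (P z ↔
      secondForm κ (fun y => c.2 (φ y)) 0 0 z = κ ∧
      secondForm κ (fun y => c.2 (φ y)) 0 1 z = 0) := by
    intro z c hc hz
    refine ⟨fun h => h c hc hz, fun h c' hc' hz' => ?_⟩
    rw [hchange z c hc hz c' hc' hz', hchange z c hc hz c' hc' hz']; exact h
  have hPloc : IsLocallyConstant P := by
    rw [IsLocallyConstant.iff_eventually_eq]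
    intro z
    obtain ⟨c, hc, hz⟩ := 𝒜.cover (φ z)
    obtain ⟨r, hr, hsub, hconst⟩ := hball z c hc hz
    filter_upwards [Metric.ball_mem_nhds z hr] with y hy
    rw [hPiff z c hc hz, hPiff y c hc (hsub hy), hconst y hy, hconst y hy]
  have hP : ∀ z, P z := by
    intro z
    rw [hPloc.apply_eq_of_preconnectedSpace z 0, hPiff 0 c₀ hc₀ hz₀]
    exact ⟨s1, s2⟩
  intro z c hc hz
  obtain ⟨r, hr, hsub, -⟩ := hball z c hc hz
  obtain ⟨A, hA, hA2⟩ := (HI hc).eq_tube hκ hr hsub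
    (fun y hy => (hP y c hc (hsub hy)).1) (fun y hy => (hP y c hc (hsub hy)).2)
  obtain ⟨g, ν, hg, hν, hν2, e₁, e₂, h1, h2, h11, h22, h12, hk1, hk2⟩ :=
    hcurv (φ z) (hφ.range_eq ▸ mem_range_self z) c hc hz
  obtain ⟨b1, b2, b3, b4⟩ := hφ.boundary_normal hT hc hz hg hν hν2 h1 h2 h11 h22 h12 hk1 hk2 hκ
  have hn := (HI hc).normalField_eq hκ hz b1
  have hT' : ∀ y, φ y ∈ 𝒜.boundary := fun y => hT (hφ.range_eq ▸ mem_range_self y)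
  have hzb := hA2 z (Metric.mem_ball_self hr)
  have hg0 := eventually_defining_eq_zero (hφ.isFlatMap hc) hz (D := c.2 '' c.1)
    (fun y hy => mem_image_of_mem _ hy) (fun y hy => image_notMem_nhdsWithin hc hy (hT' y)) hg
  refine ⟨A, hA, ?_⟩
  have hs : ∀ᶠ p : Plane × ℝ in 𝓝 (z, 0), c.2 (φ p.1) = A (tubeBase κ p.1) := by
    have : ∀ᶠ y in 𝓝 z, c.2 (φ y) = A (tubeBase κ y) := by
      filter_upwards [Metric.ball_mem_nhds z hr] with y hy using (hA2 y hy).1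
    exact (continuous_fst.tendsto (z, (0 : ℝ))).eventually this
  refine hs.and (eventually_tube_mem_iff hκ hA (g := g) ?_ ?_ ?_)
  · rw [← hzb.1]; exact hg
  · filter_upwards [hg0, Metric.ball_mem_nhds z hr] with y hy hy'
    rw [← (hA2 y hy').1]; exact hy
  · rw [← hzb.2, ← hzb.1, hn]; exact b2.inward

end HyperbolicAtlas

end

section

/-! ### Symmetries of the model surface -/

/-- The rotation (or rather the similarity) of the plane with matrix `(a, -b; b, a)`. -/
def rot (a b : ℝ) (u : Plane) : Plane := !₂[a * u 0 - b * u 1, b * u 0 + a * u 1]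

theorem continuous_rot (a b : ℝ) : Continuous (rot a b) := by
  refine (PiLp.continuous_toLp 2 _).comp (continuous_pi fun i => ?_)
  fin_cases i <;> simp <;> fun_prop

/-- The model surface is symmetric under the half-turn, and under all rotations if it is a
horosphere. -/
theorem tubeBase_rot {κ a b : ℝ} (hab : a ^ 2 + b ^ 2 = 1) (h : κ = 1 ∨ b = 0) (u : Plane) :
    tubeBase κ (rot a b u) = ![1 + vn (mX κ) (u 0) + vn (mY κ) (u 1),
      a * sn (mX κ) (u 0) - b * sn (mY κ) (u 1), b * sn (mX κ) (u 0) + a * sn (mY κ) (u 1),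
      -(κ * vn (mX κ) (u 0)) - κ⁻¹ * vn (mY κ) (u 1)] := by
  rcases h with rfl | rfl
  · have hX : mX 1 = 0 := by norm_num [mX]
    have hY : mY 1 = 0 := by norm_num [mY]
    have hsn : ∀ x, sn 0 x = x := by intro x; simp [sn]
    have hvn : ∀ x, vn 0 x = x ^ 2 / 2 := by intro x; simp [vn]
    funext i
    fin_cases i <;> simp [tubeBase, rot, hX, hY, hsn, hvn]
    · linear_combination ((u 0 ^ 2 + u 1 ^ 2) / 2) * hab
    · linear_combination (-(u 0 ^ 2 + u 1 ^ 2) / 2) * hab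
  · have ha1 : a * a = 1 := by linarith
    rcases mul_self_eq_one_iff.1 ha1 with h | h <;> rw [h] <;> funext i <;>
      fin_cases i <;> simp [tubeBase, rot, sn_neg, vn_neg]

theorem orthogonal_two {a b c d : ℝ} (o11 : a ^ 2 + b ^ 2 = 1) (o22 : c ^ 2 + d ^ 2 = 1)
    (o12 : a * c + b * d = 0) (hdet : 0 < a * d - b * c) : d = a ∧ c = -b := by
  have hd1 : a * d - b * c = 1 := by
    have : (a * d - b * c) ^ 2 = 1 := by
      linear_combination (c ^ 2 + d ^ 2) * o11 + o22 - (a * c + b * d) * o12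
    exact (pow_eq_one_iff_of_nonneg hdet.le two_ne_zero).1 this
  have hsum : (a - d) ^ 2 + (b + c) ^ 2 = 0 := by linear_combination o11 + o22 - 2 * hd1
  have h1 := sq_nonneg (a - d)
  have h2 := sq_nonneg (b + c)
  have h3 := pow_eq_zero_iff (two_ne_zero) |>.1 (show (a - d) ^ 2 = 0 by linarith)
  have h4 := pow_eq_zero_iff (two_ne_zero) |>.1 (show (b + c) ^ 2 = 0 by linarith)
  exact ⟨by linarith, by linarith⟩

/-- An orientation-preserving isometry of `ℍ³` that fixes a point of the model surface and
preserves the surface near that point acts on the surface as a rotation. -/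
theorem exists_rot_of_tubeBase {κ : ℝ} (hκ : 0 < κ) {G : Mink ≃ₗ[ℝ] Mink} (hG : IsHypIso G)
    (hdet : 0 < LinearMap.det G.toLinearMap) (h0 : G (tubeBase κ 0) = tubeBase κ 0)
    (h : ∀ᶠ u in 𝓝 (0 : Plane), ∃ w, G (tubeBase κ u) = tubeBase κ w) :
    ∃ a b, a ^ 2 + b ^ 2 = 1 ∧ ∀ u, G (tubeBase κ u) = tubeBase κ (rot a b u) := by
  have hE0 : tubeBase κ 0 = Pi.single 0 1 := by
    rw [tubeBase_zero]; funext i; fin_cases i <;> simp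
  rw [hE0] at h0
  have hx0 : ∀ x, G x 0 = x 0 := by
    intro x
    have := hG.map_mink x (Pi.single 0 1)
    rw [h0] at this
    simp [mink] at this
    linarith
  have hexp : ∀ u : Plane, tubeBase κ u
      = (1 + vn (mX κ) (u 0) + vn (mY κ) (u 1)) • (Pi.single 0 1 : Mink)
        + sn (mX κ) (u 0) • (Pi.single 1 1 : Mink) + sn (mY κ) (u 1) • (Pi.single 2 1 : Mink)
        + (-(κ * vn (mX κ) (u 0)) - κ⁻¹ * vn (mY κ) (u 1)) • (Pi.single 3 1 : Mink) := by
    intro u; funext i; fin_cases i <;> simp [tubeBase]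
  have hle : ∀ᶠ u in 𝓝 (0 : Plane), G (tubeBase κ u) 3 ≤ 0 := by
    filter_upwards [h] with u hu
    obtain ⟨w, hw⟩ := hu
    rw [hw]
    have h1 := mul_nonneg hκ.le (vn_nonneg (mX κ) (w 0))
    have h2 := mul_nonneg (inv_pos.2 hκ).le (vn_nonneg (mY κ) (w 1))
    simp [tubeBase]
    linarith
  have hline : ∀ i : Fin 2, Tendsto (fun t : ℝ => t • (EuclideanSpace.single i 1 : Plane))
      (𝓝 0) (𝓝 0) := by
    intro i
    have : Continuous (fun t : ℝ => t • (EuclideanSpace.single i 1 : Plane)) := by fun_prop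
    simpa using this.tendsto 0
  -- the height over the tangent plane has a maximum at the fixed point
  have g13 : G (Pi.single 1 1) 3 = 0 := by
    have hd : HasDerivAt (fun t : ℝ => sn (mX κ) t * G (Pi.single 1 1) 3
        + (-(κ * vn (mX κ) t)) * G (Pi.single 3 1) 3)
        (cn (mX κ) 0 * G (Pi.single 1 1) 3 + (-(κ * sn (mX κ) 0)) * G (Pi.single 3 1) 3) 0 :=
      ((hasDerivAt_sn _ 0).mul_const _).add (((hasDerivAt_vn _ 0).const_mul κ).fun_neg.mul_const _)
    have hmax : IsLocalMax (fun t : ℝ => sn (mX κ) t * G (Pi.single 1 1) 3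
        + (-(κ * vn (mX κ) t)) * G (Pi.single 3 1) 3) 0 := by
      filter_upwards [(hline 0).eventually hle] with t ht
      rw [hexp] at ht
      simp [h0, sn_zero, vn_zero] at ht
      simp [sn_zero, vn_zero]
      linarith
    have := hmax.hasDerivAt_eq_zero hd
    simpa [cn_zero, sn_zero] using this
  have g23 : G (Pi.single 2 1) 3 = 0 := by
    have hd : HasDerivAt (fun t : ℝ => sn (mY κ) t * G (Pi.single 2 1) 3
        + (-(κ⁻¹ * vn (mY κ) t)) * G (Pi.single 3 1) 3)
        (cn (mY κ) 0 * G (Pi.single 2 1) 3 + (-(κ⁻¹ * sn (mY κ) 0)) * G (Pi.single 3 1) 3) 0 :=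
      ((hasDerivAt_sn _ 0).mul_const _).add
        (((hasDerivAt_vn _ 0).const_mul κ⁻¹).fun_neg.mul_const _)
    have hmax : IsLocalMax (fun t : ℝ => sn (mY κ) t * G (Pi.single 2 1) 3
        + (-(κ⁻¹ * vn (mY κ) t)) * G (Pi.single 3 1) 3) 0 := by
      filter_upwards [(hline 1).eventually hle] with t ht
      rw [hexp] at ht
      simp [h0, sn_zero, vn_zero] at ht
      simp [sn_zero, vn_zero]
      linarith
    have := hmax.hasDerivAt_eq_zero hd
    simpa [cn_zero, sn_zero] using this
  -- the normal is fixed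
  have hGs : ∀ x y, mink (G.symm x) y = mink x (G y) := by
    intro x y; rw [← hG.map_mink, G.apply_symm_apply]
  obtain ⟨l, hl⟩ : ∃ l : ℝ, G.symm (Pi.single 3 1) = l • (Pi.single 3 1 : Mink) := by
    refine ⟨G.symm (Pi.single 3 1) 3, ?_⟩
    have e0 := hGs (Pi.single 3 1) (Pi.single 0 1)
    have e1 := hGs (Pi.single 3 1) (Pi.single 1 1)
    have e2 := hGs (Pi.single 3 1) (Pi.single 2 1)
    rw [h0] at e0
    simp [mink] at e0 e1 e2
    funext i
    fin_cases i
    · simpa using e0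
    · simpa [g13] using e1
    · simpa [g23] using e2
    · simp
  have hl2 : l * l = 1 := by
    have := hGs (Pi.single 3 1) (G.symm (Pi.single 3 1))
    rw [G.apply_symm_apply, hl] at this
    simpa [mink] using this
  have hG3 : G (Pi.single 3 1) = l • (Pi.single 3 1 : Mink) := by
    have : (Pi.single 3 1 : Mink) = l • G (Pi.single 3 1) := by
      rw [← map_smul, ← hl, G.apply_symm_apply]
    conv_rhs => rw [this, smul_smul, hl2, one_smul]
  have hne : ∀ᶠ t in 𝓝[≠] (0 : ℝ), sn (mX κ) t ≠ 0 := eventually_sn_ne_zero _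
  have hl1 : l = 1 := by
    have h1 := ((hline 0).mono_left (nhdsWithin_le_nhds (s := {0}ᶜ))).eventually hle
    obtain ⟨t, ht1, ht2⟩ := (h1.and hne).exists
    rw [hexp] at ht1
    simp [h0, g13, hG3, vn_zero, sn_zero] at ht1
    have hv : 0 < vn (mX κ) t :=
      lt_of_le_of_ne (vn_nonneg _ _) fun h => ht2 (sn_eq_zero_of_vn h.symm)
    have := mul_pos hκ hv
    rcases mul_self_eq_one_iff.1 hl2 with h | h
    · exact h
    · rw [h] at ht1; linarith
  rw [hl1, one_smul] at hG3
  obtain ⟨a, ha⟩ : ∃ a, a = G (Pi.single 1 1) 1 := ⟨_, rfl⟩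
  obtain ⟨b, hb⟩ : ∃ a, a = G (Pi.single 1 1) 2 := ⟨_, rfl⟩
  obtain ⟨c, hc⟩ : ∃ a, a = G (Pi.single 2 1) 1 := ⟨_, rfl⟩
  obtain ⟨d, hd⟩ : ∃ a, a = G (Pi.single 2 1) 2 := ⟨_, rfl⟩
  have hG1 : G (Pi.single 1 1) = ![0, a, b, 0] := by
    funext i; fin_cases i
    · simpa using hx0 (Pi.single 1 1)
    · exact ha.symm
    · exact hb.symm
    · exact g13
  have hG2 : G (Pi.single 2 1) = ![0, c, d, 0] := by
    funext i; fin_cases i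
    · simpa using hx0 (Pi.single 2 1)
    · exact hc.symm
    · exact hd.symm
    · exact g23
  have o11 : a ^ 2 + b ^ 2 = 1 := by
    have := hG.map_mink (Pi.single 1 1) (Pi.single 1 1)
    rw [hG1] at this; simp [mink] at this; linarith
  have o22 : c ^ 2 + d ^ 2 = 1 := by
    have := hG.map_mink (Pi.single 2 1) (Pi.single 2 1)
    rw [hG2] at this; simp [mink] at this; linarith
  have o12 : a * c + b * d = 0 := by
    have := hG.map_mink (Pi.single 1 1) (Pi.single 2 1)
    rw [hG1, hG2] at this; simpa [mink] using this
  have hdet' : LinearMap.det G.toLinearMap = a * d - b * c := by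
    rw [← LinearMap.det_toMatrix']
    have hm : LinearMap.toMatrix' G.toLinearMap
        = !![1, 0, 0, 0; 0, a, c, 0; 0, b, d, 0; 0, 0, 0, 1] := by
      have hcol : ∀ i j, LinearMap.toMatrix' G.toLinearMap i j = G (Pi.single j 1) i := by
        intro i j
        rw [LinearMap.toMatrix'_apply]
        simp only [LinearEquiv.coe_coe]
      ext i j
      rw [hcol]
      fin_cases j
      · simp only [Fin.zero_eta, h0]; fin_cases i <;> simp
      · simp only [Fin.mk_one, hG1]; fin_cases i <;> simp
      · simp only [Fin.reduceFinMk, hG2]; fin_cases i <;> simp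
      · simp only [Fin.reduceFinMk, hG3]; fin_cases i <;> simp
    rw [hm]
    simp [Matrix.det_succ_row_zero, Fin.sum_univ_succ]
    ring
  rw [hdet'] at hdet
  obtain ⟨hda, hcb⟩ := orthogonal_two o11 o22 o12 hdet
  have h0' : G (Pi.single 0 1) = ![1, 0, 0, 0] := by
    rw [h0]; funext i; fin_cases i <;> simp
  have hG3' : G (Pi.single 3 1) = ![0, 0, 0, 1] := by
    rw [hG3]; funext i; fin_cases i <;> simp
  have hGu : ∀ u : Plane, G (tubeBase κ u) = ![1 + vn (mX κ) (u 0) + vn (mY κ) (u 1),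
      a * sn (mX κ) (u 0) - b * sn (mY κ) (u 1), b * sn (mX κ) (u 0) + a * sn (mY κ) (u 1),
      -(κ * vn (mX κ) (u 0)) - κ⁻¹ * vn (mY κ) (u 1)] := by
    intro u
    rw [hexp]
    simp only [map_add, map_smul, h0', hG1, hG2, hG3', hda, hcb]
    funext i; fin_cases i <;> simp
    · ring
    · ring
  refine ⟨a, b, o11, fun u => ?_⟩
  rw [hGu, tubeBase_rot o11]
  rcases eq_or_ne κ 1 with hκ1 | hne1
  · exact Or.inl hκ1
  · right
    have h1 := ((hline 0).mono_left (nhdsWithin_le_nhds (s := {0}ᶜ))).eventually h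
    obtain ⟨t, ⟨w, hw⟩, ht2⟩ := (h1.and hne).exists
    rw [hGu] at hw
    have w0 := congrFun hw 0
    have w2 := congrFun hw 2
    have w3 := congrFun hw 3
    simp [tubeBase, vn_zero, sn_zero] at w0 w2 w3
    have hW : (κ - κ⁻¹) * vn (mY κ) (w 1) = 0 := by linear_combination (-κ) * w0 - w3
    have hkk : κ - κ⁻¹ ≠ 0 := by
      refine sub_ne_zero.2 fun h => hne1 ?_
      have h5 : κ * κ = 1 := by nth_rewrite 2 [h]; exact mul_inv_cancel₀ hκ.ne'
      rcases mul_self_eq_one_iff.1 h5 with h6 | h6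
      · exact h6
      · linarith
    have hW' := sn_eq_zero_of_vn ((mul_eq_zero.1 hW).resolve_left hkk)
    rw [hW'] at w2
    exact (mul_eq_zero.1 w2).resolve_right ht2

theorem stretch_zero (k : ℝ) : stretch k 0 = 1 := by simp [stretch]

variable {M : Type*} [TopologicalSpace M] {𝒜 : HyperbolicAtlas M} {κ : ℝ} {φ : Plane → M}

namespace IsTubeGerm

variable {c : Set M × (M → Mink)} {z : Plane} {A : Mink ≃ₗ[ℝ] Mink}

theorem eventually_base (h : IsTubeGerm κ φ c z A) :
    ∀ᶠ y in 𝓝 z, c.2 (φ y) = A (tubeBase κ y) := by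
  have ht : Tendsto (fun y : Plane => (y, (0 : ℝ))) (𝓝 z) (𝓝 (z, 0)) := by
    have : Continuous fun y : Plane => (y, (0 : ℝ)) := by fun_prop
    exact this.tendsto z
  filter_upwards [ht.eventually h.eventually] with y hy using hy.1

theorem apply (h : IsTubeGerm κ φ c z A) : c.2 (φ z) = A (tubeBase κ z) :=
  h.eventually_base.self_of_nhds

theorem unique (hκ : 0 < κ) (h : IsTubeGerm κ φ c z A) {B : Mink ≃ₗ[ℝ] Mink}
    (h' : IsTubeGerm κ φ c z B) : A = B := by
  refine linearEquiv_eq_of_tubeBase hκ (z := z) ?_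
  filter_upwards [h.eventually_base, h'.eventually_base] with y h1 h2
  rw [← h1, ← h2]

theorem eventually_germ (h : IsTubeGerm κ φ c z A) : ∀ᶠ y in 𝓝 z, IsTubeGerm κ φ c y A := by
  have ht : Tendsto (fun y : Plane => (y, (0 : ℝ))) (𝓝 z) (𝓝 (z, 0)) := by
    have : Continuous fun y : Plane => (y, (0 : ℝ)) := by fun_prop
    exact this.tendsto z
  filter_upwards [ht.eventually (eventually_eventually_nhds.2 h.eventually)] with y hy
  exact ⟨h.iso, hy⟩

theorem map_nhds (hκ : 0 < κ) (h : IsTubeGerm κ φ c z A) :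
    map (fun p : Plane × ℝ => A (tube κ p.1 p.2)) (𝓝 (z, 0)) = 𝓝[hyp3] (c.2 (φ z)) := by
  have h1 := map_tube_nhds hκ z 0 (by simp [stretch_zero]) (by simp [stretch_zero])
  rw [h.apply, ← tube_zero, ← h.iso.map_nhdsWithin, ← h1, map_map]
  rfl

theorem eventually_image (hκ : 0 < κ) (h : IsTubeGerm κ φ c z A) {s : Set Mink}
    (hs : ∀ᶠ p : Plane × ℝ in 𝓝 (z, 0), A (tube κ p.1 p.2) ∈ s) : s ∈ 𝓝[hyp3] (c.2 (φ z)) := by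
  rw [← h.map_nhds hκ]; exact hs

theorem notMem_nhds (hκ : 0 < κ) (h : IsTubeGerm κ φ c z A) :
    c.2 '' c.1 ∉ 𝓝[hyp3] (c.2 (φ z)) := by
  rw [← h.map_nhds hκ]
  intro hcon
  have ht : Tendsto (fun t : ℝ => (z, t)) (𝓝[<] 0) (𝓝 (z, 0)) := by
    have : Continuous fun t : ℝ => (z, t) := by fun_prop
    exact (this.tendsto 0).mono_left nhdsWithin_le_nhds
  obtain ⟨t, ⟨h1, h2⟩, h3⟩ := ((ht.eventually (h.eventually.and hcon)).and
    self_mem_nhdsWithin).exists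
  exact absurd (h1.2.1 h2) (not_le.2 h3)

end IsTubeGerm

namespace HyperbolicAtlas

theorem chart_inj {c : Set M × (M → Mink)} (hc : c ∈ 𝒜.charts) : InjOn c.2 c.1 := by
  intro x hx y hy h
  exact congrArg Subtype.val ((𝒜.isEmbedding c hc).injective (a₁ := ⟨x, hx⟩) (a₂ := ⟨y, hy⟩) h)

theorem chart_continuousOn {c : Set M × (M → Mink)} (hc : c ∈ 𝒜.charts) : ContinuousOn c.2 c.1 :=
  continuousOn_iff_continuous_domRestrict.2 (𝒜.isEmbedding c hc).continuous

theorem chart_continuousAt {c : Set M × (M → Mink)} (hc : c ∈ 𝒜.charts) {x : M} (hx : x ∈ c.1) :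
    ContinuousAt c.2 x :=
  (chart_continuousOn hc).continuousAt ((𝒜.isOpen_source c hc).mem_nhds hx)

theorem chart_tendsto {c : Set M × (M → Mink)} (hc : c ∈ 𝒜.charts) {x : M} (hx : x ∈ c.1) :
    Tendsto c.2 (𝓝 x) (𝓝[hyp3] (c.2 x)) := by
  refine tendsto_nhdsWithin_iff.2 ⟨chart_continuousAt hc hx, ?_⟩
  filter_upwards [(𝒜.isOpen_source c hc).mem_nhds hx] with y hy using 𝒜.mapsTo c hc hy

/-- A chart is a homeomorphism onto its image. -/
theorem chart_map_nhds {c : Set M × (M → Mink)} (hc : c ∈ 𝒜.charts) {x : M} (hx : x ∈ c.1) :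
    map c.2 (𝓝 x) = 𝓝[c.2 '' c.1] (c.2 x) := by
  have h1 := (𝒜.isEmbedding c hc).map_nhds_eq ⟨x, hx⟩
  have h2 : map (Subtype.val : c.1 → M) (𝓝 ⟨x, hx⟩) = 𝓝 x :=
    map_nhds_subtype_coe_eq_nhds hx ((𝒜.isOpen_source c hc).mem_nhds hx)
  rw [← h2, map_map, show c.2 ∘ Subtype.val = fun y : c.1 => c.2 y from rfl, h1]
  congr 1
  ext y; simp

end HyperbolicAtlas

namespace IsTubeMap

theorem mem_boundary (H : IsTubeMap 𝒜 κ φ) (hκ : 0 < κ) (z : Plane) : φ z ∈ 𝒜.boundary := by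
  rintro ⟨c, hc, hz, hn⟩
  obtain ⟨A, hA⟩ := H.chart z c hc hz
  exact hA.notMem_nhds hκ hn

theorem exists_injOn (H : IsTubeMap 𝒜 κ φ) (hκ : 0 < κ) (z : Plane) :
    ∃ s ∈ 𝓝 z, InjOn φ s := by
  obtain ⟨c, hc, hz⟩ := 𝒜.cover (φ z)
  obtain ⟨A, hA⟩ := H.chart z c hc hz
  obtain ⟨s, hs, hinj⟩ := eventually_tube_injective hκ z 0 (by simp [stretch_zero])
    (by simp [stretch_zero])
  have ht : Tendsto (fun y : Plane => (y, (0 : ℝ))) (𝓝 z) (𝓝 (z, 0)) := by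
    have : Continuous fun y : Plane => (y, (0 : ℝ)) := by fun_prop
    exact this.tendsto z
  refine ⟨_, hA.eventually_base.and (ht hs), ?_⟩
  rintro u ⟨hu1, hu2⟩ v ⟨hv1, hv2⟩ huv
  have h1 : A (tubeBase κ u) = A (tubeBase κ v) := by rw [← hu1, ← hv1, huv]
  have h2 := hinj hu2 hv2 (by simpa [tube_zero] using A.injective h1)
  exact congrArg Prod.fst h2

/-- The boundary near a point `φ z` is the image of a neighbourhood of `z`. -/
theorem map_nhds (H : IsTubeMap 𝒜 κ φ) (hκ : 0 < κ) (z : Plane) :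
    map φ (𝓝 z) = 𝓝[𝒜.boundary] (φ z) := by
  apply le_antisymm
  · exact tendsto_nhdsWithin_iff.2 ⟨H.continuous.continuousAt,
      Eventually.of_forall (H.mem_boundary hκ)⟩
  intro s hs
  obtain ⟨c, hc, hz⟩ := 𝒜.cover (φ z)
  obtain ⟨A, hA⟩ := H.chart z c hc hz
  have h1 : ∀ᶠ p : Plane × ℝ in 𝓝 (z, 0), φ p.1 ∈ s ∧ φ p.1 ∈ c.1 := by
    have : ∀ᶠ y in 𝓝 z, φ y ∈ s ∧ φ y ∈ c.1 := (show ∀ᶠ y in 𝓝 z, φ y ∈ s from hs).and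
      (H.continuous.continuousAt.eventually ((𝒜.isOpen_source c hc).mem_nhds hz))
    exact (continuous_fst.tendsto (z, (0 : ℝ))).eventually this
  have h2 := hA.eventually.and (h1.and (eventually_eventually_nhds.2 hA.eventually))
  obtain ⟨V, hV, hVo, hzV⟩ := mem_nhds_iff.1 h2
  have h3 : (fun p : Plane × ℝ => A (tube κ p.1 p.2)) ''
      (V ∩ {p | 0 < stretch κ p.2 ∧ 0 < stretch κ⁻¹ p.2}) ∈ 𝓝[hyp3] (c.2 (φ z)) := by
    refine hA.eventually_image hκ ?_
    have hca : Continuous (stretch κ) := by unfold stretch; fun_prop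
    have hcb : Continuous (stretch κ⁻¹) := by unfold stretch; fun_prop
    have e1 : ∀ᶠ p : Plane × ℝ in 𝓝 (z, 0), 0 < stretch κ p.2 :=
      (hca.comp continuous_snd).continuousAt.eventually (lt_mem_nhds (by simp [stretch_zero]))
    have e2 : ∀ᶠ p : Plane × ℝ in 𝓝 (z, 0), 0 < stretch κ⁻¹ p.2 :=
      (hcb.comp continuous_snd).continuousAt.eventually (lt_mem_nhds (by simp [stretch_zero]))
    filter_upwards [hVo.mem_nhds hzV, e1, e2] with p hp h1 h2
    exact mem_image_of_mem _ ⟨hp, h1, h2⟩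
  have h4 := (HyperbolicAtlas.chart_tendsto hc hz).eventually h3
  rw [mem_nhdsWithin_iff_eventually]
  filter_upwards [h4, (𝒜.isOpen_source c hc).mem_nhds hz] with x hx hxc hxb
  obtain ⟨⟨y, h⟩, ⟨hpV, ha, hb⟩, hpx⟩ := hx
  obtain ⟨⟨hb1, hb2⟩, ⟨hs', hc'⟩, hev⟩ := hV hpV
  simp only at *
  have hh : 0 ≤ h := hb2.1 (hpx ▸ mem_image_of_mem _ hxc)
  rcases hh.eq_or_lt with rfl | hh
  · rw [tube_zero, ← hb1] at hpx
    rwa [← HyperbolicAtlas.chart_inj hc hc' hxc hpx]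
  · exfalso
    refine HyperbolicAtlas.image_notMem_nhdsWithin hc hxc hxb ?_
    rw [← hpx, ← hA.iso.map_nhdsWithin, ← map_tube_nhds hκ y h ha.ne' hb.ne', map_map,
      mem_map]
    have hpos : ∀ᶠ p : Plane × ℝ in 𝓝 (y, h), 0 < p.2 :=
      continuous_snd.continuousAt.eventually (lt_mem_nhds hh)
    filter_upwards [hev, hpos] with p hp hp'
    exact hp.2.2 hp'.le

end IsTubeMap

end

section

/-! ### Deck transformations -/

variable {M : Type*} [TopologicalSpace M] {𝒜 : HyperbolicAtlas M} {κ : ℝ} {φ : Plane → M}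

theorem HyperbolicAtlas.exists_transition {c c' : Set M × (M → Mink)} (hc : c ∈ 𝒜.charts)
    (hc' : c' ∈ 𝒜.charts) {x : M} (hx : x ∈ c.1) (hx' : x ∈ c'.1) :
    ∃ B : Mink ≃ₗ[ℝ] Mink, IsHypIso B ∧ 0 < LinearMap.det B.toLinearMap ∧
      ∀ᶠ y in 𝓝 x, c'.2 y = B (c.2 y) := by
  obtain ⟨A, hA, hAe⟩ := 𝒜.compatible c hc c' hc' x ⟨hx, hx'⟩
  obtain ⟨B, hB, rfl⟩ := IsHypIso.of_oriented hA
  exact ⟨B, hB, hA.det_pos, hAe⟩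

namespace IsTubeMap

theorem germ_change (H : IsTubeMap 𝒜 κ φ) (hκ : 0 < κ) {c c' : Set M × (M → Mink)}
    (hc' : c' ∈ 𝒜.charts) {z : Plane} (hz' : φ z ∈ c'.1) {A B : Mink ≃ₗ[ℝ] Mink}
    (hA : IsTubeGerm κ φ c z A) (hB : ∀ᶠ y in 𝓝 (φ z), c'.2 y = B (c.2 y)) :
    IsTubeGerm κ φ c' z (A.trans B) := by
  obtain ⟨A', hA'⟩ := H.chart z c' hc' hz'
  have : A' = A.trans B := by
    refine linearEquiv_eq_of_tubeBase hκ (z := z) ?_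
    filter_upwards [hA.eventually_base, hA'.eventually_base,
      H.continuous.continuousAt.eventually hB] with y h1 h2 h3
    rw [← h2, h3, h1]; rfl
  rwa [← this]

theorem det_pos_iff (H : IsTubeMap 𝒜 κ φ) (hκ : 0 < κ) {c c' : Set M × (M → Mink)}
    (hc : c ∈ 𝒜.charts) (hc' : c' ∈ 𝒜.charts) {z z' : Plane} (hz : φ z ∈ c.1) (hz' : φ z' ∈ c'.1)
    {A A' : Mink ≃ₗ[ℝ] Mink} (hA : IsTubeGerm κ φ c z A) (hA' : IsTubeGerm κ φ c' z' A') :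
    0 < LinearMap.det A.toLinearMap ↔ 0 < LinearMap.det A'.toLinearMap := by
  let P : Plane → Prop := fun z => ∀ c ∈ 𝒜.charts, φ z ∈ c.1 → ∀ A, IsTubeGerm κ φ c z A →
    0 < LinearMap.det A.toLinearMap
  have hP : ∀ z, ∀ c ∈ 𝒜.charts, φ z ∈ c.1 → ∀ A, IsTubeGerm κ φ c z A →
      (P z ↔ 0 < LinearMap.det A.toLinearMap) := by
    intro z c hc hz A hA
    refine ⟨fun h => h c hc hz A hA, fun h c' hc' hz' A' hA' => ?_⟩
    obtain ⟨B, hB, hBd, hBe⟩ := HyperbolicAtlas.exists_transition hc hc' hz hz'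
    rw [hA'.unique hκ (H.germ_change hκ hc' hz' hA hBe), LinearEquiv.coe_trans,
      LinearMap.det_comp]
    exact mul_pos hBd h
  have hloc : IsLocallyConstant P := by
    rw [IsLocallyConstant.iff_eventually_eq]
    intro z
    obtain ⟨c, hc, hz⟩ := 𝒜.cover (φ z)
    obtain ⟨A, hA⟩ := H.chart z c hc hz
    filter_upwards [hA.eventually_germ,
      H.continuous.continuousAt.eventually ((𝒜.isOpen_source c hc).mem_nhds hz)] with y hy hy'
    rw [hP z c hc hz A hA, hP y c hc hy' A hy]
  rw [← hP z c hc hz A hA, ← hP z' c' hc' hz' A' hA', hloc.apply_eq_of_preconnectedSpace z z']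

/-- Unique continuation for symmetries of the covering of a boundary torus. -/
theorem comp_eq [T2Space M] (H : IsTubeMap 𝒜 κ φ) (hκ : 0 < κ) {σ : Plane → Plane}
    (hσ : Continuous σ) {Q : Mink ≃ₗ[ℝ] Mink} (hQ : ∀ y, tubeBase κ (σ y) = Q (tubeBase κ y))
    {z₀ : Plane} (h : ∀ᶠ y in 𝓝 z₀, φ (σ y) = φ y) (y : Plane) : φ (σ y) = φ y := by
  have hcl : IsClopen {z | ∀ᶠ y in 𝓝 z, φ (σ y) = φ y} := by
    refine ⟨?_, isOpen_iff_mem_nhds.2 fun z hz => eventually_eventually_nhds.2 hz⟩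
    refine isClosed_of_closure_subset fun z hz => ?_
    have hcont : Continuous fun y => φ (σ y) := H.continuous.comp hσ
    have hz0 : φ (σ z) = φ z := by
      have hc : IsClosed {y | φ (σ y) = φ y} := isClosed_eq hcont H.continuous
      exact hc.closure_subset_iff.2 (fun y hy => Eventually.self_of_nhds hy) hz
    obtain ⟨c, hc, hzc⟩ := 𝒜.cover (φ z)
    obtain ⟨A0, hA0⟩ := H.chart z c hc hzc
    obtain ⟨A1, hA1⟩ := H.chart (σ z) c hc (by rwa [hz0])
    have e1 := hσ.continuousAt.eventually hA1.eventually_base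
    have e0 := hA0.eventually_base
    have s0 := H.continuous.continuousAt.eventually ((𝒜.isOpen_source c hc).mem_nhds hzc)
    have s1 := hcont.continuousAt.eventually
      ((𝒜.isOpen_source c hc).mem_nhds (show φ (σ z) ∈ c.1 by rwa [hz0]))
    have hall := e0.and (e1.and (s0.and s1))
    obtain ⟨z', h1, h2⟩ := mem_closure_iff_nhds.1 hz _ (eventually_eventually_nhds.2 hall)
    have hAQ : Q.trans A1 = A0 := by
      refine linearEquiv_eq_of_tubeBase hκ (z := z') ?_
      filter_upwards [h1, h2] with y hy1 hy2
      rw [LinearEquiv.trans_apply, ← hQ, ← hy1.1, ← hy1.2.1, hy2]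
    filter_upwards [hall] with y hy
    refine HyperbolicAtlas.chart_inj hc hy.2.2.2 hy.2.2.1 ?_
    rw [hy.1, hy.2.1, hQ, ← hAQ]; rfl
  have huniv := hcl.eq_univ ⟨z₀, h⟩
  have hy : y ∈ {z | ∀ᶠ y in 𝓝 z, φ (σ y) = φ y} := by rw [huniv]; trivial
  exact Eventually.self_of_nhds (p := fun y => φ (σ y) = φ y) hy

theorem rot_linear (a b : ℝ) (u v : Plane) : rot a b (u + v) = rot a b u + rot a b v := by
  ext i; fin_cases i <;> simp [rot] <;> ring

/-- Points of the plane with the same image differ by a translational symmetry: a symmetry with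
a rotational part would have a fixed point, contradicting local injectivity. -/
theorem deck [T2Space M] (H : IsTubeMap 𝒜 κ φ) (hκ : 0 < κ) {z₀ z₁ : Plane} (h01 : φ z₀ = φ z₁)
    (z : Plane) : φ (z + (z₁ - z₀)) = φ z := by
  obtain ⟨c, hc, hz0⟩ := 𝒜.cover (φ z₀)
  have hz1 : φ z₁ ∈ c.1 := h01 ▸ hz0
  obtain ⟨A0, hA0⟩ := H.chart z₀ c hc hz0
  obtain ⟨A1, hA1⟩ := H.chart z₁ c hc hz1
  obtain ⟨G, hGdef⟩ : ∃ G, G = ((tubeTrans κ z₀).trans A0).trans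
    (A1.symm.trans (tubeTrans κ z₁).symm) := ⟨_, rfl⟩
  have hG : IsHypIso G := hGdef ▸ ((isHypIso_tubeTrans κ z₀).trans hA0.iso).trans
    (hA1.iso.symm.trans (isHypIso_tubeTrans κ z₁).symm)
  have hGb : ∀ u, G (tubeBase κ u) = (tubeTrans κ z₁).symm (A1.symm (A0 (tubeBase κ (z₀ + u)))) := by
    intro u; rw [hGdef]; simp [tubeTrans_tubeBase hκ]
  have hGeq : ∀ u w, G (tubeBase κ u) = tubeBase κ w ↔
      A0 (tubeBase κ (z₀ + u)) = A1 (tubeBase κ (z₁ + w)) := by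
    intro u w
    rw [hGb, LinearEquiv.symm_apply_eq, tubeTrans_tubeBase hκ, LinearEquiv.symm_apply_eq]
  have hdet : 0 < LinearMap.det G.toLinearMap := by
    have h1 := det_tubeTrans_pos hκ z₀
    have h2 := det_tubeTrans_pos hκ z₁
    have h3 := H.det_pos_iff hκ hc hc hz0 hz1 hA0 hA1
    have i1 := LinearEquiv.det_mul_det_symm A1
    have i2 := LinearEquiv.det_mul_det_symm (tubeTrans κ z₁)
    have i2' : 0 < LinearMap.det ((tubeTrans κ z₁).symm : Mink →ₗ[ℝ] Mink) := by
      by_contra hcon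
      push Not at hcon
      nlinarith
    have hne0 : LinearMap.det A0.toLinearMap ≠ 0 := (LinearEquiv.isUnit_det' _).ne_zero
    have hne1 : LinearMap.det A1.toLinearMap ≠ 0 := (LinearEquiv.isUnit_det' _).ne_zero
    have h4 : 0 < LinearMap.det A0.toLinearMap * LinearMap.det (A1.symm : Mink →ₗ[ℝ] Mink) := by
      rcases lt_or_gt_of_ne hne1 with h | h
      · have h5 : LinearMap.det A0.toLinearMap < 0 :=
          lt_of_le_of_ne (not_lt.1 fun h' => absurd (h3.1 h') (not_lt.2 h.le)) hne0
        exact mul_pos_of_neg_of_neg h5 (by by_contra hcon; push Not at hcon; nlinarith)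
      · exact mul_pos (h3.2 h) (by by_contra hcon; push Not at hcon; nlinarith)
    rw [hGdef]
    simp only [LinearEquiv.coe_trans, LinearMap.det_comp]
    have := mul_pos (mul_pos i2' h4) h1
    linarith
  have hsh : ∀ w : Plane, Tendsto (fun u : Plane => w + u) (𝓝 0) (𝓝 w) := by
    intro w
    have : Continuous fun u : Plane => w + u := by fun_prop
    simpa using this.tendsto 0
  have hloc : ∀ᶠ u in 𝓝 (0 : Plane), ∃ w, G (tubeBase κ u) = tubeBase κ w := by
    have h1 : φ '' {y | c.2 (φ y) = A1 (tubeBase κ y)} ∈ 𝓝[𝒜.boundary] (φ z₀) := by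
      rw [h01, ← H.map_nhds hκ]; exact image_mem_map hA1.eventually_base
    rw [← H.map_nhds hκ] at h1
    filter_upwards [(hsh z₀).eventually h1, (hsh z₀).eventually hA0.eventually_base] with u hu hu'
    obtain ⟨y, hy, hyu⟩ := hu
    refine ⟨y - z₁, ?_⟩
    rw [hGeq, add_sub_cancel, ← hu', ← hyu]
    exact hy
  have h0 : G (tubeBase κ 0) = tubeBase κ 0 := by
    rw [hGeq, add_zero, add_zero, ← hA0.apply, ← hA1.apply, h01]
  obtain ⟨a, b, hab, hrot⟩ := exists_rot_of_tubeBase hκ hG hdet h0 hloc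
  obtain ⟨σ, hσ⟩ : ∃ σ : Plane → Plane, σ = fun y => z₁ + rot a b (y - z₀) := ⟨_, rfl⟩
  have hσc : Continuous σ := by
    rw [hσ]; exact continuous_const.add ((continuous_rot a b).comp (by fun_prop))
  have hAσ : ∀ y, A1 (tubeBase κ (σ y)) = A0 (tubeBase κ y) := by
    intro y
    have := (hGeq (y - z₀) (rot a b (y - z₀))).1 (hrot _)
    rw [add_sub_cancel] at this
    rw [this, hσ]
  have hr0 : rot a b 0 = 0 := by ext i; fin_cases i <;> simp [rot]
  have hσz : σ z₀ = z₁ := by rw [hσ]; simp [hr0]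
  have hglob : ∀ y, φ (σ y) = φ y := by
    refine H.comp_eq hκ hσc (Q := A0.trans A1.symm) (z₀ := z₀) ?_ ?_
    · intro y
      rw [LinearEquiv.trans_apply, ← hAσ, LinearEquiv.symm_apply_apply]
    · have hσt : Tendsto σ (𝓝 z₀) (𝓝 z₁) := by
        have := hσc.tendsto z₀; rwa [hσz] at this
      have hφσ : Tendsto (fun y => φ (σ y)) (𝓝 z₀) (𝓝 (φ z₁)) := (H.continuous.tendsto z₁).comp hσt
      filter_upwards [hσt.eventually hA1.eventually_base, hA0.eventually_base,
        hφσ.eventually ((𝒜.isOpen_source c hc).mem_nhds hz1),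
        H.continuous.continuousAt.eventually ((𝒜.isOpen_source c hc).mem_nhds hz0)]
        with y h1 h2 h3 h4
      refine HyperbolicAtlas.chart_inj hc h3 h4 ?_
      rw [h1, h2, hAσ]
  have hab1 : (1 - a) ^ 2 + b ^ 2 = 0 := by
    by_contra hD
    -- the fixed point of the symmetry
    obtain ⟨v, hv⟩ : ∃ v : Plane, (z₁ - z₀) + rot a b v = v := by
      refine ⟨!₂[((1 - a) * (z₁ - z₀) 0 - b * (z₁ - z₀) 1) / ((1 - a) ^ 2 + b ^ 2),
        (b * (z₁ - z₀) 0 + (1 - a) * (z₁ - z₀) 1) / ((1 - a) ^ 2 + b ^ 2)], ?_⟩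
      ext i
      fin_cases i <;> simp [rot] <;> field_simp <;> ring
    obtain ⟨s, hs, hinj⟩ := H.exists_injOn hκ (z₀ + v)
    have hσv : ∀ u, σ (z₀ + v + u) = z₀ + v + rot a b u := by
      intro u
      rw [hσ]
      simp only
      rw [show z₀ + v + u - z₀ = v + u by abel, rot_linear]
      nth_rewrite 2 [← hv]
      abel
    have hrt : Tendsto (fun u => z₀ + v + rot a b u) (𝓝 0) (𝓝 (z₀ + v)) := by
      have : Continuous fun u => z₀ + v + rot a b u := continuous_const.add (continuous_rot a b)
      simpa [hr0] using this.tendsto 0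
    have hfix : ∀ᶠ u in 𝓝 (0 : Plane), rot a b u = u := by
      filter_upwards [(hsh (z₀ + v)).eventually hs, hrt.eventually hs] with u h1 h2
      have := hinj h2 h1 (by rw [← hσv, hglob])
      exact add_left_cancel this
    have hline : Tendsto (fun t : ℝ => t • (EuclideanSpace.single 0 1 : Plane)) (𝓝[≠] 0) (𝓝 0) := by
      have : Continuous (fun t : ℝ => t • (EuclideanSpace.single 0 1 : Plane)) := by fun_prop
      have h := this.tendsto 0
      rw [zero_smul] at h
      exact h.mono_left nhdsWithin_le_nhds
    obtain ⟨t, ht, ht0⟩ := ((hline.eventually hfix).and self_mem_nhdsWithin).exists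
    have t0 := congrArg (fun p : Plane => p 0) ht
    have t1 := congrArg (fun p : Plane => p 1) ht
    simp [rot] at t0 t1
    have ht0' : t ≠ 0 := ht0
    have ha1 : a = 1 := mul_right_cancel₀ ht0' (by linarith)
    have hb0 : b = 0 := by
      rcases t1 with h | h
      · exact h
      · exact absurd h ht0'
    apply hD; rw [ha1, hb0]; ring
  have h1 := sq_nonneg (1 - a)
  have h2 := sq_nonneg b
  have ha : 1 - a = 0 := pow_eq_zero_iff (two_ne_zero) |>.1 (by linarith)
  have hb : b = 0 := pow_eq_zero_iff (two_ne_zero) |>.1 (show b ^ 2 = 0 by linarith)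
  have ha' : a = 1 := by linarith
  have hσ2 : σ z = z + (z₁ - z₀) := by
    rw [hσ, ha', hb]
    ext i; fin_cases i <;> simp [rot] <;> ring
  rw [← hσ2, hglob]

end IsTubeMap

end

section

/-! ### Developing maps -/

/-- A hyperbolic structure without boundary and without orientation on a space `Y`: charts are
local homeomorphisms to `ℍ³`, and they differ locally by isometries. -/
structure OpenAtlas (Y : Type*) [TopologicalSpace Y] where
  charts : Set (Set Y × (Y → Mink))
  isOpen_source : ∀ c ∈ charts, IsOpen c.1
  cover : ∀ y : Y, ∃ c ∈ charts, y ∈ c.1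
  mapsTo : ∀ c ∈ charts, MapsTo c.2 c.1 hyp3
  injOn : ∀ c ∈ charts, InjOn c.2 c.1
  map_nhds : ∀ c ∈ charts, ∀ y ∈ c.1, map c.2 (𝓝 y) = 𝓝[hyp3] (c.2 y)
  compatible : ∀ c ∈ charts, ∀ c' ∈ charts, ∀ y ∈ c.1, y ∈ c'.1 →
    ∃ B : Mink ≃ₗ[ℝ] Mink, IsHypIso B ∧ ∀ᶠ x in 𝓝 y, c'.2 x = B (c.2 x)

theorem preconnected_iff_of_eventually {X : Type*} [TopologicalSpace X] {S : Set X}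
    (hS : IsPreconnected S) {P : X → Prop} (h : ∀ x ∈ S, ∀ᶠ y in 𝓝[S] x, (P y ↔ P x)) {x y : X}
    (hx : x ∈ S) (hy : y ∈ S) : P x ↔ P y := by
  have : PreconnectedSpace S := Subtype.preconnectedSpace hS
  have hloc : IsLocallyConstant (fun s : S => P s) := by
    rw [IsLocallyConstant.iff_eventually_eq]
    intro s
    have := h s s.2
    rw [nhdsWithin_eq_map_subtype_coe s.2, eventually_map] at this
    filter_upwards [this] with t ht using propext ht
  exact iff_of_eq (hloc.apply_eq_of_preconnectedSpace ⟨x, hx⟩ ⟨y, hy⟩)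

variable {Y : Type*} [TopologicalSpace Y] (𝒪 : OpenAtlas Y)
variable {X : Type*} [TopologicalSpace X]

/-- In charts, the map `E` agrees on `W` near `w` with `F` up to an isometry of `ℍ³`. -/
structure IsDevAt (E : X → Y) (F : X → Mink) (W : Set X) (w : X) : Prop where
  continuousWithinAt : ContinuousWithinAt E W w
  chart : ∀ c ∈ 𝒪.charts, E w ∈ c.1 → ∃ A : Mink ≃ₗ[ℝ] Mink, IsHypIso A ∧
    ∀ᶠ w' in 𝓝[W] w, c.2 (E w') = A (F w')

variable {𝒪}

theorem OpenAtlas.tendsto_of_chart {c : Set Y × (Y → Mink)} (hc : c ∈ 𝒪.charts) {y : Y}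
    (hy : y ∈ c.1) {l : Filter X} {E : X → Y} (h1 : ∀ᶠ x in l, E x ∈ c.1)
    (h2 : Tendsto (fun x => c.2 (E x)) l (𝓝[hyp3] (c.2 y))) : Tendsto E l (𝓝 y) := by
  rw [← 𝒪.map_nhds c hc y hy] at h2
  intro s hs
  have h3 : c.2 '' (s ∩ c.1) ∈ map c.2 (𝓝 y) :=
    image_mem_map (inter_mem hs ((𝒪.isOpen_source c hc).mem_nhds hy))
  rw [mem_map]
  filter_upwards [h1, h2.eventually h3] with x hx1 hx2
  obtain ⟨x', hx', hxx⟩ := hx2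
  rw [mem_preimage, ← 𝒪.injOn c hc hx'.2 hx1 hxx]
  exact hx'.1

theorem isDevAt_of_chart {E : X → Y} {F : X → Mink} {W : Set X} {w : X}
    {c : Set Y × (Y → Mink)} (hc : c ∈ 𝒪.charts) (hE : ContinuousWithinAt E W w)
    (hw : E w ∈ c.1) {A : Mink ≃ₗ[ℝ] Mink} (hA : IsHypIso A)
    (h : ∀ᶠ w' in 𝓝[W] w, c.2 (E w') = A (F w')) : IsDevAt 𝒪 E F W w := by
  refine ⟨hE, fun c' hc' hw' => ?_⟩
  obtain ⟨B, hB, hBe⟩ := 𝒪.compatible c hc c' hc' _ hw hw'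
  refine ⟨A.trans B, hA.trans hB, ?_⟩
  filter_upwards [h, hE.eventually hBe] with x h1 h2
  rw [h2, h1]; rfl

namespace IsDevAt

variable {E E' : X → Y} {F F' : X → Mink} {W : Set X} {w : X}

theorem congr (h : IsDevAt 𝒪 E F W w) (hw : w ∈ W) (hE : ∀ᶠ x in 𝓝[W] w, E' x = E x) :
    IsDevAt 𝒪 E' F W w := by
  have h0 : E' w = E w := hE.self_of_nhdsWithin hw
  refine ⟨h.continuousWithinAt.congr_of_eventuallyEq hE h0, fun c hc hc' => ?_⟩
  obtain ⟨A, hA, hAe⟩ := h.chart c hc (h0 ▸ hc')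
  refine ⟨A, hA, ?_⟩
  filter_upwards [hE, hAe] with x h1 h2
  rw [h1, h2]

theorem of_iso (h : IsDevAt 𝒪 E F W w) {B : Mink ≃ₗ[ℝ] Mink} (hB : IsHypIso B)
    (hF : ∀ᶠ x in 𝓝[W] w, F x = B (F' x)) : IsDevAt 𝒪 E F' W w := by
  refine ⟨h.continuousWithinAt, fun c hc hc' => ?_⟩
  obtain ⟨A, hA, hAe⟩ := h.chart c hc hc'
  refine ⟨B.trans A, hB.trans hA, ?_⟩
  filter_upwards [hF, hAe] with x h1 h2
  rw [h2, h1]; rfl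

theorem comp {X' : Type*} [TopologicalSpace X'] {g : X' → X} {W' : Set X'} {w' : X'}
    (h : IsDevAt 𝒪 E F W (g w')) (hg : Tendsto g (𝓝[W'] w') (𝓝[W] (g w'))) :
    IsDevAt 𝒪 (fun x => E (g x)) (fun x => F (g x)) W' w' := by
  refine ⟨h.continuousWithinAt.tendsto.comp hg, fun c hc hc' => ?_⟩
  obtain ⟨A, hA, hAe⟩ := h.chart c hc hc'
  exact ⟨A, hA, hg.eventually hAe⟩

theorem eventually_eq (h : IsDevAt 𝒪 E F W w) (h' : IsDevAt 𝒪 E' F' W w) {c : Set Y × (Y → Mink)}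
    (hc : c ∈ 𝒪.charts) (hw : E w ∈ c.1) (h0 : E w = E' w)
    (hE : ∀ᶠ x in 𝓝[W] w, c.2 (E x) = c.2 (E' x)) : ∀ᶠ x in 𝓝[W] w, E x = E' x := by
  have ho := (𝒪.isOpen_source c hc)
  filter_upwards [hE, h.continuousWithinAt.eventually (ho.mem_nhds hw),
    h'.continuousWithinAt.eventually (ho.mem_nhds (h0 ▸ hw))] with x h1 h2 h3
  exact 𝒪.injOn c hc h2 h3 h1

end IsDevAt

/-- The map `F` is a submersion to `ℍ³` near `w`, in the weak sense that it is open at `w`. -/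
def IsOpenAt (F : X → Mink) (W : Set X) (w : X) : Prop :=
  F w ∈ hyp3 ∧ 𝓝[hyp3] (F w) ≤ map F (𝓝[W] w)

theorem IsOpenAt.eq {F : X → Mink} {W : Set X} {w : X} (h : IsOpenAt F W w)
    {A B : Mink ≃ₗ[ℝ] Mink} (hAB : ∀ᶠ x in 𝓝[W] w, A (F x) = B (F x)) : A = B :=
  linearEquiv_eq_of_eventuallyEq h.1 (h.2 hAB)

/-- Unique continuation of developing maps along connected sets. -/
theorem dev_unique [T2Space Y] {E E' : X → Y} {F : X → Mink} {W S : Set X} (hSW : S ⊆ W)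
    (hS : IsPreconnected S) (hE : ∀ w ∈ S, IsDevAt 𝒪 E F W w)
    (hE' : ∀ w ∈ S, IsDevAt 𝒪 E' F W w) (hF : ∀ w ∈ S, IsOpenAt F W w) {w₀ w : X} (hw₀ : w₀ ∈ S)
    (hw : w ∈ S) (h : ∀ᶠ x in 𝓝[W] w₀, E x = E' x) : ∀ᶠ x in 𝓝[W] w, E x = E' x := by
  refine (preconnected_iff_of_eventually hS (P := fun w => ∀ᶠ x in 𝓝[W] w, E x = E' x) ?_ hw₀ hw).1 h
  intro x hx
  have hmono : 𝓝[S] x ≤ 𝓝[W] x := nhdsWithin_mono x hSW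
  by_cases hxx : E x = E' x
  · obtain ⟨c, hc, hxc⟩ := 𝒪.cover (E x)
    obtain ⟨A, hA, hAe⟩ := (hE x hx).chart c hc hxc
    obtain ⟨A', hA', hAe'⟩ := (hE' x hx).chart c hc (hxx ▸ hxc)
    have h1 := eventually_eventually_nhdsWithin.2 (hAe.and hAe')
    by_cases hAA : A = A'
    · have h2 : ∀ᶠ y in 𝓝[W] x, E y = E' y := by
        refine (hE x hx).eventually_eq (hE' x hx) hc hxc hxx ?_
        filter_upwards [hAe, hAe'] with y h1 h2
        rw [h1, h2, hAA]
      filter_upwards [hmono (eventually_eventually_nhdsWithin.2 h2)] with y hy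
      exact ⟨fun _ => h2, fun _ => hy⟩
    · have hn : ∀ y ∈ S, (∀ᶠ x' in 𝓝[W] y, c.2 (E x') = A (F x') ∧ c.2 (E' x') = A' (F x')) →
          ¬ ∀ᶠ x' in 𝓝[W] y, E x' = E' x' := by
        intro y hy h1 h2
        refine hAA ((hF y hy).eq ?_)
        filter_upwards [h1, h2] with u hu hu'
        rw [← hu.1, ← hu.2, hu']
      filter_upwards [hmono h1, self_mem_nhdsWithin] with y hy hyS
      exact ⟨fun h => absurd h (hn y hyS hy), fun h => absurd h (hn x hx (hAe.and hAe'))⟩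
  · have h1 : ∀ᶠ y in 𝓝[W] x, E y ≠ E' y := by
      obtain ⟨u, v, hu, hv, huv⟩ := t2_separation_nhds hxx
      filter_upwards [(hE x hx).continuousWithinAt hu, (hE' x hx).continuousWithinAt hv]
        with y h1 h2 h3
      exact Set.disjoint_left.1 huv h1 (h3 ▸ h2)
    filter_upwards [hmono h1, self_mem_nhdsWithin] with y hy hyS
    exact ⟨fun h => absurd (h.self_of_nhdsWithin (hSW hyS)) hy,
      fun h => absurd (h.self_of_nhdsWithin (hSW hx)) hxx⟩

theorem isOpenAt_id {w : Mink} (hw : w ∈ hyp3) : IsOpenAt id hyp3 w := ⟨hw, by simp⟩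

theorem isPreconnected_hball_inter {p q : Mink} (hp : p ∈ hyp3) (hq : q ∈ hyp3) (r s : ℝ) :
    IsPreconnected (hball p r ∩ hball q s) := by
  refine isPreconnected_of_forall_pair fun x hx y hy => ?_
  refine ⟨hseg x y '' Icc 0 1, ?_, ⟨0, ⟨le_rfl, zero_le_one⟩, hseg_zero hx.1.1 y⟩,
    ⟨1, ⟨zero_le_one, le_rfl⟩, hseg_one x hy.1.1⟩, isPreconnected_hseg hx.1.1 hy.1.1⟩
  rintro _ ⟨t, ht, rfl⟩
  exact ⟨hseg_mem_hball hp hx.1 hy.1 ht, hseg_mem_hball hq hx.2 hy.2 ht⟩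

variable (𝒪) in
/-- The map `e` is a developing map, in the coordinates of `ℍ³` itself, on `B ⊆ ℍ³`. -/
def IsDevOn (e : Mink → Y) (B : Set Mink) : Prop := ∀ w ∈ B, IsDevAt 𝒪 e id hyp3 w

theorem IsDevOn.mono {e : Mink → Y} {B B' : Set Mink} (h : IsDevOn 𝒪 e B) (hB : B' ⊆ B) :
    IsDevOn 𝒪 e B' := fun w hw => h w (hB hw)

theorem IsDevOn.unique [T2Space Y] {e e' : Mink → Y} {B S : Set Mink} (hS : IsPreconnected S)
    (hS3 : S ⊆ hyp3) (he : IsDevOn 𝒪 e S) (he' : IsDevOn 𝒪 e' S) {w₀ w : Mink} (hw₀ : w₀ ∈ S)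
    (hw : w ∈ S) (h : ∀ᶠ x in 𝓝[hyp3] w₀, e x = e' x) : ∀ᶠ x in 𝓝[hyp3] w, e x = e' x :=
  dev_unique hS3 hS he he' (fun w hw => isOpenAt_id (hS3 hw)) hw₀ hw h

/-- The inverse of a chart is a developing map; by compactness, it exists on balls of uniform
size. -/
theorem OpenAtlas.exists_uniform_inverse {K : Set Y} (hK : IsCompact K) : ∃ ε > 0, ∀ y ∈ K,
    ∀ c ∈ 𝒪.charts, y ∈ c.1 → ∃ e : Mink → Y, IsDevOn 𝒪 e (hball (c.2 y) ε) ∧ e (c.2 y) = y ∧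
      ∀ᶠ w in 𝓝[hyp3] (c.2 y), c.2 (e w) = w := by
  let P : Set Y → Prop := fun K => ∃ ε > 0, ∀ y ∈ K,
    ∀ c ∈ 𝒪.charts, y ∈ c.1 → ∃ e : Mink → Y, IsDevOn 𝒪 e (hball (c.2 y) ε) ∧ e (c.2 y) = y ∧
      ∀ᶠ w in 𝓝[hyp3] (c.2 y), c.2 (e w) = w
  refine hK.induction_on (p := P) ?_ ?_ ?_ ?_
  · exact ⟨1, one_pos, by simp⟩
  · rintro s t hst ⟨ε, hε, h⟩
    exact ⟨ε, hε, fun y hy => h y (hst hy)⟩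
  · rintro s t ⟨ε, hε, h⟩ ⟨ε', hε', h'⟩
    refine ⟨min ε ε', lt_min hε hε', fun y hy c hc hyc => ?_⟩
    have hm : 0 ≤ min ε ε' := (lt_min hε hε').le
    rcases hy with hy | hy
    · obtain ⟨e, h1, h2⟩ := h y hy c hc hyc
      exact ⟨e, h1.mono (hball_mono _ hm (min_le_left _ _)), h2⟩
    · obtain ⟨e, h1, h2⟩ := h' y hy c hc hyc
      exact ⟨e, h1.mono (hball_mono _ hm (min_le_right _ _)), h2⟩
  · intro y₁ _
    obtain ⟨c₁, hc₁, hy₁⟩ := 𝒪.cover y₁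
    have hp₁ := 𝒪.mapsTo c₁ hc₁ hy₁
    have himg : c₁.2 '' c₁.1 ∈ 𝓝[hyp3] (c₁.2 y₁) := by
      rw [← 𝒪.map_nhds c₁ hc₁ y₁ hy₁]
      exact image_mem_map ((𝒪.isOpen_source c₁ hc₁).mem_nhds hy₁)
    obtain ⟨ε, hε, hsubset⟩ := exists_hball_subset hp₁ himg
    have : Nonempty Y := ⟨y₁⟩
    obtain ⟨e₁, he₁⟩ : ∃ e, e = Function.invFunOn c₁.2 c₁.1 := ⟨_, rfl⟩
    have hinv : ∀ w ∈ hball (c₁.2 y₁) ε, e₁ w ∈ c₁.1 ∧ c₁.2 (e₁ w) = w := by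
      intro w hw
      rw [he₁]
      exact ⟨Function.invFunOn_mem (hsubset hw), Function.invFunOn_eq (hsubset hw)⟩
    have hdev : IsDevOn 𝒪 e₁ (hball (c₁.2 y₁) ε) := by
      intro w hw
      have hev : ∀ᶠ x in 𝓝[hyp3] w, e₁ x ∈ c₁.1 ∧ c₁.2 (e₁ x) = x := by
        filter_upwards [hball_mem_nhdsWithin hw] with x hx using hinv x hx
      refine isDevAt_of_chart hc₁ (A := LinearEquiv.refl ℝ Mink) ?_ (hinv w hw).1 IsHypIso.refl ?_
      · refine OpenAtlas.tendsto_of_chart hc₁ (hinv w hw).1 (hev.mono fun _ h => h.1) ?_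
        rw [(hinv w hw).2]
        exact tendsto_id.congr' (hev.mono fun x hx => hx.2.symm)
      · exact hev.mono fun x hx => hx.2
    have hV : ∀ᶠ y in 𝓝 y₁, y ∈ c₁.1 ∧ c₁.2 y ∈ hball (c₁.2 y₁) (ε / 2) := by
      refine (show ∀ᶠ y in 𝓝 y₁, y ∈ c₁.1 from (𝒪.isOpen_source c₁ hc₁).mem_nhds hy₁).and ?_
      have : hball (c₁.2 y₁) (ε / 2) ∈ map c₁.2 (𝓝 y₁) := by
        rw [𝒪.map_nhds c₁ hc₁ y₁ hy₁]
        exact hball_mem_nhdsWithin (mem_hball_self hp₁ (half_pos hε))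
      exact this
    refine ⟨_, nhdsWithin_le_nhds hV, ε / 2, half_pos hε, ?_⟩
    rintro y ⟨hy, hyb⟩ c hc hyc
    obtain ⟨B, hB, hBe⟩ := 𝒪.compatible c hc c₁ hc₁ y hyc hy
    have hBy : c₁.2 y = B (c.2 y) := hBe.self_of_nhds
    have hsub : ∀ w ∈ hball (c.2 y) (ε / 2), B w ∈ hball (c₁.2 y₁) ε := by
      intro w hw
      have h1 : B w ∈ hball (c₁.2 y) (ε / 2) := by rw [hBy]; exact hB.mem_hball_iff.2 hw
      have := hball_triangle hp₁ (half_pos hε).le (half_pos hε).le hyb h1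
      rwa [add_halves] at this
    have hy' : e₁ (c₁.2 y) = y := by
      have h1 := hinv (c₁.2 y) (hball_mono _ (half_pos hε).le (by linarith) hyb)
      exact 𝒪.injOn c₁ hc₁ h1.1 hy h1.2
    have hcy : c.2 y ∈ hball (c.2 y) (ε / 2) := mem_hball_self (𝒪.mapsTo c hc hyc) (half_pos hε)
    have hdev' : IsDevOn 𝒪 (fun w => e₁ (B w)) (hball (c.2 y) (ε / 2)) := by
      intro w hw
      have h1 := (hdev _ (hsub w hw)).comp (g := B) (W' := hyp3) (w' := w) (hB.tendsto w)
      exact h1.of_iso hB (Eventually.of_forall fun _ => rfl)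
    refine ⟨fun w => e₁ (B w), hdev', by simp only [← hBy, hy'], ?_⟩
    have hcont := (hdev' _ hcy).continuousWithinAt
    have h3 : e₁ (B (c.2 y)) = y := by rw [← hBy, hy']
    have h2 : Tendsto (fun w => e₁ (B w)) (𝓝[hyp3] (c.2 y)) (𝓝 y) := by
      have := hcont.tendsto
      simp only [h3] at this
      exact this
    filter_upwards [h2.eventually hBe, hball_mem_nhdsWithin hcy] with w h4 h5
    refine B.injective ?_
    rw [← h4, (hinv _ (hsub w h5)).2]

/-- A developing map can be continued from any point of a compact set over a ball of uniform
size. -/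
theorem IsDevAt.exists_continuation {ε : ℝ} {K : Set Y} (hK : ∀ y ∈ K,
    ∀ c ∈ 𝒪.charts, y ∈ c.1 → ∃ e : Mink → Y, IsDevOn 𝒪 e (hball (c.2 y) ε) ∧ e (c.2 y) = y ∧
      ∀ᶠ w in 𝓝[hyp3] (c.2 y), c.2 (e w) = w) (hε : 0 < ε) {E : X → Y} {F : X → Mink} {W : Set X}
    {w : X} (h : IsDevAt 𝒪 E F W w) (hw : w ∈ W) (hF : Tendsto F (𝓝[W] w) (𝓝[hyp3] (F w)))
    (hF3 : F w ∈ hyp3)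
    (hEw : E w ∈ K) : ∃ f : Mink → Y, IsDevOn 𝒪 f (hball (F w) ε) ∧
      ∀ᶠ x in 𝓝[W] w, f (F x) = E x := by
  obtain ⟨c, hc, hwc⟩ := 𝒪.cover (E w)
  obtain ⟨A, hA, hAe⟩ := h.chart c hc hwc
  have hA0 : c.2 (E w) = A (F w) := hAe.self_of_nhdsWithin hw
  obtain ⟨e, he1, he2, he3⟩ := hK (E w) hEw c hc hwc
  rw [hA0] at he1 he2 he3
  have hdev : IsDevOn 𝒪 (fun x => e (A x)) (hball (F w) ε) := by
    intro x hx
    have h1 := (he1 _ (hA.mem_hball_iff.2 hx)).comp (g := A) (W' := hyp3) (w' := x) (hA.tendsto x)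
    exact h1.of_iso hA (Eventually.of_forall fun _ => rfl)
  refine ⟨_, hdev, ?_⟩
  have h1 : IsDevAt 𝒪 (fun x => e (A (F x))) F W w :=
    (hdev _ (mem_hball_self hF3 hε)).comp hF
  refine h1.eventually_eq h hc (by rw [he2]; exact hwc) he2 ?_
  have ht := (hA.tendsto _).comp hF
  filter_upwards [hAe, ht.eventually he3] with x h2 h3
  exact h3.trans h2.symm

/-- A developing map on a ball whose image stays in a compact set extends to a larger ball. -/
theorem IsDevOn.exists_extension [T2Space Y] {ε : ℝ} {K : Set Y} (hK : ∀ y ∈ K,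
    ∀ c ∈ 𝒪.charts, y ∈ c.1 → ∃ e : Mink → Y, IsDevOn 𝒪 e (hball (c.2 y) ε) ∧ e (c.2 y) = y ∧
      ∀ᶠ w in 𝓝[hyp3] (c.2 y), c.2 (e w) = w) (hε : 0 < ε) {p : Mink} (hp : p ∈ hyp3) {s η : ℝ}
    (hs : 0 < s) (hη : 0 < η) (hηε : 6 * η ≤ ε) {e : Mink → Y} (he : IsDevOn 𝒪 e (hball p s))
    (hmaps : MapsTo e (hball p s) K) :
    ∃ e', IsDevOn 𝒪 e' (hball p (s + η)) ∧ EqOn e' e (hball p s) := by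
  have hchoice : ∀ q, ∃ (q' : Mink) (f : Mink → Y), q ∈ hball p (s + η) → q' ∈ hball p s ∧
      q' ∈ hball q (2 * η) ∧ IsDevOn 𝒪 f (hball q' ε) ∧ ∀ᶠ x in 𝓝[hyp3] q', f x = e x := by
    intro q
    by_cases hq : q ∈ hball p (s + η)
    · obtain ⟨q', h1, h2⟩ := exists_mem_hball_near hp hs hη hq
      obtain ⟨f, hf1, hf2⟩ := (he q' h1).exists_continuation hK hε h1.1 tendsto_id h1.1
        (hmaps h1)
      exact ⟨q', f, fun _ => ⟨h1, h2, hf1, hf2⟩⟩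
    · exact ⟨q, e, fun h => absurd h hq⟩
  choose q' f hqf using hchoice
  have claim : ∀ q ∈ hball p (s + η), ∀ x ∈ hball p s ∩ hball (q' q) ε,
      ∀ᶠ y in 𝓝[hyp3] x, f q y = e y := by
    intro q hq x hx
    obtain ⟨h1, h2, h3, h4⟩ := hqf q hq
    exact IsDevOn.unique (B := univ) (isPreconnected_hball_inter hp h1.1 s ε)
      (fun y hy => hy.1.1) (h3.mono inter_subset_right) (he.mono inter_subset_left)
      (w₀ := q' q) ⟨h1, mem_hball_self h1.1 hε⟩ hx h4
  refine ⟨fun q => f q q, ?_, ?_⟩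
  · intro q hq
    obtain ⟨h1, h2, h3, h4⟩ := hqf q hq
    have hqq : q ∈ hball (q' q) ε :=
      hball_mono _ (by linarith) (by linarith) (mem_hball_comm hq.1 h2)
    refine (h3 q hqq).congr hq.1 ?_
    filter_upwards [hball_mem_nhdsWithin hq, hball_mem_nhdsWithin
      (mem_hball_self hq.1 (show 0 < 2 * η by linarith))] with x hx hxq
    obtain ⟨g1, g2, g3, g4⟩ := hqf x hx
    have a1 : x ∈ hball (q' q) (4 * η) := by
      have := hball_triangle h1.1 (by linarith) (by linarith) (mem_hball_comm hq.1 h2) hxq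
      rwa [show 2 * η + 2 * η = 4 * η by ring] at this
    have a2 : q' x ∈ hball (q' q) ε := by
      have := hball_triangle h1.1 (by linarith) (by linarith) a1 g2
      exact hball_mono _ (by linarith) (by linarith) this
    have a3 : x ∈ hball (q' x) ε :=
      hball_mono _ (by linarith) (by linarith) (mem_hball_comm hx.1 g2)
    have hU := IsDevOn.unique (B := univ) (isPreconnected_hball_inter h1.1 g1.1 ε ε)
      (fun y hy => hy.1.1) (g3.mono inter_subset_right) (h3.mono inter_subset_left)
      (w₀ := q' x) (w := x) ⟨a2, mem_hball_self g1.1 hε⟩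
      ⟨hball_mono _ (by linarith) (by linarith) a1, a3⟩ ?_
    · exact hU.self_of_nhdsWithin hx.1
    · filter_upwards [g4, claim q hq (q' x) ⟨g1, a2⟩] with y hy hy'
      rw [hy, hy']
  · intro q hq
    have hq' := hball_mono p hs.le (show s ≤ s + η by linarith) hq
    obtain ⟨h1, h2, h3, h4⟩ := hqf q hq'
    exact (claim q hq' q ⟨hq, hball_mono _ (by linarith) (by linarith)
      (mem_hball_comm hq.1 h2)⟩).self_of_nhdsWithin hq.1

/-- The exponential map: if developing maps on concentric smaller balls cannot leave a compact
set, then a developing map exists on the whole ball. -/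
theorem OpenAtlas.exists_exp [T2Space Y] {K : Set Y} (hK : IsCompact K) {y₀ : Y} (hy₀ : y₀ ∈ K)
    {c : Set Y × (Y → Mink)} (hc : c ∈ 𝒪.charts) (hyc : y₀ ∈ c.1) {r : ℝ} (hr : 0 < r)
    (hmaps : ∀ s, 0 < s → s ≤ r → ∀ e, IsDevOn 𝒪 e (hball (c.2 y₀) s) → e (c.2 y₀) = y₀ →
      MapsTo e (hball (c.2 y₀) s) K) :
    ∃ e, IsDevOn 𝒪 e (hball (c.2 y₀) r) ∧ e (c.2 y₀) = y₀ ∧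
      ∀ᶠ w in 𝓝[hyp3] (c.2 y₀), c.2 (e w) = w := by
  obtain ⟨ε, hε, hKε⟩ := OpenAtlas.exists_uniform_inverse (𝒪 := 𝒪) hK
  have hp := 𝒪.mapsTo c hc hyc
  have hη : 0 < min ε r / 6 := by have := lt_min hε hr; linarith
  have key : ∀ n : ℕ, ∃ e, IsDevOn 𝒪 e (hball (c.2 y₀) (min r (((n : ℝ) + 1) * (min ε r / 6)))) ∧
      e (c.2 y₀) = y₀ ∧ ∀ᶠ w in 𝓝[hyp3] (c.2 y₀), c.2 (e w) = w := by
    intro n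
    induction n with
    | zero =>
      obtain ⟨e, h1, h2, h3⟩ := hKε y₀ hy₀ c hc hyc
      refine ⟨e, h1.mono (hball_mono _ ?_ ?_), h2, h3⟩
      · refine le_min hr.le ?_; push_cast; linarith
      · refine (min_le_right _ _).trans ?_
        have := min_le_left ε r
        push_cast; linarith
    | succ n ih =>
      obtain ⟨e, h1, h2, h3⟩ := ih
      have hpos : 0 < min r (((n : ℝ) + 1) * (min ε r / 6)) := lt_min hr (by positivity)
      obtain ⟨e', h1', h2'⟩ := h1.exists_extension hKε hε hp hpos hη
        (by have := min_le_left ε r; linarith) (hmaps _ hpos (min_le_left _ _) e h1 h2)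
      have hself := mem_hball_self hp hpos
      refine ⟨e', h1'.mono (hball_mono _ (le_min hr.le (by positivity)) ?_), ?_, ?_⟩
      · push_cast
        rcases le_total r (((n : ℝ) + 1) * (min ε r / 6)) with h | h
        · rw [min_eq_left h]; exact (min_le_left _ _).trans (by linarith)
        · rw [min_eq_right h]; exact (min_le_right _ _).trans (by linarith)
      · rw [h2' hself, h2]
      · filter_upwards [h3, hball_mem_nhdsWithin hself] with w hw hw'
        rw [h2' hw', hw]
  obtain ⟨n, hn⟩ := exists_nat_gt (r / (min ε r / 6))
  obtain ⟨e, h1, h2, h3⟩ := key n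
  rw [div_lt_iff₀ hη] at hn
  rw [min_eq_left (by nlinarith)] at h1
  exact ⟨e, h1, h2, h3⟩

end

section

/-! ### Exterior collars -/

variable {M : Type*} [TopologicalSpace M] {𝒜 : HyperbolicAtlas M}

theorem HyperbolicAtlas.map_nhds_of_interior {x : M} (hx : x ∉ 𝒜.boundary)
    {c : Set M × (M → Mink)} (hc : c ∈ 𝒜.charts) (hxc : x ∈ c.1) :
    map c.2 (𝓝 x) = 𝓝[hyp3] (c.2 x) := by
  rw [HyperbolicAtlas.boundary, mem_compl_iff, not_not] at hx
  obtain ⟨c', hc', hxc', hn⟩ := hx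
  have h1 : map c'.2 (𝓝 x) = 𝓝[hyp3] (c'.2 x) := by
    rw [HyperbolicAtlas.chart_map_nhds hc' hxc']
    refine le_antisymm (nhdsWithin_mono _ ?_) ?_
    · rintro _ ⟨y, hy, rfl⟩; exact 𝒜.mapsTo c' hc' hy
    · exact nhdsWithin_le_iff.2 hn
  obtain ⟨B, hB, -, hBe⟩ := HyperbolicAtlas.exists_transition hc' hc hxc' hxc
  rw [hBe.self_of_nhds, ← hB.map_nhdsWithin, ← h1, map_map]
  exact map_congr hBe

theorem HyperbolicAtlas.isClosed_boundary : IsClosed 𝒜.boundary := by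
  rw [HyperbolicAtlas.boundary, isClosed_compl_iff, isOpen_iff_mem_nhds]
  rintro x ⟨c, hc, hxc, hn⟩
  have h1 := HyperbolicAtlas.chart_tendsto hc hxc
  filter_upwards [h1.eventually (eventually_mem_nhdsWithin_iff.2 hn),
    (𝒜.isOpen_source c hc).mem_nhds hxc] with y hy hyc
  exact ⟨c, hc, hyc, hy⟩

variable {ι : Type*}

/-- The boundary tori are covered by the maps `φ i` with larger principal curvatures `κ i`, and
all tube radii are at least `R`. -/
structure IsTubeSystem (𝒜 : HyperbolicAtlas M) (R : ℝ) (κ : ι → ℝ) (φ : ι → Plane → M) :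
    Prop where
  pos : 0 < R
  one_le : ∀ i, 1 ≤ κ i
  le_coth : ∀ i, κ i ≤ Real.cosh R / Real.sinh R
  isTubeMap : ∀ i, IsTubeMap 𝒜 (κ i) (φ i)
  index_eq : ∀ i j z w, φ i z = φ j w → i = j
  exists_eq : ∀ x ∈ 𝒜.boundary, ∃ i z, φ i z = x
  exists_compact : ∀ i, ∃ K, IsCompact K ∧ ∀ z, ∃ w ∈ K, φ i w = φ i z

/-- The points of `M × ℝ` making up `M` (at height `0`) and exterior collars of width `R` of its
boundary tori (at negative heights). -/
def extended (𝒜 : HyperbolicAtlas M) (R : ℝ) : Set (M × ℝ) :=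
  {p | p.2 = 0 ∨ (p.1 ∈ 𝒜.boundary ∧ -R < p.2 ∧ p.2 < 0)}

/-- The manifold `M` as a subset of its extension by exterior collars. -/
def core (𝒜 : HyperbolicAtlas M) (R : ℝ) (x : M) : extended 𝒜 R := ⟨(x, 0), Or.inl rfl⟩

open Classical in
/-- The point of the extension over `x ∈ ∂M` at height `h ≤ 0`. -/
def collarPt (𝒜 : HyperbolicAtlas M) (R : ℝ) (x : M) (h : ℝ) : extended 𝒜 R :=
  if H : (x, h) ∈ extended 𝒜 R then ⟨(x, h), H⟩ else core 𝒜 R x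

theorem collarPt_val {R : ℝ} {x : M} {h : ℝ} (H : (x, h) ∈ extended 𝒜 R) :
    (collarPt 𝒜 R x h).1 = (x, h) := by rw [collarPt, dif_pos H]

theorem extended_height_nonpos {R : ℝ} (p : extended 𝒜 R) : p.1.2 ≤ 0 := by
  rcases p.2 with h | h
  · exact h.le
  · exact h.2.2.le

theorem extended_height_gt {R : ℝ} (hR : 0 < R) (p : extended 𝒜 R) : -R < p.1.2 := by
  rcases p.2 with h | h
  · rw [h]; linarith
  · exact h.2.1

theorem extended_boundary {R : ℝ} (p : extended 𝒜 R) (h : p.1.2 < 0) : p.1.1 ∈ 𝒜.boundary := by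
  rcases p.2 with h' | h'
  · exact absurd h' h.ne
  · exact h'.1

theorem extended_interior {R : ℝ} (p : extended 𝒜 R) (h : p.1.1 ∉ 𝒜.boundary) : p.1.2 = 0 := by
  rcases p.2 with h' | h'
  · exact h'
  · exact absurd h'.1 h

open Classical in
/-- The extension of the chart `c` of `M` over the exterior collars. -/
def extChart (κ : ι → ℝ) (φ : ι → Plane → M) (c : Set M × (M → Mink)) {R : ℝ}
    (p : extended 𝒜 R) : Mink :=
  if H : p.1.2 < 0 ∧ ∃ t : ι × Plane × (Mink ≃ₗ[ℝ] Mink), φ t.1 t.2.1 = p.1.1 ∧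
      IsTubeGerm (κ t.1) (φ t.1) c t.2.1 t.2.2 then
    H.2.choose.2.2 (tube (κ H.2.choose.1) H.2.choose.2.1 p.1.2)
  else c.2 p.1.1

namespace IsTubeSystem

variable {R : ℝ} {κ : ι → ℝ} {φ : ι → Plane → M}

theorem κ_pos (S : IsTubeSystem 𝒜 R κ φ) (i : ι) : 0 < κ i := one_pos.trans_le (S.one_le i)

theorem inv_le_coth (S : IsTubeSystem 𝒜 R κ φ) (i : ι) :
    (κ i)⁻¹ ≤ Real.cosh R / Real.sinh R :=
  (inv_le_one_of_one_le₀ (S.one_le i)).trans (one_lt_coth S.pos).le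

theorem stretch_pos (S : IsTubeSystem 𝒜 R κ φ) (i : ι) {h : ℝ} (hh : -R < h) :
    0 < stretch (κ i) h :=
  TubularTruncation.stretch_pos S.pos (S.κ_pos i).le (S.le_coth i) hh

theorem stretch_inv_pos (S : IsTubeSystem 𝒜 R κ φ) (i : ι) {h : ℝ} (hh : -R < h) :
    0 < stretch (κ i)⁻¹ h :=
  TubularTruncation.stretch_pos S.pos (inv_pos.2 (S.κ_pos i)).le (S.inv_le_coth i) hh

theorem mem_boundary (S : IsTubeSystem 𝒜 R κ φ) (i : ι) (z : Plane) : φ i z ∈ 𝒜.boundary :=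
  (S.isTubeMap i).mem_boundary (S.κ_pos i) z

theorem mem_extended (S : IsTubeSystem 𝒜 R κ φ) (i : ι) (z : Plane) {h : ℝ} (h1 : -R < h)
    (h2 : h ≤ 0) : (φ i z, h) ∈ extended 𝒜 R := by
  rcases h2.eq_or_lt with h2 | h2
  · exact Or.inl h2
  · exact Or.inr ⟨S.mem_boundary i z, h1, h2⟩

variable [T2Space M]

theorem germ_deck (S : IsTubeSystem 𝒜 R κ φ) {i j : ι} {z w : Plane} (h : φ i z = φ j w)
    {c : Set M × (M → Mink)} {A B : Mink ≃ₗ[ℝ] Mink} (hA : IsTubeGerm (κ i) (φ i) c z A)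
    (hB : IsTubeGerm (κ j) (φ j) c w B) (t : ℝ) :
    A (tube (κ i) z t) = B (tube (κ j) w t) := by
  obtain rfl := S.index_eq i j z w h
  have hd := (S.isTubeMap i).deck (S.κ_pos i) h
  have hAB : A = (tubeTrans (κ i) (w - z)).trans B := by
    refine linearEquiv_eq_of_tubeBase (S.κ_pos i) (z := z) ?_
    have ht : Tendsto (fun y : Plane => y + (w - z)) (𝓝 z) (𝓝 w) := by
      have : Continuous fun y : Plane => y + (w - z) := by fun_prop
      simpa using this.tendsto z
    filter_upwards [hA.eventually_base, ht.eventually hB.eventually_base] with y h1 h2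
    rw [← h1, LinearEquiv.trans_apply, tubeTrans_tubeBase (S.κ_pos i), add_comm, ← h2, hd]
  rw [hAB, LinearEquiv.trans_apply, tubeTrans_tube (S.κ_pos i), sub_add_cancel]

theorem extChart_eq (S : IsTubeSystem 𝒜 R κ φ) {i : ι} {z : Plane} {c : Set M × (M → Mink)}
    {A : Mink ≃ₗ[ℝ] Mink} (hA : IsTubeGerm (κ i) (φ i) c z A) {p : extended 𝒜 R}
    (hp : φ i z = p.1.1) : extChart κ φ c p = A (tube (κ i) z p.1.2) := by
  rcases (extended_height_nonpos p).lt_or_eq with h | h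
  · have H : p.1.2 < 0 ∧ ∃ t : ι × Plane × (Mink ≃ₗ[ℝ] Mink), φ t.1 t.2.1 = p.1.1 ∧
      IsTubeGerm (κ t.1) (φ t.1) c t.2.1 t.2.2 := ⟨h, (i, z, A), hp, hA⟩
    rw [extChart, dif_pos H]
    exact S.germ_deck (H.2.choose_spec.1.trans hp.symm) H.2.choose_spec.2 hA _
  · rw [extChart, dif_neg (fun H => absurd h H.1.ne), ← hp, hA.apply, h, tube_zero]

omit [T2Space M] in
theorem extChart_of_height {c : Set M × (M → Mink)} {p : extended 𝒜 R} (h : p.1.2 = 0) :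
    extChart κ φ c p = c.2 p.1.1 := by
  rw [extChart, dif_neg (fun H => absurd h H.1.ne)]

omit [T2Space M] in
theorem map_fst_nhds {p : extended 𝒜 R} (h : p.1.2 = 0) :
    𝓝 p.1.1 ≤ map (fun q : extended 𝒜 R => q.1.1) (𝓝 p) := by
  intro s hs
  have hc : Continuous (core 𝒜 R) := by
    unfold core; fun_prop
  have h0 : core 𝒜 R p.1.1 = p := Subtype.ext (Prod.ext rfl h.symm)
  have := hc.tendsto p.1.1
  rw [h0] at this
  exact this hs

/-- Near an exterior collar, the extension is parametrized by tube coordinates. -/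
theorem exists_param (S : IsTubeSystem 𝒜 R κ φ) {i : ι} {z : Plane} {c : Set M × (M → Mink)}
    (hc : c ∈ 𝒜.charts) (hz : φ i z ∈ c.1) {A : Mink ≃ₗ[ℝ] Mink}
    (hA : IsTubeGerm (κ i) (φ i) c z A) {p : extended 𝒜 R} (hp : φ i z = p.1.1) :
    ∃ ψ : Plane × ℝ → extended 𝒜 R, Tendsto ψ (𝓝 (z, p.1.2)) (𝓝 p) ∧
      (∀ s ∈ 𝓝 (z, p.1.2), ψ '' s ∈ 𝓝 p) ∧
      (∀ᶠ a in 𝓝 (z, p.1.2), extChart κ φ c (ψ a) = A (tube (κ i) a.1 a.2)) ∧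
      ∀ᶠ a in 𝓝 (z, p.1.2), a.2 ≤ 0 → (ψ a).1 = (φ i a.1, a.2) := by
  classical
  have hH := S.isTubeMap i
  have hκ := S.κ_pos i
  have hpR := extended_height_gt S.pos p
  have hp0 := extended_height_nonpos p
  obtain ⟨h, hh⟩ : ∃ h, h = p.1.2 := ⟨_, rfl⟩
  rw [← hh] at hpR hp0 ⊢
  have : Nonempty M := ⟨p.1.1⟩
  obtain ⟨inv, hinv⟩ : ∃ f : Mink → M, f = Function.invFunOn c.2 c.1 := ⟨_, rfl⟩
  have hinv1 : ∀ w ∈ c.2 '' c.1, inv w ∈ c.1 ∧ c.2 (inv w) = w := by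
    intro w hw; rw [hinv]
    exact ⟨Function.invFunOn_mem hw, Function.invFunOn_eq hw⟩
  have hinv2 : ∀ x ∈ c.1, inv (c.2 x) = x := fun x hx =>
    HyperbolicAtlas.chart_inj hc (hinv1 _ (mem_image_of_mem _ hx)).1 hx
      (hinv1 _ (mem_image_of_mem _ hx)).2
  obtain ⟨ψ, hψ⟩ : ∃ ψ : Plane × ℝ → extended 𝒜 R, ψ = fun a =>
      if a.2 ≤ 0 then collarPt 𝒜 R (φ i a.1) a.2 else core 𝒜 R (inv (A (tube (κ i) a.1 a.2))) :=
    ⟨_, rfl⟩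
  have hψ1 : ∀ a : Plane × ℝ, -R < a.2 → a.2 ≤ 0 → (ψ a).1 = (φ i a.1, a.2) := by
    intro a h1 h2
    rw [hψ]; simp only [if_pos h2]
    exact collarPt_val (S.mem_extended i a.1 h1 h2)
  have hψ2 : ∀ a : Plane × ℝ, 0 < a.2 → ψ a = core 𝒜 R (inv (A (tube (κ i) a.1 a.2))) := by
    intro a h2
    rw [hψ]; simp only [if_neg (not_le.2 h2)]
  have evR : ∀ᶠ a : Plane × ℝ in 𝓝 (z, h), -R < a.2 :=
    continuous_snd.continuousAt.eventually (lt_mem_nhds hpR)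
  have evfst : ∀ {s : Set Plane}, s ∈ 𝓝 z → ∀ᶠ a : Plane × ℝ in 𝓝 (z, h), a.1 ∈ s :=
    fun hs => (continuous_fst.tendsto (z, h)).eventually hs
  -- positive heights only matter near height zero
  have evgood : ∀ᶠ a : Plane × ℝ in 𝓝 (z, h), 0 < a.2 →
      A (tube (κ i) a.1 a.2) ∈ c.2 '' c.1 := by
    rcases hp0.lt_or_eq with h0 | h0
    · filter_upwards [continuous_snd.continuousAt.eventually (gt_mem_nhds h0)] with a ha ha'
      exact absurd ha (not_lt.2 ha'.le)
    · rw [h0]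
      filter_upwards [hA.eventually] with a ha ha'
      exact ha.2.2 ha'.le
  have evchart : ∀ᶠ a : Plane × ℝ in 𝓝 (z, h), φ i a.1 ∈ c.1 ∧ IsTubeGerm (κ i) (φ i) c a.1 A :=
    evfst ((hH.continuous.continuousAt.eventually ((𝒜.isOpen_source c hc).mem_nhds hz)).and
      hA.eventually_germ)
  refine ⟨ψ, ?_, ?_, ?_, ?_⟩
  · rw [tendsto_subtype_rng]
    have h2 : Tendsto (fun a => (ψ a).1.2) (𝓝 (z, h)) (𝓝 h) := by
      have hm : Continuous fun a : Plane × ℝ => min a.2 0 := by fun_prop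
      have := hm.tendsto (z, h)
      rw [min_eq_left hp0] at this
      refine this.congr' ?_
      filter_upwards [evR] with a ha
      rcases le_or_gt a.2 0 with h' | h'
      · rw [hψ1 a ha h', min_eq_left h']
      · rw [hψ2 a h', min_eq_right h'.le]; rfl
    have h1 : Tendsto (fun a => (ψ a).1.1) (𝓝 (z, h)) (𝓝 (φ i z)) := by
      intro U hU
      have hU1 : ∀ᶠ a : Plane × ℝ in 𝓝 (z, h), φ i a.1 ∈ U :=
        evfst (hH.continuous.continuousAt.eventually hU)
      have hU2 : ∀ᶠ a : Plane × ℝ in 𝓝 (z, h), 0 < a.2 → inv (A (tube (κ i) a.1 a.2)) ∈ U := by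
        rcases hp0.lt_or_eq with h0 | h0
        · filter_upwards [continuous_snd.continuousAt.eventually (gt_mem_nhds h0)] with a ha ha'
          exact absurd ha (not_lt.2 ha'.le)
        · have e1 : c.2 '' (U ∩ c.1) ∈ 𝓝[c.2 '' c.1] (c.2 (φ i z)) := by
            rw [← HyperbolicAtlas.chart_map_nhds hc hz]
            exact image_mem_map (inter_mem hU ((𝒜.isOpen_source c hc).mem_nhds hz))
          rw [mem_nhdsWithin_iff_eventually] at e1
          have e2 : Tendsto (fun a : Plane × ℝ => A (tube (κ i) a.1 a.2)) (𝓝 (z, h))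
              (𝓝 (c.2 (φ i z))) := by
            rw [h0]; exact (hA.map_nhds hκ).le.trans nhdsWithin_le_nhds
          filter_upwards [e2.eventually e1, evgood] with a h1 h2 ha
          obtain ⟨x, hx, hxa⟩ := h1 (h2 ha)
          rw [← hxa, hinv2 x hx.2]; exact hx.1
      rw [mem_map]
      filter_upwards [hU1, hU2, evR] with a h1 h2 h3
      rcases le_or_gt a.2 0 with h' | h'
      · rw [mem_preimage, hψ1 a h3 h']; exact h1
      · rw [mem_preimage, hψ2 a h']; exact h2 h'
    have := h1.prodMk_nhds h2
    have hpe : (φ i z, h) = p.1 := Prod.ext hp hh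
    rw [hpe] at this
    exact this
  · intro s hs
    have hpe : (φ i z, h) = p.1 := Prod.ext hp hh
    have hs' : s ∩ {a : Plane × ℝ | (0 < a.2 → A (tube (κ i) a.1 a.2) ∈ c.2 '' c.1) ∧
      φ i a.1 ∈ c.1 ∧ IsTubeGerm (κ i) (φ i) c a.1 A} ∈ 𝓝 (z, h) :=
      inter_mem hs (evgood.and evchart)
    obtain ⟨s1, hs1, s2, hs2, hsub⟩ := mem_nhds_prod_iff.1 hs'
    have c1 : Tendsto (fun q : extended 𝒜 R => q.1.1) (𝓝 p) (𝓝 (φ i z)) := by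
      rw [hp]; exact (continuous_fst.comp continuous_subtype_val).tendsto p
    have c2 : Tendsto (fun q : extended 𝒜 R => q.1.2) (𝓝 p) (𝓝 h) := by
      rw [hh]; exact (continuous_snd.comp continuous_subtype_val).tendsto p
    have d1 : ∀ᶠ x in 𝓝 (φ i z), x ∈ 𝒜.boundary → x ∈ φ i '' s1 := by
      rw [← mem_nhdsWithin_iff_eventually, ← hH.map_nhds hκ]
      exact image_mem_map hs1
    -- points of the collars
    have hneg : ∀ᶠ q : extended 𝒜 R in 𝓝 p, q.1.2 < 0 → q ∈ ψ '' s := by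
      filter_upwards [c1.eventually d1, c2.eventually hs2] with q h1 h2 h3
      obtain ⟨y, hy, hyq⟩ := h1 (extended_boundary q h3)
      refine ⟨(y, q.1.2), (hsub (mk_mem_prod hy h2)).1, Subtype.ext ?_⟩
      rw [hψ1 _ (extended_height_gt S.pos q) h3.le]
      exact Prod.ext hyq rfl
    rcases hp0.lt_or_eq with h0 | h0
    · filter_upwards [hneg, c2.eventually (gt_mem_nhds h0)] with q h1 h2 using h1 h2
    · -- points of `M`
      have hzero : ∀ᶠ q : extended 𝒜 R in 𝓝 p, q.1.2 = 0 → q ∈ ψ '' s := by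
        have e1 : ∀ᶠ a : Plane × ℝ in 𝓝 (z, 0), a ∈ s ∧ (0 < a.2 →
            A (tube (κ i) a.1 a.2) ∈ c.2 '' c.1) ∧ φ i a.1 ∈ c.1 ∧
            IsTubeGerm (κ i) (φ i) c a.1 A ∧ c.2 (φ i a.1) = A (tubeBase (κ i) a.1) ∧
            (A (tube (κ i) a.1 a.2) ∈ c.2 '' c.1 ↔ 0 ≤ a.2) := by
          rw [h0] at hs'
          filter_upwards [hs', hA.eventually] with a ha ha'
          exact ⟨ha.1, ha.2.1, ha.2.2.1, ha.2.2.2, ha'.1, ha'.2⟩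
        have e2 := hA.eventually_image hκ (s := (fun a : Plane × ℝ => A (tube (κ i) a.1 a.2)) ''
          {a | a ∈ s ∧ (0 < a.2 →
            A (tube (κ i) a.1 a.2) ∈ c.2 '' c.1) ∧ φ i a.1 ∈ c.1 ∧
            IsTubeGerm (κ i) (φ i) c a.1 A ∧ c.2 (φ i a.1) = A (tubeBase (κ i) a.1) ∧
            (A (tube (κ i) a.1 a.2) ∈ c.2 '' c.1 ↔ 0 ≤ a.2)})
          (e1.mono fun a ha => mem_image_of_mem _ ha)
        have e3 := (HyperbolicAtlas.chart_tendsto hc hz).eventually e2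
        filter_upwards [c1.eventually e3,
          c1.eventually ((𝒜.isOpen_source c hc).mem_nhds hz)] with q h1 hqc h2
        obtain ⟨a, ⟨b1, b2, b3, b4, b5, b6⟩, haq⟩ := h1
        have ha0 : 0 ≤ a.2 := b6.1 (haq ▸ mem_image_of_mem _ hqc)
        refine ⟨a, b1, Subtype.ext ?_⟩
        rcases ha0.eq_or_lt with ha | ha
        · rw [hψ1 a (by rw [← ha]; linarith [S.pos]) ha.symm.le]
          refine Prod.ext ?_ (by rw [← ha, h2])
          refine HyperbolicAtlas.chart_inj hc b3 hqc ?_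
          rw [b5, ← haq, ← ha, tube_zero]
        · rw [hψ2 a ha, haq, hinv2 _ hqc]
          exact Prod.ext rfl h2.symm
      filter_upwards [hneg, hzero] with q h1 h2
      rcases (extended_height_nonpos q).lt_or_eq with h | h
      · exact h1 h
      · exact h2 h
  · filter_upwards [evR, evgood, evchart] with a h1 h2 h3
    rcases le_or_gt a.2 0 with h' | h'
    · have hv := hψ1 a h1 h'
      have := S.extChart_eq h3.2 (p := ψ a) (by rw [hv])
      rw [this, hv]
    · rw [hψ2 a h', extChart_of_height (by rfl)]
      exact (hinv1 _ (h2 h')).2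
  · filter_upwards [evR] with a h1 h2 using hψ1 a h1 h2

/-- Extended charts are local homeomorphisms. -/
theorem extChart_local (S : IsTubeSystem 𝒜 R κ φ) {c : Set M × (M → Mink)}
    (hc : c ∈ 𝒜.charts) {p : extended 𝒜 R} (hp : p.1.1 ∈ c.1) :
    extChart κ φ c p ∈ hyp3 ∧ (∃ V ∈ 𝓝 p, InjOn (extChart κ φ c) V) ∧
      map (extChart κ φ c) (𝓝 p) = 𝓝[hyp3] (extChart κ φ c p) := by
  by_cases hb : p.1.1 ∈ 𝒜.boundary
  · obtain ⟨i, z, hz⟩ := S.exists_eq _ hb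
    obtain ⟨A, hA⟩ := (S.isTubeMap i).chart z c hc (hz ▸ hp)
    obtain ⟨ψ, h1, h2, h3, -⟩ := S.exists_param hc (hz ▸ hp) hA hz
    have hpR := extended_height_gt S.pos p
    rw [S.extChart_eq hA hz]
    have hκ := S.κ_pos i
    refine ⟨hA.iso.mem_hyp3 _ (tube_mem hκ _ _), ?_, ?_⟩
    · obtain ⟨s, hs, hinj⟩ := eventually_tube_injective hκ z p.1.2 (S.stretch_pos i hpR)
        (S.stretch_inv_pos i hpR)
      refine ⟨_, h2 _ (inter_mem hs h3), ?_⟩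
      rintro _ ⟨a, ⟨ha1, ha2⟩, rfl⟩ _ ⟨b, ⟨hb1, hb2⟩, rfl⟩ hab
      have ha2' : extChart κ φ c (ψ a) = A (tube (κ i) a.1 a.2) := ha2
      have hb2' : extChart κ φ c (ψ b) = A (tube (κ i) b.1 b.2) := hb2
      rw [ha2', hb2'] at hab
      rw [hinj ha1 hb1 (A.injective hab)]
    · have h4 := map_tube_nhds hκ z p.1.2 (S.stretch_pos i hpR).ne' (S.stretch_inv_pos i hpR).ne'
      have h5 : map (extChart κ φ c) (map ψ (𝓝 (z, p.1.2)))
          = 𝓝[hyp3] (A (tube (κ i) z p.1.2)) := by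
        rw [map_map, ← hA.iso.map_nhdsWithin, ← h4, map_map]
        exact map_congr h3
      have h6 : map ψ (𝓝 (z, p.1.2)) = 𝓝 p := by
        refine le_antisymm h1 fun s hs => ?_
        exact mem_of_superset (h2 _ hs) (image_preimage_subset _ _)
      rw [← h6, h5]
  · have h0 := extended_interior p hb
    have hm := HyperbolicAtlas.map_nhds_of_interior hb hc hp
    have hev : ∀ᶠ q : extended 𝒜 R in 𝓝 p, q.1.1 ∈ c.1 ∧ q.1.2 = 0 := by
      have : ∀ᶠ x in 𝓝 p.1.1, x ∈ c.1 ∧ x ∉ 𝒜.boundary :=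
        (show ∀ᶠ x in 𝓝 p.1.1, x ∈ c.1 from (𝒜.isOpen_source c hc).mem_nhds hp).and
          (HyperbolicAtlas.isClosed_boundary.isOpen_compl.mem_nhds hb)
      filter_upwards [((continuous_fst.comp continuous_subtype_val).tendsto p).eventually this]
        with q hq
      exact ⟨hq.1, extended_interior q hq.2⟩
    rw [extChart_of_height h0]
    refine ⟨𝒜.mapsTo c hc hp, ⟨_, hev, ?_⟩, ?_⟩
    · rintro q ⟨hq1, hq2⟩ q' ⟨hq1', hq2'⟩ hqq
      rw [extChart_of_height hq2, extChart_of_height hq2'] at hqq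
      exact Subtype.ext (Prod.ext (HyperbolicAtlas.chart_inj hc hq1 hq1' hqq) (hq2.trans hq2'.symm))
    · have h1 : map (fun q : extended 𝒜 R => q.1.1) (𝓝 p) = 𝓝 p.1.1 :=
        le_antisymm ((continuous_fst.comp continuous_subtype_val).tendsto p) (map_fst_nhds h0)
      rw [← hm, ← h1, map_map]
      refine map_congr ?_
      filter_upwards [hev] with q hq using extChart_of_height hq.2

theorem extChart_compatible (S : IsTubeSystem 𝒜 R κ φ) {c c' : Set M × (M → Mink)}
    (hc : c ∈ 𝒜.charts) (hc' : c' ∈ 𝒜.charts) {p : extended 𝒜 R} (hp : p.1.1 ∈ c.1)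
    (hp' : p.1.1 ∈ c'.1) : ∃ B : Mink ≃ₗ[ℝ] Mink, IsHypIso B ∧
      ∀ᶠ q in 𝓝 p, extChart κ φ c' q = B (extChart κ φ c q) := by
  obtain ⟨B, hB, -, hBe⟩ := HyperbolicAtlas.exists_transition hc hc' hp hp'
  refine ⟨B, hB, ?_⟩
  have c1 : Tendsto (fun q : extended 𝒜 R => q.1.1) (𝓝 p) (𝓝 p.1.1) :=
    (continuous_fst.comp continuous_subtype_val).tendsto p
  filter_upwards [c1.eventually (eventually_eventually_nhds.2 hBe),
    c1.eventually ((𝒜.isOpen_source c hc).mem_nhds hp),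
    c1.eventually ((𝒜.isOpen_source c' hc').mem_nhds hp')] with q h1 h2 h3
  rcases (extended_height_nonpos q).lt_or_eq with h | h
  · obtain ⟨i, z, hz⟩ := S.exists_eq _ (extended_boundary q h)
    obtain ⟨A, hA⟩ := (S.isTubeMap i).chart z c hc (hz ▸ h2)
    have hA' := (S.isTubeMap i).germ_change (S.κ_pos i) hc' (hz ▸ h3) hA (hz ▸ h1)
    rw [S.extChart_eq hA hz, S.extChart_eq hA' hz]; rfl
  · rw [extChart_of_height h, extChart_of_height h]
    exact h1.self_of_nhds

theorem exists_extChart_source (S : IsTubeSystem 𝒜 R κ φ) {c : Set M × (M → Mink)}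
    (hc : c ∈ 𝒜.charts) {p : extended 𝒜 R} (hp : p.1.1 ∈ c.1) :
    ∃ U, IsOpen U ∧ p ∈ U ∧ InjOn (extChart κ φ c) U ∧ ∀ q ∈ U, q.1.1 ∈ c.1 := by
  obtain ⟨-, ⟨V, hV, hinj⟩, -⟩ := S.extChart_local hc hp
  have h1 : ∀ᶠ q : extended 𝒜 R in 𝓝 p, q.1.1 ∈ c.1 :=
    ((continuous_fst.comp continuous_subtype_val).tendsto p).eventually
      ((𝒜.isOpen_source c hc).mem_nhds hp)
  obtain ⟨U, hU, hUo, hpU⟩ := mem_nhds_iff.1 (inter_mem hV h1)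
  exact ⟨U, hUo, hpU, hinj.mono fun q hq => (hU hq).1, fun q hq => (hU hq).2⟩

/-- The hyperbolic structure on the extension of `M` by exterior collars. -/
def extAtlas (S : IsTubeSystem 𝒜 R κ φ) : OpenAtlas (extended 𝒜 R) where
  charts := {d | IsOpen d.1 ∧ InjOn d.2 d.1 ∧ ∃ c ∈ 𝒜.charts, d.2 = extChart κ φ c ∧
    ∀ p ∈ d.1, p.1.1 ∈ c.1}
  isOpen_source := fun d hd => hd.1
  cover := by
    intro p
    obtain ⟨c, hc, hp⟩ := 𝒜.cover p.1.1
    obtain ⟨U, hU, hpU, hinj, hUc⟩ := S.exists_extChart_source hc hp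
    exact ⟨(U, extChart κ φ c), ⟨hU, hinj, c, hc, rfl, hUc⟩, hpU⟩
  mapsTo := by
    rintro ⟨U, D⟩ ⟨-, -, c, hc, hD, h⟩ p hp
    simp only at hD; subst hD
    exact (S.extChart_local hc (h p hp)).1
  injOn := fun d hd => hd.2.1
  map_nhds := by
    rintro ⟨U, D⟩ ⟨-, -, c, hc, hD, h⟩ p hp
    simp only at hD; subst hD
    exact (S.extChart_local hc (h p hp)).2.2
  compatible := by
    rintro ⟨U, D⟩ ⟨-, -, c, hc, hD, h⟩ ⟨U', D'⟩ ⟨-, -, c', hc', hD', h'⟩ p hp hp'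
    simp only at hD hD'; subst hD hD'
    exact S.extChart_compatible hc hc' (h p hp) (h' p hp')

end IsTubeSystem

end

section

variable {M : Type*} [TopologicalSpace M] {𝒜 : HyperbolicAtlas M} {ι : Type*}

/-! ### The exponential map at points of `M` -/

theorem abs_le_of_cosh_le {a b : ℝ} (h : Real.cosh a ≤ Real.cosh b) : |a| ≤ |b| :=
  Real.cosh_le_cosh.1 h

namespace IsTubeSystem

variable {R : ℝ} {κ : ι → ℝ} {φ : ι → Plane → M} [T2Space M]

/-- The height is 1-Lipschitz for the hyperbolic metric. -/
theorem eventually_cosh_height_le (S : IsTubeSystem 𝒜 R κ φ) {c : Set M × (M → Mink)}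
    (hc : c ∈ 𝒜.charts) {p : extended 𝒜 R} (hp : p.1.1 ∈ c.1) :
    ∀ᶠ q : extended 𝒜 R in 𝓝 p,
      Real.cosh (q.1.2 - p.1.2) ≤ hcosh (extChart κ φ c p) (extChart κ φ c q) := by
  have c1 : Tendsto (fun q : extended 𝒜 R => q.1.1) (𝓝 p) (𝓝 p.1.1) :=
    (continuous_fst.comp continuous_subtype_val).tendsto p
  have c2 : Tendsto (fun q : extended 𝒜 R => q.1.2) (𝓝 p) (𝓝 p.1.2) :=
    (continuous_snd.comp continuous_subtype_val).tendsto p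
  have hev : ∀ᶠ q : extended 𝒜 R in 𝓝 p, q.1.1 ∈ c.1 := c1.eventually
    ((𝒜.isOpen_source c hc).mem_nhds hp)
  have hzero : ∀ᶠ q : extended 𝒜 R in 𝓝 p, q.1.2 = p.1.2 →
      Real.cosh (q.1.2 - p.1.2) ≤ hcosh (extChart κ φ c p) (extChart κ φ c q) := by
    filter_upwards [hev] with q hq h
    rw [h, sub_self, Real.cosh_zero]
    exact one_le_hcosh (S.extChart_local hc hp).1 (S.extChart_local hc hq).1
  by_cases hb : p.1.1 ∈ 𝒜.boundary
  · obtain ⟨i, z, hz⟩ := S.exists_eq _ hb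
    obtain ⟨A, hA⟩ := (S.isTubeMap i).chart z c hc (hz ▸ hp)
    have d1 : ∀ᶠ x in 𝓝 p.1.1, x ∈ 𝒜.boundary →
        x ∈ φ i '' {y | IsTubeGerm (κ i) (φ i) c y A} := by
      rw [← mem_nhdsWithin_iff_eventually, ← hz, ← (S.isTubeMap i).map_nhds (S.κ_pos i)]
      exact image_mem_map hA.eventually_germ
    have hneg : ∀ᶠ q : extended 𝒜 R in 𝓝 p, q.1.2 < 0 →
        Real.cosh (q.1.2 - p.1.2) ≤ hcosh (extChart κ φ c p) (extChart κ φ c q) := by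
      filter_upwards [c1.eventually d1] with q h1 h2
      obtain ⟨y, hy, hyq⟩ := h1 (extended_boundary q h2)
      rw [S.extChart_eq hA hz, S.extChart_eq hy hyq, hA.iso.hcosh_eq, hcosh_comm,
        hcosh_tube (S.κ_pos i)]
      have e1 := S.stretch_pos i (extended_height_gt S.pos p)
      have e2 := S.stretch_pos i (extended_height_gt S.pos q)
      have e3 := S.stretch_inv_pos i (extended_height_gt S.pos p)
      have e4 := S.stretch_inv_pos i (extended_height_gt S.pos q)
      have e5 := mul_nonneg (mul_pos e2 e1).le (vn_nonneg (mX (κ i)) (y 0 - z 0))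
      have e6 := mul_nonneg (mul_pos e4 e3).le (vn_nonneg (mY (κ i)) (y 1 - z 1))
      linarith
    rcases (extended_height_nonpos p).lt_or_eq with h0 | h0
    · filter_upwards [hneg, c2.eventually (gt_mem_nhds h0)] with q h1 h2 using h1 h2
    · filter_upwards [hneg, hzero] with q h1 h2
      rcases (extended_height_nonpos q).lt_or_eq with h | h
      · exact h1 h
      · exact h2 (h.trans h0.symm)
  · have hev2 : ∀ᶠ q : extended 𝒜 R in 𝓝 p, q.1.1 ∉ 𝒜.boundary := c1.eventually
      (HyperbolicAtlas.isClosed_boundary.isOpen_compl.mem_nhds hb)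
    filter_upwards [hzero, hev2] with q h1 h2
    exact h1 ((extended_interior q h2).trans (extended_interior p hb).symm)

/-- Moving a distance less than `s` away from a point of `M` leads at most to the depth `s` of an
exterior collar. -/
theorem neg_le_height (S : IsTubeSystem 𝒜 R κ φ) {p : Mink} (hp : p ∈ hyp3) {s : ℝ}
    (hs : 0 < s) {e : Mink → extended 𝒜 R} (he : IsDevOn S.extAtlas e (hball p s))
    (h0 : (e p).1.2 = 0) {w : Mink} (hw : w ∈ hball p s) : -s ≤ (e w).1.2 := by
  obtain ⟨d, u, hd, hpu, huu, rfl⟩ := exists_geodesic hp hw.1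
  let γ : ℝ → Mink := fun t => Real.cosh t • p + Real.sinh t • u
  have hγ3 : ∀ t, γ t ∈ hyp3 := fun t => geodesic_mem_hyp3 hp hpu huu t
  have hγc : Continuous γ := by
    have h1 := Real.continuous_cosh; have h2 := Real.continuous_sinh
    fun_prop
  have hγ0 : γ 0 = p := by simp [γ]
  have hdist : ∀ a b, hcosh (γ a) (γ b) = Real.cosh (a - b) := hcosh_geodesic hp hpu huu
  have hds : d < s := by
    have h1 := hw.2
    have h2 := hdist 0 d
    rw [hγ0, zero_sub, Real.cosh_neg] at h2
    change hcosh p (γ d) < Real.cosh s at h1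
    rw [h2] at h1
    have := Real.cosh_lt_cosh.1 h1
    rwa [abs_of_nonneg hd, abs_of_pos hs] at this
  have hγb : ∀ t ∈ Icc 0 d, γ t ∈ hball p s := by
    intro t ht
    refine ⟨hγ3 t, ?_⟩
    have h2 := hdist 0 t
    rw [hγ0, zero_sub, Real.cosh_neg] at h2
    rw [h2]
    exact cosh_lt_cosh_of_nonneg ht.1 (ht.2.trans_lt hds)
  have hγt : ∀ t, Tendsto γ (𝓝 t) (𝓝[hyp3] (γ t)) := fun t =>
    tendsto_nhdsWithin_iff.2 ⟨hγc.tendsto t, Eventually.of_forall hγ3⟩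
  have hcont : ContinuousOn (fun t => (e (γ t)).1.2) (Icc 0 d) := by
    intro t ht
    have h1 : Tendsto (fun t => e (γ t)) (𝓝 t) (𝓝 (e (γ t))) :=
      (he _ (hγb t ht)).continuousWithinAt.tendsto.comp (hγt t)
    have h2 : Tendsto (fun q : extended 𝒜 R => q.1.2) (𝓝 (e (γ t))) (𝓝 (e (γ t)).1.2) :=
      (continuous_snd.comp continuous_subtype_val).tendsto _
    exact (h2.comp h1).mono_left nhdsWithin_le_nhds
  have key : Icc 0 d ⊆ {t | -t ≤ (e (γ t)).1.2} := by
    refine IsClosed.Icc_subset_of_forall_mem_nhdsWithin ?_ ?_ ?_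
    · rw [inter_comm]
      exact isClosed_Icc.isClosed_le (f := fun t : ℝ => -t) continuousOn_neg hcont
    · change -(0:ℝ) ≤ (e (γ 0)).1.2
      rw [hγ0, h0, neg_zero]
    · rintro t ⟨ht, htd⟩
      have ht' : -t ≤ (e (γ t)).1.2 := ht
      have htI : t ∈ Icc 0 d := ⟨htd.1, htd.2.le⟩
      obtain ⟨c, hc, hpc⟩ := S.extAtlas.cover (e (γ t))
      obtain ⟨A, hA, hAe⟩ := (he _ (hγb t htI)).chart c hc hpc
      obtain ⟨-, -, c', hc', hcc, hcs⟩ := hc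
      have h1 := S.eventually_cosh_height_le hc' (hcs _ hpc)
      rw [← hcc] at h1
      have h2 := (he _ (hγb t htI)).continuousWithinAt.tendsto.eventually h1
      have h3 := ((hγt t).eventually (h2.and hAe)).filter_mono
        (nhdsWithin_le_nhds : 𝓝[>] t ≤ 𝓝 t)
      filter_upwards [h3, self_mem_nhdsWithin] with v hv hvt
      obtain ⟨hv1, hv2⟩ := hv
      have hAt : c.2 (e (γ t)) = A (γ t) := hAe.self_of_nhdsWithin (hγ3 t)
      rw [hAt, hv2, id, hA.hcosh_eq, hdist] at hv1
      have := abs_le_of_cosh_le hv1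
      rw [abs_sub_comm t v, abs_of_pos (a := v - t) (sub_pos.2 hvt)] at this
      have := (abs_le.1 this).1
      change -v ≤ (e (γ v)).1.2
      linarith
  have := key ⟨hd, le_rfl⟩
  change -d ≤ (e (γ d)).1.2 at this
  change -s ≤ (e (γ d)).1.2
  linarith

omit [T2Space M] in
theorem isCompact_height [CompactSpace M] {r : ℝ} (hr : r < R) :
    IsCompact {p : extended 𝒜 R | -r ≤ p.1.2} := by
  rw [Subtype.isCompact_iff]
  have h1 : ((↑) : extended 𝒜 R → M × ℝ) '' {p : extended 𝒜 R | -r ≤ p.1.2}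
      = (univ ×ˢ Icc (-r) 0) ∩ {p : M × ℝ | p.2 = 0 ∨ p.1 ∈ 𝒜.boundary} := by
    ext ⟨x, h⟩
    constructor
    · rintro ⟨p, hp, hpe⟩
      have h1 := extended_height_nonpos p
      have h2 := p.2
      have h3 : -r ≤ p.1.2 := hp
      rw [hpe] at h1 h2 h3
      exact ⟨⟨mem_univ _, h3, h1⟩, h2.imp id fun h => h.1⟩
    · rintro ⟨⟨-, h1, h2⟩, h3⟩
      have h1' : -r ≤ h := h1
      have h2' : h ≤ 0 := h2
      refine ⟨⟨(x, h), ?_⟩, h1, rfl⟩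
      rcases h2'.eq_or_lt with h2' | h2'
      · exact Or.inl h2'
      · exact Or.inr ⟨h3.resolve_left h2'.ne, by linarith, h2'⟩
  rw [h1]
  refine (isCompact_univ.prod isCompact_Icc).inter_right ?_
  exact (isClosed_eq continuous_snd continuous_const).union
    (HyperbolicAtlas.isClosed_boundary.preimage continuous_fst)

/-- At points of `M`, the exponential map of the extension is defined on the ball of radius `R`. -/
theorem exists_exp [CompactSpace M] (S : IsTubeSystem 𝒜 R κ φ) {r : ℝ} (hr : 0 < r)
    (hrR : r < R) : ∀ y ∈ {p : extended 𝒜 R | p.1.2 = 0}, ∀ c ∈ S.extAtlas.charts, y ∈ c.1 →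
      ∃ e : Mink → extended 𝒜 R, IsDevOn S.extAtlas e (hball (c.2 y) r) ∧ e (c.2 y) = y ∧
        ∀ᶠ w in 𝓝[hyp3] (c.2 y), c.2 (e w) = w := by
  intro y hy c hc hyc
  have hy0 : y.1.2 = 0 := hy
  refine OpenAtlas.exists_exp (isCompact_height hrR) (y₀ := y) ?_ hc hyc hr ?_
  · change -r ≤ y.1.2
    rw [hy0]; linarith
  · intro s hs hsr e he h0 w hw
    have := S.neg_le_height (S.extAtlas.mapsTo c hc hyc) hs he (by rw [h0]; exact hy0) hw
    change -r ≤ (e w).1.2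
    linarith

end IsTubeSystem

end

section

/-! ### Collars -/

section

variable {Y : Type*} [TopologicalSpace Y] {𝒪 : OpenAtlas Y} {X : Type*} [TopologicalSpace X]

/-- A developing map is open wherever the map it is modelled on is open. -/
theorem IsDevAt.map_nhds {E : X → Y} {F : X → Mink} {w : X} (h : IsDevAt 𝒪 E F univ w)
    (hF : map F (𝓝 w) = 𝓝[hyp3] (F w)) : map E (𝓝 w) = 𝓝 (E w) := by
  obtain ⟨c, hc, hwc⟩ := 𝒪.cover (E w)
  obtain ⟨A, hA, hAe⟩ := h.chart c hc hwc
  rw [nhdsWithin_univ] at hAe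
  have hcont : Tendsto E (𝓝 w) (𝓝 (E w)) := by
    have := h.continuousWithinAt.tendsto
    rwa [nhdsWithin_univ] at this
  have h1 : map c.2 (map E (𝓝 w)) = map c.2 (𝓝 (E w)) := by
    rw [𝒪.map_nhds c hc _ hwc, hAe.self_of_nhds, ← hA.map_nhdsWithin, ← hF, map_map, map_map]
    exact map_congr hAe
  refine le_antisymm hcont fun s hs => ?_
  have ho := (𝒪.isOpen_source c hc).mem_nhds hwc
  have h2 : c.2 '' (s ∩ c.1) ∈ map c.2 (𝓝 (E w)) := by
    rw [← h1]; exact image_mem_map (inter_mem hs (hcont ho))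
  filter_upwards [h2, ho] with y hy hyc
  obtain ⟨x, hx, hxy⟩ := hy
  rw [← 𝒪.injOn c hc hx.2 hyc hxy]; exact hx.1

theorem IsDevAt.exists_injOn {E : X → Y} {F : X → Mink} {w : X} (h : IsDevAt 𝒪 E F univ w)
    (hF : ∃ s ∈ 𝓝 w, InjOn F s) : ∃ s ∈ 𝓝 w, InjOn E s := by
  obtain ⟨c, hc, hwc⟩ := 𝒪.cover (E w)
  obtain ⟨A, hA, hAe⟩ := h.chart c hc hwc
  rw [nhdsWithin_univ] at hAe
  obtain ⟨s, hs, hinj⟩ := hF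
  refine ⟨_, inter_mem hs hAe, ?_⟩
  rintro x ⟨hx, hx'⟩ y ⟨hy, hy'⟩ hxy
  refine hinj hx hy (A.injective ?_)
  have hx'' : c.2 (E x) = A (F x) := hx'
  have hy'' : c.2 (E y) = A (F y) := hy'
  rw [← hx'', ← hy'', hxy]

end

variable {M : Type*} [TopologicalSpace M] {𝒜 : HyperbolicAtlas M} {ι : Type*}
variable {R : ℝ} {κ : ι → ℝ} {φ : ι → Plane → M} [T2Space M]

/-- `E` is the collar of the torus `i`, in tube coordinates: it consists of the exterior collar and
an immersed interior collar of depth `δ`. -/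
structure IsCollar (S : IsTubeSystem 𝒜 R κ φ) (i : ι) (δ : ℝ) (E : Plane × ℝ → extended 𝒜 R) :
    Prop where
  dev : ∀ a : Plane × ℝ, -R < a.2 → a.2 < δ →
    IsDevAt S.extAtlas E (fun a => tube (κ i) a.1 a.2) univ a
  eq : ∀ a : Plane × ℝ, -R < a.2 → a.2 ≤ 0 → E a = collarPt 𝒜 R (φ i a.1) a.2

/-- Collars of all tori, of depths `δ' i > δ i`. Their parts of depth less than `δ i` are embedded
and pairwise disjoint. -/
structure IsCollarFamily (S : IsTubeSystem 𝒜 R κ φ) (δ δ' : ι → ℝ)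
    (E : ι → Plane × ℝ → extended 𝒜 R) : Prop where
  nonneg : ∀ i, 0 ≤ δ i
  lt : ∀ i, δ i < δ' i
  collar : ∀ i, IsCollar S i (δ' i) (E i)
  inj : ∀ i j (a b : Plane × ℝ), -R < a.2 → a.2 < δ i → -R < b.2 → b.2 < δ j → E i a = E j b →
    a.2 = b.2 ∧ φ i a.1 = φ j b.1

namespace IsTubeSystem

variable (S : IsTubeSystem 𝒜 R κ φ)
include S

theorem tendsto_tube (i : ι) (a : Plane × ℝ) :
    Tendsto (fun a : Plane × ℝ => tube (κ i) a.1 a.2) (𝓝 a) (𝓝[hyp3] (tube (κ i) a.1 a.2)) :=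
  tendsto_nhdsWithin_iff.2 ⟨(continuous_tube (κ i)).tendsto a,
    Eventually.of_forall fun b => tube_mem (S.κ_pos i) b.1 b.2⟩

theorem map_tube (i : ι) {a : Plane × ℝ} (ha : -R < a.2) :
    map (fun a : Plane × ℝ => tube (κ i) a.1 a.2) (𝓝 a) = 𝓝[hyp3] (tube (κ i) a.1 a.2) :=
  map_tube_nhds (S.κ_pos i) a.1 a.2 (S.stretch_pos i ha).ne' (S.stretch_inv_pos i ha).ne'

theorem isOpenAt_tube (i : ι) {a : Plane × ℝ} (ha : -R < a.2) :
    IsOpenAt (fun a : Plane × ℝ => tube (κ i) a.1 a.2) univ a :=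
  ⟨tube_mem (S.κ_pos i) _ _, by rw [nhdsWithin_univ, S.map_tube i ha]⟩

theorem exists_injOn_tube (i : ι) {a : Plane × ℝ} (ha : -R < a.2) :
    ∃ s ∈ 𝓝 a, InjOn (fun a : Plane × ℝ => tube (κ i) a.1 a.2) s :=
  eventually_tube_injective (S.κ_pos i) a.1 a.2 (S.stretch_pos i ha) (S.stretch_inv_pos i ha)

theorem isDevAt_collarPt (i : ι) {a : Plane × ℝ} (h1 : -R < a.2) (h2 : a.2 < 0) :
    IsDevAt S.extAtlas (fun a : Plane × ℝ => collarPt 𝒜 R (φ i a.1) a.2)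
      (fun a => tube (κ i) a.1 a.2) univ a := by
  have hev : ∀ᶠ b : Plane × ℝ in 𝓝 a,
      (collarPt 𝒜 R (φ i b.1) b.2).1 = (φ i b.1, b.2) := by
    filter_upwards [continuous_snd.continuousAt.eventually (lt_mem_nhds h1),
      continuous_snd.continuousAt.eventually (gt_mem_nhds h2)] with b hb1 hb2
    exact collarPt_val (S.mem_extended i b.1 hb1 hb2.le)
  have ha := hev.self_of_nhds
  obtain ⟨d, hd, had⟩ := S.extAtlas.cover (collarPt 𝒜 R (φ i a.1) a.2)
  have hd' := hd
  obtain ⟨-, -, c, hc, hdc, hdU⟩ := hd'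
  have hac := hdU _ had
  rw [ha] at hac
  obtain ⟨A, hA⟩ := (S.isTubeMap i).chart a.1 c hc hac
  refine isDevAt_of_chart hd ?_ had hA.iso ?_
  · rw [ContinuousWithinAt, nhdsWithin_univ, tendsto_subtype_rng, ha]
    have hc : Continuous fun b : Plane × ℝ => (φ i b.1, b.2) :=
      ((S.isTubeMap i).continuous.comp continuous_fst).prodMk continuous_snd
    exact (hc.tendsto a).congr' (hev.mono fun b hb => hb.symm)
  · rw [nhdsWithin_univ]
    filter_upwards [hev, continuous_fst.continuousAt.eventually hA.eventually_germ] with b hb1 hb2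
    rw [hdc, S.extChart_eq hb2 (by rw [hb1]), hb1]

theorem isCollar_zero (i : ι) :
    IsCollar S i 0 (fun a : Plane × ℝ => collarPt 𝒜 R (φ i a.1) a.2) :=
  ⟨fun _ h1 h2 => S.isDevAt_collarPt i h1 h2, fun _ _ _ => rfl⟩

end IsTubeSystem

namespace IsCollar

variable {S : IsTubeSystem 𝒜 R κ φ} {i : ι} {δ δ' : ℝ} {E E' : Plane × ℝ → extended 𝒜 R}

theorem mono (h : IsCollar S i δ E) (hδ : δ' ≤ δ) : IsCollar S i δ' E :=
  ⟨fun a h1 h2 => h.dev a h1 (h2.trans_le hδ), h.eq⟩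

theorem val_eq (h : IsCollar S i δ E) {a : Plane × ℝ} (h1 : -R < a.2) (h2 : a.2 ≤ 0) :
    (E a).1 = (φ i a.1, a.2) := by
  rw [h.eq a h1 h2, collarPt_val (S.mem_extended i a.1 h1 h2)]

theorem map_nhds (h : IsCollar S i δ E) {a : Plane × ℝ} (h1 : -R < a.2) (h2 : a.2 < δ) :
    map E (𝓝 a) = 𝓝 (E a) := (h.dev a h1 h2).map_nhds (S.map_tube i h1)

theorem continuousAt (h : IsCollar S i δ E) {a : Plane × ℝ} (h1 : -R < a.2) (h2 : a.2 < δ) :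
    ContinuousAt E a := (h.map_nhds h1 h2).le

theorem exists_injOn (h : IsCollar S i δ E) {a : Plane × ℝ} (h1 : -R < a.2) (h2 : a.2 < δ) :
    ∃ s ∈ 𝓝 a, InjOn E s := (h.dev a h1 h2).exists_injOn (S.exists_injOn_tube i h1)

omit [T2Space M] in
theorem isPreconnected_vertical (z : Plane) {s : Set ℝ} (hs : IsPreconnected s) :
    IsPreconnected ((fun h : ℝ => (z, h)) '' s) :=
  hs.image _ (by fun_prop : Continuous fun h : ℝ => (z, h)).continuousOn

theorem unique (h : IsCollar S i δ E) (h' : IsCollar S i δ' E') {a : Plane × ℝ} (h1 : -R < a.2)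
    (h2 : a.2 < δ) (h3 : a.2 < δ') : E a = E' a := by
  obtain ⟨z, t⟩ := a
  rcases le_or_gt t 0 with h0 | h0
  · rw [h.eq _ h1 h0, h'.eq _ h1 h0]
  have hR := S.pos
  have key := dev_unique (𝒪 := S.extAtlas) (E := E) (E' := E') (W := univ)
    (F := fun a : Plane × ℝ => tube (κ i) a.1 a.2) (S := (fun h : ℝ => (z, h)) '' Icc (-(R / 2)) t)
    (subset_univ _) (isPreconnected_vertical z isPreconnected_Icc) ?_ ?_ ?_
    (w₀ := (z, -(R / 2))) (w := (z, t)) ⟨_, ⟨le_rfl, by linarith⟩, rfl⟩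
    ⟨_, ⟨by linarith, le_rfl⟩, rfl⟩ ?_
  · rw [nhdsWithin_univ] at key; exact key.self_of_nhds
  · rintro _ ⟨u, hu, rfl⟩
    exact h.dev _ (by change -R < u; linarith [hu.1]) (hu.2.trans_lt h2)
  · rintro _ ⟨u, hu, rfl⟩
    exact h'.dev _ (by change -R < u; linarith [hu.1]) (hu.2.trans_lt h3)
  · rintro _ ⟨u, hu, rfl⟩
    exact S.isOpenAt_tube i (by change -R < u; linarith [hu.1])
  · rw [nhdsWithin_univ]
    have e1 : ∀ᶠ b : Plane × ℝ in 𝓝 (z, -(R / 2)), -R < b.2 :=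
      continuous_snd.continuousAt.eventually (lt_mem_nhds (by simp only; linarith))
    have e2 : ∀ᶠ b : Plane × ℝ in 𝓝 (z, -(R / 2)), b.2 < 0 :=
      continuous_snd.continuousAt.eventually (gt_mem_nhds (by simp only; linarith))
    filter_upwards [e1, e2] with b h1 h2
    rw [h.eq _ h1 h2.le, h'.eq _ h1 h2.le]

/-- Collars are invariant under the deck transformations of the torus. -/
theorem deck (h : IsCollar S i δ E) {z₀ z₁ : Plane} (h01 : φ i z₀ = φ i z₁) {a : Plane × ℝ}
    (h1 : -R < a.2) (h2 : a.2 < δ) : E (a.1 + (z₁ - z₀), a.2) = E a := by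
  have hκ := S.κ_pos i
  refine IsCollar.unique (S := S) (i := i) (δ := δ) (δ' := δ)
    (E := fun a => E (a.1 + (z₁ - z₀), a.2)) ⟨?_, ?_⟩ h h1 h2 h2
  · intro b hb1 hb2
    have hc : Continuous fun a : Plane × ℝ => (a.1 + (z₁ - z₀), a.2) := by fun_prop
    have := (h.dev (b.1 + (z₁ - z₀), b.2) hb1 hb2).comp
      (g := fun a : Plane × ℝ => (a.1 + (z₁ - z₀), a.2)) (W' := univ) (w' := b)
      (by simpa only [nhdsWithin_univ] using hc.tendsto b)
    refine this.of_iso (isHypIso_tubeTrans (κ i) (z₁ - z₀)) (Eventually.of_forall fun b => ?_)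
    simp only
    rw [tubeTrans_tube hκ, add_comm]
  · intro b hb1 hb2
    refine (h.eq (b.1 + (z₁ - z₀), b.2) hb1 hb2).trans ?_
    simp only
    rw [(S.isTubeMap i).deck hκ h01]

theorem eq_of_eq (h : IsCollar S i δ E) {z₀ z₁ : Plane} (h01 : φ i z₀ = φ i z₁) {t : ℝ}
    (h1 : -R < t) (h2 : t < δ) : E (z₀, t) = E (z₁, t) := by
  have := h.deck h01 (a := (z₀, t)) h1 h2
  simpa using this.symm

end IsCollar

/-- A collar whose interior part stays in `M` can be continued by a uniform amount. -/
theorem IsTubeSystem.exists_collar_extension [CompactSpace M] (S : IsTubeSystem 𝒜 R κ φ) :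
    ∃ η > 0, ∀ i δ E, 0 ≤ δ → IsCollar S i δ E →
      (∀ a : Plane × ℝ, 0 ≤ a.2 → a.2 < δ → (E a).1.2 = 0) →
      ∃ E', IsCollar S i (δ + η) E' ∧ ∀ a : Plane × ℝ, -R < a.2 → a.2 < δ → E' a = E a := by
  have hR := S.pos
  obtain ⟨ε, hε, hK⟩ := OpenAtlas.exists_uniform_inverse (𝒪 := S.extAtlas)
    (isCompact_height (𝒜 := 𝒜) (R := R) (r := R / 2) (by linarith))
  have hη : 0 < min ε R / 3 := by have := lt_min hε hR; linarith
  obtain ⟨η, hηe⟩ : ∃ η, η = min ε R / 3 := ⟨_, rfl⟩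
  rw [← hηe] at hη
  have hηε : 3 * η ≤ ε := by rw [hηe]; linarith [min_le_left ε R]
  have hηR : 3 * η ≤ R := by rw [hηe]; linarith [min_le_right ε R]
  refine ⟨η, hη, fun i δ E hδ hE hM => ?_⟩
  have hκ := S.κ_pos i
  have hmemK : ∀ z : Plane, E (z, δ - η) ∈ {p : extended 𝒜 R | -(R / 2) ≤ p.1.2} := by
    intro z
    change -(R / 2) ≤ (E (z, δ - η)).1.2
    rcases le_total (δ - η) 0 with h | h
    · rw [hE.val_eq (by change -R < δ - η; linarith) h]; change -(R / 2) ≤ δ - η; linarith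
    · rw [hM _ h (by change δ - η < δ; linarith)]; linarith
  have hchoice : ∀ z : Plane, ∃ f : Mink → extended 𝒜 R,
      IsDevOn S.extAtlas f (hball (tube (κ i) z (δ - η)) ε) ∧
      ∀ᶠ a : Plane × ℝ in 𝓝 (z, δ - η), f (tube (κ i) a.1 a.2) = E a := by
    intro z
    have := (hE.dev (z, δ - η) (by change -R < δ - η; linarith)
      (by change δ - η < δ; linarith)).exists_continuation hK hε (mem_univ _)
      (by rw [nhdsWithin_univ]; exact S.tendsto_tube i _) (tube_mem hκ _ _) (hmemK z)
    rwa [nhdsWithin_univ] at this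
  choose f hf1 hf2 using hchoice
  have hcomp : ∀ z (a : Plane × ℝ), tube (κ i) a.1 a.2 ∈ hball (tube (κ i) z (δ - η)) ε →
      IsDevAt S.extAtlas (fun a : Plane × ℝ => f z (tube (κ i) a.1 a.2))
        (fun a => tube (κ i) a.1 a.2) univ a := by
    intro z a ha
    exact IsDevAt.comp (g := fun a : Plane × ℝ => tube (κ i) a.1 a.2) (hf1 z _ ha)
      (by rw [nhdsWithin_univ]; exact S.tendsto_tube i a)
  have hvert : ∀ z t, δ - η ≤ t → t ≤ δ + η →
      tube (κ i) z t ∈ hball (tube (κ i) z (δ - η)) ε := by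
    intro z t h1 h2
    refine ⟨tube_mem hκ _ _, ?_⟩
    rw [hcosh_tube hκ, sub_self, sub_self, vn_zero, vn_zero, mul_zero, mul_zero, add_zero,
      add_zero, ← Real.cosh_neg]
    exact cosh_lt_cosh_of_nonneg (by linarith) (by linarith)
  -- the local continuations agree with the given collar
  have hagree : ∀ z t, δ - η ≤ t → t < δ →
      ∀ᶠ a : Plane × ℝ in 𝓝 (z, t), f z (tube (κ i) a.1 a.2) = E a := by
    intro z t h1 h2
    have := dev_unique (𝒪 := S.extAtlas) (E := fun a : Plane × ℝ => f z (tube (κ i) a.1 a.2))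
      (E' := E) (W := univ) (F := fun a : Plane × ℝ => tube (κ i) a.1 a.2)
      (S := (fun h : ℝ => (z, h)) '' Icc (δ - η) t)
      (subset_univ _) (IsCollar.isPreconnected_vertical z isPreconnected_Icc) ?_ ?_ ?_
      (w₀ := (z, δ - η)) (w := (z, t)) ⟨_, ⟨le_rfl, h1⟩, rfl⟩ ⟨_, ⟨h1, le_rfl⟩, rfl⟩ ?_
    · rwa [nhdsWithin_univ] at this
    · rintro _ ⟨u, hu, rfl⟩
      exact hcomp z _ (hvert z u hu.1 (by linarith [hu.2]))
    · rintro _ ⟨u, hu, rfl⟩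
      exact hE.dev _ (by change -R < u; linarith [hu.1]) (hu.2.trans_lt h2)
    · rintro _ ⟨u, hu, rfl⟩
      exact S.isOpenAt_tube i (by change -R < u; linarith [hu.1])
    · rw [nhdsWithin_univ]; exact hf2 z
  -- the local continuations agree with each other
  have hagree' : ∀ z, ∀ᶠ z' in 𝓝 z, ∀ t, δ - η ≤ t → t ≤ δ + η →
      f z' (tube (κ i) z' t) = f z (tube (κ i) z' t) := by
    intro z
    have e1 : ∀ᶠ z' in 𝓝 z, ∀ t ∈ Icc (δ - η) (δ + η),
        tube (κ i) z' t ∈ hball (tube (κ i) z (δ - η)) ε := by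
      have := isCompact_Icc.eventually_forall_of_forall_eventually (x₀ := z)
        (P := fun z' t => tube (κ i) z' t ∈ hball (tube (κ i) z (δ - η)) ε)
        (K := Icc (δ - η) (δ + η)) ?_
      · exact this
      · intro t ht
        exact (S.tendsto_tube i (z, t)).eventually (hball_mem_nhdsWithin (hvert z t ht.1 ht.2))
    have e2 : ∀ᶠ z' in 𝓝 z, ∀ᶠ a : Plane × ℝ in 𝓝 (z', δ - η),
        f z (tube (κ i) a.1 a.2) = E a := by
      have h1 := eventually_eventually_nhds.2 (hf2 z)
      have hc : Continuous fun z' : Plane => (z', δ - η) := by fun_prop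
      exact (hc.tendsto z).eventually h1
    filter_upwards [e1, e2] with z' h1 h2 t ht1 ht2
    have := dev_unique (𝒪 := S.extAtlas) (E := fun a : Plane × ℝ => f z' (tube (κ i) a.1 a.2))
      (E' := fun a : Plane × ℝ => f z (tube (κ i) a.1 a.2)) (W := univ)
      (F := fun a : Plane × ℝ => tube (κ i) a.1 a.2)
      (S := (fun h : ℝ => (z', h)) '' Icc (δ - η) t)
      (subset_univ _) (IsCollar.isPreconnected_vertical z' isPreconnected_Icc) ?_ ?_ ?_
      (w₀ := (z', δ - η)) (w := (z', t)) ⟨_, ⟨le_rfl, ht1⟩, rfl⟩ ⟨_, ⟨ht1, le_rfl⟩, rfl⟩ ?_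
    · rw [nhdsWithin_univ] at this; exact this.self_of_nhds
    · rintro _ ⟨u, hu, rfl⟩
      exact hcomp z' _ (hvert z' u hu.1 (hu.2.trans ht2))
    · rintro _ ⟨u, hu, rfl⟩
      exact hcomp z _ (h1 u ⟨hu.1, hu.2.trans ht2⟩)
    · rintro _ ⟨u, hu, rfl⟩
      exact S.isOpenAt_tube i (by change -R < u; linarith [hu.1])
    · rw [nhdsWithin_univ]
      filter_upwards [hf2 z', h2] with a g1 g2
      rw [g1, g2]
  classical
  obtain ⟨E', hE'⟩ : ∃ E' : Plane × ℝ → extended 𝒜 R, E' = fun a =>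
    if a.2 < δ - η then E a else f a.1 (tube (κ i) a.1 a.2) := ⟨_, rfl⟩
  have heq : ∀ a : Plane × ℝ, a.2 < δ → E' a = E a := by
    rintro ⟨z, t⟩ ht
    rw [hE']
    simp only
    split_ifs with h
    · rfl
    · exact (hagree z t (not_lt.1 h) ht).self_of_nhds
  have heq' : ∀ a : Plane × ℝ, δ - η ≤ a.2 → E' a = f a.1 (tube (κ i) a.1 a.2) := by
    intro a ha
    rw [hE']
    simp only
    rw [if_neg (not_lt.2 ha)]
  have hdev : ∀ a : Plane × ℝ, -R < a.2 → a.2 < δ + η →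
      IsDevAt S.extAtlas E' (fun a => tube (κ i) a.1 a.2) univ a := by
    rintro ⟨z, t⟩ h1 h2
    rcases lt_or_ge t δ with h | h
    · refine (hE.dev (z, t) h1 h).congr (mem_univ _) ?_
      rw [nhdsWithin_univ]
      filter_upwards [continuous_snd.continuousAt.eventually (gt_mem_nhds h)] with b hb
      exact heq b hb
    · refine (hcomp z (z, t) (hvert z t (by linarith) (le_of_lt h2))).congr (mem_univ _) ?_
      rw [nhdsWithin_univ]
      have h2' : t < δ + η := h2
      have e1 : ∀ᶠ b : Plane × ℝ in 𝓝 (z, t), δ - η < b.2 :=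
        continuous_snd.continuousAt.eventually (lt_mem_nhds (by simp only; linarith))
      have e2 : ∀ᶠ b : Plane × ℝ in 𝓝 (z, t), b.2 < δ + η :=
        continuous_snd.continuousAt.eventually (gt_mem_nhds h2')
      filter_upwards [e1, e2, continuous_fst.continuousAt.eventually (hagree' z)] with b g1 g2 g3
      rw [heq' b g1.le]
      exact g3 b.2 g1.le g2.le
  refine ⟨E', ⟨hdev, ?_⟩, fun a _ h => heq a h⟩
  · intro a h1 h2
    rcases lt_or_ge a.2 δ with h | h
    · rw [heq a h, hE.eq a h1 h2]
    · -- this only concerns `δ = 0`, where continuity at height zero is used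
      have ha0 : a.2 = 0 := le_antisymm h2 (hδ.trans h)
      have hδ0 : δ = 0 := le_antisymm (h.trans h2) hδ
      obtain ⟨z, t⟩ := a
      simp only at ha0
      subst ha0 hδ0
      have hcont : Tendsto E' (𝓝 (z, 0)) (𝓝 (E' (z, 0))) := by
        have := (hdev (z, 0) h1 (by simpa using hη)).continuousWithinAt.tendsto
        rwa [nhdsWithin_univ] at this
      have hc : Continuous fun t : ℝ => (z, t) := by fun_prop
      have t1 : Tendsto (fun t : ℝ => (E' (z, t)).1) (𝓝[<] 0) (𝓝 (E' (z, 0)).1) :=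
        ((continuous_subtype_val.tendsto _).comp (hcont.comp (hc.tendsto 0))).mono_left
          nhdsWithin_le_nhds
      have hc' : Continuous fun t : ℝ => (φ i z, t) := by fun_prop
      have t2 : Tendsto (fun t : ℝ => (E' (z, t)).1) (𝓝[<] 0) (𝓝 (φ i z, 0)) := by
        refine ((hc'.tendsto 0).mono_left nhdsWithin_le_nhds).congr' ?_
        filter_upwards [self_mem_nhdsWithin, nhdsWithin_le_nhds (lt_mem_nhds (neg_lt_zero.2 hR))]
          with t ht ht'
        rw [heq (z, t) ht, hE.val_eq (a := (z, t)) ht' (le_of_lt ht)]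
      refine Subtype.ext ?_
      rw [tendsto_nhds_unique t1 t2, collarPt_val (S.mem_extended i z h1 le_rfl)]

end

section

/-! ### Balls inside collars -/

section

variable {Y : Type*} [TopologicalSpace Y] {𝒪 : OpenAtlas Y} {X : Type*} [TopologicalSpace X]

theorem IsDevAt.exists_germ {e : Mink → Y} {x : Mink} (he : IsDevAt 𝒪 e id hyp3 x) (hx : x ∈ hyp3)
    {E : X → Y} {F : X → Mink} {a : X} (hE : IsDevAt 𝒪 E F univ a)
    (hF : Tendsto F (𝓝 a) (𝓝[hyp3] (F a))) (h : e x = E a) :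
    ∃ B : Mink ≃ₗ[ℝ] Mink, IsHypIso B ∧ B (F a) = x ∧ ∀ᶠ a' in 𝓝 a, e (B (F a')) = E a' := by
  obtain ⟨c, hc, hxc⟩ := 𝒪.cover (e x)
  obtain ⟨A, hA, hAe⟩ := he.chart c hc hxc
  obtain ⟨A', hA', hAe'⟩ := hE.chart c hc (h ▸ hxc)
  have hcont := hE.continuousWithinAt
  rw [ContinuousWithinAt] at hcont
  rw [nhdsWithin_univ] at hAe' hcont
  have h0 : A x = A' (F a) := by
    have h1 : c.2 (e x) = A (id x) := hAe.self_of_nhdsWithin hx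
    rw [← hAe'.self_of_nhds, ← h, h1, id]
  have hB : A.symm (A' (F a)) = x := by rw [← h0, LinearEquiv.symm_apply_apply]
  have hBi : IsHypIso (A'.trans A.symm) := hA'.trans hA.symm
  refine ⟨A'.trans A.symm, hBi, hB, ?_⟩
  have ho := (𝒪.isOpen_source c hc)
  have ht : Tendsto (fun a' => (A'.trans A.symm) (F a')) (𝓝 a) (𝓝[hyp3] x) := by
    have := (hBi.tendsto (F a)).comp hF
    rwa [show (A'.trans A.symm) (F a) = x from hB] at this
  filter_upwards [hAe', hcont.eventually (ho.mem_nhds (h ▸ hxc)), ht.eventually hAe,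
    ht.eventually (he.continuousWithinAt.eventually (ho.mem_nhds hxc))] with a' h1 h2 h3 h4
  refine 𝒪.injOn c hc h4 h2 ?_
  rw [h3, h1, id, LinearEquiv.trans_apply, LinearEquiv.apply_symm_apply]

theorem IsDevAt.germ_unique {e : Mink → Y} {F : X → Mink} {a : X} {B B' : Mink ≃ₗ[ℝ] Mink}
    (he : IsDevAt 𝒪 e id hyp3 (B (F a))) (hB : IsHypIso B) (hB' : IsHypIso B')
    (hF : map F (𝓝 a) = 𝓝[hyp3] (F a)) (hF3 : F a ∈ hyp3) (h : B (F a) = B' (F a))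
    (heq : ∀ᶠ a' in 𝓝 a, e (B (F a')) = e (B' (F a'))) : B = B' := by
  obtain ⟨c, hc, hxc⟩ := 𝒪.cover (e (B (F a)))
  obtain ⟨A, hA, hAe⟩ := he.chart c hc hxc
  have t1 : Tendsto (fun a' => B (F a')) (𝓝 a) (𝓝[hyp3] (B (F a))) :=
    (hB.tendsto (F a)).comp hF.le
  have t2 : Tendsto (fun a' => B' (F a')) (𝓝 a) (𝓝[hyp3] (B (F a))) := by
    rw [h]; exact (hB'.tendsto (F a)).comp hF.le
  refine linearEquiv_eq_of_eventuallyEq hF3 ?_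
  rw [← hF]
  rw [eventually_map]
  filter_upwards [t1.eventually hAe, t2.eventually hAe, heq] with a' h1 h2 h3
  refine A.injective ?_
  have h1' : c.2 (e (B (F a'))) = A (B (F a')) := h1
  have h2' : c.2 (e (B' (F a'))) = A (B' (F a')) := h2
  rw [← h1', ← h2', h3]

end

variable {M : Type*} [TopologicalSpace M] {𝒜 : HyperbolicAtlas M} {ι : Type*}
variable {R : ℝ} {κ : ι → ℝ} {φ : ι → Plane → M}

theorem IsTubeSystem.stretch_nonneg (S : IsTubeSystem 𝒜 R κ φ) (i : ι) {h : ℝ} (hh : -R ≤ h) :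
    0 ≤ stretch (κ i) h ∧ 0 ≤ stretch (κ i)⁻¹ h := by
  have hc : ∀ k, Continuous fun h => stretch k h := by
    intro k
    have h1 := Real.continuous_cosh; have h2 := Real.continuous_sinh
    unfold stretch; fun_prop
  have h1 : ∀ k, (∀ h, -R < h → 0 < stretch k h) → 0 ≤ stretch k h := by
    intro k hk
    have : h ∈ closure (Ioi (-R)) := by rw [closure_Ioi]; exact hh
    have h2 : closure (Ioi (-R)) ⊆ {h | 0 ≤ stretch k h} :=
      closure_minimal (fun h hh => (hk h hh).le) (isClosed_le continuous_const (hc k))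
    exact h2 this
  exact ⟨h1 _ fun h => S.stretch_pos i, h1 _ fun h => S.stretch_inv_pos i⟩

/-- Points inside a ball of radius `r ≤ R` that touches the level surface of height `t` from below
have smaller height. -/
theorem IsTubeSystem.height_lt (S : IsTubeSystem 𝒜 R κ φ) (i : ι) {w z : Plane} {t h r : ℝ}
    (hr : 0 ≤ r) (ht : r - R ≤ t) (hh : -R < h)
    (hlt : hcosh (tube (κ i) w (t - r)) (tube (κ i) z h) < Real.cosh r) : h < t := by
  rw [hcosh_tube (S.κ_pos i)] at hlt
  have h1 := S.stretch_nonneg i (h := t - r) (by linarith)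
  have e5 := mul_nonneg (mul_nonneg h1.1 (S.stretch_pos i hh).le)
    (vn_nonneg (mX (κ i)) (w 0 - z 0))
  have e6 := mul_nonneg (mul_nonneg h1.2 (S.stretch_inv_pos i hh).le)
    (vn_nonneg (mY (κ i)) (w 1 - z 1))
  have h3 : Real.cosh (t - r - h) < Real.cosh r := by linarith
  have := Real.cosh_lt_cosh.1 h3
  rw [abs_of_nonneg hr] at this
  have := (abs_lt.1 this).1
  linarith

variable [T2Space M]

/-- Let a developing map on a ball agree with the collar of the torus `j` near a boundary
point `q` of that collar. Then they agree on the part of the ball of radius `R` that touches the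
collar from within at `q`. -/
theorem IsCollar.exists_of_tangent_ball {S : IsTubeSystem 𝒜 R κ φ} {j : ι} {δ t : ℝ}
    {E : Plane × ℝ → extended 𝒜 R} (hE : IsCollar S j δ E) (ht : 0 ≤ t) (htδ : t < δ) {p : Mink}
    (hp : p ∈ hyp3) {r : ℝ} {e : Mink → extended 𝒜 R} (he : IsDevOn S.extAtlas e (hball p r))
    {B : Mink ≃ₗ[ℝ] Mink} (hB : IsHypIso B) {w : Plane} (hw : B (tube (κ j) w t) ∈ hball p r)
    (hgerm : ∀ᶠ a : Plane × ℝ in 𝓝 (w, t), e (B (tube (κ j) a.1 a.2)) = E a) {m : Mink}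
    (hm : m ∈ hball p r) (hmR : hcosh (B (tube (κ j) w (t - R))) m < Real.cosh R) :
    ∃ a : Plane × ℝ, -R < a.2 ∧ a.2 < t ∧ B (tube (κ j) a.1 a.2) = m ∧
      ∀ᶠ a' : Plane × ℝ in 𝓝 a, e (B (tube (κ j) a'.1 a'.2)) = E a' := by
  have hκ := S.κ_pos j
  have hR := S.pos
  have hc3 : B (tube (κ j) w (t - R)) ∈ hyp3 := hB.mem_hyp3 _ (tube_mem hκ _ _)
  obtain ⟨q, hq⟩ : ∃ q, q = B (tube (κ j) w t) := ⟨_, rfl⟩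
  have hq3 : q ∈ hyp3 := by rw [hq]; exact hB.mem_hyp3 _ (tube_mem hκ _ _)
  rw [← hq] at hw
  have hcq : hcosh (B (tube (κ j) w (t - R))) q = Real.cosh R := by
    rw [hq, hB.hcosh_eq, hcosh_tube hκ, sub_self, sub_self, vn_zero, vn_zero, mul_zero, mul_zero,
      add_zero, add_zero, sub_sub_cancel_left, Real.cosh_neg]
  obtain ⟨γ, hγ⟩ : ∃ γ, γ = hseg q m := ⟨_, rfl⟩
  have hγball : ∀ u ∈ Icc (0 : ℝ) 1, γ u ∈ hball p r := fun u hu => by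
    rw [hγ]; exact hseg_mem_hball hp hw hm hu
  have hγR : ∀ u ∈ Ioc (0 : ℝ) 1, hcosh (B (tube (κ j) w (t - R))) (γ u) < Real.cosh R := by
    intro u hu
    have := hcosh_hseg_le hc3 hq3 hm.1 (Ioc_subset_Icc_self hu)
    rw [← hγ, hcq] at this
    nlinarith [hu.1]
  have hγ0 : γ 0 = q := by rw [hγ, hseg_zero hq3]
  have hγ1 : γ 1 = m := by rw [hγ, hseg_one q hm.1]
  have hγt : ∀ u ∈ Icc (0 : ℝ) 1, Tendsto γ (𝓝[Icc 0 1] u) (𝓝[hyp3] (γ u)) := by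
    intro u hu
    refine tendsto_nhdsWithin_iff.2 ⟨?_, ?_⟩
    · rw [hγ]; exact continuousOn_hseg hq3 hm.1 u hu
    · filter_upwards [self_mem_nhdsWithin] with u' hu' using (hγball u' hu').1
  -- the points reached so far
  obtain ⟨G, hG⟩ : ∃ G : Mink → Prop, ∀ x, G x ↔ ∃ a : Plane × ℝ, -R < a.2 ∧ a.2 < t ∧
      B (tube (κ j) a.1 a.2) = x ∧
      ∀ᶠ a' : Plane × ℝ in 𝓝 a, e (B (tube (κ j) a'.1 a'.2)) = E a' := ⟨_, fun _ => Iff.rfl⟩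
  rw [← hG, ← hγ1]
  have hBt : ∀ a : Plane × ℝ, -R < a.2 →
      map (fun a : Plane × ℝ => B (tube (κ j) a.1 a.2)) (𝓝 a)
        = 𝓝[hyp3] (B (tube (κ j) a.1 a.2)) := by
    intro a ha
    rw [← hB.map_nhdsWithin, ← S.map_tube j ha, map_map]; rfl
  have hht : ∀ (a : Plane × ℝ) (x : Mink), -R < a.2 → B (tube (κ j) a.1 a.2) = x →
      hcosh (B (tube (κ j) w (t - R))) x < Real.cosh R → a.2 < t := by
    intro a x ha hax hx
    rw [← hax, hB.hcosh_eq] at hx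
    exact S.height_lt j hR.le (by linarith) ha hx
  have hlocal : ∀ a : Plane × ℝ, -R < a.2 →
      (∀ᶠ a' : Plane × ℝ in 𝓝 a, e (B (tube (κ j) a'.1 a'.2)) = E a') →
      ∀ᶠ x in 𝓝[hyp3] (B (tube (κ j) a.1 a.2)),
        hcosh (B (tube (κ j) w (t - R))) x < Real.cosh R → G x := by
    intro a ha hgerm
    rw [← hBt a ha, eventually_map]
    filter_upwards [continuous_snd.continuousAt.eventually (lt_mem_nhds ha),
      eventually_eventually_nhds.2 hgerm] with b hb1 hb2 hb3
    exact (hG _).2 ⟨b, hb1, hht b _ hb1 rfl hb3, rfl, hb2⟩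
  have hstart : ∃ u₀ ∈ Ioc (0 : ℝ) 1, G (γ u₀) := by
    have h1 := hlocal (w, t) (by simp only; linarith) hgerm
    simp only at h1
    rw [← hq, ← hγ0] at h1
    have h2 := (hγt 0 ⟨le_rfl, zero_le_one⟩).eventually h1
    have h3 : 𝓝[Ioc (0 : ℝ) 1] 0 ≤ 𝓝[Icc 0 1] 0 := nhdsWithin_mono _ Ioc_subset_Icc_self
    have : (𝓝[Ioc (0 : ℝ) 1] 0).NeBot := by
      rw [← mem_closure_iff_nhdsWithin_neBot, closure_Ioc zero_ne_one]
      exact ⟨le_rfl, zero_le_one⟩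
    obtain ⟨u, hu1, hu2⟩ := ((h2.filter_mono h3).and self_mem_nhdsWithin).exists
    exact ⟨u, hu2, hu1 (hγR u hu2)⟩
  obtain ⟨u₀, hu₀, hGu₀⟩ := hstart
  refine (preconnected_iff_of_eventually (P := fun u => G (γ u)) isPreconnected_Ioc ?_ hu₀
    ⟨one_pos, le_rfl⟩).1 hGu₀
  intro u hu
  have huI := Ioc_subset_Icc_self hu
  have hmono : 𝓝[Ioc (0 : ℝ) 1] u ≤ 𝓝[Icc 0 1] u := nhdsWithin_mono _ Ioc_subset_Icc_self
  by_cases hGu : G (γ u)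
  · obtain ⟨a, h1, h2, h3, h4⟩ := (hG _).1 hGu
    have h5 := hlocal a h1 h4
    rw [h3] at h5
    filter_upwards [hmono ((hγt u huI).eventually h5), self_mem_nhdsWithin] with u' h6 h7
    exact ⟨fun _ => hGu, fun _ => h6 (hγR u' h7)⟩
  by_contra hcon
  have hfreq : ∃ᶠ u' in 𝓝[Ioc (0 : ℝ) 1] u, G (γ u') := by
    intro h
    refine hcon ?_
    filter_upwards [h] with u' hu'
    exact ⟨fun h => absurd h hu', fun h => absurd h hGu⟩
  apply hGu
  obtain ⟨K, hK, hKφ⟩ := S.exists_compact j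
  have heγ : Tendsto (fun u => e (γ u)) (𝓝[Icc 0 1] u) (𝓝 (e (γ u))) :=
    (he _ (hγball u huI)).continuousWithinAt.tendsto.comp (hγt u huI)
  obtain ⟨ρ, hρ1, hρ2⟩ := exists_between (extended_height_gt hR (e (γ u)))
  have hhρ : ∀ᶠ u' in 𝓝[Ioc (0 : ℝ) 1] u, ρ < (e (γ u')).1.2 :=
    hmono ((((continuous_snd.comp continuous_subtype_val).tendsto _).comp heγ).eventually
      (lt_mem_nhds hρ2))
  -- pairs of a time and tube coordinates, the latter in a compact set
  let Rel : ℝ → Plane × ℝ → Prop := fun u' a => u' ∈ Ioc (0 : ℝ) 1 ∧ a.2 < t ∧ ∃ v : Plane,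
    φ j (a.1 + v) = φ j a.1 ∧ B (tube (κ j) (a.1 + v) a.2) = γ u' ∧
      ∀ᶠ a' : Plane × ℝ in 𝓝 a, e (B (tube (κ j) (a'.1 + v) a'.2)) = E a'
  have hrel : ∃ᶠ u' in 𝓝 u, ∃ a ∈ K ×ˢ Icc ρ t, Rel u' a := by
    rw [frequently_nhdsWithin_iff] at hfreq
    rw [eventually_nhdsWithin_iff] at hhρ
    refine (hfreq.and_eventually hhρ).mono ?_
    rintro u' ⟨⟨hGu', hu'⟩, hhu'⟩
    obtain ⟨a, h1, h2, h3, h4⟩ := (hG _).1 hGu'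
    obtain ⟨z, hzK, hz⟩ := hKφ a.1
    have hEa : e (γ u') = E a := by rw [← h3]; exact h4.self_of_nhds
    have ha2 : ρ ≤ a.2 := by
      rcases le_total a.2 0 with h0 | h0
      · have := hhu' hu'
        rw [hEa, hE.val_eq h1 h0] at this
        exact this.le
      · have := hhu' hu'
        linarith [extended_height_nonpos (e (γ u'))]
    refine ⟨(z, a.2), ⟨hzK, ha2, h2.le⟩, hu', h2, a.1 - z, ?_, ?_, ?_⟩
    · simp only [add_sub_cancel]; exact hz.symm
    · simp only [add_sub_cancel]; exact h3
    · have hc : Continuous fun b : Plane × ℝ => (b.1 + (a.1 - z), b.2) := by fun_prop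
      have h5 := hc.tendsto (z, a.2)
      simp only [add_sub_cancel] at h5
      have e1 : ∀ᶠ b : Plane × ℝ in 𝓝 (z, a.2), -R < b.2 :=
        (continuous_snd.tendsto (z, a.2)).eventually (lt_mem_nhds h1)
      have e2 : ∀ᶠ b : Plane × ℝ in 𝓝 (z, a.2), b.2 < δ :=
        (continuous_snd.tendsto (z, a.2)).eventually (gt_mem_nhds (h2.trans htδ))
      filter_upwards [h5.eventually h4, e1, e2] with b hb g1 g2
      rw [hb]
      exact hE.deck hz g1 g2
  have hcl : ∃ a ∈ K ×ˢ Icc ρ t, ∃ᶠ x : ℝ × (Plane × ℝ) in 𝓝 (u, a), Rel x.1 x.2 := by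
    by_contra hno
    push Not at hno
    have := (hK.prod isCompact_Icc).eventually_forall_of_forall_eventually (x₀ := u)
      (P := fun u' a => ¬ Rel u' a) hno
    refine hrel (this.mono ?_)
    rintro u' hu' ⟨a, ha, har⟩
    exact hu' a ha har
  obtain ⟨a, ⟨haK, haI⟩, hfr⟩ := hcl
  have haR : -R < a.2 := hρ1.trans_le haI.1
  have haδ : a.2 < δ := haI.2.trans_lt htδ
  have hEa : e (γ u) = E a := by
    have : (𝓝 (u, a) ⊓ 𝓟 {x : ℝ × (Plane × ℝ) | Rel x.1 x.2}).NeBot :=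
      frequently_mem_iff_neBot.1 hfr
    have hmem : ∀ᶠ x : ℝ × (Plane × ℝ) in 𝓝 (u, a) ⊓ 𝓟 {x | Rel x.1 x.2}, Rel x.1 x.2 :=
      mem_inf_of_right (mem_principal_self _)
    have t1 : Tendsto (fun x : ℝ × (Plane × ℝ) => e (γ x.1))
        (𝓝 (u, a) ⊓ 𝓟 {x | Rel x.1 x.2}) (𝓝 (e (γ u))) := by
      refine heγ.comp (tendsto_nhdsWithin_iff.2 ⟨?_, ?_⟩)
      · exact (continuous_fst.tendsto (u, a)).mono_left inf_le_left
      · exact hmem.mono fun x hx => Ioc_subset_Icc_self hx.1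
    have t2 : Tendsto (fun x : ℝ × (Plane × ℝ) => E x.2)
        (𝓝 (u, a) ⊓ 𝓟 {x | Rel x.1 x.2}) (𝓝 (E a)) :=
      (((hE.continuousAt haR haδ).tendsto).comp (continuous_snd.tendsto (u, a))).mono_left
        inf_le_left
    refine tendsto_nhds_unique_of_eventuallyEq t1 t2 (hmem.mono ?_)
    rintro ⟨u', b⟩ ⟨-, -, v, -, h2, h3⟩
    simp only
    rw [← h2, h3.self_of_nhds]
  obtain ⟨B', hB', hB'1, hB'2⟩ := (he _ (hγball u huI)).exists_germ (hγball u huI).1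
    (hE.dev a haR haδ) (S.tendsto_tube j a) hEa
  obtain ⟨s, hs, hinj⟩ := hE.exists_injOn haR haδ
  -- near the limit, the coordinates of the limit germ are those of the approximating points
  have himg : (fun a : Plane × ℝ => B' (tube (κ j) a.1 a.2)) ''
      {b | b ∈ s ∧ e (B' (tube (κ j) b.1 b.2)) = E b} ∈ 𝓝[hyp3] (γ u) := by
    rw [← hB'1, ← hB'.map_nhdsWithin, ← S.map_tube j haR, map_map]
    exact image_mem_map (inter_mem hs hB'2)
  have hev : ∀ᶠ x : ℝ × (Plane × ℝ) in 𝓝 (u, a), (x.1 ∈ Icc (0 : ℝ) 1 → γ x.1 ∈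
      (fun a : Plane × ℝ => B' (tube (κ j) a.1 a.2)) ''
        {b | b ∈ s ∧ e (B' (tube (κ j) b.1 b.2)) = E b}) ∧ x.2 ∈ s ∧ -R < x.2.2 ∧
      ∀ᶠ b : Plane × ℝ in 𝓝 x.2, e (B' (tube (κ j) b.1 b.2)) = E b := by
    have h1 := (hγt u huI).eventually himg
    rw [eventually_nhdsWithin_iff] at h1
    have h2 : ∀ᶠ b : Plane × ℝ in 𝓝 a, -R < b.2 :=
      continuous_snd.continuousAt.eventually (lt_mem_nhds haR)
    filter_upwards [(continuous_fst.tendsto (u, a)).eventually h1,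
      (continuous_snd.tendsto (u, a)).eventually hs,
      (continuous_snd.tendsto (u, a)).eventually h2,
      (continuous_snd.tendsto (u, a)).eventually (eventually_eventually_nhds.2 hB'2)]
      with x g1 g2 g3 g4
    exact ⟨g1, g2, g3, g4⟩
  obtain ⟨⟨u', b⟩, ⟨hu', hbt, v, hv1, hv2, hv3⟩, g1, g2, g3, g4⟩ :=
    (hfr.and_eventually hev).exists
  obtain ⟨b', ⟨hb's, hb'E⟩, hb'γ⟩ := g1 (Ioc_subset_Icc_self hu')
  simp only at hb'γ hbt hv1 hv2 hv3 g2 g3 g4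
  have hbb : b' = b := by
    refine hinj hb's g2 ?_
    rw [← hb'E, hb'γ, ← hv2, hv3.self_of_nhds]
  subst hbb
  have htr : ∀ x h, tube (κ j) (x + v) h = tubeTrans (κ j) v (tube (κ j) x h) := by
    intro x h; rw [tubeTrans_tube hκ, add_comm]
  have hBB : B' = (tubeTrans (κ j) v).trans B := by
    refine IsDevAt.germ_unique (𝒪 := S.extAtlas) (e := e) (a := b')
      (F := fun a : Plane × ℝ => tube (κ j) a.1 a.2) ?_ hB' ((isHypIso_tubeTrans _ v).trans hB)
      (S.map_tube j g3) (tube_mem hκ _ _) ?_ ?_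
    · rw [hb'γ]; exact he _ (hγball u' (Ioc_subset_Icc_self hu'))
    · rw [LinearEquiv.trans_apply, ← htr, hb'γ, hv2]
    · filter_upwards [hv3, g4] with c h1 h2
      rw [LinearEquiv.trans_apply, ← htr, h1, h2]
  have hfin : B (tube (κ j) (a.1 + v) a.2) = γ u := by
    rw [← hB'1, hBB, LinearEquiv.trans_apply, ← htr]
  have hdeck : ∀ z, φ j (z + v) = φ j z := by
    intro z
    have := (S.isTubeMap j).deck hκ hv1.symm z
    rwa [add_sub_cancel_left] at this
  refine (hG _).2 ⟨(a.1 + v, a.2), haR, hht (a.1 + v, a.2) _ haR hfin (hγR u hu), hfin, ?_⟩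
  have hc : Continuous fun b : Plane × ℝ => (b.1 - v, b.2) := by fun_prop
  have h5 := hc.tendsto (a.1 + v, a.2)
  simp only [add_sub_cancel_right] at h5
  have e1 : ∀ᶠ b : Plane × ℝ in 𝓝 (a.1 + v, a.2), -R < b.2 :=
    (continuous_snd.tendsto (a.1 + v, a.2)).eventually (lt_mem_nhds haR)
  have e2 : ∀ᶠ b : Plane × ℝ in 𝓝 (a.1 + v, a.2), b.2 < δ :=
    (continuous_snd.tendsto (a.1 + v, a.2)).eventually (gt_mem_nhds haδ)
  filter_upwards [h5.eventually hB'2, e1, e2] with b hb k1 k2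
  rw [hBB, LinearEquiv.trans_apply, ← htr] at hb
  simp only [sub_add_cancel] at hb
  rw [hb]
  have h6 : φ j (b.1 - v) = φ j b.1 := by
    have := hdeck (b.1 - v)
    rwa [sub_add_cancel, eq_comm] at this
  exact hE.eq_of_eq h6 k1 k2

end

section

/-! ### Bumping along short translations -/

theorem vn_le {m : ℝ} (hm : 0 ≤ m) (x : ℝ) : 2 * vn m x ≤ x ^ 2 := by
  unfold vn cn
  split_ifs with h1 h2
  · linarith
  · have h3 := Real.one_sub_sq_div_two_le_cos (x := √m * x)
    rw [mul_pow, Real.sq_sqrt hm] at h3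
    rw [mul_div_assoc', div_le_iff₀ h2]
    linarith
  · exact absurd (lt_of_le_of_ne hm (Ne.symm h1)) h2

theorem vn_mul_le {m : ℝ} (hm : m ≤ 0) {c : ℝ} (hc : |c| ≤ 1) (x : ℝ) :
    vn m (c * x) ≤ vn m x := by
  have habs : |c * x| ≤ |x| := by
    rw [abs_mul]
    exact mul_le_of_le_one_left (abs_nonneg x) hc
  unfold vn cn
  split_ifs with h1 h2
  · have := sq_le_sq.2 habs
    linarith
  · exact absurd hm (not_le.2 h2)
  · have h3 : Real.cosh (√(-m) * (c * x)) ≤ Real.cosh (√(-m) * x) := by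
      rw [Real.cosh_le_cosh, abs_mul, abs_mul (√(-m)) x]
      exact mul_le_mul_of_nonneg_left habs (abs_nonneg _)
    exact div_le_div_of_nonpos_of_le hm (by linarith)

theorem vn_eq_zero {m x : ℝ} (hm : m * x ^ 2 < 4) (h : vn m x = 0) : x = 0 := by
  unfold vn cn at h
  split_ifs at h with h1 h2
  · have : x ^ 2 = 0 := by linarith
    exact pow_eq_zero_iff two_ne_zero |>.1 this
  · have hs := Real.sqrt_pos.2 h2
    have h3 : Real.cos (√m * x) = 1 := by
      have := (div_eq_zero_iff.1 h).resolve_right h1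
      linarith
    have h4 : (√m * x) ^ 2 < 2 ^ 2 := by
      rw [mul_pow, Real.sq_sqrt h2.le]; linarith
    have h5 := abs_lt_of_sq_lt_sq h4 two_pos.le
    have h6 := (abs_lt.1 h5)
    have hpi := Real.pi_gt_three
    have := (Real.cos_eq_one_iff_of_lt_of_lt (by linarith) (by linarith)).1 h3
    exact (mul_eq_zero.1 this).resolve_left hs.ne'
  · have hm0 : 0 < -m := by
      have := lt_of_le_of_ne (not_lt.1 h2) h1
      linarith
    have hs := Real.sqrt_pos.2 hm0
    have h3 : Real.cosh (√(-m) * x) = 1 := by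
      have := (div_eq_zero_iff.1 h).resolve_right h1
      linarith
    by_contra hx
    have := Real.one_lt_cosh.2 (mul_ne_zero hs.ne' hx)
    linarith

theorem mX_nonneg {κ : ℝ} (hκ : 1 ≤ κ) : 0 ≤ mX κ := by unfold mX; nlinarith

theorem mY_nonpos {κ : ℝ} (hκ : 1 ≤ κ) : mY κ ≤ 0 := by
  unfold mY
  have h1 := inv_le_one_of_one_le₀ hκ
  have h2 := inv_nonneg.2 (zero_le_one.trans hκ)
  have : κ⁻¹ ^ 2 ≤ 1 := pow_le_one₀ h2 h1
  linarith

/-- The estimates behind `exists_meeting_height`, with `c = cosh R` and `s = sinh R`. -/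
theorem meeting_estimates {c s a a' b b' A B m m' V W ξ η : ℝ} (hs : 0 < s) (hc1 : 1 < c)
    (hcs : c ^ 2 = s ^ 2 + 1) (ha : 0 < a) (ha' : 0 < a') (hb : 0 < b) (hb' : 0 < b')
    (hA : A = a * c + a' * s) (hB : B = b * c + b' * s) (hm : a' ^ 2 - a ^ 2 = m)
    (hm' : b' ^ 2 - b ^ 2 = m') (hab : a' * b' = a * b) (hm0 : 0 ≤ m) (hm0' : m' ≤ 0)
    (hV : 0 ≤ V) (hVξ : 2 * V ≤ ξ) (hW : 0 ≤ W) (hWη : 2 * W - m' * W ^ 2 = η)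
    (hcond : A ^ 2 * ξ + B ^ 2 * η < s ^ 2) {P Q : ℝ} (hP : P = c + A * a * V + B * b * W)
    (hQ : Q = s - A * a' * V - B * b' * W) :
    1 + a ^ 2 * ξ / 2 + b ^ 2 * W < c ∧ 0 < Q ∧ Q ≤ s ∧ c ≤ P ∧ 1 ≤ P ^ 2 - Q ^ 2 ∧
      P ^ 2 - Q ^ 2 < c ^ 2 := by
  have hc0 : 0 < c := by linarith
  have hξ : 0 ≤ ξ := by linarith
  have hmV := mul_nonneg hm0 (sq_nonneg V)
  have hWη' : 2 * W ≤ η := by linarith [mul_nonneg (neg_nonneg.2 hm0') (sq_nonneg W)]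
  have hη : 0 ≤ η := by linarith
  have hA1 : a * c ≤ A := by linarith [mul_pos ha' hs]
  have hA2 : a' * s ≤ A := by linarith [mul_pos ha hc0]
  have hB1 : b * c ≤ B := by linarith [mul_pos hb' hs]
  have hB2 : b' * s ≤ B := by linarith [mul_pos hb hc0]
  have hA0 : 0 < A := lt_of_lt_of_le (mul_pos ha hc0) hA1
  have hB0 : 0 < B := lt_of_lt_of_le (mul_pos hb hc0) hB1
  have hQ1 : Q ≤ s := by
    have h1 : 0 ≤ A * a' * V := by positivity
    have h2 : 0 ≤ B * b' * W := by positivity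
    linarith
  have hP0 : c ≤ P := by
    have h1 : 0 ≤ A * a * V := by positivity
    have h2 : 0 ≤ B * b * W := by positivity
    linarith
  have hQ0 : 0 < Q := by
    have h1 : A * (a' * s) * (2 * V) ≤ A * A * ξ :=
      mul_le_mul (mul_le_mul_of_nonneg_left hA2 hA0.le) hVξ (by linarith) (by positivity)
    have h2 : B * (b' * s) * (2 * W) ≤ B * B * η :=
      mul_le_mul (mul_le_mul_of_nonneg_left hB2 hB0.le) hWη' (by linarith) (by positivity)
    have h3 : 0 < s * Q := by
      rw [hQ]
      have : 0 < s ^ 2 := by positivity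
      linarith
    exact pos_of_mul_pos_right h3 hs.le
  have hPQ : P ^ 2 - Q ^ 2 = 1 + A ^ 2 * (2 * V - m * V ^ 2) + B ^ 2 * η := by
    subst hA hB hm hm' hWη hP hQ
    linear_combination hcs - 2 * (a * c + a' * s) * (b * c + b' * s) * V * W * hab
  have hA3 : A ^ 2 * (2 * V - m * V ^ 2) ≤ A ^ 2 * ξ :=
    mul_le_mul_of_nonneg_left (by linarith) (sq_nonneg A)
  refine ⟨?_, hQ0, hQ1, hP0, ?_, by linarith⟩
  · have h1 : (a * c) ^ 2 * ξ ≤ A ^ 2 * ξ :=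
      mul_le_mul_of_nonneg_right (pow_le_pow_left₀ (mul_pos ha hc0).le hA1 2) hξ
    have h2 : (b * c) ^ 2 * (2 * W) ≤ B ^ 2 * η :=
      mul_le_mul (pow_le_pow_left₀ (mul_pos hb hc0).le hB1 2) hWη' (by linarith) (sq_nonneg _)
    have h3 : (a ^ 2 * ξ + b ^ 2 * (2 * W)) * c ^ 2 < 2 * (c - 1) * c ^ 2 := by
      have h4 : c ^ 2 - 1 ≤ 2 * (c - 1) * c ^ 2 := by
        have h5 : 0 ≤ (2 * c + 1) * (c - 1) ^ 2 := by positivity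
        linarith
      linarith
    have h4 := lt_of_mul_lt_mul_right h3 (sq_nonneg c)
    linarith
  · have h1 := pow_le_pow_left₀ hc0.le hP0 2
    have h2 := pow_le_pow_left₀ hQ0.le hQ1 2
    linarith

/-- If two balls of radius `R` touch a surface of constant curvatures at nearby points, then they
meet on the normal geodesic halfway between. In the notation of the proof below, the distance `τ`
along that normal minimizes `P cosh τ - Q sinh τ`. -/
theorem exists_meeting_height {R a a' b b' m m' V W ξ η : ℝ} (hR : 0 < R) (ha : 0 < a)
    (ha' : 0 < a') (hb : 0 < b) (hb' : 0 < b') (hm : a' ^ 2 - a ^ 2 = m)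
    (hm' : b' ^ 2 - b ^ 2 = m') (hab : a' * b' = a * b) (hm0 : 0 ≤ m) (hm0' : m' ≤ 0)
    (hV : 0 ≤ V) (hVξ : 2 * V ≤ ξ) (hW : 0 ≤ W) (hWη : 2 * W - m' * W ^ 2 = η)
    (hcond : (a * Real.cosh R + a' * Real.sinh R) ^ 2 * ξ
      + (b * Real.cosh R + b' * Real.sinh R) ^ 2 * η < Real.sinh R ^ 2) :
    (1 + a ^ 2 * ξ / 2 + b ^ 2 * W < Real.cosh R) ∧ ∃ τ, 0 < τ ∧ τ < R ∧
      Real.cosh (R - τ)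
        + (a * Real.cosh R + a' * Real.sinh R) * (a * Real.cosh τ + a' * Real.sinh τ) * V
        + (b * Real.cosh R + b' * Real.sinh R) * (b * Real.cosh τ + b' * Real.sinh τ) * W
        < Real.cosh R := by
  have hs : 0 < Real.sinh R := Real.sinh_pos_iff.2 hR
  have hc1 : 1 < Real.cosh R := Real.one_lt_cosh.2 hR.ne'
  obtain ⟨A, hA⟩ : ∃ A, A = a * Real.cosh R + a' * Real.sinh R := ⟨_, rfl⟩
  obtain ⟨B, hB⟩ : ∃ B, B = b * Real.cosh R + b' * Real.sinh R := ⟨_, rfl⟩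
  rw [← hA, ← hB] at hcond ⊢
  obtain ⟨P, hP⟩ : ∃ P, P = Real.cosh R + A * a * V + B * b * W := ⟨_, rfl⟩
  obtain ⟨Q, hQ⟩ : ∃ Q, Q = Real.sinh R - A * a' * V - B * b' * W := ⟨_, rfl⟩
  obtain ⟨h1, hQ0, hQ1, hP0, hPQ2, hPQ1⟩ := meeting_estimates hs hc1 (Real.cosh_sq R) ha ha' hb hb'
    hA hB hm hm' hab hm0 hm0' hV hVξ hW hWη hcond hP hQ
  refine ⟨h1, ?_⟩
  have hc0 : 0 < Real.cosh R := by linarith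
  obtain ⟨D, hD⟩ : ∃ D, D = √(P ^ 2 - Q ^ 2) := ⟨_, rfl⟩
  have hD2 : D ^ 2 = P ^ 2 - Q ^ 2 := by rw [hD, Real.sq_sqrt (by linarith)]
  have hD1 : 1 ≤ D := by rw [hD]; exact Real.one_le_sqrt.2 hPQ2
  have hD0 : 0 < D := by linarith
  have hDc : D < Real.cosh R := lt_of_pow_lt_pow_left₀ 2 hc0.le (by linarith)
  obtain ⟨τ₀, hτ₀⟩ : ∃ τ₀, τ₀ = Real.arsinh (Q / D) := ⟨_, rfl⟩
  have hsτ : Real.sinh τ₀ = Q / D := by rw [hτ₀]; exact Real.sinh_arsinh _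
  have hcτ : Real.cosh τ₀ = P / D := by
    have h1 := Real.cosh_sq τ₀
    rw [hsτ] at h1
    have h2 : Real.cosh τ₀ ^ 2 = (P / D) ^ 2 := by
      rw [h1, div_pow, div_pow]
      field_simp
      linarith
    have hPD : 0 ≤ P / D := div_nonneg (by linarith) hD0.le
    exact (pow_left_inj₀ (Real.cosh_pos _).le hPD two_ne_zero).1 h2
  have hτ0 : 0 < τ₀ := by
    rw [← Real.sinh_pos_iff, hsτ]; exact div_pos hQ0 hD0
  have hτR : τ₀ ≤ R := by
    rw [← Real.sinh_le_sinh, hsτ, div_le_iff₀ hD0]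
    exact hQ1.trans (le_mul_of_one_le_right hs.le hD1)
  -- the minimum is attained at `τ₀ ≤ R`, and the inequality is open
  obtain ⟨f, hf⟩ : ∃ f : ℝ → ℝ, f = fun τ => P * Real.cosh τ - Q * Real.sinh τ := ⟨_, rfl⟩
  have hfc : Continuous f := by
    have h1 := Real.continuous_cosh; have h2 := Real.continuous_sinh
    rw [hf]; fun_prop
  have hfτ : f τ₀ < Real.cosh R := by
    have : f τ₀ = D := by
      rw [hf]
      simp only
      rw [hsτ, hcτ]
      field_simp
      linarith
    rw [this]; exact hDc
  have hcl : τ₀ ∈ closure (Ioo 0 R) := by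
    rw [closure_Ioo hR.ne]; exact ⟨hτ0.le, hτR⟩
  obtain ⟨τ, hτ1, hτ2⟩ := mem_closure_iff.1 hcl {τ | f τ < Real.cosh R}
    (isOpen_lt hfc continuous_const) hfτ
  refine ⟨τ, hτ2.1, hτ2.2, ?_⟩
  have hτ1' : f τ < Real.cosh R := hτ1
  rw [hf] at hτ1'
  simp only [hP, hQ] at hτ1'
  rw [Real.cosh_sub]
  linarith

theorem stretch_add (k h t : ℝ) : stretch k (h + t)
    = stretch k h * Real.cosh t + (Real.sinh h + k * Real.cosh h) * Real.sinh t := by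
  simp only [stretch, Real.cosh_add, Real.sinh_add]; ring

end

section

variable {M : Type*} [TopologicalSpace M] {𝒜 : HyperbolicAtlas M} {ι : Type*}
variable {R : ℝ} {κ : ι → ℝ} {φ : ι → Plane → M} [T2Space M]

theorem IsCollar.height_eq_zero {S : IsTubeSystem 𝒜 R κ φ} {i : ι} {δ δ' : ℝ}
    {E : Plane × ℝ → extended 𝒜 R} (hE : IsCollar S i δ' E) (hδ : 0 ≤ δ) (hδ' : δ < δ')
    (h : ∀ a : Plane × ℝ, 0 ≤ a.2 → a.2 < δ → (E a).1.2 = 0) {a : Plane × ℝ} (h0 : 0 ≤ a.2)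
    (ha : a.2 ≤ δ) : (E a).1.2 = 0 := by
  have hR := S.pos
  obtain ⟨z, t⟩ := a
  rcases h0.eq_or_lt with h0 | h0
  · rw [hE.val_eq (by rw [← h0]; linarith) h0.symm.le, ← h0]
  have hcl : t ∈ closure (Ioo 0 t) := by rw [closure_Ioo h0.ne]; exact ⟨h0.le, le_rfl⟩
  have := mem_closure_iff_nhdsWithin_neBot.1 hcl
  have hc : Continuous fun t : ℝ => (z, t) := by fun_prop
  have t1 : Tendsto (fun u : ℝ => (E (z, u)).1.2) (𝓝[Ioo 0 t] t) (𝓝 (E (z, t)).1.2) := by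
    have h1 := (hE.continuousAt (a := (z, t)) (by linarith) (by linarith)).tendsto
    exact (((continuous_snd.comp continuous_subtype_val).tendsto _).comp
      (h1.comp (hc.tendsto t))).mono_left nhdsWithin_le_nhds
  have t2 : Tendsto (fun u : ℝ => (E (z, u)).1.2) (𝓝[Ioo 0 t] t) (𝓝 0) := by
    refine tendsto_const_nhds.congr' ?_
    filter_upwards [self_mem_nhdsWithin] with u hu
    exact (h (z, u) hu.1.le (hu.2.trans_le ha)).symm
  exact tendsto_nhds_unique t1 t2

namespace IsCollarFamily

variable {S : IsTubeSystem 𝒜 R κ φ} {δ δ' : ι → ℝ} {E : ι → Plane × ℝ → extended 𝒜 R}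

/-- The interior parts of embedded disjoint collars lie in `M`. -/
theorem height_eq_zero (hE : IsCollarFamily S δ δ' E) {i : ι} {a : Plane × ℝ} (h0 : 0 ≤ a.2)
    (ha : a.2 ≤ δ i) : (E i a).1.2 = 0 := by
  have hR := S.pos
  refine (hE.collar i).height_eq_zero (hE.nonneg i) (hE.lt i) (fun a h0 ha => ?_) h0 ha
  by_contra hne
  have hlt := lt_of_le_of_ne (extended_height_nonpos (E i a)) hne
  have hgt := extended_height_gt hR (E i a)
  obtain ⟨j, w, hw⟩ := S.exists_eq _ (extended_boundary _ hlt)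
  have h1 : E i a = E j (w, (E i a).1.2) := by
    refine Subtype.ext ?_
    rw [(hE.collar j).val_eq hgt hlt.le]
    exact Prod.ext hw.symm rfl
  have := (hE.inj i j a (w, (E i a).1.2) (by linarith) ha hgt (hlt.trans_le (hE.nonneg j)) h1).1
  simp only at this
  linarith

/-- When two collars first touch, they do so with opposite normals. -/
theorem eq_or_opposite (hE : IsCollarFamily S δ δ' E) {i j : ι} {a b : Plane × ℝ} (ha0 : 0 ≤ a.2)
    (ha : a.2 ≤ δ i) (hb0 : 0 ≤ b.2) (hb : b.2 ≤ δ j) {e : Mink → extended 𝒜 R}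
    {B : Mink ≃ₗ[ℝ] Mink} (hB : IsHypIso B)
    (hab : B (tube (κ j) b.1 b.2) = tube (κ i) a.1 a.2)
    (hea : ∀ᶠ a' : Plane × ℝ in 𝓝 a, e (tube (κ i) a'.1 a'.2) = E i a')
    (heb : ∀ᶠ b' : Plane × ℝ in 𝓝 b, e (B (tube (κ j) b'.1 b'.2)) = E j b') :
    (a.2 = b.2 ∧ φ i a.1 = φ j b.1) ∨ B (tubeN (κ j) b.1 b.2) = -tubeN (κ i) a.1 a.2 := by
  have hR := S.pos
  obtain ⟨x, hx⟩ : ∃ x, x = tube (κ i) a.1 a.2 := ⟨_, rfl⟩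
  obtain ⟨n, hn⟩ : ∃ n, n = tubeN (κ i) a.1 a.2 := ⟨_, rfl⟩
  obtain ⟨n', hn'⟩ : ∃ n', n' = B (tubeN (κ j) b.1 b.2) := ⟨_, rfl⟩
  have hFa := isFrame_tube (S.κ_pos i) a.1 a.2
  have hFb := isFrame_tube (S.κ_pos j) b.1 b.2
  have hx3 : x ∈ hyp3 := by rw [hx]; exact hFa.mem
  have hxx : mink x x = -1 := hx3.1
  have hxn : mink x n = 0 := by rw [hx, hn]; exact hFa.pn
  have hnn : mink n n = 1 := by rw [hn]; exact hFa.nn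
  have hxn' : mink x n' = 0 := by rw [hx, ← hab, hn', hB.map_mink]; exact hFb.pn
  have hnn' : mink n' n' = 1 := by rw [hn', hB.map_mink]; exact hFb.nn
  rw [← hn, ← hn']
  rw [or_iff_not_imp_right]
  intro hopp
  obtain ⟨u, hu⟩ : ∃ u, u = -(n + n') := ⟨_, rfl⟩
  have hxu : mink x u = 0 := by rw [hu, mink_neg_right, mink_add_right, hxn, hxn']; norm_num
  have hu0 : u ≠ 0 := by
    intro h; apply hopp
    rw [h, eq_comm, neg_eq_zero] at hu
    exact eq_neg_of_add_eq_zero_right hu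
  have huu : 0 < mink u u := lt_of_le_of_ne (mink_nonneg_of_tangent hx3 hxu)
    (fun h => hu0 (eq_zero_of_tangent hx3 hxu h.symm))
  have hnu : mink n u = -(mink u u) / 2 := by
    rw [hu]
    simp only [mink_neg_right, mink_neg_left, mink_add_right, mink_add_left, hnn, hnn',
      mink_comm n' n]
    ring
  have hnu' : mink n' u = -(mink u u) / 2 := by
    rw [hu]
    simp only [mink_neg_right, mink_neg_left, mink_add_right, mink_add_left, hnn, hnn',
      mink_comm n' n]
    ring
  obtain ⟨μ, hμ⟩ : ∃ μ, μ = √(mink u u) := ⟨_, rfl⟩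
  have hμ0 : 0 < μ := by rw [hμ]; exact Real.sqrt_pos.2 huu
  have hμ2 : μ ^ 2 = mink u u := by rw [hμ, Real.sq_sqrt huu.le]
  obtain ⟨v, hv⟩ : ∃ v, v = μ⁻¹ • u := ⟨_, rfl⟩
  have hxv : mink x v = 0 := by rw [hv, mink_smul_right, hxu, mul_zero]
  have hvv : mink v v = 1 := by
    rw [hv, mink_smul_right, mink_smul_left, ← hμ2]; field_simp
  have hnv : mink n v = -μ / 2 := by
    rw [hv, mink_smul_right, hnu, ← hμ2]; field_simp
  have hnv' : mink n' v = -μ / 2 := by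
    rw [hv, mink_smul_right, hnu', ← hμ2]; field_simp
  -- a short geodesic enters both tangent balls
  have hsmall : ∀ᶠ ε : ℝ in 𝓝[>] 0,
      Real.cosh R * Real.cosh ε - Real.sinh R * Real.sinh ε * (μ / 2) < Real.cosh R := by
    have h1 : Tendsto (fun ε => Real.cosh R * Real.sinh ε) (𝓝 0)
        (𝓝 (Real.cosh R * Real.sinh 0)) := by
      exact ((Real.continuous_sinh.tendsto 0).const_mul _)
    rw [Real.sinh_zero, mul_zero] at h1
    have hs : 0 < Real.sinh R * μ := mul_pos (Real.sinh_pos_iff.2 hR) hμ0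
    filter_upwards [nhdsWithin_le_nhds (h1.eventually (gt_mem_nhds hs)), self_mem_nhdsWithin]
      with ε h2 h3
    have h4 : 0 < Real.sinh ε := Real.sinh_pos_iff.2 h3
    have h5 : 2 * (Real.cosh ε - 1) ≤ Real.sinh ε ^ 2 := by
      have h6 := Real.cosh_sq ε
      have h7 := Real.one_le_cosh ε
      nlinarith
    have h8 : 0 < Real.cosh R := Real.cosh_pos R
    have h9 := mul_lt_mul_of_pos_right h2 h4
    have h10 := mul_le_mul_of_nonneg_left h5 h8.le
    nlinarith
  have hpath : Tendsto (fun ε => Real.cosh ε • x + Real.sinh ε • v) (𝓝[>] 0) (𝓝[hyp3] x) := by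
    refine tendsto_nhdsWithin_iff.2 ⟨?_, Eventually.of_forall fun ε =>
      geodesic_mem_hyp3 hx3 hxv hvv ε⟩
    have h1 := Real.continuous_cosh; have h2 := Real.continuous_sinh
    have hc : Continuous fun ε => Real.cosh ε • x + Real.sinh ε • v := by fun_prop
    have := (hc.tendsto 0).mono_left (nhdsWithin_le_nhds (s := Ioi 0))
    simpa using this
  have hball : ∀ k, (mink x k = 0) → mink k v = -μ / 2 → ∀ᶠ ε : ℝ in 𝓝[>] 0,
      hcosh (Real.cosh (-R) • x + Real.sinh (-R) • k) (Real.cosh ε • x + Real.sinh ε • v)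
        < Real.cosh R := by
    intro k hk hkv
    filter_upwards [hsmall] with ε hε
    simp only [hcosh, mink_add_left, mink_add_right, mink_smul_left, mink_smul_right, hxx, hxv,
      hkv, mink_comm k x, hk, Real.cosh_neg, Real.sinh_neg]
    linarith
  have ha' : tube (κ i) a.1 (a.2 - R) = Real.cosh (-R) • x + Real.sinh (-R) • n := by
    rw [sub_eq_add_neg, tube_add, hx, hn]
  have hb' : B (tube (κ j) b.1 (b.2 - R)) = Real.cosh (-R) • x + Real.sinh (-R) • n' := by
    rw [sub_eq_add_neg, tube_add, hx, hn', map_add, map_smul, map_smul, hab]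
  have hclosed : IsClosed {p : (Plane × ℝ) × (Plane × ℝ) | p.1.2 = p.2.2 ∧
      φ i p.1.1 = φ j p.2.1} := by
    have h1 := (S.isTubeMap i).continuous
    have h2 := (S.isTubeMap j).continuous
    exact (isClosed_eq (by fun_prop) (by fun_prop)).inter
      (isClosed_eq (h1.comp (by fun_prop)) (h2.comp (by fun_prop)))
  have hmem : (a, b) ∈ closure {p : (Plane × ℝ) × (Plane × ℝ) | p.1.2 = p.2.2 ∧
      φ i p.1.1 = φ j p.2.1} := by
    rw [mem_closure_iff_nhds]
    intro W hW
    obtain ⟨U, hU, V, hV, hUV⟩ := mem_nhds_prod_iff.1 hW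
    have haR : -R < a.2 := by linarith
    have hbR : -R < b.2 := by linarith
    have e1 : ∀ᶠ a' : Plane × ℝ in 𝓝 a, -R < a'.2 :=
      continuous_snd.continuousAt.eventually (lt_mem_nhds haR)
    have e2 : ∀ᶠ a' : Plane × ℝ in 𝓝 b, -R < a'.2 :=
      continuous_snd.continuousAt.eventually (lt_mem_nhds hbR)
    have i1 : (fun a' : Plane × ℝ => tube (κ i) a'.1 a'.2) ''
        {a' | a' ∈ U ∧ -R < a'.2 ∧ e (tube (κ i) a'.1 a'.2) = E i a'} ∈ 𝓝[hyp3] x := by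
      rw [hx, ← S.map_tube i haR]
      exact image_mem_map ((show ∀ᶠ a' in 𝓝 a, a' ∈ U from hU).and (e1.and hea))
    have i2 : (fun b' : Plane × ℝ => B (tube (κ j) b'.1 b'.2)) ''
        {b' | b' ∈ V ∧ -R < b'.2 ∧ e (B (tube (κ j) b'.1 b'.2)) = E j b'} ∈ 𝓝[hyp3] x := by
      rw [hx, ← hab, ← hB.map_nhdsWithin, ← S.map_tube j hbR, map_map]
      exact image_mem_map ((show ∀ᶠ b' in 𝓝 b, b' ∈ V from hV).and (e2.and heb))
    obtain ⟨ε, ⟨a', ⟨ha'U, ha'R, ha'E⟩, hpa⟩, ⟨b', ⟨hb'V, hb'R, hb'E⟩, hpb⟩, k1, k2⟩ :=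
      ((hpath.eventually i1).and ((hpath.eventually i2).and
        ((hball n hxn hnv).and (hball n' hxn' hnv')))).exists
    simp only at hpa hpb
    rw [← ha', ← hpa] at k1
    rw [← hb', ← hpb, hB.hcosh_eq] at k2
    have l1 := S.height_lt i hR.le (by linarith) ha'R k1
    have l2 := S.height_lt j hR.le (by linarith) hb'R k2
    have hEE : E i a' = E j b' := by rw [← ha'E, ← hb'E, hpa, hpb]
    exact ⟨(a', b'), hUV (mk_mem_prod ha'U hb'V),
      hE.inj i j a' b' ha'R (by linarith) hb'R (by linarith) hEE⟩
  exact hclosed.closure_subset hmem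

/-- Lines of curvature `κ` may close up in `ℍ³`, but a short translation is shorter than their
period, so it has no fixed point on the model surface. -/
theorem eq_zero_of_short {κ R s : ℝ} (hR : 0 < R) (hκ : 1 ≤ κ) (hs : 0 ≤ s) {u : Plane}
    (hshort : stretch κ (s + R) ^ 2 * u 0 ^ 2
      + stretch κ⁻¹ (s + R) ^ 2 * sn (mY κ) (u 1) ^ 2 < Real.sinh R ^ 2)
    (h0 : vn (mX κ) (2 * u 0) = 0) (h1 : vn (mY κ) (2 * u 1) = 0) : u = 0 := by
  have hκ0 : 0 < κ := one_pos.trans_le hκ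
  have hsR : 0 < Real.sinh R := Real.sinh_pos_iff.2 hR
  obtain ⟨a', ha'⟩ : ∃ a', a' = Real.sinh s + κ * Real.cosh s := ⟨_, rfl⟩
  have ha'0 : 0 < a' := by
    rw [ha']
    exact add_pos_of_nonneg_of_pos (Real.sinh_nonneg_iff.2 hs) (mul_pos hκ0 (Real.cosh_pos s))
  have y2 : 2 * u 1 = 0 := by
    refine vn_eq_zero ?_ h1
    have := mul_nonneg (neg_nonneg.2 (mY_nonpos hκ)) (sq_nonneg (2 * u 1))
    linarith
  have y1 : 2 * u 0 = 0 := by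
    refine vn_eq_zero ?_ h0
    have w1 : (a' * Real.sinh R) ^ 2 ≤ stretch κ (s + R) ^ 2 := by
      refine pow_le_pow_left₀ (mul_pos ha'0 hsR).le ?_ 2
      rw [stretch_add, ← ha']
      linarith [mul_pos (stretch_pos_of_nonneg hκ0.le hs) (Real.cosh_pos R)]
    have w2 : mX κ ≤ a' ^ 2 := by
      have : a' ^ 2 - stretch κ s ^ 2 = mX κ := by
        rw [ha']
        unfold mX stretch; linear_combination (κ ^ 2 - 1) * Real.cosh_sq s
      linarith [sq_nonneg (stretch κ s)]
    have w3 := mul_le_mul_of_nonneg_right w1 (sq_nonneg (u 0))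
    have w4 : 0 ≤ stretch κ⁻¹ (s + R) ^ 2 * sn (mY κ) (u 1) ^ 2 := by positivity
    have w5 : (a' ^ 2 * u 0 ^ 2) * Real.sinh R ^ 2 < 1 * Real.sinh R ^ 2 := by linarith
    have w6 := lt_of_mul_lt_mul_right w5 (sq_nonneg _)
    have w7 := mul_le_mul_of_nonneg_right w2 (sq_nonneg (u 0))
    linarith
  ext k
  fin_cases k
  · change u 0 = 0; linarith
  · change u 1 = 0; linarith

set_option maxHeartbeats 1000000 in
/-- The bumping argument: collars do not touch where the surface of one of them is invariant under
a short translation `u + u`. In the tube about one torus, the other torus would appear with two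
disjoint balls of radius `R`, touching the surface at two points that differ by this translation;
but the balls meet halfway between these points. -/
theorem eq_of_short [CompactSpace M] (hE : IsCollarFamily S δ δ' E) {i j : ι} {a b : Plane × ℝ}
    (ha0 : 0 ≤ a.2) (ha : a.2 ≤ δ i) (hb0 : 0 ≤ b.2) (hb : b.2 ≤ δ j) (hab : E i a = E j b)
    {u : Plane} (hu0 : u ≠ 0) (hu : ∀ z, φ i (z + (u + u)) = φ i z)
    (hshort : stretch (κ i) (a.2 + R) ^ 2 * u 0 ^ 2
      + stretch (κ i)⁻¹ (a.2 + R) ^ 2 * sn (mY (κ i)) (u 1) ^ 2 < Real.sinh R ^ 2) :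
    a.2 = b.2 ∧ φ i a.1 = φ j b.1 := by
  have hR := S.pos
  have hκ := S.κ_pos i
  have hκj := S.κ_pos j
  obtain ⟨zx, s⟩ := a
  obtain ⟨wy, t⟩ := b
  simp only at ha0 ha hb0 hb hshort
  have hsR : -R < s := by linarith
  have hs1 := S.stretch_pos i hsR
  have hs2 := S.stretch_inv_pos i hsR
  have hκi : 0 < (κ i)⁻¹ := inv_pos.2 hκ
  have hd : ∀ k, 0 < k → 0 < Real.sinh s + k * Real.cosh s := fun k hk =>
    add_pos_of_nonneg_of_pos (Real.sinh_nonneg_iff.2 ha0) (mul_pos hk (Real.cosh_pos s))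
  have hcs := Real.cosh_sq s
  have hm0 := mX_nonneg (S.one_le i)
  have hm0' := mY_nonpos (S.one_le i)
  obtain ⟨hnear, τ, hτ0, hτR, hmeet⟩ := exists_meeting_height (R := R) (a := stretch (κ i) s)
    (a' := Real.sinh s + κ i * Real.cosh s) (b := stretch (κ i)⁻¹ s)
    (b' := Real.sinh s + (κ i)⁻¹ * Real.cosh s) (m := mX (κ i)) (m' := mY (κ i))
    (V := vn (mX (κ i)) (u 0)) (W := vn (mY (κ i)) (u 1)) (ξ := u 0 ^ 2)
    (η := sn (mY (κ i)) (u 1) ^ 2) hR hs1 (hd _ hκ) hs2 (hd _ hκi)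
    (by unfold mX stretch; linear_combination (κ i ^ 2 - 1) * hcs)
    (by unfold mY stretch; linear_combination ((κ i)⁻¹ ^ 2 - 1) * hcs)
    (by
      unfold stretch
      have h1 : κ i * (κ i)⁻¹ = 1 := mul_inv_cancel₀ hκ.ne'
      linear_combination (Real.cosh s ^ 2 - Real.sinh s ^ 2) * h1)
    hm0 hm0' (vn_nonneg _ _) (vn_le hm0 _) (vn_nonneg _ _) (sn_sq _ _).symm
    (by rw [← stretch_add, ← stretch_add]; exact hshort)
  simp only [← stretch_add] at hmeet
  obtain ⟨za, hza⟩ : ∃ za, za = zx + u := ⟨_, rfl⟩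
  -- the exponential map at the midpoint
  obtain ⟨r₀, hr₀, hr₀R, hr₀c⟩ := exists_lt_cosh (c := 1 + stretch (κ i) s ^ 2 * u 0 ^ 2 / 2
    + stretch (κ i)⁻¹ s ^ 2 * vn (mY (κ i)) (u 1)) (by
      have := vn_nonneg (mY (κ i)) (u 1)
      have h1 : 0 ≤ stretch (κ i) s ^ 2 * u 0 ^ 2 / 2 := by positivity
      have h2 : 0 ≤ stretch (κ i)⁻¹ s ^ 2 * vn (mY (κ i)) (u 1) := by positivity
      linarith) hnear hR.le
  obtain ⟨r, hr1, hrR⟩ := exists_between (max_lt hr₀R hτR)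
  have hr₀r : r₀ < r := (le_max_left _ _).trans_lt hr1
  have hτr : τ < r := (le_max_right _ _).trans_lt hr1
  have hr0 : 0 < r := hτ0.trans hτr
  have hmem : ∀ c : ℝ, |c| ≤ 1 → tube (κ i) (za + c • u) s ∈ hball (tube (κ i) za s) r := by
    intro c hc
    refine ⟨tube_mem hκ _ _, ?_⟩
    have h0 : za 0 - (za + c • u) 0 = -(c * u 0) := by simp
    have h1 : za 1 - (za + c • u) 1 = -(c * u 1) := by simp
    rw [hcosh_tube hκ, h0, h1, vn_neg, vn_neg, sub_self, Real.cosh_zero]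
    have h2 := vn_mul_le hm0' hc (u 1)
    have h3 := vn_le hm0 (c * u 0)
    have h4 : (c * u 0) ^ 2 ≤ u 0 ^ 2 := by
      rw [mul_pow]
      exact mul_le_of_le_one_left (sq_nonneg _) ((sq_le_one_iff_abs_le_one c).2 hc)
    have h5 := mul_le_mul_of_nonneg_left (h3.trans h4) (sq_nonneg (stretch (κ i) s))
    have h6 := mul_le_mul_of_nonneg_left h2 (sq_nonneg (stretch (κ i)⁻¹ s))
    have h7 := cosh_lt_cosh_of_nonneg hr₀ hr₀r
    rw [← hr₀c] at h7
    linarith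
  have hE0 : (E i (za, s)).1.2 = 0 := hE.height_eq_zero ha0 ha
  have hsδ : s < δ' i := ha.trans_lt (hE.lt i)
  have htδ : t < δ' j := hb.trans_lt (hE.lt j)
  obtain ⟨e, he, hez⟩ := ((hE.collar i).dev (za, s) hsR hsδ).exists_continuation
    (S.exists_exp hr0 hrR) hr0 (mem_univ _) (by rw [nhdsWithin_univ]; exact S.tendsto_tube i _)
    (tube_mem hκ _ _) hE0
  rw [nhdsWithin_univ] at hez
  simp only at he
  have hcomp : ∀ a : Plane × ℝ, tube (κ i) a.1 a.2 ∈ hball (tube (κ i) za s) r →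
      IsDevAt S.extAtlas (fun a : Plane × ℝ => e (tube (κ i) a.1 a.2))
        (fun a => tube (κ i) a.1 a.2) univ a := by
    intro a ha
    exact IsDevAt.comp (g := fun a : Plane × ℝ => tube (κ i) a.1 a.2) (he _ ha)
      (by rw [nhdsWithin_univ]; exact S.tendsto_tube i a)
  have hgen : ∀ c ∈ Icc (-1 : ℝ) 1,
      ∀ᶠ a : Plane × ℝ in 𝓝 (za + c • u, s), e (tube (κ i) a.1 a.2) = E i a := by
    intro c hc
    have hcont : Continuous fun c : ℝ => (za + c • u, s) := by fun_prop
    have := dev_unique (𝒪 := S.extAtlas) (E := fun a : Plane × ℝ => e (tube (κ i) a.1 a.2))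
      (E' := E i) (W := univ) (F := fun a : Plane × ℝ => tube (κ i) a.1 a.2)
      (S := (fun c : ℝ => (za + c • u, s)) '' Icc (-1) 1) (subset_univ _)
      (isPreconnected_Icc.image _ hcont.continuousOn) ?_ ?_ ?_
      (w₀ := (za, s)) (w := (za + c • u, s)) ⟨0, by simp, by simp⟩ ⟨c, hc, rfl⟩ ?_
    · rwa [nhdsWithin_univ] at this
    · rintro _ ⟨c', hc', rfl⟩
      exact hcomp (za + c' • u, s) (hmem c' (abs_le.2 hc'))
    · rintro _ ⟨c', hc', rfl⟩
      exact (hE.collar i).dev _ hsR hsδ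
    · rintro _ ⟨c', hc', rfl⟩
      exact S.isOpenAt_tube i hsR
    · rw [nhdsWithin_univ]; exact hez
  have hx0 : za + (-1 : ℝ) • u = zx := by rw [hza]; simp
  have hx1 : za + (1 : ℝ) • u = u + u + zx := by rw [hza, one_smul]; abel
  have hgen0 := hgen (-1) (by simp)
  have hgen1 := hgen 1 (by simp)
  have hmem0 := hmem (-1) (by simp)
  have hmem1 := hmem 1 (by simp)
  rw [hx0] at hgen0 hmem0
  rw [hx1] at hgen1 hmem1
  have hpa : tube (κ i) za s ∈ hyp3 := tube_mem hκ _ _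
  have hq : e (tube (κ i) zx s) = E j (wy, t) := by rw [← hab]; exact hgen0.self_of_nhds
  obtain ⟨B, hB, hB1, hB2⟩ := (he _ hmem0).exists_germ hmem0.1
    ((hE.collar j).dev (wy, t) (by simp only; linarith) htδ) (S.tendsto_tube j _) hq
  simp only at hB1
  rcases hE.eq_or_opposite ha0 ha hb0 hb hB hB1 hgen0 hB2 with h | hopp
  · exact h
  exfalso
  simp only at hopp
  have hc0 : B (tube (κ j) wy (t - R)) = tube (κ i) zx (s + R) := by
    rw [sub_eq_add_neg, tube_add, tube_add, map_add, map_smul, map_smul, hB1, hopp,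
      Real.cosh_neg, Real.sinh_neg, smul_neg, neg_smul, neg_neg]
  obtain ⟨m, hm⟩ : ∃ m, m = tube (κ i) za (s + τ) := ⟨_, rfl⟩
  have hmball : m ∈ hball (tube (κ i) za s) r := by
    refine ⟨by rw [hm]; exact tube_mem hκ _ _, ?_⟩
    rw [hm, hcosh_tube hκ, sub_self, sub_self, vn_zero, vn_zero, mul_zero, mul_zero, add_zero,
      add_zero, sub_add_cancel_left, Real.cosh_neg]
    exact cosh_lt_cosh_of_nonneg hτ0.le hτr
  have hm0R : hcosh (B (tube (κ j) wy (t - R))) m < Real.cosh R := by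
    have h0 : zx 0 - za 0 = -(u 0) := by rw [hza]; simp
    have h1 : zx 1 - za 1 = -(u 1) := by rw [hza]; simp
    rw [hc0, hm, hcosh_tube hκ, h0, h1, vn_neg, vn_neg, add_sub_add_left_eq_sub]
    exact hmeet
  -- the picture near the second point of contact
  obtain ⟨T, hT⟩ : ∃ T, T = tubeTrans (κ i) (u + u) := ⟨_, rfl⟩
  have hTi : IsHypIso T := by rw [hT]; exact isHypIso_tubeTrans _ _
  have hTt : ∀ z h, T (tube (κ i) z h) = tube (κ i) (u + u + z) h := by
    intro z h; rw [hT, tubeTrans_tube hκ]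
  have hTe : ∀ᶠ y in 𝓝[hyp3] (tube (κ i) zx s), e (T y) = e y := by
    rw [← S.map_tube i (a := (zx, s)) hsR, eventually_map]
    have hc : Continuous fun a : Plane × ℝ => (u + u + a.1, a.2) := by fun_prop
    have e1 : ∀ᶠ a : Plane × ℝ in 𝓝 (zx, s), -R < a.2 :=
      continuous_snd.continuousAt.eventually (lt_mem_nhds hsR)
    have e2 : ∀ᶠ a : Plane × ℝ in 𝓝 (zx, s), a.2 < δ' i :=
      continuous_snd.continuousAt.eventually (gt_mem_nhds hsδ)
    filter_upwards [hgen0, (hc.tendsto (zx, s)).eventually hgen1, e1, e2] with a h1 h2 h3 h4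
    rw [hTt, h1, h2]
    exact (hE.collar i).eq_of_eq (by rw [add_comm, hu]) h3 h4
  have hBt : Tendsto (fun b : Plane × ℝ => B (tube (κ j) b.1 b.2)) (𝓝 (wy, t))
      (𝓝[hyp3] (tube (κ i) zx s)) := by
    rw [← hB1]; exact (hB.tendsto _).comp (S.tendsto_tube j (wy, t))
  have hm1R : hcosh (B.trans T (tube (κ j) wy (t - R))) m < Real.cosh R := by
    have h0 : (u + u + zx) 0 - za 0 = u 0 := by rw [hza]; simp; ring
    have h1 : (u + u + zx) 1 - za 1 = u 1 := by rw [hza]; simp; ring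
    rw [LinearEquiv.trans_apply, hc0, hTt, hm, hcosh_tube hκ, h0, h1, add_sub_add_left_eq_sub]
    exact hmeet
  obtain ⟨a₀, h₀R, h₀t, h₀m, h₀g⟩ := (hE.collar j).exists_of_tangent_ball hb0 htδ hpa he hB
    (by rw [hB1]; exact hmem0) hB2 hmball hm0R
  obtain ⟨a₁, h₁R, h₁t, h₁m, h₁g⟩ := (hE.collar j).exists_of_tangent_ball hb0 htδ hpa he
    (hB.trans hTi) (w := wy) (by rw [LinearEquiv.trans_apply, hB1, hTt]; exact hmem1) (by
      filter_upwards [hBt.eventually hTe, hB2] with b h1 h2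
      rw [LinearEquiv.trans_apply, h1, h2]) hmball hm1R
  have hEE : E j a₀ = E j a₁ := by
    rw [← h₀g.self_of_nhds, ← h₁g.self_of_nhds, h₀m, h₁m]
  obtain ⟨hh, hφ⟩ := hE.inj j j a₀ a₁ h₀R (h₀t.trans_le hb) h₁R (h₁t.trans_le hb) hEE
  obtain ⟨l, hl⟩ : ∃ l, l = a₁.1 - a₀.1 := ⟨_, rfl⟩
  have htr : ∀ x h, tube (κ j) (x + l) h = tubeTrans (κ j) l (tube (κ j) x h) := by
    intro x h; rw [tubeTrans_tube hκj, add_comm]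
  have ha1 : a₁ = (a₀.1 + l, a₀.2) := by
    refine Prod.ext ?_ hh.symm
    rw [hl]; simp
  have hBB : B = ((tubeTrans (κ j) l).trans (B.trans T)) := by
    refine IsDevAt.germ_unique (𝒪 := S.extAtlas) (e := e) (a := a₀)
      (F := fun a : Plane × ℝ => tube (κ j) a.1 a.2) ?_ hB
      ((isHypIso_tubeTrans _ l).trans (hB.trans hTi)) (S.map_tube j h₀R) (tube_mem hκj _ _) ?_ ?_
    · rw [h₀m]; exact he _ hmball
    · rw [LinearEquiv.trans_apply, ← htr, h₀m, ← h₁m, ha1]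
    · have hc : Continuous fun a : Plane × ℝ => (a.1 + l, a.2) := by fun_prop
      have h5 := hc.tendsto a₀
      rw [← ha1] at h5
      have e1 : ∀ᶠ a : Plane × ℝ in 𝓝 a₀, -R < a.2 :=
        continuous_snd.continuousAt.eventually (lt_mem_nhds h₀R)
      have e2 : ∀ᶠ a : Plane × ℝ in 𝓝 a₀, a.2 < δ' j :=
        continuous_snd.continuousAt.eventually (gt_mem_nhds (h₀t.trans htδ))
      filter_upwards [h₀g, h5.eventually h₁g, e1, e2] with a g1 g2 g3 g4
      rw [LinearEquiv.trans_apply, ← htr, g1, g2, hl]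
      exact ((hE.collar j).deck hφ g3 g4).symm
  have hq1 : B (tube (κ j) (wy - l) t) = tube (κ i) (u + u + zx) s := by
    rw [hBB, LinearEquiv.trans_apply, ← htr, sub_add_cancel, LinearEquiv.trans_apply, hB1, hTt]
  -- the second point of contact lies on the wrong side
  have hsd := hd _ hκ
  have hsd' := hd _ hκi
  have k1 : mink (B (tubeN (κ j) wy t)) (B (tube (κ j) (wy - l) t)) ≤ 0 := by
    have htR : -R < t := by linarith
    have hd' : ∀ k, 0 < k → 0 < Real.sinh t + k * Real.cosh t := fun k hk =>
      add_pos_of_nonneg_of_pos (Real.sinh_nonneg_iff.2 hb0) (mul_pos hk (Real.cosh_pos t))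
    rw [hB.map_mink, mink_tubeN_tube hκj, sub_self, Real.sinh_zero]
    have h1 := mul_nonneg (mul_pos (hd' _ hκj) (S.stretch_pos j htR)).le
      (vn_nonneg (mX (κ j)) (wy 0 - (wy - l) 0))
    have h2 := mul_nonneg (mul_pos (hd' _ (inv_pos.2 hκj)) (S.stretch_inv_pos j htR)).le
      (vn_nonneg (mY (κ j)) (wy 1 - (wy - l) 1))
    linarith
  have h0 : zx 0 - (u + u + zx) 0 = -(2 * u 0) := by simp; ring
  have h1 : zx 1 - (u + u + zx) 1 = -(2 * u 1) := by simp; ring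
  rw [hopp, hq1, mink_neg_left, mink_tubeN_tube hκ, sub_self, Real.sinh_zero, h0, h1, vn_neg,
    vn_neg] at k1
  have p1 := mul_pos hsd hs1
  have p2 := mul_pos hsd' hs2
  have v1 := vn_nonneg (mX (κ i)) (2 * u 0)
  have v2 := vn_nonneg (mY (κ i)) (2 * u 1)
  have q1 := mul_nonneg p1.le v1
  have q2 := mul_nonneg p2.le v2
  have z1 : vn (mX (κ i)) (2 * u 0) = 0 :=
    (mul_eq_zero.1 (le_antisymm (by linarith) q1)).resolve_left p1.ne'
  have z2 : vn (mY (κ i)) (2 * u 1) = 0 :=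
    (mul_eq_zero.1 (le_antisymm (by linarith) q2)).resolve_left p2.ne'
  exact hu0 (eq_zero_of_short hR (S.one_le i) ha0 hshort z1 z2)

end IsCollarFamily

end

section

/-! ### Growing the collars -/

variable {M : Type*} [TopologicalSpace M] {𝒜 : HyperbolicAtlas M} {ι : Type*}
variable {R : ℝ} {κ : ι → ℝ} {φ : ι → Plane → M} [T2Space M]

/-- The *closed* collars of depths `δ i` are embedded and pairwise disjoint. -/
structure IsEmbeddedFamily (S : IsTubeSystem 𝒜 R κ φ) (δ δ' : ι → ℝ)
    (E : ι → Plane × ℝ → extended 𝒜 R) : Prop extends IsCollarFamily S δ δ' E where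
  inj_le : ∀ i j (a b : Plane × ℝ), -R < a.2 → a.2 ≤ δ i → -R < b.2 → b.2 ≤ δ j → E i a = E j b →
    a.2 = b.2 ∧ φ i a.1 = φ j b.1

variable {S : IsTubeSystem 𝒜 R κ φ} {δ δ' : ι → ℝ} {E : ι → Plane × ℝ → extended 𝒜 R}

theorem IsEmbeddedFamily.of_le (h0 : ∀ i, 0 ≤ δ i) (hlt : ∀ i, δ i < δ' i)
    (hE : ∀ i, IsCollar S i (δ' i) (E i))
    (hinj : ∀ i j (a b : Plane × ℝ), -R < a.2 → a.2 ≤ δ i → -R < b.2 → b.2 ≤ δ j → E i a = E j b →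
      a.2 = b.2 ∧ φ i a.1 = φ j b.1) : IsEmbeddedFamily S δ δ' E :=
  { nonneg := h0
    lt := hlt
    collar := hE
    inj := fun i j a b h1 h2 h3 h4 => hinj i j a b h1 h2.le h3 h4.le
    inj_le := hinj }

theorem IsEmbeddedFamily.mono (h : IsEmbeddedFamily S δ δ' E) {δ₁ : ι → ℝ} (h0 : ∀ i, 0 ≤ δ₁ i)
    (hle : ∀ i, δ₁ i ≤ δ i) : IsEmbeddedFamily S δ₁ δ' E :=
  .of_le h0 (fun i => (hle i).trans_lt (h.lt i)) h.collar fun i j a b h1 h2 h3 h4 =>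
    h.inj_le i j a b h1 (h2.trans (hle i)) h3 (h4.trans (hle j))

theorem IsTubeSystem.inj_of_nonpos (hE : ∀ i, IsCollar S i (δ' i) (E i)) {i j : ι}
    {a b : Plane × ℝ} (h1 : -R < a.2) (h2 : a.2 ≤ 0) (h3 : -R < b.2) (h4 : b.2 ≤ 0)
    (h : E i a = E j b) : a.2 = b.2 ∧ φ i a.1 = φ j b.1 := by
  have := congrArg Subtype.val h
  rw [(hE i).val_eq h1 h2, (hE j).val_eq h3 h4] at this
  exact ⟨(Prod.ext_iff.1 this).2, (Prod.ext_iff.1 this).1⟩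

theorem IsTubeSystem.exists_embedded_zero [CompactSpace M] (S : IsTubeSystem 𝒜 R κ φ) :
    ∃ δ' E, IsEmbeddedFamily S (fun _ => 0) δ' E := by
  obtain ⟨η, hη, h⟩ := S.exists_collar_extension
  choose E hE hE' using fun i => h i 0 _ le_rfl (S.isCollar_zero i)
    (fun a h1 h2 => absurd h1 (not_le.2 h2))
  exact ⟨fun _ => 0 + η, E, .of_le (fun _ => le_rfl) (fun _ => by linarith) hE
    fun i j a b h1 h2 h3 h4 => S.inj_of_nonpos hE h1 h2 h3 h4⟩

theorem IsEmbeddedFamily.exists_extension [CompactSpace M] (S : IsTubeSystem 𝒜 R κ φ) :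
    ∃ η > 0, ∀ δ δ' E, IsEmbeddedFamily S δ δ' E → ∃ E',
      (∀ i, IsCollar S i (δ i + η) (E' i)) ∧
      IsEmbeddedFamily S δ (fun i => δ i + η) E' := by
  obtain ⟨η, hη, h⟩ := S.exists_collar_extension
  refine ⟨η, hη, fun δ δ' E hE => ?_⟩
  choose E' hE' hE'' using fun i => h i (δ i) (E i) (hE.nonneg i)
    ((hE.collar i).mono (hE.lt i).le) fun a h1 h2 => hE.height_eq_zero h1 h2.le
  refine ⟨E', hE', .of_le hE.nonneg (fun i => by linarith) hE' ?_⟩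
  intro i j a b h1 h2 h3 h4 heq
  have e1 := (hE' i).unique (hE.collar i) h1 (by linarith) (h2.trans_lt (hE.lt i))
  have e2 := (hE' j).unique (hE.collar j) h3 (by linarith) (h4.trans_lt (hE.lt j))
  rw [e1, e2] at heq
  exact hE.inj_le i j a b h1 h2 h3 h4 heq

/-- By compactness, embedded disjoint closed collars can be enlarged by a small amount. -/
theorem IsEmbeddedFamily.exists_larger [CompactSpace M] [Finite ι]
    (hE : IsEmbeddedFamily S δ δ' E) {η : ℝ} (hη : 0 < η)
    (hcol : ∀ i, IsCollar S i (δ i + η) (E i)) :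
    ∃ ε > 0, ε < η ∧ ∀ i j (a b : Plane × ℝ), -R < a.2 → a.2 ≤ δ i + ε → -R < b.2 →
      b.2 ≤ δ j + ε → E i a = E j b → a.2 = b.2 ∧ φ i a.1 = φ j b.1 := by
  have hR := S.pos
  choose K hK hKφ using S.exists_compact
  have evgt : ∀ i (a : Plane × ℝ), δ i < a.2 → ∀ᶠ x : ℝ × (Plane × ℝ) in 𝓝 (0, a),
      ¬ x.2.2 ≤ δ i + x.1 := by
    intro i a ha
    have hc : Continuous fun x : ℝ × (Plane × ℝ) => x.2.2 - x.1 := by fun_prop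
    have := (hc.tendsto (0, a)).eventually (lt_mem_nhds (a := δ i) (by simpa using ha))
    filter_upwards [this] with x hx
    linarith
  have hheight : ∀ j, ∀ᶠ ε : ℝ in 𝓝 0, ∀ b ∈ K j ×ˢ Icc 0 (δ j + η / 2),
      b.2 ≤ δ j + ε → -(R / 2) < (E j b).1.2 := by
    intro j
    refine ((hK j).prod isCompact_Icc).eventually_forall_of_forall_eventually
      (P := fun ε b => b.2 ≤ δ j + ε → -(R / 2) < (E j b).1.2) ?_
    rintro b ⟨-, hb0, hb1⟩
    rcases le_or_gt b.2 (δ j) with h | h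
    · have h1 := hE.height_eq_zero hb0 h
      have h2 : Tendsto (fun x : ℝ × (Plane × ℝ) => (E j x.2).1.2) (𝓝 (0, b))
          (𝓝 (E j b).1.2) :=
        ((continuous_snd.comp continuous_subtype_val).tendsto _).comp
          (((hcol j).continuousAt (by linarith) (by linarith)).tendsto.comp
            (continuous_snd.tendsto (0, b)))
      filter_upwards [h2.eventually (lt_mem_nhds (a := -(R / 2)) (by rw [h1]; linarith))]
        with x hx _ using hx
    · filter_upwards [evgt j b h] with x hx h' using absurd h' hx
  have hpair : ∀ i j, ∀ᶠ ε : ℝ in 𝓝 0,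
      ∀ p ∈ (K i ×ˢ Icc (-(R / 2)) (δ i + η / 2)) ×ˢ (K j ×ˢ Icc (-(R / 2)) (δ j + η / 2)),
      p.1.2 ≤ δ i + ε → p.2.2 ≤ δ j + ε → E i p.1 = E j p.2 →
        p.1.2 = p.2.2 ∧ φ i p.1.1 = φ j p.2.1 := by
    intro i j
    refine (((hK i).prod isCompact_Icc).prod ((hK j).prod
      isCompact_Icc)).eventually_forall_of_forall_eventually
      (P := fun ε p => p.1.2 ≤ δ i + ε → p.2.2 ≤ δ j + ε → E i p.1 = E j p.2 →
        p.1.2 = p.2.2 ∧ φ i p.1.1 = φ j p.2.1) ?_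
    rintro ⟨a, b⟩ ⟨⟨-, ha0, ha1⟩, -, hb0, hb1⟩
    simp only at ha0 ha1 hb0 hb1 ⊢
    have c1 : Continuous fun x : ℝ × (Plane × ℝ) × (Plane × ℝ) => (x.1, x.2.1) := by fun_prop
    have c2 : Continuous fun x : ℝ × (Plane × ℝ) × (Plane × ℝ) => (x.1, x.2.2) := by fun_prop
    have c3 : Continuous fun x : ℝ × (Plane × ℝ) × (Plane × ℝ) => x.2.1 := by fun_prop
    have c4 : Continuous fun x : ℝ × (Plane × ℝ) × (Plane × ℝ) => x.2.2 := by fun_prop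
    have haR : -R < a.2 := by linarith
    have hbR : -R < b.2 := by linarith
    have haη : a.2 < δ i + η := by linarith
    have hbη : b.2 < δ j + η := by linarith
    rcases lt_or_ge (δ i) a.2 with h | ha
    · filter_upwards [(c1.tendsto (0, a, b)).eventually (evgt i a h)] with x hx h'
      exact absurd h' hx
    rcases lt_or_ge (δ j) b.2 with h | hb
    · filter_upwards [(c2.tendsto (0, a, b)).eventually (evgt j b h)] with x hx _ h'
      exact absurd h' hx
    have t1 := ((hcol i).continuousAt haR haη).tendsto.comp (c3.tendsto (0, a, b))
    have t2 := ((hcol j).continuousAt hbR hbη).tendsto.comp (c4.tendsto (0, a, b))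
    by_cases hab : E i a = E j b
    · obtain ⟨h1, h2⟩ := hE.inj_le i j a b haR ha hbR hb hab
      obtain rfl := S.index_eq i j _ _ h2
      obtain ⟨s, hs, hinj⟩ := (hcol i).exists_injOn haR haη
      have c5 : Continuous fun x : ℝ × (Plane × ℝ) × (Plane × ℝ) =>
        (x.2.2.1 + (a.1 - b.1), x.2.2.2) := by fun_prop
      have t5 := c5.tendsto (0, a, b)
      simp only [add_sub_cancel] at t5
      have hba : (a.1, b.2) = a := Prod.ext rfl h1.symm
      rw [hba] at t5
      have e1 : ∀ᶠ x : ℝ × (Plane × ℝ) × (Plane × ℝ) in 𝓝 (0, a, b), -R < x.2.2.2 :=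
        ((continuous_snd.comp c4).tendsto (0, a, b)).eventually (lt_mem_nhds hbR)
      have e2 : ∀ᶠ x : ℝ × (Plane × ℝ) × (Plane × ℝ) in 𝓝 (0, a, b), x.2.2.2 < δ i + η :=
        ((continuous_snd.comp c4).tendsto (0, a, b)).eventually (gt_mem_nhds hbη)
      filter_upwards [(c3.tendsto (0, a, b)).eventually hs, t5.eventually hs, e1, e2]
        with x g1 g2 g3 g4 _ _ heq
      have h5 := (hcol i).deck h2.symm g3 g4
      rw [← heq] at h5
      have h6 := hinj g2 g1 h5
      have h7 := congrArg Prod.fst h6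
      have h8 := congrArg Prod.snd h6
      simp only at h7 h8
      refine ⟨h8.symm, ?_⟩
      rw [← h7, (S.isTubeMap i).deck (S.κ_pos i) h2.symm]
    · obtain ⟨U, V, hU, hV, hUV⟩ := t2_separation_nhds hab
      filter_upwards [t1.eventually hU, t2.eventually hV] with x g1 g2 _ _ heq
      exact absurd (heq ▸ g2 : E i x.2.1 ∈ V) (Set.disjoint_left.1 hUV g1)
  have hall := (eventually_all.2 fun i => eventually_all.2 (hpair i)).and (eventually_all.2 hheight)
  obtain ⟨ε, ⟨h1, h2⟩, hε0, hεη⟩ := ((hall.filter_mono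
    (nhdsWithin_le_nhds (s := Ioi 0))).and (Ioo_mem_nhdsGT (half_pos hη))).exists
  refine ⟨ε, hε0, by linarith, ?_⟩
  have hred : ∀ i (a : Plane × ℝ), -R < a.2 → a.2 ≤ δ i + ε → ∃ z ∈ K i, φ i z = φ i a.1 ∧
      E i (z, a.2) = E i a := by
    intro i a ha ha'
    obtain ⟨z, hz, hzφ⟩ := hKφ i a.1
    exact ⟨z, hz, hzφ, (hcol i).eq_of_eq hzφ ha (by linarith)⟩
  have hlow : ∀ i j (a b : Plane × ℝ), -R < a.2 → -R < b.2 → b.2 ≤ δ j + ε → a.2 < -(R / 2) →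
      E i a = E j b → b.2 ≤ 0 := by
    intro i j a b ha hb hb' ha' hab
    by_contra hb0
    obtain ⟨z, hz, hzφ, hzE⟩ := hred j b hb hb'
    have h3 := h2 j (z, b.2) ⟨hz, (not_le.1 hb0).le, by simp only; linarith⟩ hb'
    rw [hzE, ← hab, (hcol i).val_eq ha (by linarith)] at h3
    simp only at h3
    linarith
  intro i j a b ha ha' hb hb' hab
  rcases lt_or_ge a.2 (-(R / 2)) with h | h
  · exact S.inj_of_nonpos hcol ha (by linarith) hb (hlow i j a b ha hb hb' h hab) hab
  rcases lt_or_ge b.2 (-(R / 2)) with h' | h'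
  · exact S.inj_of_nonpos hcol ha (hlow j i b a hb ha ha' h' hab.symm) hb (by linarith) hab
  obtain ⟨z, hz, hzφ, hzE⟩ := hred i a ha ha'
  obtain ⟨w, hw, hwφ, hwE⟩ := hred j b hb hb'
  have := h1 i j ((z, a.2), (w, b.2)) ⟨⟨hz, h, by simp only; linarith⟩, hw, h',
    by simp only; linarith⟩ ha' hb' (by rw [hzE, hwE, hab])
  simp only at this
  rwa [hzφ, hwφ] at this

/-- All collars grow simultaneously, each one until it has reached the depth `d i`; they remain
embedded and disjoint as long as the surfaces of the growing collars are invariant under short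
translations. -/
theorem IsTubeSystem.exists_embedded [CompactSpace M] [Finite ι] (S : IsTubeSystem 𝒜 R κ φ)
    {d : ι → ℝ} (hd : ∀ i, 0 ≤ d i)
    (hshort : ∀ i s, 0 < s → s ≤ d i → ∃ u : Plane, u ≠ 0 ∧ (∀ z, φ i (z + (u + u)) = φ i z) ∧
      stretch (κ i) (s + R) ^ 2 * u 0 ^ 2
        + stretch (κ i)⁻¹ (s + R) ^ 2 * sn (mY (κ i)) (u 1) ^ 2 < Real.sinh R ^ 2) :
    ∃ δ' E, IsEmbeddedFamily S d δ' E := by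
  have hR := S.pos
  obtain ⟨η, hη, hext⟩ := IsEmbeddedFamily.exists_extension S
  let P : ℝ → Prop := fun s => ∃ δ' E, IsEmbeddedFamily S (fun i => min s (d i)) δ' E
  have hP0 : P 0 := by
    obtain ⟨δ', E, h⟩ := S.exists_embedded_zero
    exact ⟨δ', E, h.mono (fun i => le_min le_rfl (hd i)) fun i => min_le_left _ _⟩
  have hmono : ∀ s s', 0 ≤ s → s ≤ s' → P s' → P s := by
    rintro s s' hs hss ⟨δ', E, h⟩
    exact ⟨δ', E, h.mono (fun i => le_min hs (hd i)) fun i => min_le_min_right _ hss⟩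
  have hopen : ∀ s, 0 ≤ s → P s → ∃ ε > 0, P (s + ε) := by
    rintro s hs ⟨δ', E, h⟩
    obtain ⟨E', hE', h'⟩ := hext _ _ _ h
    obtain ⟨ε, hε, hεη, hinj⟩ := h'.exists_larger hη hE'
    have hle : ∀ i, min (s + ε) (d i) ≤ min s (d i) + ε := fun i => by
      rw [← min_add_add_right]; exact min_le_min_left _ (by linarith)
    refine ⟨ε, hε, fun i => min s (d i) + η, E', .of_le (fun i => le_min (by linarith) (hd i))
      (fun i => (hle i).trans_lt (by linarith)) hE' ?_⟩
    intro i j a b h1 h2 h3 h4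
    exact hinj i j a b h1 (h2.trans (hle i)) h3 (h4.trans (hle j))
  have hclosed : ∀ s, 0 < s → (∀ t, 0 ≤ t → t < s → P t) → P s := by
    intro s hs h
    have hs1 : max 0 (s - η / 2) < s := max_lt hs (by linarith)
    obtain ⟨δ', E, hE⟩ := h _ (le_max_left _ _) hs1
    obtain ⟨E', hE', h'⟩ := hext _ _ _ hE
    have hle : ∀ i, min s (d i) < min (max 0 (s - η / 2)) (d i) + η := fun i => by
      rw [← min_add_add_right]
      exact lt_min ((min_le_left _ _).trans_lt (by linarith [le_max_right 0 (s - η / 2)]))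
        ((min_le_right _ _).trans_lt (by linarith))
    have hinh : ∀ i j (a b : Plane × ℝ), -R < a.2 → a.2 < s → a.2 ≤ d i → -R < b.2 → b.2 < s →
        b.2 ≤ d j → E' i a = E' j b → a.2 = b.2 ∧ φ i a.1 = φ j b.1 := by
      intro i j a b a1 a2 a3 b1 b2 b3 hab
      obtain ⟨t, ht⟩ : ∃ t, t = max 0 (max a.2 b.2) := ⟨_, rfl⟩
      have ht0 : 0 ≤ t := by rw [ht]; exact le_max_left _ _
      have hta : a.2 ≤ t := by rw [ht]; exact (le_max_left _ _).trans (le_max_right _ _)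
      have htb : b.2 ≤ t := by rw [ht]; exact (le_max_right _ _).trans (le_max_right _ _)
      have hts : t < s := by rw [ht]; exact max_lt hs (max_lt a2 b2)
      obtain ⟨δ₂, E₂, h₂⟩ := h t ht0 hts
      have ka := le_min hta a3
      have kb := le_min htb b3
      have la : a.2 < min (max 0 (s - η / 2)) (d i) + η := (le_min a2.le a3).trans_lt (hle i)
      have lb : b.2 < min (max 0 (s - η / 2)) (d j) + η := (le_min b2.le b3).trans_lt (hle j)
      rw [(hE' i).unique (h₂.collar i) a1 la (ka.trans_lt (h₂.lt i)),
        (hE' j).unique (h₂.collar j) b1 lb (kb.trans_lt (h₂.lt j))] at hab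
      exact h₂.inj_le i j a b a1 ka b1 kb hab
    have hfam : IsCollarFamily S (fun i => min s (d i))
        (fun i => min (max 0 (s - η / 2)) (d i) + η) E' :=
      ⟨fun i => le_min hs.le (hd i), hle, hE', fun i j a b a1 a2 b1 b2 =>
        hinh i j a b a1 (a2.trans_le (min_le_left _ _)) (a2.le.trans (min_le_right _ _)) b1
          (b2.trans_le (min_le_left _ _)) (b2.le.trans (min_le_right _ _))⟩
    -- only the surfaces which are still growing can cause a new contact
    have hnew : ∀ i j (a b : Plane × ℝ), a.2 = s → s ≤ d i → -R < b.2 →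
        b.2 ≤ min s (d j) → E' i a = E' j b → a.2 = b.2 ∧ φ i a.1 = φ j b.1 := by
      intro i j a b ha hsd b1 b2 hab
      obtain ⟨u, hu0, hu, hlt⟩ := hshort i s hs hsd
      have ha0 : 0 ≤ a.2 := by rw [ha]; exact hs.le
      have ha1 : a.2 ≤ min s (d i) := by rw [ha]; exact le_min le_rfl hsd
      have hb0 : 0 ≤ b.2 := by
        by_contra hb0
        have h1 := hfam.height_eq_zero (i := i) ha0 ha1
        rw [hab, (hE' j).val_eq b1 (not_le.1 hb0).le] at h1
        simp only at h1
        linarith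
      exact hfam.eq_of_short ha0 ha1 hb0 b2 hab hu0 hu (by rw [ha]; exact hlt)
    refine ⟨_, E', .of_le hfam.nonneg hle hE' ?_⟩
    intro i j a b a1 a2 b1 b2 hab
    rcases lt_or_ge a.2 s with h1 | h1
    · rcases lt_or_ge b.2 s with h2 | h2
      · exact hinh i j a b a1 h1 (a2.trans (min_le_right _ _)) b1 h2
          (b2.trans (min_le_right _ _)) hab
      · have := hnew j i b a (le_antisymm (b2.trans (min_le_left _ _)) h2)
          (h2.trans (b2.trans (min_le_right _ _))) a1 a2 hab.symm
        exact ⟨this.1.symm, this.2.symm⟩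
    · exact hnew i j a b (le_antisymm (a2.trans (min_le_left _ _)) h1)
        (h1.trans (a2.trans (min_le_right _ _))) b1 b2 hab
  have hall : ∀ s, 0 ≤ s → P s := by
    by_contra hno
    push Not at hno
    obtain ⟨s₁, hs₁, hPs₁⟩ := hno
    obtain ⟨A, hA⟩ : ∃ A : Set ℝ, A = {s | 0 ≤ s ∧ ¬ P s} := ⟨_, rfl⟩
    have hAne : A.Nonempty := ⟨s₁, by rw [hA]; exact ⟨hs₁, hPs₁⟩⟩
    have hAb : BddBelow A := ⟨0, by rw [hA]; rintro s ⟨h, -⟩; exact h⟩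
    have hinf0 : 0 ≤ sInf A := le_csInf hAne (by rw [hA]; rintro s ⟨h, -⟩; exact h)
    have hlt : ∀ t, 0 ≤ t → t < sInf A → P t := by
      intro t ht htA
      by_contra hPt
      exact notMem_of_lt_csInf htA hAb (by rw [hA]; exact ⟨ht, hPt⟩)
    have hPinf : P (sInf A) := by
      rcases hinf0.eq_or_lt with h | h
      · rw [← h]; exact hP0
      · exact hclosed _ h hlt
    obtain ⟨ε, hε, hPε⟩ := hopen _ hinf0 hPinf
    obtain ⟨s, hs, hsε⟩ := exists_lt_of_csInf_lt hAne (lt_add_of_pos_right (sInf A) hε)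
    rw [hA] at hs
    exact hs.2 (hmono s _ hs.1 hsε.le hPε)
  obtain ⟨D, hD⟩ := (Set.finite_range d).bddAbove
  have hdD : ∀ i, d i ≤ D := fun i => hD (mem_range_self i)
  obtain ⟨δ', E, h⟩ := hall (max 0 D) (le_max_left _ _)
  refine ⟨δ', E, ?_⟩
  have : (fun i => min (max 0 D) (d i)) = d :=
    funext fun i => min_eq_right ((hdD i).trans (le_max_right _ _))
  rwa [this] at h

end

section

/-! ### The depth of the truncation -/

theorem sinh_le_of_le_quarter {x : ℝ} (h0 : 0 ≤ x) (h1 : x ≤ 1 / 4) :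
    0.985 * Real.sinh x ≤ x := by
  have hx : |x| ≤ 1 := by rw [abs_of_nonneg h0]; linarith
  have e1 := (abs_le.1 (Real.exp_bound hx (n := 4) (by norm_num))).2
  have e2 := (abs_le.1 (Real.exp_bound (x := -x) (by rwa [abs_neg]) (n := 4) (by norm_num))).1
  simp only [Finset.sum_range_succ, Finset.sum_range_zero, Nat.factorial, abs_neg,
    abs_of_nonneg h0] at e1 e2
  norm_num at e1 e2
  rw [Real.sinh_eq]
  have h3 : x ^ 3 ≤ (1 / 4) ^ 2 * x := by
    have := mul_le_mul_of_nonneg_right (pow_le_pow_left₀ h0 h1 2) h0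
    linarith
  have h4 : x ^ 4 ≤ (1 / 4) ^ 3 * x := by
    have := mul_le_mul_of_nonneg_right (pow_le_pow_left₀ h0 h1 3) h0
    linarith
  linarith

/-- In the bumping argument, displacements in the direction of curvature `κ⁻¹` enter through the
hyperbolic sine; for small displacements it may be replaced by its argument. -/
theorem sn_sq_le {m x : ℝ} (hm : m ≤ 0) (h : -m * x ^ 2 ≤ 1 / 16) :
    0.985 ^ 2 * sn m x ^ 2 ≤ x ^ 2 := by
  unfold sn
  split_ifs with h1 h2
  · exact absurd hm (not_le.2 h1)
  · nlinarith [sq_nonneg x]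
  · have hm0 : 0 < -m := neg_pos.2 (lt_of_le_of_ne hm h2)
    have hs := Real.sqrt_pos.2 hm0
    have hsq := Real.sq_sqrt hm0.le
    have hθ : |√(-m) * x| ≤ 1 / 4 := by
      refine abs_le_of_sq_le_sq ?_ (by norm_num)
      rw [mul_pow, hsq]; linarith
    have h3 := sinh_le_of_le_quarter (abs_nonneg _) hθ
    rw [← Real.abs_sinh] at h3
    have h4 := pow_le_pow_left₀ (by positivity) h3 2
    rw [mul_pow, sq_abs, sq_abs, mul_pow, hsq] at h4
    rw [div_pow, hsq, mul_div_assoc', div_le_iff₀ hm0]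
    linarith

/-- A translation of Euclidean length less than `2 c'` along the surface of height `s` is short
enough for the bumping argument. -/
theorem short_of_lt {κ R s c : ℝ} {u : Plane} (hR : 0 < R) (hκ : 1 ≤ κ)
    (hle : κ ≤ Real.cosh R / Real.sinh R) (hs : 0 ≤ s) (hc : 0 < c)
    (h1 : c * (Real.cosh R / Real.sinh R * stretch κ s + (Real.sinh s + κ * Real.cosh s))
      ≤ stretch κ s) (h2 : c * (Real.cosh R / Real.sinh R + 1) ≤ 0.985)
    (h : stretch κ s ^ 2 * u 0 ^ 2 + stretch κ⁻¹ s ^ 2 * u 1 ^ 2 < c ^ 2) :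
    stretch κ (s + R) ^ 2 * u 0 ^ 2
      + stretch κ⁻¹ (s + R) ^ 2 * sn (mY κ) (u 1) ^ 2 < Real.sinh R ^ 2 := by
  have hκ0 : 0 < κ := one_pos.trans_le hκ
  have hκi : 0 < κ⁻¹ := inv_pos.2 hκ0
  have hκ1 : κ⁻¹ ≤ 1 := inv_le_one_of_one_le₀ hκ
  have hsh : 0 < Real.sinh R := Real.sinh_pos_iff.2 hR
  have hss : 0 ≤ Real.sinh s := Real.sinh_nonneg_iff.2 hs
  have hch := Real.cosh_pos s
  have hcs := Real.cosh_sq s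
  have hlt : Real.sinh s < Real.cosh s := Real.sinh_lt_cosh s
  rw [stretch_add, stretch_add]
  have ha := stretch_pos_of_nonneg hκ0.le hs
  have hb := stretch_pos_of_nonneg hκi.le hs
  obtain ⟨C, hC⟩ : ∃ C, C = Real.cosh R / Real.sinh R := ⟨_, rfl⟩
  have hCR : Real.cosh R = C * Real.sinh R := by rw [hC]; field_simp
  have hC1 : 1 < C := by rw [hC]; exact one_lt_coth hR
  rw [← hC] at h1 h2 hle
  rw [hCR]
  obtain ⟨a', ha'⟩ : ∃ a', a' = Real.sinh s + κ * Real.cosh s := ⟨_, rfl⟩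
  obtain ⟨b', hb'⟩ : ∃ b', b' = Real.sinh s + κ⁻¹ * Real.cosh s := ⟨_, rfl⟩
  have ha'0 : 0 < a' := by rw [ha']; positivity
  have hb'0 : 0 < b' := by rw [hb']; positivity
  have hb'b : b' ≤ stretch κ⁻¹ s := by
    rw [hb']; unfold stretch
    linarith [mul_nonneg (sub_nonneg.2 hκ1) (sub_nonneg.2 hlt.le)]
  have ha'C : a' ≤ C * stretch κ s := by
    have : a' ≤ κ * stretch κ s := by
      rw [ha']; unfold stretch
      have h1 : 1 ≤ κ * κ := by nlinarith
      linarith [mul_nonneg (sub_nonneg.2 h1) hss]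
    exact this.trans (mul_le_mul_of_nonneg_right hle ha.le)
  have hab : a' * b' = stretch κ s * stretch κ⁻¹ s := by
    rw [ha', hb']; unfold stretch
    linear_combination (Real.cosh s ^ 2 - Real.sinh s ^ 2) * (mul_inv_cancel₀ hκ0.ne')
  have hm : b' ^ 2 - stretch κ⁻¹ s ^ 2 = mY κ := by
    rw [hb']; unfold mY stretch; linear_combination (κ⁻¹ ^ 2 - 1) * hcs
  rw [← ha', ← hb']
  rw [← ha'] at h1
  generalize stretch κ s = a at *
  generalize stretch κ⁻¹ s = b at *
  generalize Real.sinh R = sR at *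
  have hsn : 0.985 ^ 2 * sn (mY κ) (u 1) ^ 2 ≤ u 1 ^ 2 := by
    refine sn_sq_le (mY_nonpos hκ) ?_
    have k1 : 2 * c * a' ≤ a := by
      have := mul_le_mul_of_nonneg_left ha'C hc.le
      linarith
    have k2 : 2 * c * b ≤ b' := by
      have := mul_le_mul_of_nonneg_right k1 hb'0.le
      have h3 : a * (2 * c * b) ≤ a * b' := by linear_combination this - 2 * c * hab
      exact le_of_mul_le_mul_left h3 ha
    have k3 : (2 * c * b) ^ 2 ≤ b' ^ 2 := pow_le_pow_left₀ (by positivity) k2 2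
    have k4 : b ^ 2 * u 1 ^ 2 ≤ c ^ 2 := by
      have : 0 ≤ a ^ 2 * u 0 ^ 2 := by positivity
      linarith
    have k5 : 0 ≤ b ^ 2 - b' ^ 2 := by nlinarith
    have k6 : (b ^ 2 - b' ^ 2) * b' ^ 2 ≤ b ^ 4 / 4 := by
      nlinarith [sq_nonneg (b ^ 2 - 2 * b' ^ 2)]
    -- multiply the claim by `4 b ^ 4`
    have k7 : 4 * b ^ 4 * ((b ^ 2 - b' ^ 2) * u 1 ^ 2) ≤ 4 * b ^ 4 * (1 / 16) := by
      have l1 := mul_le_mul_of_nonneg_left k4 (mul_nonneg k5 (sq_nonneg b))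
      have l2 := mul_le_mul_of_nonneg_left k3 k5
      linarith
    have := le_of_mul_le_mul_left k7 (by positivity)
    rw [← hm]
    linarith
  have j1 : c ^ 2 * ((a * (C * sR) + a' * sR) ^ 2 * u 0 ^ 2) ≤ sR ^ 2 * (a ^ 2 * u 0 ^ 2) := by
    have := pow_le_pow_left₀ (by positivity) h1 2
    have := mul_le_mul_of_nonneg_left this (mul_nonneg (sq_nonneg sR) (sq_nonneg (u 0)))
    linarith
  have j2 : c ^ 2 * ((b * (C * sR) + b' * sR) ^ 2 * sn (mY κ) (u 1) ^ 2)
      ≤ sR ^ 2 * (b ^ 2 * u 1 ^ 2) := by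
    have l1 : c * (C * b + b') ≤ 0.985 * b := by
      have m1 := mul_le_mul_of_nonneg_right h2 hb.le
      have m2 := mul_le_mul_of_nonneg_left hb'b hc.le
      linarith
    have l2 := pow_le_pow_left₀ (by positivity) l1 2
    have l3 := mul_le_mul_of_nonneg_left l2
      (mul_nonneg (sq_nonneg sR) (sq_nonneg (sn (mY κ) (u 1))))
    have l4 := mul_le_mul_of_nonneg_left hsn (mul_nonneg (sq_nonneg sR) (sq_nonneg b))
    linarith
  have j3 : c ^ 2 * ((a * (C * sR) + a' * sR) ^ 2 * u 0 ^ 2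
      + (b * (C * sR) + b' * sR) ^ 2 * sn (mY κ) (u 1) ^ 2) < c ^ 2 * sR ^ 2 := by
    have := mul_lt_mul_of_pos_left h (pow_pos hsh 2)
    linarith
  exact lt_of_mul_lt_mul_left j3 (sq_nonneg c)

theorem truncationConstant_pos {R : ℝ} (hR : 0 < R) : 0 < truncationConstant R := by
  have := one_lt_coth hR
  unfold truncationConstant
  refine lt_min (div_pos (by norm_num) (by linarith)) (div_pos one_pos (by linarith))

/-- The truncation constant leaves room for the bumping argument at positive heights. -/
theorem exists_bumping_constant {κ R s : ℝ} (hR : 0 < R) (hκ : 1 ≤ κ)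
    (hle : κ ≤ Real.cosh R / Real.sinh R) (hs : 0 < s) : ∃ c, truncationConstant R < c ∧
      c * (Real.cosh R / Real.sinh R * stretch κ s + (Real.sinh s + κ * Real.cosh s))
        ≤ stretch κ s ∧ c * (Real.cosh R / Real.sinh R + 1) ≤ 0.985 := by
  have hC1 := one_lt_coth hR
  obtain ⟨C, hC⟩ : ∃ C, C = Real.cosh R / Real.sinh R := ⟨_, rfl⟩
  unfold truncationConstant
  rw [← hC] at hle hC1 ⊢
  have hκ0 : 0 < κ := one_pos.trans_le hκ
  have hss : 0 < Real.sinh s := Real.sinh_pos_iff.2 hs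
  have hch := Real.cosh_pos s
  have ha := stretch_pos_of_nonneg hκ0.le hs.le
  obtain ⟨a', ha'⟩ : ∃ a', a' = Real.sinh s + κ * Real.cosh s := ⟨_, rfl⟩
  have ha'0 : 0 < a' := by rw [ha']; positivity
  have ha'C : a' < C * stretch κ s := by
    rw [ha']; unfold stretch
    rcases hκ.eq_or_lt with h | h
    · rw [← h]
      linarith [mul_pos (sub_pos.2 hC1) (add_pos hch hss)]
    · have h1 : 1 < κ * κ := by nlinarith
      have h2 : κ * (Real.cosh s + κ * Real.sinh s) ≤ C * (Real.cosh s + κ * Real.sinh s) :=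
        mul_le_mul_of_nonneg_right hle (by positivity)
      linarith [mul_pos (sub_pos.2 h1) hss]
  rw [← ha']
  generalize stretch κ s = a at *
  have hpos : 0 < C * a + a' := by positivity
  have hC0 : 0 < C + 1 := by linarith
  refine ⟨min (0.985 / (C + 1)) (a / (C * a + a')), ?_, ?_, ?_⟩
  · refine lt_min ((min_le_left _ _).trans_lt ?_) ((min_le_right _ _).trans_lt ?_)
    · exact div_lt_div_of_pos_right (by norm_num) hC0
    · rw [div_lt_div_iff₀ (by linarith) hpos]; linarith
  · refine (mul_le_mul_of_nonneg_right (min_le_right _ _) hpos.le).trans ?_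
    rw [div_mul_cancel₀ _ hpos.ne']
  · refine (mul_le_mul_of_nonneg_right (min_le_left _ _) hC0.le).trans ?_
    rw [div_mul_cancel₀ _ hC0.ne']

theorem continuous_stretch (k : ℝ) : Continuous (stretch k) :=
  continuous_iff_continuousAt.2 fun h => (hasDerivAt_stretch k h).continuousAt

theorem cosh_le_stretch {k h : ℝ} (hk : 0 ≤ k) (hh : 0 ≤ h) : Real.cosh h ≤ stretch k h := by
  unfold stretch
  linarith [mul_nonneg hk (Real.sinh_nonneg_iff.2 hh)]

variable {M : Type*} [TopologicalSpace M] {𝒜 : HyperbolicAtlas M} {ι : Type*}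
variable {R : ℝ} {κ : ι → ℝ} {φ : ι → Plane → M}

/-- The depth to which the torus `i` is moved: the smallest one for which all translations of the
torus have length at least `2 c`, where `c` is the truncation constant. -/
theorem IsTubeSystem.exists_depth (S : IsTubeSystem 𝒜 R κ φ) (i : ι) : ∃ d, 0 ≤ d ∧
    (∀ v : Plane, (∀ z, φ i (z + v) = φ i z) → v ≠ 0 →
      (2 * truncationConstant R) ^ 2 ≤ stretch (κ i) d ^ 2 * v 0 ^ 2
        + stretch (κ i)⁻¹ d ^ 2 * v 1 ^ 2) ∧
    ∀ s, 0 < s → s ≤ d → ∃ u : Plane, u ≠ 0 ∧ (∀ z, φ i (z + (u + u)) = φ i z) ∧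
      stretch (κ i) (s + R) ^ 2 * u 0 ^ 2
        + stretch (κ i)⁻¹ (s + R) ^ 2 * sn (mY (κ i)) (u 1) ^ 2 < Real.sinh R ^ 2 := by
  have hR := S.pos
  have hκ := S.κ_pos i
  have hκi : 0 < (κ i)⁻¹ := inv_pos.2 hκ
  obtain ⟨c, hc⟩ : ∃ c, c = truncationConstant R := ⟨_, rfl⟩
  have hc0 : 0 < c := by rw [hc]; exact truncationConstant_pos hR
  rw [← hc]
  obtain ⟨D, hD⟩ : ∃ D : Set ℝ, D = {d | 0 ≤ d ∧ ∀ v : Plane, (∀ z, φ i (z + v) = φ i z) → v ≠ 0 →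
      (2 * c) ^ 2 ≤ stretch (κ i) d ^ 2 * v 0 ^ 2 + stretch (κ i)⁻¹ d ^ 2 * v 1 ^ 2} := ⟨_, rfl⟩
  have hne : D.Nonempty := by
    obtain ⟨s, hs, hinj⟩ := (S.isTubeMap i).exists_injOn hκ 0
    obtain ⟨ρ, hρ, hρs⟩ := Metric.mem_nhds_iff.1 hs
    have hmin : ∀ v : Plane, (∀ z, φ i (z + v) = φ i z) → v ≠ 0 → ρ ≤ ‖v‖ := by
      intro v hv hv0
      by_contra h
      refine hv0 (hinj (hρs ?_) (mem_of_mem_nhds hs) ?_)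
      · rw [mem_ball_zero_iff]; exact not_le.1 h
      · simpa using hv 0
    refine ⟨2 * c / ρ, ?_⟩
    rw [hD]
    have hd0 : 0 ≤ 2 * c / ρ := by positivity
    refine ⟨hd0, fun v hv hv0 => ?_⟩
    have hch : 2 * c / ρ ≤ Real.cosh (2 * c / ρ) :=
      (Real.self_le_sinh_iff.2 hd0).trans (Real.sinh_lt_cosh _).le
    have h1 := pow_le_pow_left₀ hd0 (hch.trans (cosh_le_stretch hκ.le hd0)) 2
    have h2 := pow_le_pow_left₀ hd0 (hch.trans (cosh_le_stretch hκi.le hd0)) 2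
    have h3 : ρ ^ 2 ≤ v 0 ^ 2 + v 1 ^ 2 := by
      have := pow_le_pow_left₀ hρ.le (hmin v hv hv0) 2
      rw [EuclideanSpace.norm_sq_eq, Fin.sum_univ_two] at this
      simpa using this
    calc (2 * c) ^ 2 = (2 * c / ρ) ^ 2 * ρ ^ 2 := by field_simp
      _ ≤ (2 * c / ρ) ^ 2 * (v 0 ^ 2 + v 1 ^ 2) := mul_le_mul_of_nonneg_left h3 (sq_nonneg _)
      _ ≤ _ := by
        rw [mul_add]
        exact add_le_add (mul_le_mul_of_nonneg_right h1 (sq_nonneg _))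
          (mul_le_mul_of_nonneg_right h2 (sq_nonneg _))
  have hbdd : BddBelow D := ⟨0, by rw [hD]; rintro d ⟨h, -⟩; exact h⟩
  have hcl : IsClosed D := by
    rw [hD]
    simp only [ofPred_and, ofPred_forall]
    refine (isClosed_le continuous_const continuous_id).inter ?_
    refine isClosed_iInter fun v => isClosed_iInter fun _ => isClosed_iInter fun _ => ?_
    have h1 := continuous_stretch (κ i); have h2 := continuous_stretch (κ i)⁻¹
    exact isClosed_le continuous_const (by fun_prop)
  have hmem := hcl.csInf_mem hne hbdd
  have hDm : ∀ d, d ∈ D ↔ 0 ≤ d ∧ ∀ v : Plane, (∀ z, φ i (z + v) = φ i z) → v ≠ 0 →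
      (2 * c) ^ 2 ≤ stretch (κ i) d ^ 2 * v 0 ^ 2 + stretch (κ i)⁻¹ d ^ 2 * v 1 ^ 2 := by
    rw [hD]; exact fun _ => Iff.rfl
  have hmem' := (hDm _).1 hmem
  refine ⟨sInf D, hmem'.1, hmem'.2, fun s hs hsD => ?_⟩
  obtain ⟨c', hcc', h1, h2⟩ := exists_bumping_constant hR (S.one_le i) (S.le_coth i) hs
  rw [← hc] at hcc'
  have hc'0 : 0 < c' := hc0.trans hcc'
  -- compare with a slightly smaller height
  have hev : ∀ k, 0 ≤ k → ∀ᶠ t in 𝓝[<] s, c * stretch k s < c' * stretch k t := by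
    intro k hk
    have h3 := ((continuous_stretch k).tendsto s).const_mul c'
    exact nhdsWithin_le_nhds (h3.eventually (lt_mem_nhds
      (mul_lt_mul_of_pos_right hcc' (stretch_pos_of_nonneg hk hs.le))))
  obtain ⟨t, ht1, ht2, ht0, hts⟩ := ((hev _ hκ.le).and ((hev _ hκi.le).and
    (Ioo_mem_nhdsLT hs))).exists
  have htD : t ∉ D := notMem_of_lt_csInf (hts.trans_le hsD) hbdd
  rw [hD] at htD
  have htD' : ∃ v : Plane, (∀ z, φ i (z + v) = φ i z) ∧ v ≠ 0 ∧
      stretch (κ i) t ^ 2 * v 0 ^ 2 + stretch (κ i)⁻¹ t ^ 2 * v 1 ^ 2 < (2 * c) ^ 2 := by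
    by_contra hno
    push Not at hno
    exact htD ⟨ht0.le, hno⟩
  obtain ⟨v, hv, hv0, hvc⟩ := htD'
  have hvv : (2⁻¹ : ℝ) • v + (2⁻¹ : ℝ) • v = v := by
    rw [← add_smul]; norm_num
  refine ⟨(2⁻¹ : ℝ) • v, smul_ne_zero (by norm_num) hv0, by rw [hvv]; exact hv, ?_⟩
  refine short_of_lt hR (S.one_le i) (S.le_coth i) hs.le hc'0 h1 h2 ?_
  have e0 : ((2⁻¹ : ℝ) • v) 0 = 2⁻¹ * v 0 := rfl
  have e1 : ((2⁻¹ : ℝ) • v) 1 = 2⁻¹ * v 1 := rfl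
  rw [e0, e1]
  have p1 := pow_le_pow_left₀ (mul_nonneg hc0.le (stretch_pos_of_nonneg hκ.le hs.le).le) ht1.le 2
  have p2 := pow_le_pow_left₀ (mul_nonneg hc0.le (stretch_pos_of_nonneg hκi.le hs.le).le) ht2.le 2
  have q1 := mul_le_mul_of_nonneg_right p1 (sq_nonneg (v 0))
  have q2 := mul_le_mul_of_nonneg_right p2 (sq_nonneg (v 1))
  have q3 := mul_lt_mul_of_pos_left hvc (pow_pos hc'0 2)
  have q4 : c ^ 2 * (stretch (κ i) s ^ 2 * (2⁻¹ * v 0) ^ 2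
      + stretch (κ i)⁻¹ s ^ 2 * (2⁻¹ * v 1) ^ 2) < c ^ 2 * c' ^ 2 := by linarith
  exact lt_of_mul_lt_mul_left q4 (sq_nonneg c)

end

section

/-! ### Parallel surfaces -/

theorem contDiff_tubeForm (κ : ℝ) : ContDiff ℝ ∞ (tubeForm κ) := by
  unfold tubeForm; fun_prop

theorem fderiv_tubeForm {κ d : ℝ} (hκ : 0 < κ) (ha : stretch κ d ≠ 0) (hb : stretch κ⁻¹ d ≠ 0)
    (z : Plane) {v : Mink} (hv : mink (tube κ z d) v = 0) :
    fderiv ℝ (tubeForm κ) (tube κ z d) v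
      = 2 * stretch κ d * (Real.sinh d + κ * Real.cosh d) * mink v (tubeN κ z d) := by
  have hQ := ((contDiff_tubeForm κ).differentiable (by simp) (tube κ z d)).hasFDerivAt
  have h1 := hQ.comp z (hasFDerivAt_tube hκ.ne' z d)
  have h1' : HasFDerivAt (tubeForm κ ∘ fun z => tube κ z d) (0 : Plane →L[ℝ] ℝ) z := by
    refine (hasFDerivAt_const (stretch κ d ^ 2) z).congr_of_eventuallyEq (.of_forall fun w => ?_)
    exact tubeForm_tube hκ w d
  have h2 := hQ.comp_hasDerivAt d (hasDerivAt_tube κ z d)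
  have h2' : HasDerivAt (tubeForm κ ∘ tube κ z)
      (2 * stretch κ d * (Real.sinh d + κ * Real.cosh d)) d := by
    refine (((hasDerivAt_stretch κ d).pow 2).congr_of_eventuallyEq
      (.of_forall fun w => tubeForm_tube hκ z w)).congr_deriv ?_
    push_cast; ring
  have e3 := h2.unique h2'
  have e0 := h1.unique h1'
  have e1 := DFunLike.congr_fun e0 (!₂[1, 0] : Plane)
  have e2 := DFunLike.congr_fun e0 (!₂[0, 1] : Plane)
  simp [ha] at e1
  simp [hb] at e2
  have hx := (isFrame_tube hκ z d).expand v
  rw [mink_comm v (tube κ z d), hv, neg_zero, zero_smul, zero_add] at hx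
  have : fderiv ℝ (tubeForm κ) (tube κ z d) v = mink v (tubeN κ z d)
      * fderiv ℝ (tubeForm κ) (tube κ z d) (tubeN κ z d) := by
    conv_lhs => rw [hx]
    simp [e1, e2]
  rw [this, e3]; ring

/-- The linear map that takes each point of the surface at distance `d` from `tubeBase κ` to its
unit normal. -/
def levelOp (κ d : ℝ) : Mink →ₗ[ℝ] Mink :=
  (Real.sinh d * (2 * Real.cosh d + (κ + κ⁻¹) * Real.sinh d) / (stretch κ d * stretch κ⁻¹ d)) •
    LinearMap.id + (stretch κ d * stretch κ⁻¹ d)⁻¹ • shapeOp κ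

theorem levelOp_tube {κ d : ℝ} (hκ : 0 < κ) (ha : stretch κ d ≠ 0) (hb : stretch κ⁻¹ d ≠ 0)
    (z : Plane) : levelOp κ d (tube κ z d) = tubeN κ z d := by
  have hab : stretch κ d * stretch κ⁻¹ d = Real.cosh d ^ 2 + (κ + κ⁻¹) * Real.cosh d * Real.sinh d
      + Real.sinh d ^ 2 := by
    unfold stretch; linear_combination Real.sinh d ^ 2 * mul_inv_cancel₀ hκ.ne'
  have hne := mul_ne_zero ha hb
  have hcs := Real.cosh_sq d
  simp only [levelOp, LinearMap.add_apply, LinearMap.smul_apply, LinearMap.id_apply]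
  rw [← smul_right_inj hne, smul_add, smul_smul, smul_smul, mul_div_cancel₀ _ hne,
    mul_inv_cancel₀ hne, one_smul, hab]
  simp only [tube, tubeN, map_add, map_smul, shapeOp_sq hκ.ne']
  funext i
  simp only [Pi.add_apply, Pi.smul_apply, Pi.sub_apply, smul_eq_mul]
  linear_combination (Real.sinh d * tubeBase κ z i
    - (Real.cosh d + (κ + κ⁻¹) * Real.sinh d) * shapeOp κ (tubeBase κ z) i) * hcs

theorem levelOp_tubeE₁ {κ d : ℝ} (hκ : 0 < κ) (hb : stretch κ⁻¹ d ≠ 0) (z : Plane) :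
    levelOp κ d (tubeE₁ κ z) = ((Real.sinh d + κ * Real.cosh d) / stretch κ d) • tubeE₁ κ z := by
  simp only [levelOp, LinearMap.add_apply, LinearMap.smul_apply, LinearMap.id_apply,
    shapeOp_tubeE₁ hκ.ne', smul_smul, ← add_smul]
  congr 1
  have h : Real.sinh d * (2 * Real.cosh d + (κ + κ⁻¹) * Real.sinh d) + κ
      = (Real.sinh d + κ * Real.cosh d) * stretch κ⁻¹ d := by
    unfold stretch
    linear_combination (-κ) * Real.cosh_sq d
      - Real.sinh d * Real.cosh d * mul_inv_cancel₀ hκ.ne'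
  rw [inv_mul_eq_div, ← add_div, h, mul_div_mul_right _ _ hb]

theorem levelOp_tubeE₂ {κ d : ℝ} (hκ : 0 < κ) (ha : stretch κ d ≠ 0) (z : Plane) :
    levelOp κ d (tubeE₂ κ z) = ((Real.sinh d + κ⁻¹ * Real.cosh d) / stretch κ⁻¹ d) • tubeE₂ κ z := by
  simp only [levelOp, LinearMap.add_apply, LinearMap.smul_apply, LinearMap.id_apply,
    shapeOp_tubeE₂ hκ.ne', smul_smul, ← add_smul]
  congr 1
  have h : Real.sinh d * (2 * Real.cosh d + (κ + κ⁻¹) * Real.sinh d) + κ⁻¹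
      = (Real.sinh d + κ⁻¹ * Real.cosh d) * stretch κ d := by
    unfold stretch
    linear_combination (-κ⁻¹) * Real.cosh_sq d
      - Real.sinh d * Real.cosh d * mul_inv_cancel₀ hκ.ne'
  rw [inv_mul_eq_div, ← add_div, h, mul_comm (stretch κ d), mul_div_mul_right _ _ ha]

/-- The larger principal curvature of the surface at distance `d` from a surface with constant
principal curvatures `κ, κ⁻¹`. -/
def levelCurvature (κ d : ℝ) : ℝ := (Real.sinh d + κ * Real.cosh d) / stretch κ d

theorem one_le_levelCurvature {κ d : ℝ} (hκ : 1 ≤ κ) (hd : 0 ≤ d) : 1 ≤ levelCurvature κ d := by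
  rw [levelCurvature, one_le_div (stretch_pos_of_nonneg (by linarith) hd)]
  unfold stretch
  linarith [mul_nonneg (sub_nonneg.2 hκ) (sub_nonneg.2 (Real.sinh_lt_cosh d).le)]

theorem levelCurvature_inv {κ d : ℝ} (hκ : 0 < κ) (hd : 0 ≤ d) :
    (levelCurvature κ d)⁻¹ = (Real.sinh d + κ⁻¹ * Real.cosh d) / stretch κ⁻¹ d := by
  have h1 := stretch_pos_of_nonneg hκ.le hd
  have h2 := stretch_pos_of_nonneg (inv_pos.2 hκ).le hd
  have h3 : 0 < Real.sinh d + κ * Real.cosh d := by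
    have := Real.sinh_nonneg_iff.2 hd; have := Real.cosh_pos d; positivity
  rw [levelCurvature, inv_div, div_eq_div_iff h3.ne' h2.ne']
  unfold stretch
  linear_combination (Real.sinh d ^ 2 - Real.cosh d ^ 2) * mul_inv_cancel₀ hκ.ne'

/-- Near the point `A (tube κ z d)`, the set `D` is the image under `A` of the side of larger
distances of the model surface at distance `d`. -/
structure IsTubeSide (D : Set Mink) (κ d : ℝ) (z : Plane) (A : Mink ≃ₗ[ℝ] Mink) : Prop where
  iso : IsHypIso A
  one_le : 1 ≤ κ
  nonneg : 0 ≤ d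
  mem_iff : ∀ᶠ b : Plane × ℝ in 𝓝 (z, d), A (tube κ b.1 b.2) ∈ D ↔ d ≤ b.2

namespace IsTubeSide

variable {D : Set Mink} {κ d : ℝ} {z : Plane} {A : Mink ≃ₗ[ℝ] Mink} (H : IsTubeSide D κ d z A)
include H

theorem pos : 0 < κ := one_pos.trans_le H.one_le

theorem stretch_pos : 0 < stretch κ d := stretch_pos_of_nonneg H.pos.le H.nonneg

theorem stretch_inv_pos : 0 < stretch κ⁻¹ d :=
  stretch_pos_of_nonneg (inv_pos.2 H.pos).le H.nonneg

theorem map_nhds : map (fun b : Plane × ℝ => A (tube κ b.1 b.2)) (𝓝 (z, d))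
    = 𝓝[hyp3] (A (tube κ z d)) := by
  rw [← H.iso.map_nhdsWithin, ← map_tube_nhds H.pos z d H.stretch_pos.ne' H.stretch_inv_pos.ne',
    map_map]
  rfl

theorem notMem_nhds : D ∉ 𝓝[hyp3] (A (tube κ z d)) := by
  intro h
  rw [← H.map_nhds] at h
  have h1 : ∀ᶠ b : Plane × ℝ in 𝓝 (z, d), d ≤ b.2 := by
    filter_upwards [h, H.mem_iff] with b h1 h2 using h2.1 h1
  have hc : Continuous fun t : ℝ => (z, t) := by fun_prop
  have h2 : ∀ᶠ t in 𝓝[<] d, d ≤ t := nhdsWithin_le_nhds ((hc.tendsto d).eventually h1)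
  obtain ⟨t, ht, ht'⟩ := (h2.and self_mem_nhdsWithin).exists
  exact absurd ht (not_le.2 ht')

/-- The stretching factor increases with the distance, so its square defines the side of larger
distances. -/
theorem eventually_stretch_iff : ∀ᶠ h in 𝓝 d, (0 ≤ stretch κ h ^ 2 - stretch κ d ^ 2 ↔ d ≤ h) ∧
    (stretch κ h ^ 2 - stretch κ d ^ 2 = 0 → h = d) := by
  have hmono : StrictMono (stretch κ) := by
    refine strictMono_of_hasDerivAt_pos (fun h => hasDerivAt_stretch κ h) fun h => ?_
    have h1 : 0 < Real.sinh h + Real.cosh h := by rw [Real.sinh_add_cosh]; exact Real.exp_pos h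
    linarith [mul_nonneg (sub_nonneg.2 H.one_le) (Real.cosh_pos h).le]
  filter_upwards [((continuous_stretch κ).tendsto d).eventually (lt_mem_nhds H.stretch_pos)]
    with h hh
  refine ⟨?_, fun h0 => ?_⟩
  · rw [sub_nonneg, pow_le_pow_iff_left₀ H.stretch_pos.le hh.le two_ne_zero, hmono.le_iff_le]
  · rw [sub_eq_zero, pow_left_inj₀ hh.le H.stretch_pos.le two_ne_zero] at h0
    exact hmono.injective h0

omit H in
theorem hasFDerivAt_form (p : Mink) :
    HasFDerivAt (fun q => tubeForm κ (A.symm q) - stretch κ d ^ 2)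
      ((fderiv ℝ (tubeForm κ) p).comp A.symm.toContinuousLinearEquiv.toContinuousLinearMap)
      (A p) := by
  have hQ := ((contDiff_tubeForm κ).differentiable (by simp) p).hasFDerivAt
  have h1 := A.symm.toContinuousLinearEquiv.hasFDerivAt (x := A p)
  have e : A.symm.toContinuousLinearEquiv (A p) = p := A.symm_apply_apply p
  rw [← e] at hQ
  have := (hQ.comp (A p) h1).sub_const (stretch κ d ^ 2)
  rw [e] at this
  exact this

theorem fderiv_form (w : Plane) {v : Mink} (hv : mink (tube κ w d) v = 0) :
    fderiv ℝ (fun q => tubeForm κ (A.symm q) - stretch κ d ^ 2) (A (tube κ w d)) (A v)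
      = 2 * stretch κ d * (Real.sinh d + κ * Real.cosh d) * mink v (tubeN κ w d) := by
  rw [(hasFDerivAt_form _).fderiv,
    ← fderiv_tubeForm H.pos H.stretch_pos.ne' H.stretch_inv_pos.ne' w hv]
  exact congrArg _ (A.symm_apply_apply v)

theorem factor_pos : 0 < 2 * stretch κ d * (Real.sinh d + κ * Real.cosh d) := by
  have := H.stretch_pos; have := H.pos
  have := Real.sinh_nonneg_iff.2 H.nonneg; have := Real.cosh_pos d
  positivity

theorem isInwardUnitNormal (w : Plane) :
    IsInwardUnitNormal (fun q => tubeForm κ (A.symm q) - stretch κ d ^ 2) (A (tube κ w d))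
      (A (tubeN κ w d)) := by
  have hf := isFrame_tube H.pos w d
  refine ⟨by rw [H.iso.map_mink, hf.pn], by rw [H.iso.map_mink, hf.nn], ?_, ?_⟩
  · rw [H.fderiv_form w hf.pn, hf.nn, mul_one]; exact H.factor_pos
  · rintro v ⟨h1, h2⟩
    obtain ⟨v, rfl⟩ := A.surjective v
    rw [H.iso.map_mink] at h1 ⊢
    rw [H.fderiv_form w h1] at h2
    rw [mink_comm]
    exact (mul_eq_zero.1 h2).resolve_left H.factor_pos.ne'

theorem isDefiningFunction : IsDefiningFunction D (A (tube κ z d))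
    (fun q => tubeForm κ (A.symm q) - stretch κ d ^ 2) := by
  have hf := isFrame_tube H.pos z d
  refine ⟨.of_forall fun q => ?_, ?_, ⟨A (tubeN κ z d), ?_, ?_⟩, ?_⟩
  · exact (((contDiff_tubeForm κ).comp
      A.symm.toContinuousLinearEquiv.contDiff).sub contDiff_const).contDiffAt
  · simp [tubeForm_tube H.pos]
  · rw [H.iso.map_mink, hf.pn]
  · exact (H.isInwardUnitNormal z).inward.ne'
  · rw [← H.map_nhds, eventually_map]
    filter_upwards [H.mem_iff,
      (continuous_snd.tendsto (z, d)).eventually H.eventually_stretch_iff] with b h1 h2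
    rw [h1, A.symm_apply_apply, tubeForm_tube H.pos, h2.1]

theorem hasPrincipalCurvatures : HasPrincipalCurvatures D (A (tube κ z d))
    (levelCurvature κ d) (levelCurvature κ d)⁻¹ := by
  have hf := isFrame_tube H.pos z d
  obtain ⟨L, hL⟩ : ∃ L : Mink →L[ℝ] Mink, ∀ v, L (A v) = A (levelOp κ d v) :=
    ⟨LinearMap.toContinuousLinearMap (A.toLinearMap ∘ₗ levelOp κ d ∘ₗ A.symm.toLinearMap),
      fun v => by simp⟩
  refine ⟨_, L, H.isDefiningFunction, .of_forall fun q => L.contDiff.contDiffAt, ?_,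
    A (tubeE₁ κ z), A (tubeE₂ κ z), ⟨?_, ?_⟩, ⟨?_, ?_⟩, ?_, ?_, ?_, ?_, ?_⟩
  · rw [← H.map_nhds, eventually_map]
    filter_upwards [(continuous_snd.tendsto (z, d)).eventually H.eventually_stretch_iff] with b h2 h3
    rw [A.symm_apply_apply, tubeForm_tube H.pos] at h3
    rw [h2.2 h3, hL, levelOp_tube H.pos H.stretch_pos.ne' H.stretch_inv_pos.ne']
    exact H.isInwardUnitNormal b.1
  · rw [H.iso.map_mink, hf.pe₁]
  · rw [H.fderiv_form z hf.pe₁, hf.e₁n, mul_zero]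
  · rw [H.iso.map_mink, hf.pe₂]
  · rw [H.fderiv_form z hf.pe₂, hf.e₂n, mul_zero]
  · rw [H.iso.map_mink, hf.e₁₁]
  · rw [H.iso.map_mink, hf.e₂₂]
  · rw [H.iso.map_mink, hf.e₁₂]
  · rw [L.fderiv, hL, levelOp_tubeE₁ H.pos H.stretch_inv_pos.ne', map_smul]
    rfl
  · rw [L.fderiv, hL, levelOp_tubeE₂ H.pos H.stretch_pos.ne', map_smul,
      levelCurvature_inv H.pos H.nonneg]

end IsTubeSide

/-- Euclidean coordinates on the surface at distance `d`. -/
def levelCoord (κ d : ℝ) (y : Plane) : Plane := !₂[(stretch κ d)⁻¹ * y 0, (stretch κ⁻¹ d)⁻¹ * y 1]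

theorem contDiff_levelCoord (κ d : ℝ) : ContDiff ℝ ∞ (levelCoord κ d) := by
  refine contDiff_euclidean.2 fun i => ?_
  fin_cases i <;> simp [levelCoord] <;> fun_prop

theorem levelCoord_surjective {κ d : ℝ} (ha : stretch κ d ≠ 0) (hb : stretch κ⁻¹ d ≠ 0) :
    Function.Surjective (levelCoord κ d) := by
  intro z
  refine ⟨!₂[stretch κ d * z 0, stretch κ⁻¹ d * z 1], ?_⟩
  ext i
  fin_cases i <;> simp [levelCoord, ha, hb]

theorem contDiff_tube_levelCoord (κ d : ℝ) :
    ContDiff ℝ ∞ fun y => tube κ (levelCoord κ d y) d :=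
  (contDiff_tube κ).comp ((contDiff_levelCoord κ d).prodMk contDiff_const)

/-- The coordinates `levelCoord` make the parametrization of the parallel surface isometric. -/
theorem mink_fderiv_tube_levelCoord {κ d : ℝ} (hκ : 0 < κ) (ha : stretch κ d ≠ 0)
    (hb : stretch κ⁻¹ d ≠ 0) {A : Mink ≃ₗ[ℝ] Mink} (hA : IsHypIso A) (y v w : Plane) :
    mink (fderiv ℝ (fun y => A (tube κ (levelCoord κ d y) d)) y v)
      (fderiv ℝ (fun y => A (tube κ (levelCoord κ d y) d)) y w) = inner ℝ v w := by
  have hL : ∀ v, levelCoord κ d v = LinearMap.toContinuousLinearMap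
      ({ toFun := levelCoord κ d
         map_add' := fun x y => by ext i; fin_cases i <;> simp [levelCoord, mul_add]
         map_smul' := fun c x => by
          ext i; fin_cases i <;> simp [levelCoord, mul_left_comm] } : Plane →ₗ[ℝ] Plane) v :=
    fun v => rfl
  generalize LinearMap.toContinuousLinearMap (_ : Plane →ₗ[ℝ] Plane) = L at hL
  have hf := isFrame_tube hκ (levelCoord κ d y) d
  have h1 : HasFDerivAt (levelCoord κ d) L y :=
    L.hasFDerivAt.congr_of_eventuallyEq (.of_forall hL)
  have h2 := A.toContinuousLinearEquiv.hasFDerivAt.comp y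
    ((hasFDerivAt_tube hκ.ne' (levelCoord κ d y) d).comp y h1)
  have h3 : ∀ v : Plane, fderiv ℝ (fun y => A (tube κ (levelCoord κ d y) d)) y v
      = A (v 0 • tubeE₁ κ (levelCoord κ d y) + v 1 • tubeE₂ κ (levelCoord κ d y)) := by
    intro v
    have e := congrArg (fun f : Plane →L[ℝ] Mink => f v) h2.fderiv
    refine e.trans ?_
    simp only [ContinuousLinearMap.comp_apply]
    refine congrArg A ?_
    rw [← hL]
    simp [levelCoord, smul_smul, mul_right_comm, ha, hb]
  rw [h3, h3, hA.map_mink]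
  simp only [mink_add_left, mink_add_right, mink_smul_left, mink_smul_right, hf.e₁₁, hf.e₂₂,
    hf.e₁₂, mink_comm (tubeE₂ _ _) (tubeE₁ _ _)]
  simp [PiLp.inner_apply, Fin.sum_univ_two]

end

section

/-! ### The truncated manifold -/

variable {M : Type*} [TopologicalSpace M] {𝒜 : HyperbolicAtlas M} {ι : Type*}
variable {R : ℝ} {κ : ι → ℝ} {φ : ι → Plane → M}

theorem IsTubeSystem.exists_embedded_of_lt [CompactSpace M] [T2Space M] [Finite ι]
    (S : IsTubeSystem 𝒜 R κ φ)
    {d : ι → ℝ} (hd : ∀ i, 0 ≤ d i)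
    (hshort : ∀ i s, 0 < s → s ≤ d i → ∃ u : Plane, u ≠ 0 ∧ (∀ z, φ i (z + (u + u)) = φ i z) ∧
      stretch (κ i) (s + R) ^ 2 * u 0 ^ 2
        + stretch (κ i)⁻¹ (s + R) ^ 2 * sn (mY (κ i)) (u 1) ^ 2 < Real.sinh R ^ 2) :
    ∃ δ δ' E, (∀ i, d i < δ i) ∧ IsEmbeddedFamily S δ δ' E := by
  obtain ⟨δ₁, E₁, hE₁⟩ := S.exists_embedded hd hshort
  obtain ⟨η, hη, h⟩ := IsEmbeddedFamily.exists_extension S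
  obtain ⟨E, hcol, hE⟩ := h _ _ _ hE₁
  obtain ⟨ε, hε, hεη, hinj⟩ := hE.exists_larger hη hcol
  exact ⟨fun i => d i + ε, fun i => d i + η, E, fun i => by linarith,
    .of_le (fun i => by linarith [hd i]) (fun i => by linarith) hcol hinj⟩

/-- The complement of the half-open collars of depths `d i`. -/
def truncated {R : ℝ} (d : ι → ℝ) (E : ι → Plane × ℝ → extended 𝒜 R) : Set M :=
  {x | ∃ i z s, 0 ≤ s ∧ s < d i ∧ (E i (z, s)).1.1 = x}ᶜ

/-- The image in the truncated manifold of a chart of `M`. -/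
theorem HyperbolicAtlas.restrict_image (N : Set M) (c : Set M × (M → Mink)) :
    (fun x : N => c.2 x) '' (Subtype.val ⁻¹' c.1) = c.2 '' (c.1 ∩ N) := by
  ext w
  constructor
  · rintro ⟨x, hx, rfl⟩; exact ⟨x, ⟨hx, x.2⟩, rfl⟩
  · rintro ⟨x, ⟨hx, hN⟩, rfl⟩; exact ⟨⟨x, hN⟩, hx, rfl⟩

namespace IsEmbeddedFamily

variable [T2Space M] {S : IsTubeSystem 𝒜 R κ φ} {δ δ' : ι → ℝ}
variable {E : ι → Plane × ℝ → extended 𝒜 R} (hE : IsEmbeddedFamily S δ δ' E)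
include hE

theorem val_inj {i j : ι} {a b : Plane × ℝ} (ha0 : 0 ≤ a.2) (ha : a.2 ≤ δ i) (hb0 : 0 ≤ b.2)
    (hb : b.2 ≤ δ j) (h : (E i a).1.1 = (E j b).1.1) : a.2 = b.2 ∧ φ i a.1 = φ j b.1 := by
  have hR := S.pos
  refine hE.inj_le i j a b (by linarith) ha (by linarith) hb (Subtype.ext (Prod.ext h ?_))
  rw [hE.height_eq_zero ha0 ha, hE.height_eq_zero hb0 hb]

theorem val_index {i j : ι} {a b : Plane × ℝ} (ha0 : 0 ≤ a.2) (ha : a.2 ≤ δ i) (hb0 : 0 ≤ b.2)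
    (hb : b.2 ≤ δ j) (h : (E i a).1.1 = (E j b).1.1) : i = j :=
  S.index_eq _ _ _ _ (hE.val_inj ha0 ha hb0 hb h).2

theorem val_of_nonpos {i : ι} {a : Plane × ℝ} (h1 : -R < a.2) (h2 : a.2 ≤ 0) :
    (E i a).1.1 = φ i a.1 := by
  rw [(hE.collar i).val_eq h1 h2]

theorem val_zero (i : ι) (z : Plane) : (E i (z, 0)).1.1 = φ i z :=
  hE.val_of_nonpos (a := (z, 0)) (by simpa using S.pos) le_rfl

theorem val_congr {i : ι} {z w : Plane} (h : φ i z = φ i w) {s : ℝ} (h0 : 0 ≤ s) (hs : s ≤ δ i) :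
    (E i (z, s)).1.1 = (E i (w, s)).1.1 := by
  rw [(hE.collar i).eq_of_eq h (by linarith [S.pos]) (hs.trans_lt (hE.lt i))]

/-- The collar maps are open, also at the boundary, since the exterior collars are projected to
the boundary. -/
theorem map_nhds_val {i : ι} {a : Plane × ℝ} (h0 : 0 ≤ a.2) (ha : a.2 ≤ δ i) :
    map (fun b => (E i b).1.1) (𝓝 a) = 𝓝 (E i a).1.1 := by
  have h1 := (hE.collar i).map_nhds (a := a) (by linarith [S.pos]) (ha.trans_lt (hE.lt i))
  have e : (fun b => (E i b).1.1) = (fun q : extended 𝒜 R => q.1.1) ∘ E i := rfl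
  rw [e, ← map_map, h1]
  exact le_antisymm ((continuous_fst.comp continuous_subtype_val).tendsto _)
    (IsTubeSystem.map_fst_nhds (hE.height_eq_zero h0 ha))

theorem tendsto_val {i : ι} {a : Plane × ℝ} (h0 : 0 ≤ a.2) (ha : a.2 ≤ δ i) :
    Tendsto (fun b => (E i b).1.1) (𝓝 a) (𝓝 (E i a).1.1) := (hE.map_nhds_val h0 ha).le

/-- In a chart, collars are tubes. -/
theorem exists_germ {i : ι} {a : Plane × ℝ} (h0 : 0 ≤ a.2) (ha : a.2 < δ i)
    {c : Set M × (M → Mink)} (hc : c ∈ 𝒜.charts) (hac : (E i a).1.1 ∈ c.1) :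
    ∃ A : Mink ≃ₗ[ℝ] Mink, IsHypIso A ∧
      (∀ᶠ b in 𝓝 a, 0 ≤ b.2 → c.2 (E i b).1.1 = A (tube (κ i) b.1 b.2)) ∧
      (a.2 = 0 → IsTubeGerm (κ i) (φ i) c a.1 A) := by
  have hR := S.pos
  obtain ⟨U, hU, haU, hinj, hUc⟩ := S.exists_extChart_source hc hac
  obtain ⟨A, hA, hev⟩ := ((hE.collar i).dev a (by linarith) (ha.trans (hE.lt i))).chart
    (U, extChart κ φ c) ⟨hU, hinj, c, hc, rfl, hUc⟩ haU
  rw [nhdsWithin_univ] at hev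
  have hev' : ∀ᶠ b in 𝓝 a, 0 ≤ b.2 → c.2 (E i b).1.1 = A (tube (κ i) b.1 b.2) := by
    filter_upwards [hev, (continuous_snd.tendsto a).eventually (gt_mem_nhds ha)] with b h1 h2 h3
    rw [← h1, IsTubeSystem.extChart_of_height (hE.height_eq_zero h3 h2.le)]
  refine ⟨A, hA, hev', fun h => ?_⟩
  obtain ⟨z, s⟩ := a
  obtain rfl : s = 0 := h
  have hz := hE.val_zero i z
  obtain ⟨B, hB⟩ := (S.isTubeMap i).chart z c hc (hz ▸ hac)
  have hAB : A = B := by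
    refine linearEquiv_eq_of_tubeBase (S.κ_pos i) (z := z) ?_
    have hcont : Continuous fun y : Plane => (y, (0 : ℝ)) := by fun_prop
    filter_upwards [hB.eventually_base, (hcont.tendsto z).eventually hev'] with y h1 h2
    rw [← h1, ← hE.val_zero i y, h2 le_rfl, tube_zero]
  rw [hAB]; exact hB

theorem isInwardNormalGeodesic {i : ι} (z : Plane) {ℓ : ℝ} (h0 : 0 ≤ ℓ) (hℓ : ℓ < δ i) :
    𝒜.IsInwardNormalGeodesic (φ i z) ℓ fun s => (E i (z, s)).1.1 := by
  refine ⟨hE.val_zero i z, fun s hs => ?_, fun s hs c hc hsc => ?_⟩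
  · have hcont : Continuous fun t : ℝ => (z, t) := by fun_prop
    exact ((hE.tendsto_val (a := (z, s)) hs.1 (hs.2.trans hℓ.le)).comp
      (hcont.tendsto s)).mono_left nhdsWithin_le_nhds
  · obtain ⟨A, hA, hev, hgerm⟩ := hE.exists_germ (a := (z, s)) hs.1 (hs.2.trans_lt hℓ) hc hsc
    have hf := isFrame_tube (S.κ_pos i) z s
    have hself : c.2 (E i (z, s)).1.1 = A (tube (κ i) z s) := hev.self_of_nhds hs.1
    refine ⟨A (tubeN (κ i) z s), ?_, ?_, ?_, fun h => ?_⟩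
    · rw [hself, hA.map_mink, hf.pn]
    · rw [hA.map_mink, hf.nn]
    · have hcont : Continuous fun t : ℝ => (z, t) := by fun_prop
      filter_upwards [nhdsWithin_le_nhds ((hcont.tendsto s).eventually hev), self_mem_nhdsWithin]
        with u h1 h2
      rw [h1 h2.1, hself, ← map_smul, ← map_smul, ← map_add, ← tube_add, add_sub_cancel]
    · obtain rfl := h
      have hg := hgerm rfl
      have hs : IsTubeSide (c.2 '' c.1) (κ i) 0 z A :=
        ⟨hA, S.one_le i, le_rfl, hg.eventually.mono fun b hb => hb.2⟩
      have hz : c.2 (φ i z) = A (tube (κ i) z 0) := by rw [hg.apply, tube_zero]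
      rw [hz]
      exact ⟨_, hs.isDefiningFunction, hs.isInwardUnitNormal z⟩

variable {d : ι → ℝ} (hd0 : ∀ i, 0 ≤ d i) (hd : ∀ i, d i < δ i)
include hd0 hd

omit hd0 in
theorem mem_truncated_iff {i : ι} {a : Plane × ℝ} (h0 : 0 ≤ a.2) (ha : a.2 ≤ δ i) :
    (E i a).1.1 ∈ truncated d E ↔ d i ≤ a.2 := by
  constructor
  · intro h
    by_contra hlt
    exact h ⟨i, a.1, a.2, h0, not_le.1 hlt, rfl⟩
  · rintro h ⟨j, w, s, hs0, hs, he⟩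
    have he' := hE.val_inj (a := (w, s)) hs0 (hs.le.trans (hd j).le) h0 ha he
    obtain rfl := S.index_eq _ _ _ _ he'.2
    have : s = a.2 := he'.1
    linarith

theorem level_mem (i : ι) (z : Plane) : (E i (z, d i)).1.1 ∈ truncated d E :=
  (hE.mem_truncated_iff hd (a := (z, d i)) (hd0 i) (hd i).le).2 le_rfl

omit hd0 in
theorem isClosed_truncated : IsClosed (truncated d E) := by
  rw [truncated, isClosed_compl_iff, isOpen_iff_mem_nhds]
  rintro _ ⟨i, z, s, hs0, hs, rfl⟩
  have hR := S.pos
  have h1 := hE.map_nhds_val (i := i) (a := (z, s)) hs0 (hs.le.trans (hd i).le)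
  refine (congrArg (_ ∈ ·) h1).mp ?_
  rw [mem_map]
  filter_upwards [(continuous_snd.tendsto (z, s)).eventually (gt_mem_nhds hs),
    (continuous_snd.tendsto (z, s)).eventually (lt_mem_nhds (show -R < s by linarith))]
    with b h1 h2
  rcases le_or_gt 0 b.2 with h | h
  · exact ⟨i, b.1, b.2, h, h1, rfl⟩
  · exact ⟨i, b.1, 0, le_rfl, hs0.trans_lt hs, (hE.val_zero i b.1).trans (hE.val_of_nonpos h2 h.le).symm⟩

/-- Near its boundary, the truncated manifold is one side of a parallel surface. -/
theorem exists_side {i : ι} {z : Plane} {c : Set M × (M → Mink)} (hc : c ∈ 𝒜.charts)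
    (hz : (E i (z, d i)).1.1 ∈ c.1) : ∃ A : Mink ≃ₗ[ℝ] Mink,
      IsTubeSide (c.2 '' (c.1 ∩ truncated d E)) (κ i) (d i) z A ∧
      ∀ᶠ b in 𝓝 (z, d i), 0 ≤ b.2 → c.2 (E i b).1.1 = A (tube (κ i) b.1 b.2) := by
  obtain ⟨A, hA, hev, hgerm⟩ := hE.exists_germ (a := (z, d i)) (hd0 i) (hd i) hc hz
  refine ⟨A, ⟨hA, S.one_le i, hd0 i, ?_⟩, hev⟩
  have hmap := hE.map_nhds_val (i := i) (a := (z, d i)) (hd0 i) (hd i).le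
  have hevc : ∀ᶠ b in 𝓝 (z, d i), (E i b).1.1 ∈ c.1 :=
    hmap.le ((𝒜.isOpen_source c hc).mem_nhds hz)
  have hpos : ∀ᶠ b : Plane × ℝ in 𝓝 (z, d i), 0 ≤ b.2 →
      (A (tube (κ i) b.1 b.2) ∈ c.2 '' (c.1 ∩ truncated d E) ↔ d i ≤ b.2) := by
    filter_upwards [hev, hevc,
      (continuous_snd.tendsto (z, d i)).eventually (gt_mem_nhds (hd i))] with b h1 h2 h3 h4
    rw [← h1 h4, ← hE.mem_truncated_iff hd h4 h3.le]
    constructor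
    · rintro ⟨x, ⟨hx, hN⟩, hxe⟩
      rwa [← HyperbolicAtlas.chart_inj hc hx h2 hxe]
    · exact fun h => ⟨_, ⟨h2, h⟩, rfl⟩
  rcases (hd0 i).eq_or_lt with h | h
  · have hg := (hgerm h.symm).eventually
    rw [h] at hg
    filter_upwards [hpos, hg] with b h1 h2
    rcases le_or_gt 0 b.2 with h3 | h3
    · exact h1 h3
    · refine iff_of_false (fun hm => ?_) (by linarith)
      exact absurd (h2.2.1 (image_mono inter_subset_left hm)) (not_le.2 (by linarith))
  · filter_upwards [hpos, (continuous_snd.tendsto (z, d i)).eventually (lt_mem_nhds h)]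
      with b h1 h2 using h1 h2.le

/-- Away from the moved tori, the truncated manifold has no boundary. -/
theorem image_mem_nhds [Finite ι] {x : M} (hx : x ∈ truncated d E)
    (hne : ∀ i z, (E i (z, d i)).1.1 ≠ x) {c : Set M × (M → Mink)} (hc : c ∈ 𝒜.charts)
    (hxc : x ∈ c.1) : c.2 '' (c.1 ∩ truncated d E) ∈ 𝓝[hyp3] (c.2 x) := by
  choose K hK hKφ using S.exists_compact
  have hcl : IsClosed (⋃ i, (fun b => (E i b).1.1) '' (K i ×ˢ Icc 0 (d i))) := by
    refine isClosed_iUnion_of_finite fun i => (IsCompact.image_of_continuousOn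
      ((hK i).prod isCompact_Icc) fun b hb => ?_).isClosed
    exact (hE.tendsto_val hb.2.1 (hb.2.2.trans (hd i).le)).mono_left nhdsWithin_le_nhds
  have hmem : ∀ i z s, 0 ≤ s → s ≤ d i →
      (E i (z, s)).1.1 ∈ ⋃ i, (fun b => (E i b).1.1) '' (K i ×ˢ Icc 0 (d i)) := by
    intro i z s h0 hs
    obtain ⟨w, hw, hwz⟩ := hKφ i z
    exact mem_iUnion.2 ⟨i, (w, s), ⟨hw, h0, hs⟩, hE.val_congr hwz h0 (hs.trans (hd i).le)⟩
  have hxn : x ∉ ⋃ i, (fun b => (E i b).1.1) '' (K i ×ˢ Icc 0 (d i)) := by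
    intro h
    obtain ⟨i, ⟨w, s⟩, ⟨-, h0, hs⟩, rfl⟩ := mem_iUnion.1 h
    rcases (show s ≤ d i from hs).eq_or_lt with h | h
    · exact hne i w (by rw [h])
    · exact hx ⟨i, w, s, h0, h, rfl⟩
  have hxb : x ∉ 𝒜.boundary := by
    intro h
    obtain ⟨i, w, rfl⟩ := S.exists_eq _ h
    exact hxn (hE.val_zero i w ▸ hmem i w 0 le_rfl (hd0 i))
  rw [← HyperbolicAtlas.map_nhds_of_interior hxb hc hxc]
  refine image_mem_map (inter_mem ((𝒜.isOpen_source c hc).mem_nhds hxc) ?_)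
  filter_upwards [hcl.isOpen_compl.mem_nhds hxn] with y hy
  rintro ⟨i, w, s, h0, h, rfl⟩
  exact hy (hmem i w s h0 h.le)

theorem mem_boundary_iff [Finite ι] (x : truncated d E) :
    x ∈ (𝒜.restrict (truncated d E)).boundary ↔ ∃ i z, (E i (z, d i)).1.1 = x.1 := by
  rw [HyperbolicAtlas.boundary, mem_compl_iff, not_iff_comm]
  constructor
  · intro h
    push Not at h
    obtain ⟨c, hc, hxc⟩ := 𝒜.cover x.1
    refine ⟨_, ⟨c, hc, rfl⟩, hxc, ?_⟩
    rw [HyperbolicAtlas.restrict_image]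
    exact hE.image_mem_nhds hd0 hd x.2 h hc hxc
  · rintro ⟨_, ⟨c, hc, rfl⟩, hxc, hn⟩ ⟨i, z, hz⟩
    rw [HyperbolicAtlas.restrict_image] at hn
    simp only at hn
    have hzc : (E i (z, d i)).1.1 ∈ c.1 := hz ▸ hxc
    obtain ⟨A, hA, hev⟩ := hE.exists_side hd0 hd hc hzc
    have hself : c.2 (E i (z, d i)).1.1 = A (tube (κ i) z (d i)) := hev.self_of_nhds (hd0 i)
    rw [← hz, hself] at hn
    exact hA.notMem_nhds hn

theorem isManifold_truncated [Finite ι] : (𝒜.restrict (truncated d E)).IsManifold := by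
  rintro _ ⟨c, hc, rfl⟩ x hxc
  rw [HyperbolicAtlas.restrict_image]
  by_cases h : ∃ i z, (E i (z, d i)).1.1 = x.1
  · right
    obtain ⟨i, z, hz⟩ := h
    have hzc : (E i (z, d i)).1.1 ∈ c.1 := hz ▸ hxc
    obtain ⟨A, hA, hev⟩ := hE.exists_side hd0 hd hc hzc
    have hself : c.2 (E i (z, d i)).1.1 = A (tube (κ i) z (d i)) := hev.self_of_nhds (hd0 i)
    simp only [← hz, hself]
    exact ⟨_, hA.isDefiningFunction⟩
  · left
    push Not at h
    exact hE.image_mem_nhds hd0 hd x.2 h hc hxc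

end IsEmbeddedFamily

end

section

/-! ### The boundary of the truncated manifold -/

theorem connectedComponentIn_eq_range {X ι P : Type*} [TopologicalSpace X] [TopologicalSpace P]
    [PreconnectedSpace P] {B : Set X} {ψ : ι → P → X} (hψ : ∀ i, Continuous (ψ i))
    (hB : ∀ x, x ∈ B ↔ ∃ i z, ψ i z = x) (hinj : ∀ i j z w, ψ i z = ψ j w → i = j)
    (hopen : ∀ i z, ∀ᶠ x in 𝓝[B] (ψ i z), x ∈ range (ψ i)) (i : ι) (z : P) :
    connectedComponentIn B (ψ i z) = range (ψ i) := by
  have hz : ψ i z ∈ B := (hB _).2 ⟨i, z, rfl⟩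
  refine Subset.antisymm (fun y hy => ?_)
    ((isPreconnected_range (hψ i)).subset_connectedComponentIn ⟨z, rfl⟩ ?_)
  · refine (preconnected_iff_of_eventually isPreconnected_connectedComponentIn
      (P := fun x => x ∈ range (ψ i)) ?_ (mem_connectedComponentIn hz) hy).1 ⟨z, rfl⟩
    intro x hx
    obtain ⟨j, w, rfl⟩ := (hB x).1 (connectedComponentIn_subset _ _ hx)
    filter_upwards [nhdsWithin_mono _ (connectedComponentIn_subset _ _) (hopen j w)]
    rintro _ ⟨w', rfl⟩
    constructor
    · rintro ⟨u, hu⟩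
      obtain rfl := hinj _ _ _ _ hu
      exact ⟨w, rfl⟩
    · rintro ⟨u, hu⟩
      obtain rfl := hinj _ _ _ _ hu
      exact ⟨w', rfl⟩
  · rintro _ ⟨w, rfl⟩; exact (hB _).2 ⟨i, w, rfl⟩

/-- Compact Hausdorff quotients of a compact space by the same relation are homeomorphic. -/
theorem nonempty_homeomorph_of_ker {K X Y : Type*} [TopologicalSpace K] [TopologicalSpace X]
    [TopologicalSpace Y] [CompactSpace K] [T2Space X] [T2Space Y] {f : K → X} {g : K → Y}
    (hf : Continuous f) (hf' : Function.Surjective f) (hg : Continuous g)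
    (hg' : Function.Surjective g) (h : ∀ a b, f a = f b ↔ g a = g b) : Nonempty (X ≃ₜ Y) := by
  have h1 := IsQuotientMap.homeomorph (f := (⟨f, hf⟩ : C(K, X)))
    (hf.isClosedMap.isQuotientMap hf hf')
  have h2 := IsQuotientMap.homeomorph (f := (⟨g, hg⟩ : C(K, Y)))
    (hg.isClosedMap.isQuotientMap hg hg')
  have hk : Setoid.ker (⟨f, hf⟩ : C(K, X)) = Setoid.ker (⟨g, hg⟩ : C(K, Y)) := by
    ext a b; exact h a b
  rw [hk] at h1
  exact ⟨h1.symm.trans h2⟩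

variable {M : Type*} [TopologicalSpace M] {𝒜 : HyperbolicAtlas M} {ι : Type*}
variable {R : ℝ} {κ : ι → ℝ} {φ : ι → Plane → M}

theorem IsTubeSystem.connectedComponentIn_boundary (S : IsTubeSystem 𝒜 R κ φ) (i : ι) (z : Plane) :
    connectedComponentIn 𝒜.boundary (φ i z) = range (φ i) := by
  refine connectedComponentIn_eq_range (fun i => (S.isTubeMap i).continuous)
    (fun x => ⟨S.exists_eq x, ?_⟩) S.index_eq (fun i z => ?_) i z
  · rintro ⟨i, z, rfl⟩; exact S.mem_boundary i z
  · rw [← (S.isTubeMap i).map_nhds (S.κ_pos i), eventually_map]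
    exact .of_forall fun w => ⟨w, rfl⟩

namespace IsEmbeddedFamily

variable [T2Space M] {S : IsTubeSystem 𝒜 R κ φ} {δ δ' : ι → ℝ}
variable {E : ι → Plane × ℝ → extended 𝒜 R} (hE : IsEmbeddedFamily S δ δ' E)
variable {d : ι → ℝ} (hd0 : ∀ i, 0 ≤ d i) (hd : ∀ i, d i < δ i)
include hE hd0 hd

theorem isTruncation_truncated : 𝒜.IsTruncation (truncated d E) := by
  have key : ∀ x, ∃ (t : ℝ) (g : ℝ → M), x ∈ 𝒜.boundary →
      ∃ i z, φ i z = x ∧ t = d i ∧ g = fun s => (E i (z, s)).1.1 := by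
    intro x
    by_cases hx : x ∈ 𝒜.boundary
    · obtain ⟨i, z, hz⟩ := S.exists_eq x hx
      exact ⟨_, _, fun _ => ⟨i, z, hz, rfl, rfl⟩⟩
    · exact ⟨0, fun _ => x, fun h => absurd h hx⟩
  choose depth G hG using key
  refine ⟨depth, G, fun x hx => ?_, ?_, fun x hx => ?_, ?_, ?_⟩
  · obtain ⟨i, z, -, h, -⟩ := hG x hx
    rw [h]; exact hd0 i
  · rintro T ⟨x₀, hx₀, rfl⟩ x hx y hy
    obtain ⟨i₀, z₀, rfl⟩ := S.exists_eq x₀ hx₀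
    have hdepth : ∀ x ∈ connectedComponentIn 𝒜.boundary (φ i₀ z₀), depth x = d i₀ := by
      intro x hx
      obtain ⟨i, z, h1, h2, -⟩ := hG x (connectedComponentIn_subset _ _ hx)
      rw [S.connectedComponentIn_boundary] at hx
      obtain ⟨w, hw⟩ := hx
      rw [h2, S.index_eq _ _ _ _ (h1.trans hw.symm)]
    rw [hdepth x hx, hdepth y hy]
  · obtain ⟨i, z, h1, h2, h3⟩ := hG x hx
    rw [h2, h3, ← h1]
    exact hE.isInwardNormalGeodesic z (hd0 i) (hd i)
  · intro x hx y hy s hs t ht h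
    obtain ⟨i, z, h1, h2, h3⟩ := hG x hx
    obtain ⟨j, w, h4, h5, h6⟩ := hG y hy
    rw [h3, h6] at h
    rw [h2] at hs
    rw [h5] at ht
    have := hE.val_inj (a := (z, s)) (b := (w, t)) hs.1 (hs.2.trans (hd i).le) ht.1
      (ht.2.trans (hd j).le) h
    exact ⟨by rw [← h1, ← h4]; exact this.2, this.1⟩
  · refine congrArg _ (Set.ext fun x => ⟨?_, ?_⟩)
    · rintro ⟨i, z, s, h0, hs, rfl⟩
      obtain ⟨j, w, h1, h2, h3⟩ := hG (φ i z) (S.mem_boundary i z)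
      obtain rfl := S.index_eq _ _ _ _ h1
      refine ⟨φ j z, S.mem_boundary j z, s, ⟨h0, by rwa [h2]⟩, ?_⟩
      rw [h3]
      exact hE.val_congr h1 h0 (hs.le.trans (hd j).le)
    · rintro ⟨y, hy, s, hs, rfl⟩
      obtain ⟨i, z, h1, h2, h3⟩ := hG y hy
      rw [h2] at hs
      exact ⟨i, z, s, hs.1, hs.2, by rw [h3]⟩

/-- The point of the truncated manifold at depth `d i` below `φ i z`. -/
def levelPoint (i : ι) (z : Plane) : truncated d E := ⟨_, hE.level_mem hd0 hd i z⟩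

theorem continuous_levelPoint (i : ι) : Continuous (hE.levelPoint hd0 hd i) := by
  refine Continuous.subtype_mk (continuous_iff_continuousAt.2 fun z => ?_) _
  have hcont : Continuous fun z : Plane => (z, d i) := by fun_prop
  exact (hE.tendsto_val (i := i) (a := (z, d i)) (hd0 i) (hd i).le).comp (hcont.tendsto z)

theorem levelPoint_eq_iff {i j : ι} {z w : Plane} :
    hE.levelPoint hd0 hd i z = hE.levelPoint hd0 hd j w ↔ φ i z = φ j w := by
  constructor
  · intro h
    exact (hE.val_inj (a := (z, d i)) (b := (w, d j)) (hd0 i) (hd i).le (hd0 j) (hd j).le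
      (congrArg Subtype.val h)).2
  · intro h
    obtain rfl := S.index_eq _ _ _ _ h
    exact Subtype.ext (hE.val_congr h (hd0 i) (hd i).le)

theorem connectedComponentIn_truncated [Finite ι] (i : ι) (z : Plane) :
    connectedComponentIn (𝒜.restrict (truncated d E)).boundary (hE.levelPoint hd0 hd i z)
      = range (hE.levelPoint hd0 hd i) := by
  refine connectedComponentIn_eq_range (hE.continuous_levelPoint hd0 hd) (fun x => ?_)
    (fun i j z w h => S.index_eq _ _ _ _ ((hE.levelPoint_eq_iff hd0 hd).1 h)) (fun i z => ?_) i z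
  · rw [hE.mem_boundary_iff hd0 hd]
    exact exists₂_congr fun i z => (Subtype.ext_iff (a1 := hE.levelPoint hd0 hd i z)).symm
  · have hR := S.pos
    have h1 : ∀ᶠ x in 𝓝 (E i (z, d i)).1.1, ∃ b : Plane × ℝ,
        -R < b.2 ∧ b.2 < δ i ∧ (E i b).1.1 = x := by
      rw [← hE.map_nhds_val (a := (z, d i)) (hd0 i) (hd i).le, eventually_map]
      filter_upwards [(continuous_snd.tendsto (z, d i)).eventually (gt_mem_nhds (hd i)),
        (continuous_snd.tendsto (z, d i)).eventually
          (lt_mem_nhds (show -R < d i by linarith [hd0 i]))] with b h1 h2 using ⟨b, h2, h1, rfl⟩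
    have h2 : Tendsto (Subtype.val : truncated d E → M) (𝓝 (hE.levelPoint hd0 hd i z))
        (𝓝 (E i (z, d i)).1.1) := continuous_subtype_val.tendsto _
    filter_upwards [nhdsWithin_le_nhds (h2.eventually h1), self_mem_nhdsWithin] with x hx hxB
    obtain ⟨j, w, hw⟩ := (hE.mem_boundary_iff hd0 hd x).1 hxB
    obtain ⟨b, hb1, hb2, hbx⟩ := hx
    have hij : i = j := by
      rcases le_or_gt 0 b.2 with h | h
      · exact hE.val_index (b := (w, d j)) h hb2.le (hd0 j) (hd j).le (hbx.trans hw.symm)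
      · refine hE.val_index (a := (b.1, 0)) (b := (w, d j)) le_rfl (hE.nonneg i) (hd0 j)
          (hd j).le (Eq.trans ?_ (hbx.trans hw.symm))
        exact (hE.val_zero i b.1).trans (hE.val_of_nonpos hb1 h.le).symm
    subst hij
    exact ⟨w, Subtype.ext hw⟩

theorem isFlatUniformization_level (i : ι) : (𝒜.restrict (truncated d E)).IsFlatUniformization
    (range (hE.levelPoint hd0 hd i))
    (hE.levelPoint hd0 hd i ∘ levelCoord (κ i) (d i)) := by
  have ha := stretch_pos_of_nonneg (S.κ_pos i).le (hd0 i)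
  have hb := stretch_pos_of_nonneg (inv_pos.2 (S.κ_pos i)).le (hd0 i)
  have hlc := (contDiff_levelCoord (κ i) (d i)).continuous
  have key : ∀ c ∈ 𝒜.charts, ∀ y, (E i (levelCoord (κ i) (d i) y, d i)).1.1 ∈ c.1 →
      ∃ A : Mink ≃ₗ[ℝ] Mink, IsHypIso A ∧
      (fun y => c.2 (E i (levelCoord (κ i) (d i) y, d i)).1.1)
        =ᶠ[𝓝 y] fun y => A (tube (κ i) (levelCoord (κ i) (d i) y) (d i)) := by
    intro c hc y hy
    obtain ⟨A, hA, hev, -⟩ := hE.exists_germ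
      (a := (levelCoord (κ i) (d i) y, d i)) (hd0 i) (hd i) hc hy
    have hcont : Continuous fun y => (levelCoord (κ i) (d i) y, d i) := by fun_prop
    exact ⟨A, hA, ((hcont.tendsto y).eventually hev).mono fun w hw => hw (hd0 i)⟩
  refine ⟨(hE.continuous_levelPoint hd0 hd i).comp hlc,
    (levelCoord_surjective ha.ne' hb.ne').range_comp _, ?_, ?_⟩
  · rintro _ ⟨c, hc, rfl⟩ y hy
    obtain ⟨A, hA, hev⟩ := key c hc y hy
    exact ContDiffAt.congr_of_eventuallyEq (A.toContinuousLinearEquiv.contDiff.comp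
      (contDiff_tube_levelCoord (κ i) (d i))).contDiffAt hev
  · rintro _ ⟨c, hc, rfl⟩ y hy v w
    obtain ⟨A, hA, hev⟩ := key c hc y hy
    rw [← mink_fderiv_tube_levelCoord (S.κ_pos i) ha.ne' hb.ne' hA y v w, ← hev.fderiv_eq]
    rfl

theorem isTubularTorus_level (i : ι) (htorus : Nonempty (range (φ i) ≃ₜ Circle × Circle)) :
    (𝒜.restrict (truncated d E)).IsTubularTorus (range (hE.levelPoint hd0 hd i))
      (tubeRadius (levelCurvature (κ i) (d i))) := by
  refine ⟨?_, ⟨_, hE.isFlatUniformization_level hd0 hd i⟩, _,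
    one_le_levelCurvature (S.one_le i) (hd0 i), rfl, ?_⟩
  · obtain ⟨K, hK, hKφ⟩ := S.exists_compact i
    have := isCompact_iff_compactSpace.1 hK
    obtain ⟨e⟩ := htorus
    obtain ⟨e'⟩ := nonempty_homeomorph_of_ker (K := K)
      (f := fun z => (⟨hE.levelPoint hd0 hd i z, mem_range_self _⟩ :
        range (hE.levelPoint hd0 hd i)))
      (g := fun z => (⟨φ i z, mem_range_self _⟩ : range (φ i)))
      (((hE.continuous_levelPoint hd0 hd i).comp continuous_subtype_val).subtype_mk _)
      (by
        rintro ⟨_, z, rfl⟩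
        obtain ⟨w, hw, h⟩ := hKφ z
        exact ⟨⟨w, hw⟩, Subtype.ext ((hE.levelPoint_eq_iff hd0 hd).2 h)⟩)
      (((S.isTubeMap i).continuous.comp continuous_subtype_val).subtype_mk _)
      (by
        rintro ⟨_, z, rfl⟩
        obtain ⟨w, hw, h⟩ := hKφ z
        exact ⟨⟨w, hw⟩, Subtype.ext h⟩)
      (fun a b => by
        rw [Subtype.ext_iff, Subtype.ext_iff (a1 := (⟨φ i a, _⟩ : range (φ i)))]
        exact hE.levelPoint_eq_iff hd0 hd)
    exact ⟨e'.trans e⟩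
  · rintro _ ⟨z, rfl⟩ _ ⟨c, hc, rfl⟩ hzc
    rw [HyperbolicAtlas.restrict_image]
    have hzc' : (E i (z, d i)).1.1 ∈ c.1 := hzc
    obtain ⟨A, hA, hev⟩ := hE.exists_side hd0 hd hc hzc'
    have hself : c.2 (E i (z, d i)).1.1 = A (tube (κ i) z (d i)) := hev.self_of_nhds (hd0 i)
    have := hA.hasPrincipalCurvatures
    rw [← hself] at this
    exact this

/-- Points of the plane with the same image differ by a translation, so discs are embedded if their
radius is at most half of the length of every translation. -/
theorem le_injRadius_level (i : ι) {c : ℝ}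
    (hper : ∀ v : Plane, (∀ z, φ i (z + v) = φ i z) → v ≠ 0 →
      (2 * c) ^ 2 ≤ stretch (κ i) (d i) ^ 2 * v 0 ^ 2 + stretch (κ i)⁻¹ (d i) ^ 2 * v 1 ^ 2) :
    ENNReal.ofReal c ≤
      (𝒜.restrict (truncated d E)).injRadius (range (hE.levelPoint hd0 hd i)) := by
  refine le_sSup ⟨_, hE.isFlatUniformization_level hd0 hd i, fun x y hy y' hy' h => ?_⟩
  have ha := stretch_pos_of_nonneg (S.κ_pos i).le (hd0 i)
  have hb := stretch_pos_of_nonneg (inv_pos.2 (S.κ_pos i)).le (hd0 i)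
  have h1 := (S.isTubeMap i).deck (S.κ_pos i) ((hE.levelPoint_eq_iff hd0 hd).1 h)
  rw [mem_ofPred_eq, edist_lt_ofReal] at hy hy'
  by_contra hne
  have e0 : (levelCoord (κ i) (d i) y' - levelCoord (κ i) (d i) y) 0
      = (stretch (κ i) (d i))⁻¹ * (y' 0 - y 0) := by simp [levelCoord, mul_sub]
  have e1 : (levelCoord (κ i) (d i) y' - levelCoord (κ i) (d i) y) 1
      = (stretch (κ i)⁻¹ (d i))⁻¹ * (y' 1 - y 1) := by simp [levelCoord, mul_sub]
  have hdist : dist y' y < 2 * c := by linarith [dist_triangle_right y' y x]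
  have h2 := hper _ h1 fun h0 => hne ?_
  · have hmul : ∀ a t : ℝ, 0 < a → a ^ 2 * (a⁻¹ * t) ^ 2 = t ^ 2 := fun a t ha => by
      rw [← mul_pow, mul_inv_cancel_left₀ ha.ne']
    rw [e0, e1, hmul _ _ ha, hmul _ _ hb] at h2
    have h3 : dist y' y ^ 2 = (y' 0 - y 0) ^ 2 + (y' 1 - y 1) ^ 2 := by
      rw [EuclideanSpace.dist_eq, Real.sq_sqrt (by positivity), Fin.sum_univ_two, Real.dist_eq,
        Real.dist_eq, sq_abs, sq_abs]
    have := pow_lt_pow_left₀ hdist dist_nonneg two_ne_zero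
    linarith
  · rw [h0] at e0 e1
    ext j
    fin_cases j
    · have := (mul_eq_zero.1 e0.symm).resolve_left (inv_ne_zero ha.ne')
      exact (sub_eq_zero.1 this).symm
    · have := (mul_eq_zero.1 e1.symm).resolve_left (inv_ne_zero hb.ne')
      exact (sub_eq_zero.1 this).symm

/-- A component of the boundary of the truncated manifold is one of the moved tori. -/
theorem exists_eq_range_levelPoint [Finite ι] {T : Set (truncated d E)}
    (hT : (𝒜.restrict (truncated d E)).IsBoundaryComponent T) :
    ∃ i, T = range (hE.levelPoint hd0 hd i) := by
  obtain ⟨x, hx, rfl⟩ := hT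
  obtain ⟨i, z, hz⟩ := (hE.mem_boundary_iff hd0 hd x).1 hx
  obtain rfl : hE.levelPoint hd0 hd i z = x := Subtype.ext hz
  exact ⟨i, hE.connectedComponentIn_truncated hd0 hd i z⟩

end IsEmbeddedFamily

end

section

/-! ### Uniformization of the boundary tori -/

theorem le_coth_of_le_tubeRadius {κ R : ℝ} (hR : 0 < R) (hκ : 1 ≤ κ)
    (h : ENNReal.ofReal R ≤ tubeRadius κ) : κ ≤ Real.cosh R / Real.sinh R := by
  have hκ0 : 0 < κ := one_pos.trans_le hκ
  rcases hκ.eq_or_lt with h1 | h1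
  · rw [← h1]; exact (one_lt_coth hR).le
  · rw [tubeRadius, if_neg h1.ne', ENNReal.ofReal_le_ofReal_iff
      (Real.artanh_nonneg (inv_pos.2 hκ0).le), ← Real.artanh_tanh R, Real.artanh_le_artanh_iff
      ⟨Real.neg_one_lt_tanh R, Real.tanh_lt_one R⟩
      ⟨by linarith [inv_pos.2 hκ0], inv_lt_one_of_one_lt₀ h1⟩, Real.tanh_eq_sinh_div_cosh] at h
    have hs := Real.sinh_pos_iff.2 hR
    rw [div_le_iff₀ (Real.cosh_pos R), inv_mul_eq_div, le_div_iff₀ hκ0] at h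
    rwa [le_div_iff₀ hs, mul_comm]

variable {M : Type*} [TopologicalSpace M] {𝒜 : HyperbolicAtlas M}

theorem HyperbolicAtlas.IsBoundaryComponent.eq_of_mem {T T' : Set M}
    (h : 𝒜.IsBoundaryComponent T) (h' : 𝒜.IsBoundaryComponent T') {x : M} (hx : x ∈ T)
    (hx' : x ∈ T') : T = T' := by
  obtain ⟨y, -, rfl⟩ := h
  obtain ⟨y', -, rfl⟩ := h'
  rw [connectedComponentIn_eq hx, connectedComponentIn_eq hx']

theorem IsTubeMap.exists_isCompact {κ : ℝ} {φ : Plane → M} (H : IsTubeMap 𝒜 κ φ) (hκ : 0 < κ)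
    (hφ : IsCompact (range φ)) : ∃ K, IsCompact K ∧ ∀ z, ∃ w ∈ K, φ w = φ z := by
  have hsub : range φ ⊆ 𝒜.boundary := range_subset_iff.2 (H.mem_boundary hκ)
  have hloc : ∀ x ∈ range φ, ∃ t ∈ 𝓝[range φ] x, ∃ K, IsCompact K ∧ t ⊆ φ '' K := by
    rintro _ ⟨z, rfl⟩
    refine ⟨φ '' Metric.closedBall z 1, nhdsWithin_mono _ hsub ?_, _,
      isCompact_closedBall z 1, Subset.rfl⟩
    rw [← H.map_nhds hκ]
    exact image_mem_map (Metric.closedBall_mem_nhds z one_pos)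
  obtain ⟨K, hK, h⟩ := hφ.induction_on (p := fun s => ∃ K, IsCompact K ∧ s ⊆ φ '' K)
    ⟨∅, isCompact_empty, empty_subset _⟩ (fun s t hst ⟨K, hK, h⟩ => ⟨K, hK, hst.trans h⟩)
    (fun s t ⟨K, hK, h⟩ ⟨L, hL, h'⟩ => ⟨K ∪ L, hK.union hL, by
      rw [image_union]; exact union_subset_union h h'⟩) hloc
  exact ⟨K, hK, fun z => h ⟨z, rfl⟩⟩

/-- The boundary components of a compact manifold with tubular boundary form a tube system. -/
theorem HyperbolicAtlas.HasTubularBoundary.exists_isTubeSystem (h𝒜 : 𝒜.HasTubularBoundary)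
    {R : ℝ} (hR : 0 < R) (hrad : ∀ (T : Set M) (r : ℝ≥0∞), 𝒜.IsBoundaryComponent T →
      𝒜.IsTubularTorus T r → ENNReal.ofReal R ≤ r) :
    ∃ (κ : {T // 𝒜.IsBoundaryComponent T} → ℝ)
      (φ : {T // 𝒜.IsBoundaryComponent T} → Plane → M), IsTubeSystem 𝒜 R κ φ ∧
      ∀ i, Nonempty (range (φ i) ≃ₜ Circle × Circle) := by
  have key : ∀ i : {T // 𝒜.IsBoundaryComponent T}, ∃ (κ : ℝ) (φ : Plane → M), 1 ≤ κ ∧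
      κ ≤ Real.cosh R / Real.sinh R ∧ range φ = i.1 ∧ IsTubeMap 𝒜 κ φ ∧
      Nonempty (range φ ≃ₜ Circle × Circle) := by
    rintro ⟨T, hT⟩
    obtain ⟨r, hr⟩ := h𝒜.2 T hT
    obtain ⟨κ, hκ, rfl, hcurv⟩ := hr.curvature
    obtain ⟨φ₀, hφ₀⟩ := hr.flat
    have hsub : T ⊆ 𝒜.boundary := by
      obtain ⟨x, -, rfl⟩ := hT; exact connectedComponentIn_subset _ _
    obtain ⟨φ, hφ, hφ'⟩ := hφ₀.exists_isTubeMap hsub (one_pos.trans_le hκ) hcurv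
    refine ⟨κ, φ, hκ, le_coth_of_le_tubeRadius hR hκ (hrad T _ hT hr), hφ.range_eq, hφ', ?_⟩
    rw [hφ.range_eq]; exact hr.torus
  choose κ φ h1 h2 h3 h4 h5 using key
  refine ⟨κ, φ, ⟨hR, h1, h2, h4, fun i j z w h => ?_, fun x hx => ?_, fun i => ?_⟩, h5⟩
  · refine Subtype.ext (i.2.eq_of_mem j.2 (x := φ i z) ?_ ?_)
    · rw [← h3]; exact ⟨z, rfl⟩
    · rw [← h3, h]; exact ⟨w, rfl⟩
  · have hx' := mem_connectedComponentIn hx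
    have := h3 ⟨_, x, hx, rfl⟩
    simp only at this
    rw [← this] at hx'
    exact ⟨_, hx'⟩
  · obtain ⟨e⟩ := h5 i
    have := e.symm.compactSpace
    exact (h4 i).exists_isCompact (one_pos.trans_le (h1 i)) (isCompact_iff_compactSpace.2 this)

theorem IsTubeSystem.finite [CompactSpace M] {ι : Type*} {R : ℝ} {κ : ι → ℝ}
    {φ : ι → Plane → M} (S : IsTubeSystem 𝒜 R κ φ) : Finite ι := by
  have h := HyperbolicAtlas.isClosed_boundary.isCompact.induction_on (s := 𝒜.boundary)
    (p := fun s => {i | ∃ z, φ i z ∈ s}.Finite) (by simp)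
    (fun s t hst h => h.subset fun i ⟨z, hz⟩ => ⟨z, hst hz⟩)
    (fun s t hs ht => (hs.union ht).subset fun i ⟨z, hz⟩ =>
      hz.imp (fun h => ⟨z, h⟩) fun h => ⟨z, h⟩) fun x hx => by
      obtain ⟨i, z, rfl⟩ := S.exists_eq x hx
      refine ⟨range (φ i), ?_, (finite_singleton i).subset ?_⟩
      · rw [← (S.isTubeMap i).map_nhds (S.κ_pos i), mem_map]
        exact Filter.Eventually.of_forall fun w => ⟨w, rfl⟩
      · rintro j ⟨w, u, hu⟩
        exact (S.index_eq _ _ _ _ hu).symm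
  refine Set.finite_univ_iff.1 (h.subset fun i _ => ⟨0, S.mem_boundary i 0⟩)

end

end

end TubularTruncation

theorem mainTheorem12 {M : Type*} [TopologicalSpace M] [T2Space M] [CompactSpace M]
    (𝒜 : TubularTruncation.HyperbolicAtlas M) (h𝒜 : 𝒜.HasTubularBoundary)
    (R : ℝ) (hR : 0 < R)
    (hrad : ∀ (T : Set M) (r : ENNReal), 𝒜.IsBoundaryComponent T → 𝒜.IsTubularTorus T r →
      ENNReal.ofReal R ≤ r) :
    0 < TubularTruncation.truncationConstant R ∧
    ∃ N : Set M, 𝒜.IsTruncation N ∧ IsCompact N ∧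
      (𝒜.restrict N).HasTubularBoundary ∧
      ∀ T : Set N, (𝒜.restrict N).IsBoundaryComponent T →
        ENNReal.ofReal (TubularTruncation.truncationConstant R) ≤
          (𝒜.restrict N).injRadius T := by
  refine ⟨TubularTruncation.truncationConstant_pos hR, ?_⟩
  obtain ⟨κ, φ, S, htorus⟩ := h𝒜.exists_isTubeSystem hR hrad
  have := S.finite
  choose d hd0 hper hshort using S.exists_depth
  obtain ⟨δ, δ', E, hd, hE⟩ := S.exists_embedded_of_lt hd0 hshort
  refine ⟨TubularTruncation.truncated d E, hE.isTruncation_truncated hd0 hd,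
    (hE.isClosed_truncated hd).isCompact, ⟨hE.isManifold_truncated hd0 hd, fun T hT => ?_⟩,
    fun T hT => ?_⟩
  · obtain ⟨i, rfl⟩ := hE.exists_eq_range_levelPoint hd0 hd hT
    exact ⟨_, hE.isTubularTorus_level hd0 hd i (htorus i)⟩
  · obtain ⟨i, rfl⟩ := hE.exists_eq_range_levelPoint hd0 hd hT
    exact hE.le_injRadius_level hd0 hd i (hper i)
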